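/- **Trees.** Fix $n\ge 1$. For $k\in\mathbb N^n$ put $|k|=\sum_i k_i$ and let $T(k)=\{t^{(i)}_j : 1\le i\le n,\ 1\le j\le k_i\}$. Let $\mathcal A^{|k|}$ be the complex vector space generated by the ordered $|k|$-forests (acyclic graphs with $|k|$ edges, numbered $1,\dots,|k|$) on the vertex set $T(k)\cup\{z\}$, modulo two kinds of relations: interchanging two edge numbers changes the sign; and $T_1+T_2+T_3=0$ whenever $T_1,T_2,T_3$ agree except that, for three distinct vertices $x,y,w$ and two numbers $a\ne b$, the edges numbered $(a,b)$ are $(xy,xw)$, $(yw,xy)$, $(xw,yw)$ respectively. Let $G_k=\prod_i\Sigma_{k_i}$ act by permuting the $t^{(i)}_j$ with the same $i$, let $\mathcal A(k)\subset\mathcal A^{|k|}$ be the skew-invariant subspace, and let $\mathrm{Asym}(x)=\sum_{\pi\in G_k}\mathrm{sgn}(\pi)\,\pi x$. Write $\mathrm{str}(u_1,\dots,u_m)$ for the path $z-u_1-\cdots-u_m$ whose edges are numbered $1,\dots,m$ starting from $z$. The *star-product* $\mathcal A(k)\otimes\mathcal A(l)\to\mathcal A(k+l)$ is induced by $$T_1*T_2=\frac{\epsilon(T_1)\epsilon(T_2)\epsilon(T)}{\prod_i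 k_i!\,l_i!}\,\mathrm{Asym}(T),$$ where $T$ is obtained by replacing $t^{(i)}_j$ by $t^{(i)}_{k_i+j}$ in $T_2$, adding $|k|$ to its edge numbers and gluing the two trees at $z$. Here $\epsilon$ of a tree is the sign of the sequence of the heads (the ends farther from $z$) of its edges $1,2,\dots$ relative to the order $t^{(1)}_1,\dots,t^{(1)}_{k_1},\dots,t^{(n)}_1,\dots,t^{(n)}_{k_n}$. **Canonical element.** Let $U[k]$ be the degree-$k$ part of the free associative $\mathbb C$-algebra on $\tilde f_1,\dots,\tilde f_n$. The residue $\mathrm{res}_t$ at a variable $t$ sends a forest in which $zt$ is the edge numbered $a$ to $(-1)^{a-1}$ times the forest obtained by contracting this edge to $z$ and lowering the numbers $>a$ by $1$; it is $0$ on a forest without the edge $zt$. A $k$-multiindex is a map $J:\{1,\dots,|k|\}\to\{1,\dots,n\}$ taking each value $i$ exactly $k_i$ times; put $\tilde f_J=\tilde f_{J(|k|)}\cdots\tilde f_{J(1)}$, $\mathrm{sgn}(J)=(-1)^{\#\{a<b:\,J(a)>J(b)\}}$, $c(a)=\#\{b\le a: J(b)=J(a)\}$. Then $\langle\tilde f_J,x\rangle$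 is $\mathrm{sgn}(J)$ times the number obtained from $x\in\mathcal A(k)$ by taking successively the residues at $t^{(J(1))}_{c(1)},\dots,t^{(J(|k|))}_{c(|k|)}$. The *canonical element* $\Omega_k\in\mathcal A(k)\otimes U[k]$ is the element with $(\langle\tilde f_J,\cdot\rangle\otimes\mathrm{id})\Omega_k=\tilde f_J$ for all $J$. **Lie algebras.** Let $\mathfrak g$ be a finite-dimensional complex simple Lie algebra of one of the types below, with Cartan decomposition $\mathfrak g=\mathfrak n\oplus\mathfrak h\oplus\mathfrak n_+$ and Chevalley generators $e_i,h_i,f_i$ for the indicated simple roots $\alpha_i$ (so $\mathfrak n$ is generated by the $f_i$; the number $n$ of colours is the rank). Let $q$ be the homomorphism $\tilde f_i\mapsto f_i$ to $U(\mathfrak n)$ and $\Omega^{\mathfrak g}_k=(\mathrm{id}\otimes q)\Omega_k$. In the root lists $e_1,\dots,e_r$ denotes an orthonormal basis, $[f_{(i_1,\dots,i_m)}]=[\dots[[f_{i_1},f_{i_2}],f_{i_3}]\dots,f_{i_m}]$, and $(a,\dots,b)$ runs through consecutive integers from $a$ to $b$ (up or down as appropriate). For the following orderings $\beta_1<\dots<\beta_m$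 of the positive roots and root vectors $F_\beta$, let $k^{(j)}\in\mathbb N^n$ be the degree of $F_{\beta_j}$ and $F^p=F_{\beta_1}^{p_1}\cdots F_{\beta_m}^{p_m}$. * **$A_{r-1}$, $r\ge2$.** $\alpha_i=e_i-e_{i+1}$ ($1\le i<r$). Order: $e_i-e_j<e_{i'}-e_{j'}$ if $i<i'$, or $i=i'$ and $j<j'$. For $i<j$: $F_{e_i-e_j}=[f_{(j-1,\dots,i)}]$. Elements: $\eta_{e_i-e_j}=\mathrm{str}(t^{(i)}_1,\dots,t^{(j-1)}_1)$. * **$B_r$, $r\ge 1$.** $\alpha_i=e_i-e_{i+1}$ ($i<r$), $\alpha_r=e_r$. Order: each of $e_i,e_i\pm e_j$ ($j>i$) precedes each of $e_{i'},e_{i'}\pm e_{j'}$ ($j'>i'$) if $i>i'$; and for fixed $i$, $e_i+e_{i+1}<e_i+e_{i+2}<\dots<e_i+e_r<e_i<e_i-e_r<\dots<e_i-e_{i+2}<e_i-e_{i+1}$. For $i<j$: $F_{e_i-e_j}=[f_{(j-1,\dots,i)}]$, $F_{e_i+e_j}=(-1)^{\binom{j-i+1}2+(r-j+1)}[f_{(i,\dots,r,r,\dots,j)}]$;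 and $F_{e_i}=[f_{(r,\dots,i)}]$. Elements: $\eta_{e_i-e_j}=(-1)^{\binom{j-i-1}2}\mathrm{str}(t^{(j-1)}_1,\dots,t^{(i)}_1)$, $\eta_{e_i}=(-1)^{\binom{r-i}2}\mathrm{str}(t^{(r)}_1,\dots,t^{(i)}_1)$, $\eta_{e_i+e_j}=(-1)^{j-i}\,\mathrm{Asym}\,\mathrm{str}(t^{(j)}_2,\dots,t^{(r)}_2,t^{(r)}_1,\dots,t^{(i)}_1)$. * **$C_r$, $r\ge 1$.** $\alpha_i=e_i-e_{i+1}$ ($i<r$), $\alpha_r=2e_r$. Order: as for $B_r$ with $2e_i$ in place of $e_i$. For $i<j$: $F_{e_i-e_j}=[f_{(j-1,\dots,i)}]$, $F_{e_i+e_j}=(-1)^{r-j}[f_{(i,\dots,r,r-1,\dots,j)}]$ (so $F_{e_i+e_r}=[f_{(i,\dots,r)}]$); and $F_{2e_i}=\frac{(-1)^{r-i}}2[f_{(i,\dots,r,r-1,\dots,i)}]$ (so $F_{2e_r}=\frac12f_r$). Elements: $\eta_{e_i-e_j}=(-1)^{\binom{j-i-1}2}\mathrm{str}(t^{(j-1)}_1,\dots,t^{(i)}_1)$,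 $\eta_{e_i+e_j}=(-1)^{\binom{j-i+1}2+(r-j)}\,\mathrm{Asym}\,\mathrm{str}(t^{(j)}_2,\dots,t^{(r-1)}_2,t^{(r)}_1,\dots,t^{(i)}_1)$. For $i<r$, $\eta_{2e_i}=\mathrm{Asym}(T)$, where $T$ consists of the edge $z-t^{(r)}_1$ numbered $1$, the branch $t^{(r)}_1-t^{(r-1)}_1-\cdots-t^{(i)}_1$ numbered $2,\dots,r-i+1$ in this direction, and the branch $t^{(r)}_1-t^{(r-1)}_2-\cdots-t^{(i)}_2$ numbered $2r-2i+1,2r-2i,\dots,r-i+2$ in this direction. Finally $\eta_{2e_r}=2\,\mathrm{str}(t^{(r)}_1)$. * **$D_r$, $r\ge 3$.** $\alpha_1=e_1+e_2$, $\alpha_j=e_j-e_{j-1}$ ($1<j\le r$). Order: $e_j\pm e_i$ ($i<j$) precedes $e_{j'}\pm e_{i'}$ ($i'<j'$) if $j<j'$; and for fixed $j$, $e_j+e_{j-1}<\dots<e_j+e_2<e_j+e_1<e_j-e_1<e_j-e_2<\dots<e_j-e_{j-1}$. For $i<j$: $F_{e_j-e_i}=[f_{(j,\dots,i+1)}]$,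 $F_{e_j+e_1}=[f_{(j,\dots,3,1)}]$ (so $F_{e_2+e_1}=f_1$), and $F_{e_j+e_i}=[f_{(j,\dots,1,3,\dots,i)}]$ for $i>1$ (so $F_{e_j+e_2}=[f_{(j,\dots,1)}]$). Elements: $\eta_{e_j-e_i}=\mathrm{str}(t^{(i+1)}_1,\dots,t^{(j)}_1)$, $\eta_{e_j+e_1}=\mathrm{str}(t^{(1)}_1,t^{(3)}_1,\dots,t^{(j)}_1)$, and for $i>1$ $$\eta_{e_j+e_i}=(-1)^i\Big(\mathrm{Asym}\,\mathrm{str}(t^{(i)}_2,\dots,t^{(3)}_2,t^{(1)}_1,t^{(2)}_1,t^{(3)}_1,\dots,t^{(j)}_1)-\mathrm{Asym}\,\mathrm{str}(t^{(i)}_2,\dots,t^{(3)}_2,t^{(2)}_1,t^{(1)}_1,t^{(3)}_1,\dots,t^{(j)}_1)\Big).$$ **Theorem.** In each of these cases the monomials $F^p$ ($p\in\mathbb N^m$) form a basis of $U(\mathfrak n)$, the canonical element $\Omega_k$ exists and is unique for every $k$, and the elements $\eta_{\beta_j}\in\mathcal A(k^{(j)})$ listed above are the unique family of elements such that, for every $k\in\mathbb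 N^n$, $$\Omega^{\mathfrak g}_k=\sum_{p:\ \sum_j p_jk^{(j)}=k}T_p\otimes F^p,\qquad T_p=\frac1{\prod_l p_l!}\ \eta_{\beta_1}^{*p_1}*\eta_{\beta_2}^{*p_2}*\cdots*\eta_{\beta_m}^{*p_m}.$$ -/

import Mathlib

open scoped TensorProduct DirectSum
noncomputable section
namespace TreePBW

/-! ### Ordered forests and the spaces they span -/

/-- A sequence of `p` edges (the edge numbered `a` is `e a`) is an ordered `p`-forest: the edges are
distinct, there are no loops, and the graph that they form has no cycle. -/
def IsForest {V : Type} {p : ℕ} (e : Fin p → Sym2 V) : Prop :=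
  Function.Injective e ∧ (∀ a, ¬ (e a).IsDiag) ∧
    (SimpleGraph.fromEdgeSet (Set.range e)).IsAcyclic

/-- The ordered `p`-forests on the vertex set `V`. -/
abbrev Forest (V : Type) (p : ℕ) : Type := {e : Fin p → Sym2 V // IsForest e}

/-- The three edge sequences agree except for the edges numbered `a` and `b`, where they run through
the three pairs of sides of the triangle `x y w` as in the three-term relation. -/
def Triangle {V : Type} {p : ℕ} (e₁ e₂ e₃ : Fin p → Sym2 V) (a b : Fin p) (x y w : V) : Prop :=
  a ≠ b ∧ x ≠ y ∧ x ≠ w ∧ y ≠ w ∧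
  e₁ a = s(x, y) ∧ e₁ b = s(x, w) ∧
  e₂ a = s(y, w) ∧ e₂ b = s(x, y) ∧
  e₃ a = s(x, w) ∧ e₃ b = s(y, w) ∧
  ∀ c, c ≠ a → c ≠ b → e₁ c = e₂ c ∧ e₁ c = e₃ c

/-- The span of the relations: interchanging two edge numbers changes the sign, and the sum of three
forests that differ only in a triangle, as described by `Triangle`, is zero. -/
def relations (V : Type) (p : ℕ) : Submodule ℂ (Forest V p →₀ ℂ) :=
  Submodule.span ℂ
    ({u | ∃ (T₁ T₂ : Forest V p) (a b : Fin p), a ≠ b ∧ T₂.1 = T₁.1 ∘ Equiv.swap a b ∧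
        u = Finsupp.single T₁ 1 + Finsupp.single T₂ 1} ∪
     {u | ∃ (T₁ T₂ T₃ : Forest V p) (a b : Fin p) (x y w : V),
        Triangle T₁.1 T₂.1 T₃.1 a b x y w ∧
        u = Finsupp.single T₁ 1 + Finsupp.single T₂ 1 + Finsupp.single T₃ 1})

/-- The complex vector space generated by the ordered `p`-forests on `V` modulo
`relations`. -/
abbrev OS (V : Type) (p : ℕ) : Type := (Forest V p →₀ ℂ) ⧸ relations V p

open Classical in
/-- The class of a sequence of edges: the class of the ordered forest if it is one, otherwise 0. -/
def cls {V : Type} {p : ℕ} (e : Fin p → Sym2 V) : OS V p :=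
  if h : IsForest e then (relations V p).mkQ (Finsupp.single ⟨e, h⟩ 1) else 0

/-- The coboundary modulo 2 of a function on the vertices. -/
def bd {V : Type} (g : V → ZMod 2) : Sym2 V → ZMod 2 :=
  Sym2.lift ⟨fun x y => g x + g y, fun _ _ => add_comm _ _⟩

theorem bd_mk {V : Type} (g : V → ZMod 2) (x y : V) : bd g s(x, y) = g x + g y := rfl

theorem bd_sum {V ι : Type} (s : Finset ι) (c : ι → ZMod 2) (g : ι → V → ZMod 2) (z : Sym2 V) :
    bd (fun v => ∑ i ∈ s, c i * g i v) z = ∑ i ∈ s, c i * bd (g i) z := by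
  induction z using Sym2.ind with
  | _ x y => simp only [bd_mk, ← Finset.sum_add_distrib, mul_add]

/-- A graph is a forest if and only if its edges are linearly independent modulo 2. -/
theorem isForest_iff {V : Type} {p : ℕ} (e : Fin p → Sym2 V) :
    IsForest e ↔ ∀ c : Fin p → ZMod 2, ∃ g : V → ZMod 2, ∀ a, bd g (e a) = c a := by
  classical
  constructor
  · rintro ⟨hinj, hd, hac⟩
    have key : ∀ a, ∃ g : V → ZMod 2, ∀ b, bd g (e b) = if b = a then 1 else 0 := by
      intro a
      obtain ⟨x, y, hxy⟩ : ∃ x y, e a = s(x, y) := by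
        induction h : e a using Sym2.ind with
        | _ x y => exact ⟨x, y, rfl⟩
      set G := SimpleGraph.fromEdgeSet (Set.range e) with hG
      have hne : x ≠ y := by
        have := hd a
        rw [hxy] at this
        simpa using this
      have hadj : G.Adj x y := by
        rw [hG, SimpleGraph.fromEdgeSet_adj]
        exact ⟨⟨a, hxy⟩, hne⟩
      have hbr := SimpleGraph.isAcyclic_iff_forall_adj_isBridge.1 hac hadj
      rw [SimpleGraph.isBridge_iff] at hbr
      replace hbr : ¬ (G \ SimpleGraph.fromEdgeSet {s(x, y)}).Reachable x y := hbr
      refine ⟨fun v => if (G \ SimpleGraph.fromEdgeSet {s(x, y)}).Reachable x v then 1 else 0, ?_⟩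
      intro b
      by_cases hba : b = a
      · subst hba
        rw [hxy, bd_mk, if_pos (SimpleGraph.Reachable.refl x), if_neg hbr]
        simp
      · rw [if_neg hba]
        have hb : ∀ u w, e b = s(u, w) →
            (G \ SimpleGraph.fromEdgeSet {s(x, y)}).Adj u w := by
          intro u w huw
          rw [SimpleGraph.sdiff_adj, hG, SimpleGraph.fromEdgeSet_adj,
            SimpleGraph.fromEdgeSet_adj]
          have hdb := hd b
          rw [huw] at hdb
          refine ⟨⟨⟨b, huw⟩, by simpa using hdb⟩, ?_⟩
          rintro ⟨h1, -⟩
          exact hba (hinj (by rw [huw, hxy]; exact h1))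
        induction h : e b using Sym2.ind with
        | _ u w =>
          have := hb u w h
          rw [bd_mk]
          by_cases hu : (G \ SimpleGraph.fromEdgeSet {s(x, y)}).Reachable x u
          · rw [if_pos hu, if_pos (hu.trans this.reachable)]; decide
          · rw [if_neg hu, if_neg (fun hw => hu (hw.trans this.reachable.symm))]; decide
    choose g hg using key
    intro c
    refine ⟨fun v => ∑ a, c a * g a v, fun a => ?_⟩
    rw [bd_sum]
    simp [hg]
  · intro h
    have hd : ∀ a, ¬ (e a).IsDiag := by
      intro a ha
      obtain ⟨g, hg⟩ := h (fun _ => 1)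
      have h1 := hg a
      induction h2 : e a using Sym2.ind with
      | _ u w =>
        rw [h2] at ha h1
        have : u = w := by simpa using ha
        subst this
        rw [bd_mk, CharTwo.add_self_eq_zero] at h1
        exact absurd h1 (by decide)
    refine ⟨?_, hd, ?_⟩
    · intro a b hab
      by_contra hne
      obtain ⟨g, hg⟩ := h (fun i => if i = a then 1 else 0)
      have h1 := hg a
      have h2 := hg b
      rw [if_pos rfl] at h1
      rw [if_neg (fun h => hne h.symm), ← hab, h1] at h2
      exact absurd h2 (by decide)
    · rw [SimpleGraph.isAcyclic_iff_forall_adj_isBridge]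
      intro x y hxy
      rw [SimpleGraph.isBridge_iff]
      intro hr
      rw [SimpleGraph.fromEdgeSet_adj] at hxy
      obtain ⟨⟨a, ha⟩, hne⟩ := hxy
      obtain ⟨g, hg⟩ := h (fun i => if i = a then 1 else 0)
      have key : ∀ u w, (SimpleGraph.fromEdgeSet (Set.range e) \
          SimpleGraph.fromEdgeSet {s(x, y)}).Reachable u w → g u = g w := by
        rintro u w ⟨q⟩
        induction q with
        | nil => rfl
        | cons hadj q ih =>
          rw [← ih]
          rw [SimpleGraph.sdiff_adj, SimpleGraph.fromEdgeSet_adj,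
            SimpleGraph.fromEdgeSet_adj] at hadj
          obtain ⟨⟨⟨b, hb⟩, hne'⟩, hn⟩ := hadj
          have hba : b ≠ a := by
            rintro rfl
            exact hn ⟨by rw [← hb, ha]; rfl, hne'⟩
          have := hg b
          rw [if_neg hba, hb, bd_mk] at this
          exact CharTwo.add_eq_zero.1 this
      have h1 := hg a
      rw [if_pos rfl, ha, bd_mk, key x y hr, CharTwo.add_self_eq_zero] at h1
      exact absurd h1 (by decide)

theorem IsForest.perm {V : Type} {p : ℕ} {e : Fin p → Sym2 V} (h : IsForest e)
    (σ : Equiv.Perm (Fin p)) : IsForest (e ∘ σ) := by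
  refine ⟨h.1.comp σ.injective, fun a => h.2.1 _, ?_⟩
  rw [Set.range_comp, σ.surjective.range_eq, Set.image_univ]
  exact h.2.2

theorem cls_of_forest {V : Type} {p : ℕ} {e : Fin p → Sym2 V} (h : IsForest e) :
    cls e = (relations V p).mkQ (Finsupp.single ⟨e, h⟩ 1) := dif_pos h

theorem cls_of_not {V : Type} {p : ℕ} {e : Fin p → Sym2 V} (h : ¬ IsForest e) :
    cls e = 0 := dif_neg h

theorem cls_swap {V : Type} {p : ℕ} (e : Fin p → Sym2 V) {a b : Fin p} (hab : a ≠ b) :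
    cls (e ∘ Equiv.swap a b) = - cls e := by
  by_cases h : IsForest e
  · rw [cls_of_forest h, cls_of_forest (h.perm (Equiv.swap a b)), eq_neg_iff_add_eq_zero,
      ← map_add, add_comm, Submodule.mkQ_apply, Submodule.Quotient.mk_eq_zero]
    exact Submodule.subset_span (Or.inl ⟨_, _, a, b, hab, rfl, rfl⟩)
  · rw [cls_of_not h, cls_of_not, neg_zero]
    intro h'
    apply h
    have := h'.perm (Equiv.swap a b)
    rwa [Function.comp_assoc, ← Equiv.coe_trans, ← Equiv.Perm.mul_def, Equiv.swap_mul_self,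
      Equiv.Perm.coe_one, Function.comp_id] at this

theorem cls_perm {V : Type} {p : ℕ} (e : Fin p → Sym2 V) (σ : Equiv.Perm (Fin p)) :
    cls (e ∘ σ) = ((Equiv.Perm.sign σ : ℤ) : ℂ) • cls e := by
  induction σ using Equiv.Perm.swap_induction_on' with
  | one => simp
  | mul_swap f x y hxy ih =>
    rw [Equiv.Perm.coe_mul, ← Function.comp_assoc, cls_swap _ hxy, ih]
    simp [Equiv.Perm.sign_swap hxy]

theorem Triangle.rotate {V : Type} {p : ℕ} {e₁ e₂ e₃ : Fin p → Sym2 V} {a b : Fin p} {x y w : V}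
    (h : Triangle e₁ e₂ e₃ a b x y w) : Triangle e₂ e₃ e₁ a b y w x := by
  obtain ⟨h1, h2, h3, h4, h5, h6, h7, h8, h9, h10, h11⟩ := h
  refine ⟨h1, h4, h2.symm, h3.symm, h7, ?_, ?_, h10, ?_, ?_, ?_⟩
  · rw [h8, Sym2.eq_swap]
  · rw [h9, Sym2.eq_swap]
  · rw [h5, Sym2.eq_swap]
  · rw [h6, Sym2.eq_swap]
  · intro c hc hc'
    obtain ⟨u, v⟩ := h11 c hc hc'
    exact ⟨u.symm.trans v, u.symm⟩

theorem Triangle.forest {V : Type} {p : ℕ} {e₁ e₂ e₃ : Fin p → Sym2 V} {a b : Fin p} {x y w : V}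
    (h : Triangle e₁ e₂ e₃ a b x y w) (hf : IsForest e₁) : IsForest e₂ := by
  obtain ⟨h1, h2, h3, h4, h5, h6, h7, h8, h9, h10, h11⟩ := h
  rw [isForest_iff] at hf ⊢
  intro c
  obtain ⟨g, hg⟩ := hf (fun i => if i = a then c b else if i = b then c a + c b else c i)
  refine ⟨g, fun i => ?_⟩
  have ha := hg a
  have hb := hg b
  rw [if_pos rfl, h5, bd_mk] at ha
  rw [if_neg h1.symm, if_pos rfl, h6, bd_mk] at hb
  by_cases hia : i = a
  · subst hia
    rw [h7, bd_mk]
    have e : g y + g w = (g x + g y) + (g x + g w) := by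
      have := CharTwo.add_self_eq_zero (g x)
      linear_combination -this
    rw [e, ha, hb]
    have := CharTwo.add_self_eq_zero (c b)
    linear_combination this
  · by_cases hib : i = b
    · subst hib
      rw [h8, bd_mk, ha]
    · have := hg i
      rw [if_neg hia, if_neg hib] at this
      rw [← (h11 i hia hib).1, this]

theorem cls_triangle {V : Type} {p : ℕ} {e₁ e₂ e₃ : Fin p → Sym2 V} {a b : Fin p} {x y w : V}
    (h : Triangle e₁ e₂ e₃ a b x y w) : cls e₁ + cls e₂ + cls e₃ = 0 := by
  by_cases hf : IsForest e₁
  · have hf2 := h.forest hf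
    have hf3 := h.rotate.forest hf2
    rw [cls_of_forest hf, cls_of_forest hf2, cls_of_forest hf3, ← map_add, ← map_add,
      Submodule.mkQ_apply, Submodule.Quotient.mk_eq_zero]
    exact Submodule.subset_span (Or.inr ⟨_, _, _, a, b, x, y, w, h, rfl⟩)
  · have hf3 : ¬ IsForest e₃ := fun h3 => hf (h.rotate.rotate.forest h3)
    have hf2 : ¬ IsForest e₂ := fun h2 => hf3 (h.rotate.forest h2)
    rw [cls_of_not hf, cls_of_not hf2, cls_of_not hf3]
    simp

/-- A linear map out of `OS V p` from its values on ordered forests. -/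
def OS.lift {V : Type} {p : ℕ} {M : Type*} [AddCommGroup M] [Module ℂ M]
    (φ : (Fin p → Sym2 V) → M)
    (h₁ : ∀ e, IsForest e → ∀ a b, a ≠ b → φ (e ∘ Equiv.swap a b) = - φ e)
    (h₂ : ∀ e₁ e₂ e₃ a b x y w, IsForest e₁ → IsForest e₂ → IsForest e₃ →
      Triangle e₁ e₂ e₃ a b x y w → φ e₁ + φ e₂ + φ e₃ = 0) : OS V p →ₗ[ℂ] M :=
  (relations V p).liftQ (Finsupp.linearCombination ℂ fun T : Forest V p => φ T.1) (by
    rw [relations, Submodule.span_le]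
    rintro u (⟨T₁, T₂, a, b, hab, h, rfl⟩ | ⟨T₁, T₂, T₃, a, b, x, y, w, h, rfl⟩)
    · simp [h, h₁ T₁.1 T₁.2 a b hab]
    · simpa using h₂ _ _ _ a b x y w T₁.2 T₂.2 T₃.2 h)

theorem OS.lift_cls {V : Type} {p : ℕ} {M : Type*} [AddCommGroup M] [Module ℂ M]
    (φ : (Fin p → Sym2 V) → M) (h₁) (h₂) {e : Fin p → Sym2 V} (h : IsForest e) :
    OS.lift φ h₁ h₂ (cls e) = φ e := by
  rw [cls_of_forest h, OS.lift, Submodule.mkQ_apply, Submodule.liftQ_apply]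
  simp

theorem OS.hom_ext {V : Type} {p : ℕ} {M : Type*} [AddCommGroup M] [Module ℂ M]
    {φ ψ : OS V p →ₗ[ℂ] M} (h : ∀ e, IsForest e → φ (cls e) = ψ (cls e)) : φ = ψ := by
  apply Submodule.linearMap_qext
  apply Finsupp.lhom_ext'
  intro T
  ext
  have := h T.1 T.2
  rw [cls_of_forest T.2] at this
  simpa using this

/-- The map induced by an injective renaming of the vertices. -/
def OS.map {V W : Type} {p : ℕ} (f : V ↪ W) : OS V p →ₗ[ℂ] OS W p :=
  OS.lift (fun e => cls (Sym2.map f ∘ e))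
    (fun e _ a b hab => by rw [← Function.comp_assoc, cls_swap _ hab])
    (fun e₁ e₂ e₃ a b x y w _ _ _ h => by
      obtain ⟨h1, h2, h3, h4, h5, h6, h7, h8, h9, h10, h11⟩ := h
      refine cls_triangle (a := a) (b := b) (x := f x) (y := f y) (w := f w)
        ⟨h1, f.injective.ne h2, f.injective.ne h3, f.injective.ne h4, ?_, ?_, ?_, ?_, ?_, ?_,
          fun c hc hc' => ?_⟩
      on_goal 7 => exact ⟨congrArg _ (h11 c hc hc').1, congrArg _ (h11 c hc hc').2⟩
      all_goals simp [*])

theorem isForest_map {V W : Type} {p : ℕ} (f : V ↪ W) {e : Fin p → Sym2 V} (h : IsForest e) :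
    IsForest (Sym2.map f ∘ e) := by
  rw [isForest_iff] at h ⊢
  intro c
  obtain ⟨g, hg⟩ := h c
  refine ⟨Function.extend f g 0, fun a => ?_⟩
  rw [← hg a, Function.comp_apply]
  induction e a using Sym2.ind with
  | _ x y => simp [bd_mk, f.injective.extend_apply]

theorem OS.map_cls {V W : Type} {p : ℕ} (f : V ↪ W) {e : Fin p → Sym2 V} (h : IsForest e) :
    OS.map f (cls e) = cls (Sym2.map f ∘ e) := OS.lift_cls _ _ _ h

theorem OS.map_map {V W X : Type} {p : ℕ} (f : V ↪ W) (g : W ↪ X) (u : OS V p) :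
    OS.map g (OS.map f u) = OS.map (f.trans g) u := by
  have : (OS.map g (p := p)) ∘ₗ OS.map f = OS.map (f.trans g) := by
    apply OS.hom_ext
    intro e he
    rw [LinearMap.comp_apply, OS.map_cls f he, OS.map_cls g (isForest_map f he),
      OS.map_cls _ he]
    congr 1
    funext a
    simp [Sym2.map_map]
  exact LinearMap.congr_fun this u

/-- Juxtaposition of ordered graphs on the same vertex set; the edge numbers of the second one are
increased by the number of edges of the first one. -/
def OS.join {V : Type} {p q : ℕ} : OS V p →ₗ[ℂ] OS V q →ₗ[ℂ] OS V (p + q) :=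
  OS.lift
    (fun e => OS.lift (fun e' => cls (Fin.append e e'))
      (fun e' _ a b hab => by
        rw [← cls_swap _ ((Fin.natAdd_injective q p).ne hab)]
        congr 1
        funext c
        refine Fin.addCases (fun i => ?_) (fun i => ?_) c
        · rw [Function.comp_apply, Equiv.swap_apply_of_ne_of_ne]
          · simp
          · intro h; have := congrArg Fin.val h; have := i.2; simp at *; omega
          · intro h; have := congrArg Fin.val h; have := i.2; simp at *; omega
        · rw [Function.comp_apply, (Fin.natAdd_injective q p).swap_apply]
          simp)
      (fun e₁ e₂ e₃ a b x y w _ _ _ h => by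
        obtain ⟨h1, h2, h3, h4, h5, h6, h7, h8, h9, h10, h11⟩ := h
        refine cls_triangle (a := Fin.natAdd p a) (b := Fin.natAdd p b) (x := x) (y := y) (w := w)
          ⟨(Fin.natAdd_injective q p).ne h1, h2, h3, h4, by simpa, by simpa, by simpa, by simpa,
            by simpa, by simpa, fun c => ?_⟩
        refine Fin.addCases (fun i => ?_) (fun i => ?_) c
        · intro _ _; simp
        · intro hc hc'
          simpa using h11 i (fun h => hc (h ▸ rfl)) (fun h => hc' (h ▸ rfl))))
    (fun e _ a b hab => by
      apply OS.hom_ext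
      intro e' he'
      rw [LinearMap.neg_apply, OS.lift_cls _ _ _ he', OS.lift_cls _ _ _ he',
        ← cls_swap _ ((Fin.castAdd_injective p q).ne hab)]
      congr 1
      funext c
      refine Fin.addCases (fun i => ?_) (fun i => ?_) c
      · rw [Function.comp_apply, (Fin.castAdd_injective p q).swap_apply]
        simp
      · rw [Function.comp_apply, Equiv.swap_apply_of_ne_of_ne]
        · simp
        · intro h; have := congrArg Fin.val h; have := a.2; simp at *; omega
        · intro h; have := congrArg Fin.val h; have := b.2; simp at *; omega)
    (fun e₁ e₂ e₃ a b x y w _ _ _ h => by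
      apply OS.hom_ext
      intro e' he'
      rw [LinearMap.add_apply, LinearMap.add_apply, OS.lift_cls _ _ _ he', OS.lift_cls _ _ _ he',
        OS.lift_cls _ _ _ he', LinearMap.zero_apply]
      obtain ⟨h1, h2, h3, h4, h5, h6, h7, h8, h9, h10, h11⟩ := h
      refine cls_triangle (a := Fin.castAdd q a) (b := Fin.castAdd q b) (x := x) (y := y) (w := w)
        ⟨(Fin.castAdd_injective p q).ne h1, h2, h3, h4, by simpa, by simpa, by simpa, by simpa,
          by simpa, by simpa, fun c => ?_⟩
      refine Fin.addCases (fun i => ?_) (fun i => ?_) c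
      · intro hc hc'
        simpa using h11 i (fun h => hc (h ▸ rfl)) (fun h => hc' (h ▸ rfl))
      · intro _ _; simp)

/-! ### Residues -/

theorem cls_succAbove {V : Type} {p : ℕ} (e : Fin (p + 1) → Sym2 V) (σ : Equiv.Perm (Fin (p + 1)))
    (a : Fin (p + 1)) :
    (-1 : ℂ) ^ (a : ℕ) • cls (fun b => e (σ (a.succAbove b))) =
      (((Equiv.Perm.sign σ : ℤ) : ℂ) * (-1 : ℂ) ^ ((σ a : Fin (p + 1)) : ℕ)) •
        cls (fun b => e ((σ a).succAbove b)) := by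
  set P : Equiv.Perm (Fin (p + 1)) := Fin.cycleRange (σ a) * σ * (Fin.cycleRange a)⁻¹ with hP
  obtain ⟨⟨j, ρ⟩, hj⟩ : ∃ jρ, P = Equiv.Perm.decomposeFin.symm jρ :=
    ⟨Equiv.Perm.decomposeFin P, by simp⟩
  have hP0 : P 0 = 0 := by
    have : (Fin.cycleRange a)⁻¹ 0 = a := by
      rw [Equiv.Perm.inv_eq_iff_eq, Fin.cycleRange_self]
    rw [hP, Equiv.Perm.mul_apply, Equiv.Perm.mul_apply, this, Fin.cycleRange_self]
  have hj0 : j = 0 := by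
    rw [hj, Equiv.Perm.decomposeFin_symm_apply_zero] at hP0
    exact hP0
  subst hj0
  have hfun : ∀ b, σ (a.succAbove b) = (σ a).succAbove (ρ b) := by
    intro b
    have h1 : P b.succ = (ρ b).succ := by
      rw [hj, Equiv.Perm.decomposeFin_symm_apply_succ]
      simp
    have h2 : (Fin.cycleRange a)⁻¹ b.succ = a.succAbove b := by
      rw [Equiv.Perm.inv_eq_iff_eq, Fin.cycleRange_succAbove]
    rw [hP, Equiv.Perm.mul_apply, Equiv.Perm.mul_apply, h2, ← Fin.cycleRange_succAbove (σ a)] at h1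
    exact (Fin.cycleRange (σ a)).injective h1
  have hs : Equiv.Perm.sign ρ = (-1) ^ ((σ a : Fin (p + 1)) : ℕ) * Equiv.Perm.sign σ * (-1) ^ (a : ℕ) := by
    have := congrArg Equiv.Perm.sign hj
    rw [Equiv.Perm.decomposeFin.symm_sign, hP] at this
    simpa [Fin.sign_cycleRange] using this.symm
  have : (fun b => e (σ (a.succAbove b))) = (fun b => e ((σ a).succAbove b)) ∘ ρ := by
    funext b; simp [hfun]
  rw [this, cls_perm, hs, smul_smul]
  congr 1
  push_cast
  have h1 : ((-1 : ℂ) ^ (a : ℕ)) * (-1) ^ (a : ℕ) = 1 := by rw [← mul_pow]; simp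
  linear_combination (((Equiv.Perm.sign σ : ℤ) : ℂ) * (-1 : ℂ) ^ ((σ a : Fin (p + 1)) : ℕ)) * h1

/-- The vertex map that identifies `v` with `z`. -/
def contractVertex {V : Type} [DecidableEq V] (z v : V) (u : V) : V := if u = v then z else u

/-- The edge numbered `a` is deleted, its end `v` is identified with `z`, and the numbers greater than
`a` decrease by one. -/
def contract {V : Type} [DecidableEq V] {p : ℕ} (z v : V) (e : Fin (p + 1) → Sym2 V)
    (a : Fin (p + 1)) : Fin p → Sym2 V :=
  fun b => (e (a.succAbove b)).map (contractVertex z v)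

/-- The residue of an ordered forest; at most one term of the sum is nonzero. -/
def resSeq {V : Type} [DecidableEq V] {p : ℕ} (z v : V) (e : Fin (p + 1) → Sym2 V) : OS V p :=
  ∑ a : Fin (p + 1), if e a = s(z, v) then (-1 : ℂ) ^ (a : ℕ) • cls (contract z v e a) else 0

theorem resSeq_swap {V : Type} [DecidableEq V] {p : ℕ} (z v : V) (e : Fin (p + 1) → Sym2 V)
    (a b : Fin (p + 1)) (hab : a ≠ b) :
    resSeq z v (e ∘ Equiv.swap a b) = - resSeq z v e := by
  unfold resSeq
  rw [← Equiv.sum_comp (Equiv.swap a b) (fun c => if e c = s(z, v) then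
    (-1 : ℂ) ^ (c : ℕ) • cls (contract z v e c) else 0), ← Finset.sum_neg_distrib]
  refine Finset.sum_congr rfl fun c _ => ?_
  rw [Function.comp_apply]
  split_ifs
  · have := cls_succAbove (Sym2.map (contractVertex z v) ∘ e) (Equiv.swap a b) c
    rw [Equiv.Perm.sign_swap hab] at this
    change (-1 : ℂ) ^ (c : ℕ) • cls (contract z v (e ∘ Equiv.swap a b) c) =
      _ • cls (contract z v e (Equiv.swap a b c)) at this
    rw [this]
    simp
  · simp

theorem resSeq_cancel {V : Type} [DecidableEq V] {p : ℕ} (z v : V) (e e' : Fin (p + 1) → Sym2 V)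
    (a b : Fin (p + 1)) (hab : a ≠ b)
    (h : ∀ c, c ≠ b → (e' c).map (contractVertex z v) =
      (e (Equiv.swap a b c)).map (contractVertex z v)) :
    (-1 : ℂ) ^ (a : ℕ) • cls (contract z v e a) + (-1 : ℂ) ^ (b : ℕ) • cls (contract z v e' b)
      = 0 := by
  have h1 := cls_succAbove (Sym2.map (contractVertex z v) ∘ e) (Equiv.swap a b) b
  rw [Equiv.Perm.sign_swap hab, Equiv.swap_apply_right] at h1
  have h2 : contract z v e' b =
      fun c => (Sym2.map (contractVertex z v) ∘ e) (Equiv.swap a b (b.succAbove c)) := by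
    funext c
    exact h _ (Fin.succAbove_ne b c)
  change _ = _ • cls (contract z v e a) at h1
  rw [h2, h1]
  simp

theorem contractVertex_eq {V : Type} [DecidableEq V] {z v x y : V} (h : s(x, y) = s(z, v)) :
    contractVertex z v x = contractVertex z v y := by
  unfold contractVertex
  rcases Sym2.eq_iff.1 h with ⟨rfl, rfl⟩ | ⟨rfl, rfl⟩ <;> simp

theorem contractVertex_ne {V : Type} [DecidableEq V] {z v x y : V} (hxy : x ≠ y)
    (h : s(x, y) ≠ s(z, v)) : contractVertex z v x ≠ contractVertex z v y := by
  unfold contractVertex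
  intro h'
  split_ifs at h' with h1 h2 h2
  · exact hxy (h1.trans h2.symm)
  · subst h1 h'; exact h Sym2.eq_swap
  · subst h2 h'; exact h rfl
  · exact hxy h'

theorem resSeq_triangle_aux {V : Type} [DecidableEq V] {p : ℕ} (z v : V)
    {e₁ e₂ e₃ : Fin (p + 1) → Sym2 V} {a b : Fin (p + 1)} {x y w : V}
    (h : Triangle e₁ e₂ e₃ a b x y w) :
    (if e₁ a = s(z, v) then (-1 : ℂ) ^ (a : ℕ) • cls (contract z v e₁ a) else 0) +
      (if e₂ b = s(z, v) then (-1 : ℂ) ^ (b : ℕ) • cls (contract z v e₂ b) else 0) = 0 := by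
  obtain ⟨h1, h2, h3, h4, h5, h6, h7, h8, h9, h10, h11⟩ := h
  rw [h5, h8]
  split_ifs with hs
  · apply resSeq_cancel z v e₁ e₂ a b h1
    intro c hc
    by_cases hca : c = a
    · subst hca
      rw [Equiv.swap_apply_left, h6, h7, Sym2.map_mk, Sym2.map_mk, contractVertex_eq hs]
    · rw [Equiv.swap_apply_of_ne_of_ne hca hc, (h11 c hca hc).1]
  · simp

theorem resSeq_triangle {V : Type} [DecidableEq V] {p : ℕ} (z v : V)
    {e₁ e₂ e₃ : Fin (p + 1) → Sym2 V} {a b : Fin (p + 1)} {x y w : V}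
    (hf₁ : IsForest e₁) (hf₂ : IsForest e₂) (h : Triangle e₁ e₂ e₃ a b x y w) :
    resSeq z v e₁ + resSeq z v e₂ + resSeq z v e₃ = 0 := by
  unfold resSeq
  rw [← Finset.sum_add_distrib, ← Finset.sum_add_distrib, Fintype.sum_eq_add a b h.1]
  · have t1 := resSeq_triangle_aux z v h
    have t2 := resSeq_triangle_aux z v h.rotate
    have t3 := resSeq_triangle_aux z v h.rotate.rotate
    calc _ = _ := ?_
      _ = (0 : OS V p) + 0 + 0 := congrArg₂ _ (congrArg₂ _ t1 t2) t3
      _ = 0 := by simp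
    abel
  · rintro c ⟨hca, hcb⟩
    obtain ⟨h1, h2, h3, h4, h5, h6, h7, h8, h9, h10, h11⟩ := h
    rw [← (h11 c hca hcb).1, ← (h11 c hca hcb).2]
    split_ifs with hs
    · obtain ⟨a', ha'⟩ := Fin.exists_succAbove_eq (Ne.symm hca)
      obtain ⟨b', hb'⟩ := Fin.exists_succAbove_eq (Ne.symm hcb)
      rw [← smul_add, ← smul_add]
      have : cls (contract z v e₁ c) + cls (contract z v e₂ c) + cls (contract z v e₃ c) = 0 := by
        refine cls_triangle (a := a') (b := b') (x := contractVertex z v x)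
          (y := contractVertex z v y) (w := contractVertex z v w)
          ⟨?_, ?_, ?_, ?_, ?_, ?_, ?_, ?_, ?_, ?_, ?_⟩
        · rintro rfl
          exact h1 (ha'.symm.trans hb')
        · apply contractVertex_ne h2
          intro h
          exact hca (hf₁.1 (by rw [hs, h5, h]))
        · apply contractVertex_ne h3
          intro h
          exact hcb (hf₁.1 (by rw [hs, h6, h]))
        · apply contractVertex_ne h4
          intro h
          exact hca (hf₂.1 (by rw [← (h11 c hca hcb).1, hs, h7, h]))
        · unfold contract; rw [ha', h5, Sym2.map_mk]
        · unfold contract; rw [hb', h6, Sym2.map_mk]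
        · unfold contract; rw [ha', h7, Sym2.map_mk]
        · unfold contract; rw [hb', h8, Sym2.map_mk]
        · unfold contract; rw [ha', h9, Sym2.map_mk]
        · unfold contract; rw [hb', h10, Sym2.map_mk]
        · intro d hda hdb
          have hd := h11 (c.succAbove d)
            (fun h => hda (Fin.succAbove_right_injective (h.trans ha'.symm)))
            (fun h => hdb (Fin.succAbove_right_injective (h.trans hb'.symm)))
          unfold contract
          rw [← hd.1, ← hd.2]
          exact ⟨rfl, rfl⟩
      rw [this, smul_zero]
    · simp

/-- The residue at `v` (with respect to the base vertex `z`). The vertex `v` is kept as an isolated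
vertex instead of being removed from the vertex set. -/
def OS.res {V : Type} [DecidableEq V] {p : ℕ} (z v : V) : OS V (p + 1) →ₗ[ℂ] OS V p :=
  OS.lift (resSeq z v) (fun e _ a b hab => resSeq_swap z v e a b hab)
    (fun _ _ _ _ _ _ _ _ hf₁ hf₂ _ h => resSeq_triangle z v hf₁ hf₂ h)

/-- The coefficient of the edgeless graph. -/
def OS.coeffEmpty {V : Type} : OS V 0 →ₗ[ℂ] ℂ :=
  OS.lift (fun _ => 1) (fun _ _ a => a.elim0) (fun _ _ _ a => a.elim0)

/-- The iterated residue, taken first at `v 0`, then at `v 1`, and so on. -/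
def OS.iterRes {V : Type} [DecidableEq V] (z : V) : (p : ℕ) → (Fin p → V) → (OS V p →ₗ[ℂ] ℂ)
  | 0, _ => OS.coeffEmpty
  | p + 1, v => OS.iterRes z p (fun a => v a.succ) ∘ₗ OS.res z (v 0)

/-! ### The graded algebra of skew-invariant trees -/

/-- The set `T(k)` of the variables `t^{(i)}_j`, here with `i` and `j` counted from 0. -/
abbrev Var {n : ℕ} (k : Fin n → ℕ) : Type := Σ i : Fin n, Fin (k i)

/-- The vertex set `T(k) ∪ {z}`; the vertex `z` is `none`. -/
abbrev Vert {n : ℕ} (k : Fin n → ℕ) : Type := Option (Var k)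

/-- The group `G_k`, a product of symmetric groups. -/
abbrev ColorPerm {n : ℕ} (k : Fin n → ℕ) : Type := ∀ i : Fin n, Equiv.Perm (Fin (k i))

/-- The sign of an element of `G_k`. -/
def colorSign {n : ℕ} {k : Fin n → ℕ} (π : ColorPerm k) : ℂ :=
  ∏ i, ((Equiv.Perm.sign (π i) : ℤ) : ℂ)

/-- The permutation of the vertices given by an element of `G_k`. -/
def permVert {n : ℕ} {k : Fin n → ℕ} (π : ColorPerm k) : Vert k ≃ Vert k :=
  Equiv.optionCongr (Equiv.sigmaCongrRight π)

/-- The action of `G_k` on trees. -/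
def act {n : ℕ} {k : Fin n → ℕ} {p : ℕ} (π : ColorPerm k) : OS (Vert k) p →ₗ[ℂ] OS (Vert k) p :=
  OS.map (permVert π).toEmbedding

theorem act_act {n : ℕ} {k : Fin n → ℕ} {p : ℕ} (π σ : ColorPerm k) (u : OS (Vert k) p) :
    act π (act σ u) = act (π * σ) u := by
  unfold act
  rw [OS.map_map]
  congr 1
  congr 1
  ext v
  cases v <;> rfl

theorem colorSign_mul {n : ℕ} {k : Fin n → ℕ} (π σ : ColorPerm k) :
    colorSign (π * σ) = colorSign π * colorSign σ := by
  simp [colorSign, Finset.prod_mul_distrib]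

theorem colorSign_sq {n : ℕ} {k : Fin n → ℕ} (π : ColorPerm k) :
    colorSign π * colorSign π = 1 := by
  rw [colorSign, ← Finset.prod_mul_distrib]
  refine Finset.prod_eq_one fun i _ => ?_
  rcases Int.units_eq_one_or (Equiv.Perm.sign (π i)) with h | h <;> simp [h]

/-- The space `A(k)`: the skew-invariant part of the space of trees on `T(k) ∪ {z}`. -/
def skew {n : ℕ} (k : Fin n → ℕ) : Submodule ℂ (OS (Vert k) (∑ i, k i)) where
  carrier := {u | ∀ π : ColorPerm k, act π u = colorSign π • u}
  zero_mem' := by intro π; simp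
  add_mem' := by intro u v hu hv π; rw [map_add, hu π, hv π, smul_add]
  smul_mem' := by intro c u hu π; rw [map_smul, hu π, smul_comm]

/-- Antisymmetrization. -/
def asym {n : ℕ} (k : Fin n → ℕ) : OS (Vert k) (∑ i, k i) →ₗ[ℂ] skew k :=
  LinearMap.codRestrict (skew k) (∑ π : ColorPerm k, colorSign π • act π) (by
    intro u σ
    simp only [LinearMap.sum_apply, LinearMap.smul_apply, map_sum, map_smul, act_act,
      Finset.smul_sum, smul_smul]
    refine Fintype.sum_equiv (Equiv.mulLeft σ) _ _ fun π => ?_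
    rw [Equiv.coe_mulLeft, colorSign_mul, ← mul_assoc, colorSign_sq, one_mul])

/-- Vertices of the first factor of a star-product. -/
def inlVert {n : ℕ} (k l : Fin n → ℕ) : Vert k ↪ Vert (k + l) :=
  Function.Embedding.optionMap
    ⟨fun v => ⟨v.1, Fin.castAdd (l v.1) v.2⟩, by
      rintro ⟨i, a⟩ ⟨j, b⟩ h
      obtain rfl : i = j := congrArg Sigma.fst h
      simpa using h⟩

/-- Vertices of the second factor of a star-product: `t^{(i)}_j` becomes `t^{(i)}_{k_i + j}`. -/
def inrVert {n : ℕ} (k l : Fin n → ℕ) : Vert l ↪ Vert (k + l) :=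
  Function.Embedding.optionMap
    ⟨fun v => ⟨v.1, Fin.natAdd (k v.1) v.2⟩, by
      rintro ⟨i, a⟩ ⟨j, b⟩ h
      obtain rfl : i = j := congrArg Sigma.fst h
      simpa using h⟩

/-- The sign and the normalization of the star-product. The heads of the edges of the tree `T` that is
glued from `T₁` and `T₂` are, in order, those of `T₁` followed by those of `T₂`; so
`ε(T) = ε(T₁) ε(T₂) s`, where `s` is the sign of the reordering of the variables of `T(k)` followed by
the (shifted) variables of `T(l)` into the order of `T(k + l)`, and `ε(T₁) ε(T₂) ε(T) = s` is
`(-1) ^ ∑_{j < i} k_i l_j`. -/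
def starCoeff {n : ℕ} (k l : Fin n → ℕ) : ℂ :=
  (-1) ^ (∑ i, ∑ j, if j < i then k i * l j else 0) /
    ∏ i, ((k i).factorial * (l i).factorial : ℂ)

/-- Change of the name of the number of edges. -/
def OS.cast {V : Type} {p q : ℕ} (h : p = q) : OS V p →ₗ[ℂ] OS V q := h ▸ LinearMap.id

/-- The star-product `A(k) ⊗ A(l) → A(k + l)`. -/
def star {n : ℕ} (k l : Fin n → ℕ) : skew k →ₗ[ℂ] skew l →ₗ[ℂ] skew (k + l) :=
  starCoeff k l •
    ((OS.join.compl₁₂ (OS.map (inlVert k l) ∘ₗ (skew k).subtype)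
      (OS.map (inrVert k l) ∘ₗ (skew l).subtype)).compr₂
        (asym (k + l) ∘ₗ OS.cast (by simp [Finset.sum_add_distrib])))

/-- The star-product on the direct sum of all `A(k)`. -/
def starTotal (n : ℕ) : (⨁ k : Fin n → ℕ, skew k) →ₗ[ℂ] (⨁ k : Fin n → ℕ, skew k) →ₗ[ℂ]
    (⨁ k : Fin n → ℕ, skew k) :=
  DirectSum.toModule ℂ _ _ fun k => LinearMap.flip <|
    DirectSum.toModule ℂ _ _ fun l => LinearMap.flip <|
      (star k l).compr₂ (DirectSum.lof ℂ (Fin n → ℕ) (fun k => skew k) (k + l))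

/-- The unit of the star-product: the class of the tree without edges in `A(0)`. -/
def starOne (n : ℕ) : ⨁ k : Fin n → ℕ, skew k :=
  DirectSum.lof ℂ (Fin n → ℕ) (fun k => skew k) 0
    (asym 0 (OS.cast (by simp) (cls (p := 0) Fin.elim0)))

/-! ### Multiindices, the pairing, and the canonical element -/

/-- The `k`-multiindices. -/
def Multiindex {n : ℕ} (k : Fin n → ℕ) : Type :=
  {J : Fin (∑ i, k i) → Fin n // ∀ i, (Finset.univ.filter fun a => J a = i).card = k i}

/-- The variable `t^{(J(a))}_{c(a)}`: it is the next one of its colour. -/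
def Multiindex.var {n : ℕ} {k : Fin n → ℕ} (J : Multiindex k) (a : Fin (∑ i, k i)) : Var k :=
  ⟨J.1 a, (Finset.univ.filter fun b => b < a ∧ J.1 b = J.1 a).card, by
    rw [← J.2 (J.1 a)]
    apply Finset.card_lt_card
    rw [Finset.ssubset_iff_of_subset]
    · exact ⟨a, by simp, by simp⟩
    · intro b; simp⟩

/-- The sign of a multiindex: `(-1) ^ m`, where `m` is the minimal number of interchanges of
neighbours that sort the list `J(1), J(2), …`, that is, its number of inversions. -/
def Multiindex.sgn {n : ℕ} {k : Fin n → ℕ} (J : Multiindex k) : ℂ :=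
  (-1) ^ (Finset.univ.filter fun ab : Fin (∑ i, k i) × Fin (∑ i, k i) =>
    ab.1 < ab.2 ∧ J.1 ab.2 < J.1 ab.1).card

/-- The monomial `f̃_J = f̃_{J(|k|)} ⋯ f̃_{J(1)}` in the free associative algebra. -/
def Multiindex.monomial {n : ℕ} {k : Fin n → ℕ} (J : Multiindex k) : FreeAlgebra ℂ (Fin n) :=
  (List.ofFn fun a => FreeAlgebra.ι ℂ (J.1 a)).reverse.prod

/-- The functional `⟨f̃_J, ·⟩` on `A(k)`. -/
def Multiindex.pairing {n : ℕ} {k : Fin n → ℕ} (J : Multiindex k) : skew k →ₗ[ℂ] ℂ :=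
  J.sgn • (OS.iterRes none (∑ i, k i) (fun a => some (J.var a)) ∘ₗ (skew k).subtype)

/-- The component `U[k]` of the free associative algebra. -/
def freePart {n : ℕ} (k : Fin n → ℕ) : Submodule ℂ (FreeAlgebra ℂ (Fin n)) :=
  Submodule.span ℂ (Set.range (Multiindex.monomial (k := k)))

/-- An element of `A(k) ⊗ U[k]` is the canonical element if, as a map from `U[k]` to `U[k]` by means
of the pairing between `U[k]` and `A(k)`, it is the identity. -/
def IsCanonical {n : ℕ} (k : Fin n → ℕ) (Ω : skew k ⊗[ℂ] freePart k) : Prop :=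
  ∀ J : Multiindex k,
    (TensorProduct.lid ℂ (freePart k) (LinearMap.rTensor (freePart k) J.pairing Ω)).1 = J.monomial

/-! ### The four types: simple roots, ordered positive roots, root vectors -/

/-- The four series; the parameter `r` below is the number of coordinates `e_1, …, e_r`. -/
inductive ClassicalType
  | A | B | C | D

/-- The smallest `r` that is considered: `A_{r-1}` for `r ≥ 2`, `B_r` and `C_r` for `r ≥ 1`, `D_r`
for `r ≥ 3`. -/
def ClassicalType.minSize : ClassicalType → ℕ
  | .A => 2
  | .B => 1
  | .C => 1
  | .D => 3

/-- The rank: `r - 1` for type `A_{r-1}`, and `r` for types `B_r`, `C_r`, `D_r`. -/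
def ClassicalType.rank : ClassicalType → ℕ → ℕ
  | .A, r => r - 1
  | .B, r => r
  | .C, r => r
  | .D, r => r

/-- Names for vectors: `diff i j = e_i - e_j`, `sum i j = e_i + e_j`, `single i = e_i`,
`double i = 2 e_i`, with indices counted from 1. -/
inductive Root
  | diff (i j : ℕ)
  | sum (i j : ℕ)
  | single (i : ℕ)
  | double (i : ℕ)

/-- The coordinates of a vector in the basis `e_1, e_2, …`. -/
def Root.coord : Root → ℕ → ℤ
  | .diff i j, m => (if m = i then 1 else 0) - (if m = j then 1 else 0)
  | .sum i j, m => (if m = i then 1 else 0) + (if m = j then 1 else 0)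
  | .single i, m => if m = i then 1 else 0
  | .double i, m => if m = i then 2 else 0

/-- The standard inner product of vectors in the span of `e_1, …, e_r`. -/
def Root.inner (r : ℕ) (α β : Root) : ℤ := ∑ m ∈ Finset.Icc 1 r, α.coord m * β.coord m

/-- The simple root `α_i`, with `i` counted from 1. -/
def ClassicalType.simpleRoot : ClassicalType → ℕ → ℕ → Root
  | .A, _, i => .diff i (i + 1)
  | .B, r, i => if i = r then .single r else .diff i (i + 1)
  | .C, r, i => if i = r then .double r else .diff i (i + 1)
  | .D, _, i => if i = 1 then .sum 1 2 else .diff i (i - 1)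

/-- The list `a, a + 1, …, b`, empty if `a > b`. -/
def up (a b : ℕ) : List ℕ := List.range' a (b + 1 - a)

/-- The list `a, a - 1, …, b`, empty if `a < b`. -/
def down (a b : ℕ) : List ℕ := (up b a).reverse

/-- The positive roots in increasing order.
Type A: `e_i - e_j < e_{i'} - e_{j'}` if `i < i'`, or `i = i'` and `j < j'`.
Types B and C: a root with first index `i` precedes one with first index `i'` if `i > i'`, and for
fixed `i`: `e_i + e_{i+1} < ⋯ < e_i + e_r < e_i < e_i - e_r < ⋯ < e_i - e_{i+1}`
(with `2 e_i` in place of `e_i` for type C).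
Type D: `e_j ± e_i` precedes `e_{j'} ± e_{i'}` if `j < j'`, and for fixed `j`:
`e_j + e_{j-1} < ⋯ < e_j + e_1 < e_j - e_1 < ⋯ < e_j - e_{j-1}`. -/
def ClassicalType.posRoots : ClassicalType → ℕ → List Root
  | .A, r => (up 1 (r - 1)).flatMap fun i => (up (i + 1) r).map (Root.diff i)
  | .B, r => (down r 1).flatMap fun i =>
      (up (i + 1) r).map (Root.sum i) ++ [Root.single i] ++ (down r (i + 1)).map (Root.diff i)
  | .C, r => (down r 1).flatMap fun i =>
      (up (i + 1) r).map (Root.sum i) ++ [Root.double i] ++ (down r (i + 1)).map (Root.diff i)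
  | .D, r => (up 1 r).flatMap fun j =>
      (down (j - 1) 1).map (Root.sum j) ++ (up 1 (j - 1)).map (Root.diff j)

/-- The sequence `I` of indices for which `F_β` is a multiple of `[f_I]`. -/
def ClassicalType.word : ClassicalType → ℕ → Root → List ℕ
  | .A, _, .diff i j => down (j - 1) i
  | .B, _, .diff i j => down (j - 1) i
  | .B, r, .single i => down r i
  | .B, r, .sum i j => up i r ++ down r j
  | .C, _, .diff i j => down (j - 1) i
  | .C, r, .sum i j => up i r ++ down (r - 1) j
  | .C, r, .double i => up i r ++ down (r - 1) i
  | .D, _, .diff j i => down j (i + 1)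
  | .D, _, .sum j i => if i = 1 then down j 3 ++ [1] else down j 1 ++ up 3 i
  | _, _, _ => []

/-- The coefficient of `[f_I]` in `F_β`. -/
def ClassicalType.wordCoeff : ClassicalType → ℕ → Root → ℂ
  | .B, r, .sum i j => (-1) ^ ((j - i + 1).choose 2 + (r - j + 1))
  | .C, r, .sum _ j => (-1) ^ (r - j)
  | .C, r, .double i => (-1) ^ (r - i) / 2
  | _, _, _ => 1

/-- The degree of `F_β`: how often `f_i` occurs. -/
def ClassicalType.deg (X : ClassicalType) (r : ℕ) (β : Root) : Fin (X.rank r) → ℕ :=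
  fun i => (X.word r β).count ((i : ℕ) + 1)

/-- The left-normed commutator `[…[[x_1, x_2], x_3] …, x_n]`. -/
def leftComm {L : Type*} [LieRing L] : List L → L
  | [] => 0
  | x :: l => l.foldl (fun u v => ⁅u, v⁆) x

/-! ### Explicit trees -/

/-- The variable `t^{(i)}_j`, with `i` and `j` counted from 1 (it is only used when it exists). -/
def tvar {n : ℕ} (k : Fin n → ℕ) (i j : ℕ) : Vert k :=
  if h : ∃ hi : i - 1 < n, j - 1 < k ⟨i - 1, hi⟩ then some ⟨⟨i - 1, h.1⟩, ⟨j - 1, h.2⟩⟩ else none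

/-- The consecutive edges of the path through the given vertices. -/
def pathEdges {V : Type} (l : List V) : List (Sym2 V) := List.zipWith (fun x y => s(x, y)) l l.tail

/-- The antisymmetrization of the tree with the given list of edges, numbered in the order of the
list (which is only used for lists of the right length `|k|`). -/
def asymTree {n : ℕ} (k : Fin n → ℕ) (es : List (Sym2 (Vert k))) : skew k :=
  if h : es.length = ∑ i, k i then asym k (cls fun a => es.get (Fin.cast h.symm a)) else 0

/-- `Asym (str(u_1, …, u_n))` for the string `z — u_1 — … — u_n`. If all `k_i ≤ 1`, then this is
`str(u_1, …, u_n)` itself. -/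
def asymStr {n : ℕ} (k : Fin n → ℕ) (us : List (Vert k)) : skew k :=
  asymTree k (pathEdges (none :: us))

/-- `Asym` of the tree with an edge from `z` to `t^{(r)}_1` that carries the number 1, the branch
`t^{(r)}_1 — t^{(r-1)}_1 — … — t^{(i)}_1` numbered away from the root by `2, …, r - i + 1`, and the
branch `t^{(r)}_1 — t^{(r-1)}_2 — … — t^{(i)}_2` numbered towards the root by
`r - i + 2, …, 2 r - 2 i + 1`. -/
def twoBranchTree {n : ℕ} (k : Fin n → ℕ) (r i : ℕ) : skew k :=
  asymTree k
    (s(none, tvar k r 1) :: (pathEdges ((down r i).map fun m => tvar k m 1) ++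
      (pathEdges (tvar k r 1 :: (down (r - 1) i).map fun m => tvar k m 2)).reverse))

/-- The listed element of `A(k)` for the positive root `β`, where `k` is the degree of `F_β`. -/
def listed {n : ℕ} (k : Fin n → ℕ) : ClassicalType → ℕ → Root → skew k
  | .A, _, .diff i j => asymStr k ((up i (j - 1)).map fun m => tvar k m 1)
  | .B, _, .diff i j =>
      (-1 : ℂ) ^ (j - i - 1).choose 2 • asymStr k ((down (j - 1) i).map fun m => tvar k m 1)
  | .B, r, .single i =>
      (-1 : ℂ) ^ (r - i).choose 2 • asymStr k ((down r i).map fun m => tvar k m 1)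
  | .B, r, .sum i j =>
      (-1 : ℂ) ^ (j - i) • asymStr k
        (((up j r).map fun m => tvar k m 2) ++ ((down r i).map fun m => tvar k m 1))
  | .C, _, .diff i j =>
      (-1 : ℂ) ^ (j - i - 1).choose 2 • asymStr k ((down (j - 1) i).map fun m => tvar k m 1)
  | .C, r, .sum i j =>
      (-1 : ℂ) ^ ((j - i + 1).choose 2 + (r - j)) • asymStr k
        (((up j (r - 1)).map fun m => tvar k m 2) ++ ((down r i).map fun m => tvar k m 1))
  | .C, r, .double i => (if i = r then 2 else 1 : ℂ) • twoBranchTree k r i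
  | .D, _, .diff j i => asymStr k ((up (i + 1) j).map fun m => tvar k m 1)
  | .D, _, .sum j i =>
      if i = 1 then asymStr k (tvar k 1 1 :: (up 3 j).map fun m => tvar k m 1)
      else (-1 : ℂ) ^ i •
        (asymStr k (((down i 3).map fun m => tvar k m 2) ++
            tvar k 1 1 :: tvar k 2 1 :: (up 3 j).map fun m => tvar k m 1) -
          asymStr k (((down i 3).map fun m => tvar k m 2) ++
            tvar k 2 1 :: tvar k 1 1 :: (up 3 j).map fun m => tvar k m 1))
  | _, _, _ => 0

/-! ### The Lie algebra, its PBW monomials, and the product formula -/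

section Lie

variable {𝔤 : Type*} [LieRing 𝔤] [LieAlgebra ℂ 𝔤] {𝔥 : LieSubalgebra ℂ 𝔤}

/-- The Lie algebra with the Chevalley generators `b` is of type `X` with the simple roots named
above: its Cartan matrix `α_i(h_j)` is `2 (α_i, α_j) / (α_j, α_j)`. -/
def IsOfType (X : ClassicalType) (r : ℕ) (b : LieAlgebra.Basis (Fin (X.rank r)) 𝔥) : Prop :=
  ∀ i j : Fin (X.rank r),
    b.A i j * Root.inner r (X.simpleRoot r ((j : ℕ) + 1)) (X.simpleRoot r ((j : ℕ) + 1)) =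
      2 * Root.inner r (X.simpleRoot r ((i : ℕ) + 1)) (X.simpleRoot r ((j : ℕ) + 1))

/-- The nilpotent subalgebra `𝔫` of the Cartan decomposition, generated by the `f_i`. -/
def lowerNil {n : ℕ} (b : LieAlgebra.Basis (Fin n) 𝔥) : LieSubalgebra ℂ 𝔤 :=
  LieSubalgebra.lieSpan ℂ 𝔤 (Set.range b.f)

/-- The generator `f_i` of `𝔫`. -/
def gen {n : ℕ} (b : LieAlgebra.Basis (Fin n) 𝔥) (i : Fin n) : lowerNil b :=
  ⟨b.f i, LieSubalgebra.subset_lieSpan (Set.mem_range_self i)⟩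

/-- The generator `f_i` of `𝔫`, with `i` counted from 1 (only used for `1 ≤ i ≤ n`). -/
def genNat {n : ℕ} (b : LieAlgebra.Basis (Fin n) 𝔥) (i : ℕ) : lowerNil b :=
  if h : i - 1 < n then gen b ⟨i - 1, h⟩ else 0

/-- The root vector `F_β`. -/
def rootVector (X : ClassicalType) (r : ℕ) (b : LieAlgebra.Basis (Fin (X.rank r)) 𝔥) (β : Root) :
    lowerNil b :=
  X.wordCoeff r β • leftComm ((X.word r β).map (genNat b))

/-- The enveloping algebra `U(𝔫)`. -/
abbrev U {n : ℕ} (b : LieAlgebra.Basis (Fin n) 𝔥) : Type _ :=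
  UniversalEnvelopingAlgebra ℂ (lowerNil b)

/-- The quotient map `q` from the free associative algebra to `U(𝔫)`, `f̃_i ↦ f_i`. -/
def quotMap {n : ℕ} (b : LieAlgebra.Basis (Fin n) 𝔥) : FreeAlgebra ℂ (Fin n) →ₐ[ℂ] U b :=
  FreeAlgebra.lift ℂ fun i => UniversalEnvelopingAlgebra.ι ℂ (gen b i)

/-- The image `Ω_k^𝔤` in `A(k) ⊗ U(𝔫)` of an element of `A(k) ⊗ U[k]` under `id ⊗ q`. -/
def project {n : ℕ} (b : LieAlgebra.Basis (Fin n) 𝔥) (k : Fin n → ℕ) :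
    skew k ⊗[ℂ] freePart k →ₗ[ℂ] skew k ⊗[ℂ] U b :=
  LinearMap.lTensor (skew k) ((quotMap b).toLinearMap ∘ₗ (freePart k).subtype)

/-- The positive roots `β_1 < … < β_m`. -/
def ClassicalType.root (X : ClassicalType) (r : ℕ) (j : Fin (X.posRoots r).length) : Root :=
  (X.posRoots r).get j

/-- The PBW monomial `F^p = F_{β_1}^{p_1} ⋯ F_{β_m}^{p_m}`. -/
def pbwMonomial (X : ClassicalType) (r : ℕ) (b : LieAlgebra.Basis (Fin (X.rank r)) 𝔥)
    (p : Fin (X.posRoots r).length → ℕ) : U b :=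
  (List.ofFn fun j =>
    UniversalEnvelopingAlgebra.ι ℂ (rootVector X r b (X.root r j)) ^ p j).prod

end Lie

/-- A choice of elements `η_j ∈ A(k^{(j)})`, where `k^{(j)}` is the degree of `F_{β_j}`. -/
abbrev EtaFamily (X : ClassicalType) (r : ℕ) : Type :=
  ∀ j : Fin (X.posRoots r).length, skew (X.deg r (X.root r j))

/-- The family of the listed elements. -/
def listedEta (X : ClassicalType) (r : ℕ) : EtaFamily X r :=
  fun j => listed (X.deg r (X.root r j)) X r (X.root r j)

/-- `(∏ p_l !)⁻¹ η_1 * ⋯ * η_1 * η_2 * ⋯ * η_m`, where `η_l` occurs `p_l` times. -/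
def starMonomial {X : ClassicalType} {r : ℕ} (η : EtaFamily X r)
    (p : Fin (X.posRoots r).length → ℕ) : ⨁ k : Fin (X.rank r) → ℕ, skew k :=
  (∏ j, ((p j).factorial : ℂ))⁻¹ •
    (List.finRange _).foldr
      (fun j u => (starTotal (X.rank r) (DirectSum.lof ℂ (Fin (X.rank r) → ℕ)
        (fun k => skew k) _ (η j)))^[p j] u)
      (starOne (X.rank r))

/-- The exponents `p` with `∑ p_j k^{(j)} = k`. As every `k^{(j)}` is nonzero, they have entries at
most `|k|`. -/
def exponents (X : ClassicalType) (r : ℕ) (k : Fin (X.rank r) → ℕ) :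
    Finset (Fin (X.posRoots r).length → ℕ) :=
  (Fintype.piFinset fun _ => Finset.range (∑ i, k i + 1)).filter fun p =>
    ∑ j, p j • X.deg r (X.root r j) = k

/-- The product formula: for every `k` the projection of the canonical element is
`∑_p T_p ⊗ F^p`, where `T_p` is the normalized star-monomial in the elements `η_j`. -/
def ProductFormula {𝔤 : Type*} [LieRing 𝔤] [LieAlgebra ℂ 𝔤] {𝔥 : LieSubalgebra ℂ 𝔤}
    (X : ClassicalType) (r : ℕ) (b : LieAlgebra.Basis (Fin (X.rank r)) 𝔥) (η : EtaFamily X r) :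
    Prop :=
  ∀ (k : Fin (X.rank r) → ℕ) (Ω : skew k ⊗[ℂ] freePart k), IsCanonical k Ω →
    project b k Ω = ∑ p ∈ exponents X r k, starMonomial η p k ⊗ₜ[ℂ] pbwMonomial X r b p

end TreePBW
end

/-!
The space `A(k)` of skew-invariant trees turns out to be the dual of the degree-`k` part of the free
associative algebra, the star-product is the shuffle product under this duality, and the product
formula says that the listed elements are dual to the root vectors with respect to the
Poincaré–Birkhoff–Witt basis.

*Duality.* An iterated residue of a forest along an ordering of the variables is, up to sign, a
determinant (`ordRes_cls`), and the residues of the strings `z — u₁ — ⋯ — u_p` form an identity matrix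
up to signs (`ordRes_strEdges`). On the other hand, the three-term relation shows that the
`p!` forests in which each vertex is joined to a smaller one span the space of trees
(`cls_mem_span_decreasingForest`). So the residues separate points (`eq_zero_of_ordRes`), and an
element of `A(k)` is the same as a function on sequences of colours, its coefficients `coeff k L`.
The canonical element is the sum of dual bases (`existsUnique_isCanonical`), and the coefficients of a
star-product are given by shuffles (`coeff_star`).

*Convolution.* The coproduct of `U(𝔫)`, for which `𝔫` is primitive, turns functionals on `U(𝔫)` into
an algebra, and pulling a functional back to the free algebra turns convolution into the shuffle
product. Suppose that for each positive root `β` there is a functional `ψ_β` with value 1 at `F_β` and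
0 at all other ordered monomials in the root vectors. Then the convolution products of the `ψ_β` are,
up to factorials, dual to the monomials `F^p` (`convList_expList`), so that these are linearly
independent. They span because the root vectors span `𝔫`. If moreover the coefficients of `η_β` are
the values of `ψ_β` at the monomials in the generators, then the product formula is the expansion of
these monomials in the basis `F^p`, and it determines the `η_β`, as one sees by applying `ψ_β` to
it (`productFormula_of_functionals`).

*Representations.* The functionals come from the standard representations by matrices. To have these
for an abstract simple Lie algebra given by Chevalley generators, consider the subalgebra of
`𝔤 × 𝔤𝔩` generated by pairs of corresponding generators. Its elements `(0, y)` in the lower part are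
shown to vanish by positivity of the trace of `y* y`
(`ChevalleyMatrices.eq_zero_of_eigenvector`), so that the lower part is the graph of a
representation of `𝔫`, which is faithful as `𝔤` is simple. The images of the root vectors are computed
explicitly (`matrixRep_rootVector`), and they span the image of `𝔫` (`span_rootVector`).

*Functionals.* For all roots except the long roots of type `C`, a multiple of a single matrix entry in
the standard representation has the required properties (`entryFunctional_listProd`,
`coeff_listed`). For a root `2 e_i` of type `C` this fails, and one lets `𝔫` act on matrices by
commutators instead. Applied to the diagonal matrix with the entries 1 at positive and -1 at
negative indices, the monomials have at the place `(-i, i)` entries which count the ways to merge two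
descending sequences (`doubleFunctional_revProd`), and the residues of the tree with two branches
count the same (`coeff_twoBranchTree`).
-/

open scoped TensorProduct DirectSum

noncomputable section

namespace TreePBW

/-! ### Iterated residues as determinants -/

theorem bd_map {V W : Type} (g : W → ZMod 2) (f : V → W) (x : Sym2 V) :
    bd g (x.map f) = bd (g ∘ f) x := by
  induction x using Sym2.ind with
  | _ x y => rfl

theorem bd_add {V : Type} (g g' : V → ZMod 2) (x : Sym2 V) :
    bd (fun v => g v + g' v) x = bd g x + bd g' x := by
  induction x using Sym2.ind with
  | _ x y => simp only [bd_mk]; ring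

theorem isForest_contract_iff {V : Type} [DecidableEq V] {p : ℕ} {z v : V} (hzv : v ≠ z)
    {e : Fin (p + 1) → Sym2 V} {a : Fin (p + 1)} (ha : e a = s(z, v)) :
    IsForest (contract z v e a) ↔ IsForest e := by
  rw [isForest_iff, isForest_iff]
  constructor
  · intro h c
    set δ : V → ZMod 2 := fun u => if u = v then c a else 0 with hδ
    obtain ⟨g, hg⟩ := h fun b => c (a.succAbove b) + bd δ (e (a.succAbove b))
    refine ⟨fun u => (g ∘ contractVertex z v) u + δ u, fun b => ?_⟩
    rw [bd_add, ← bd_map]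
    rcases Fin.eq_self_or_eq_succAbove a b with rfl | ⟨b, rfl⟩
    · rw [ha, Sym2.map_mk, bd_mk, bd_mk]
      simp [contractVertex, hδ, hzv.symm, CharTwo.add_self_eq_zero]
    · have := hg b
      rw [contract] at this
      rw [this, add_assoc, CharTwo.add_self_eq_zero, add_zero]
  · intro h c
    obtain ⟨g, hg⟩ := h (Fin.insertNth (α := fun _ => ZMod 2) a 0 c)
    refine ⟨g, fun b => ?_⟩
    have h1 := hg a
    rw [ha, bd_mk, Fin.insertNth_apply_same] at h1
    have h2 : g ∘ contractVertex z v = g := by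
      funext u
      simp only [Function.comp_apply, contractVertex]
      split_ifs with hu
      · rw [hu, CharTwo.add_eq_zero.1 h1]
      · rfl
    rw [contract, bd_map, h2, hg, Fin.insertNth_apply_succAbove]

/-- The residue of the class of any sequence of edges, forest or not. -/
theorem OS.res_cls {V : Type} [DecidableEq V] {p : ℕ} {z v : V} (hzv : v ≠ z)
    (e : Fin (p + 1) → Sym2 V) : OS.res z v (cls e) = resSeq z v e := by
  by_cases h : IsForest e
  · exact OS.lift_cls _ _ _ h
  · rw [cls_of_not h, map_zero, resSeq]
    refine (Finset.sum_eq_zero fun a _ => ?_).symm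
    split_ifs with ha
    · rw [cls_of_not (fun h' => h ((isForest_contract_iff hzv ha).1 h')), smul_zero]
    · rfl

/-- The matrix with an entry 1 in row `a` and column `b` if the edge `e b` turns into the edge from
`z` to `v a` when the vertices `v 0, …, v (a - 1)` are identified with `z`, and 0 otherwise. -/
def headMatrix {V : Type} [DecidableEq V] (z : V) {ι : Type} :
    (p : ℕ) → (Fin p → V) → (ι → Sym2 V) → Matrix (Fin p) ι ℂ
  | 0, _, _ => fun a _ => a.elim0
  | p + 1, v, e => Fin.cons (fun b => if e b = s(z, v 0) then 1 else 0)
      (headMatrix z p (fun a => v a.succ) fun b => (e b).map (contractVertex z (v 0)))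

theorem headMatrix_comp {V : Type} [DecidableEq V] (z : V) {ι κ : Type} (f : κ → ι) (p : ℕ)
    (v : Fin p → V) (e : ι → Sym2 V) :
    headMatrix z p v (e ∘ f) = (headMatrix z p v e).submatrix id f := by
  induction p generalizing e with
  | zero => ext a; exact a.elim0
  | succ p ih =>
    ext a b
    refine Fin.cases ?_ (fun a => ?_) a
    · rfl
    · exact congrFun (congrFun (ih (fun a => v a.succ)
        (fun b => (e b).map (contractVertex z (v 0)))) a) b

/-- The recursion of the iterated residue is the Laplace expansion along the first row. -/
theorem OS.iterRes_cls {V : Type} [DecidableEq V] {z : V} {p : ℕ} {v : Fin p → V}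
    (hv : ∀ a, v a ≠ z) (e : Fin p → Sym2 V) :
    OS.iterRes z p v (cls e) = (headMatrix z p v e).det := by
  induction p with
  | zero =>
    have he : IsForest e := by rw [isForest_iff]; exact fun c => ⟨0, fun a => a.elim0⟩
    rw [Matrix.det_isEmpty]
    rw [OS.iterRes, OS.coeffEmpty, OS.lift_cls _ _ _ he]
  | succ p ih =>
    rw [OS.iterRes, LinearMap.comp_apply, OS.res_cls (hv 0), resSeq, map_sum,
      Matrix.det_succ_row_zero]
    refine Finset.sum_congr rfl fun b _ => ?_
    have h0 : headMatrix z (p + 1) v e 0 b = if e b = s(z, v 0) then 1 else 0 := rfl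
    rw [h0]
    split_ifs with hb
    · rw [map_smul, ih (fun a => hv a.succ), smul_eq_mul, mul_one]
      congr 2
      exact headMatrix_comp z b.succAbove p (fun a => v a.succ)
        (fun b => (e b).map (contractVertex z (v 0)))
    · simp

open Classical in
theorem headMatrix_apply {V : Type} [DecidableEq V] {z : V} {ι : Type} {p : ℕ} {v : Fin p → V}
    (hv : ∀ a, v a ≠ z) (hinj : Function.Injective v) (e : ι → Sym2 V) (a : Fin p) (b : ι) :
    headMatrix z p v e a b =
      if ∃ x, e b = s(x, v a) ∧ (x = z ∨ ∃ a' < a, x = v a') then 1 else 0 := by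
  induction p generalizing e with
  | zero => exact a.elim0
  | succ p ih =>
    refine Fin.cases ?_ (fun a => ?_) a
    · have h0 : headMatrix z (p + 1) v e 0 b = if e b = s(z, v 0) then 1 else 0 := rfl
      rw [h0]
      congr 1
      simp
    · have h0 : headMatrix z (p + 1) v e a.succ b = headMatrix z p (fun a => v a.succ)
        (fun b => (e b).map (contractVertex z (v 0))) a b := rfl
      rw [h0, ih (fun a => hv a.succ) (fun a a' h => Fin.succ_injective _ (hinj h))]
      congr 1
      apply propext
      have hne : ∀ c : Fin p, v c.succ ≠ v 0 := fun c h => Fin.succ_ne_zero c (hinj h)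
      have key : ∀ (u : V) (c : Fin p), contractVertex z (v 0) u = v c.succ ↔ u = v c.succ := by
        intro u c
        unfold contractVertex
        split_ifs with hu
        · subst hu
          exact ⟨fun h => absurd h.symm (hv _), fun h => absurd h.symm (hne c)⟩
        · rfl
      have keyz : ∀ u : V, contractVertex z (v 0) u = z ↔ u = z ∨ u = v 0 := by
        intro u
        unfold contractVertex
        split_ifs with hu <;> simp [hu]
      have hlt : ∀ u : V, (contractVertex z (v 0) u = z ∨
          ∃ a' < a, contractVertex z (v 0) u = v a'.succ) ↔
          (u = z ∨ ∃ a' < a.succ, u = v a') := by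
        intro u
        rw [keyz]
        simp only [key]
        constructor
        · rintro ((h | h) | ⟨a', h, h'⟩)
          · exact Or.inl h
          · exact Or.inr ⟨0, Fin.succ_pos _, h⟩
          · exact Or.inr ⟨a'.succ, Fin.succ_lt_succ_iff.2 h, h'⟩
        · rintro (h | ⟨a', h, h'⟩)
          · exact Or.inl (Or.inl h)
          · revert h h'
            refine Fin.cases ?_ (fun a' => ?_) a'
            · exact fun _ h => Or.inl (Or.inr h)
            · exact fun h h' => Or.inr ⟨a', Fin.succ_lt_succ_iff.1 h, h'⟩
      induction e b using Sym2.ind with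
      | _ x y =>
        simp only [Sym2.map_mk]
        constructor
        · rintro ⟨u, hu, h⟩
          rcases Sym2.eq_iff.1 hu with ⟨h1, h2⟩ | ⟨h1, h2⟩
          · exact ⟨x, by rw [(key _ _).1 h2], (hlt x).1 (h1 ▸ h)⟩
          · exact ⟨y, by rw [(key _ _).1 h1, Sym2.eq_swap], (hlt y).1 (h2 ▸ h)⟩
        · rintro ⟨u, hu, h⟩
          refine ⟨contractVertex z (v 0) u, ?_, (hlt u).2 h⟩
          have h3 : contractVertex z (v 0) (v a.succ) = v a.succ := (key _ _).2 rfl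
          rcases Sym2.eq_iff.1 hu with ⟨rfl, rfl⟩ | ⟨rfl, rfl⟩
          · rw [h3]
          · rw [h3, Sym2.eq_swap]

/-! ### Orderings of the vertices and normalized residues -/

section Orderings

variable {W : Type} {p : ℕ}

/-- With respect to the order of the vertices in which `none` is the smallest one and the other ones
are compared by `ρ`, the vertex `y` is the larger end of the edge `e`. -/
def IsHead (ρ : W → ℕ) (e : Sym2 (Option W)) (y : W) : Prop :=
  ∃ x : Option W, e = s(x, some y) ∧ ∀ y', x = some y' → ρ y' < ρ y

open Classical in
/-- The sign of the sequence of the larger ends of the edges, relative to the reference order `std`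
of the vertices; it is 0 if these larger ends are not all different. -/
def headDet (std : Fin p ≃ W) (ρ : W → ℕ) (e : Fin p → Sym2 (Option W)) : ℂ :=
  Matrix.det (Matrix.of fun a b => if IsHead ρ (e b) (std a) then 1 else 0)

/-- The sign of the ordering `w` of the vertices, relative to the reference order `std`. -/
def ordSign (std w : Fin p ≃ W) : ℂ := ((Equiv.Perm.sign (w.trans std.symm) : ℤ) : ℂ)

theorem ordSign_mul_self (std w : Fin p ≃ W) : ordSign std w * ordSign std w = 1 := by
  unfold ordSign
  rcases Int.units_eq_one_or (Equiv.Perm.sign (w.trans std.symm)) with h | h <;> simp [h]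

/-- The iterated residue along the ordering `w` of the vertices, multiplied by the sign of `w`. -/
def ordRes [DecidableEq W] (std w : Fin p ≃ W) : OS (Option W) p →ₗ[ℂ] ℂ :=
  ordSign std w • OS.iterRes none p fun a => some (w a)

/-- The determinant depends only on the order in which the vertices are removed. -/
theorem headDet_congr (std : Fin p ≃ W) {ρ ρ' : W → ℕ} (h : ∀ y y', ρ y < ρ y' ↔ ρ' y < ρ' y')
    (e : Fin p → Sym2 (Option W)) : headDet std ρ e = headDet std ρ' e := by
  have : IsHead (W := W) ρ = IsHead ρ' := by
    funext e y
    simp only [IsHead, h]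
  unfold headDet
  rw [this]

/-- The normalized residue of a forest along an ordering `w` of the vertices is the determinant of
the relation between vertices and edges that marks the end of each edge that comes later in `w`. -/
theorem ordRes_cls [DecidableEq W] (std w : Fin p ≃ W) (e : Fin p → Sym2 (Option W)) :
    ordRes std w (cls e) = headDet std (fun y => w.symm y) e := by
  classical
  rw [ordRes, LinearMap.smul_apply, OS.iterRes_cls (by simp)]
  have : headMatrix none p (fun a => some (w a)) e =
      (Matrix.of fun a b => if IsHead (fun y => w.symm y) (e b) (std a) then (1 : ℂ)
        else 0).submatrix (w.trans std.symm) id := by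
    ext a b
    rw [headMatrix_apply (by simp) (fun a a' h => by simpa using h)]
    simp only [Matrix.submatrix_apply, Matrix.of_apply, Equiv.trans_apply, Equiv.apply_symm_apply,
      id]
    congr 1
    apply propext
    unfold IsHead
    refine exists_congr fun x => and_congr_right fun _ => ?_
    constructor
    · rintro (rfl | ⟨a', h, rfl⟩) y' h'
      · simp at h'
      · obtain rfl : w a' = y' := by simpa using h'
        simpa using h
    · intro h
      cases x with
      | none => exact Or.inl rfl
      | some y => exact Or.inr ⟨w.symm y, by simpa using h y rfl, by simp⟩
  rw [this, Matrix.det_permute, smul_eq_mul, ← mul_assoc, ← ordSign, ordSign_mul_self, one_mul]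
  rfl

/-- The normalized residue of a tree whose edges `t b — h b` are directed away from the root: up to
the sign of the sequence of heads it is 1 if the order is compatible with the tree, and else 0. -/
theorem headDet_oriented (std h : Fin p ≃ W) (t : Fin p → Option W) (d : W → ℕ)
    (hd : ∀ b y, t b = some y → d y < d (h b)) (ρ : W → ℕ) [Decidable
      (∀ b y, t b = some y → ρ y < ρ (h b))] :
    headDet std ρ (fun b => s(t b, some (h b))) =
      if ∀ b y, t b = some y → ρ y < ρ (h b) then ordSign std h else 0 := by
  classical
  split_ifs with hc
  · have key : ∀ b y, IsHead ρ s(t b, some (h b)) y ↔ y = h b := by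
      intro b y
      constructor
      · rintro ⟨x, hx, hlt⟩
        rcases Sym2.eq_iff.1 hx with ⟨h1, h2⟩ | ⟨h1, h2⟩
        · exact (Option.some_injective _ h2).symm
        · exact absurd (hlt (h b) h2.symm) (hc b y h1).asymm
      · rintro rfl
        exact ⟨t b, rfl, hc b⟩
    have : (Matrix.of fun a b => if IsHead ρ s(t b, some (h b)) (std a) then (1 : ℂ) else 0) =
        (1 : Matrix (Fin p) (Fin p) ℂ).submatrix id
          (h.trans std.symm) := by
      ext a b
      simp only [key, Matrix.of_apply, Matrix.submatrix_apply, Matrix.one_apply, id,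
        Equiv.trans_apply,
        Equiv.eq_symm_apply]
    rw [headDet, this, Matrix.det_permute', Matrix.det_one, mul_one, ordSign]
  · by_contra hne
    apply hc
    rw [headDet, Matrix.det_apply] at hne
    obtain ⟨τ, -, hτ⟩ := Finset.exists_ne_zero_of_sum_ne_zero hne
    have hτ' : ∀ b, IsHead ρ s(t b, some (h b)) (std (τ b)) := by
      intro b
      by_contra hb
      apply hτ
      rw [Finset.prod_eq_zero (Finset.mem_univ b) (if_neg hb), smul_zero]
    -- A nonzero term of the determinant assigns to each edge one of its ends, injectively; going up
    -- from the root by induction on `d`, the end must be `h b`, since the other end is already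
    -- taken.
    have key : ∀ N b, d (h b) = N → std (τ b) = h b := by
      intro N
      induction N using Nat.strong_induction_on with
      | _ N ih =>
        intro b hb
        obtain ⟨x, hx, -⟩ := hτ' b
        rcases Sym2.eq_iff.1 hx with ⟨h1, h2⟩ | ⟨h1, h2⟩
        · exact (Option.some_injective _ h2).symm
        · have h3 := hd b _ h1
          obtain ⟨b', hb'⟩ := h.surjective (std (τ b))
          have h4 := ih _ (hb ▸ h3) b' (by rw [hb'])
          have h5 : b' = b := τ.injective (std.injective (h4.trans hb'))
          rw [← hb', h5] at h3
          exact absurd h3 (lt_irrefl _)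
    intro b y hy
    obtain ⟨x, hx, hlt⟩ := hτ' b
    rw [key _ b rfl] at hx hlt
    rcases Sym2.eq_iff.1 hx with ⟨h1, h2⟩ | ⟨h1, h2⟩
    · exact hlt y (h1 ▸ hy)
    · exact absurd (hd b _ h1) (lt_irrefl _)

/-- The tails of the edges of the string `z — w 0 — w 1 — ⋯`. -/
def strTail (w : Fin p → W) (b : Fin p) : Option W :=
  if (b : ℕ) = 0 then none else some (w ⟨b - 1, by omega⟩)

/-- The edges of the string `z — w 0 — w 1 — ⋯`. -/
def strEdges (w : Fin p → W) (b : Fin p) : Sym2 (Option W) := s(strTail w b, some (w b))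

/-- The only ordering compatible with a string is the order of its vertices. -/
theorem eq_of_strTail_lt {w w' : Fin p ≃ W}
    (h : ∀ b y, strTail w b = some y → (w'.symm y : ℕ) < w'.symm (w b)) : w = w' := by
  have hmono : StrictMono fun a => w'.symm (w a) := by
    cases p with
    | zero => exact fun a => a.elim0
    | succ p =>
      rw [Fin.strictMono_iff_lt_succ]
      intro a
      exact h a.succ (w a.castSucc) (by simp [strTail]; rfl)
  have := Subsingleton.elim
    (hmono.orderIsoOfSurjective _ (w.trans w'.symm).surjective) (OrderIso.refl _)
  ext a
  have h2 : w'.symm (w a) = a := DFunLike.congr_fun this a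
  rw [Equiv.symm_apply_eq] at h2
  exact h2

/-- The strings are dual to the normalized residues, up to signs. -/
theorem ordRes_strEdges [DecidableEq W] (std w w' : Fin p ≃ W) :
    ordRes std w' (cls (strEdges w)) = if w = w' then ordSign std w else 0 := by
  classical
  have h1 : ∀ b y, strTail w b = some y → (w.symm y : ℕ) < w.symm (w b) := by
    intro b y hy
    unfold strTail at hy
    split_ifs at hy with hb
    obtain rfl := Option.some_injective _ hy
    simp only [Equiv.symm_apply_apply]
    omega
  rw [ordRes_cls]
  unfold strEdges
  rw [headDet_oriented std w (strTail w) (fun y => w.symm y) h1]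
  by_cases hw : w = w'
  · subst hw
    rw [if_pos rfl, if_pos h1]
  · rw [if_neg hw, if_neg fun h => hw (eq_of_strTail_lt h)]

/-! ### The normalized residues separate the points -/

/-- The position of a vertex in the reference order, where `none` has position 0. -/
def level (std : Fin p ≃ W) : Option W → ℕ
  | none => 0
  | some y => std.symm y + 1

theorem level_injective (std : Fin p ≃ W) : Function.Injective (level std) := by
  rintro (_ | x) (_ | y) h
  · rfl
  · simp [level] at h
  · simp [level] at h
  · have : std.symm x = std.symm y := Fin.ext (by simpa [level] using h)
    rw [std.symm.injective this]

/-- The position of the larger end of an edge. -/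
def edgeLevel (std : Fin p ≃ W) : Sym2 (Option W) → ℕ :=
  Sym2.lift ⟨fun x y => max (level std x) (level std y), fun _ _ => max_comm _ _⟩

theorem edgeLevel_mk (std : Fin p ≃ W) (x y : Option W) :
    edgeLevel std s(x, y) = max (level std x) (level std y) := rfl

theorem exists_edgeLevel (std : Fin p ≃ W) (e : Sym2 (Option W)) (he : ¬ e.IsDiag) :
    ∃ x y, e = s(x, some y) ∧ level std x < level std (some y) ∧
      edgeLevel std e = level std (some y) := by
  induction e using Sym2.ind with
  | _ x y =>
    have hne : x ≠ y := by simpa using he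
    have aux : ∀ x y : Option W, level std x < level std y → ∃ x' y', s(x, y) = s(x', some y') ∧
        level std x' < level std (some y') ∧ edgeLevel std s(x, y) = level std (some y') := by
      intro x y h
      cases y with
      | none => simp [level] at h
      | some y => exact ⟨x, y, rfl, h, max_eq_right h.le⟩
    rcases lt_trichotomy (level std x) (level std y) with h | h | h
    · exact aux x y h
    · exact absurd (level_injective std h) hne
    · rw [Sym2.eq_swap]
      exact aux y x h

/-- The forest in which each vertex `std a` is joined to the smaller vertex at position `x a`. -/
def decreasingForest (std : Fin p ≃ W) (x : ∀ a : Fin p, Fin (a + 1)) (a : Fin p) :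
    Sym2 (Option W) :=
  s(if h : (x a : ℕ) = 0 then none else some (std ⟨x a - 1, by omega⟩), some (std a))

/-- The forests in which each vertex has exactly one smaller neighbour span the whole space: if two
edges have the same larger end, then the three-term relation replaces one of them by the edge that
joins their smaller ends. -/
theorem cls_mem_span_decreasingForest (std : Fin p ≃ W) (N : ℕ) (e : Fin p → Sym2 (Option W))
    (hN : ∑ b, edgeLevel std (e b) = N) :
    cls e ∈ Submodule.span ℂ (Set.range fun x => cls (decreasingForest std x)) := by
  induction N using Nat.strong_induction_on generalizing e with
  | _ N ih =>
    by_cases hf : IsForest e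
    swap
    · rw [cls_of_not hf]; exact Submodule.zero_mem _
    choose x y hxy hlt hlev using fun b => exists_edgeLevel std (e b) (hf.2.1 b)
    by_cases hinj : Function.Injective y
    · set τ : Equiv.Perm (Fin p) :=
        Equiv.ofBijective (fun b => std.symm (y b))
          (Finite.injective_iff_bijective.1 (std.symm.injective.comp hinj)) with hτ
      have hl : ∀ a, level std (x (τ.symm a)) < a + 1 := by
        intro a
        have := hlt (τ.symm a)
        have h2 : std.symm (y (τ.symm a)) = a := τ.apply_symm_apply a
        simpa [level, h2] using this
      have h1 : e ∘ τ.symm = decreasingForest std fun a => ⟨level std (x (τ.symm a)), hl a⟩ := by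
        funext a
        have h2 : std.symm (y (τ.symm a)) = a := τ.apply_symm_apply a
        rw [Equiv.symm_apply_eq] at h2
        rw [Function.comp_apply, hxy, decreasingForest, h2]
        congr 2
        split_ifs with h
        · exact level_injective std h
        · obtain ⟨u, hu⟩ := Option.ne_none_iff_exists'.1 fun hn : x (τ.symm a) = none =>
            h (by simp [hn, level])
          refine hu.trans ?_
          rw [Option.some_inj, ← Equiv.symm_apply_eq]
          ext
          simp [hu, level]
      have h3 := cls_perm e τ.symm
      rw [h1] at h3
      have h4 : cls e = ((Equiv.Perm.sign τ.symm : ℤ) : ℂ) •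
          cls (decreasingForest std fun a => ⟨level std (x (τ.symm a)), hl a⟩) := by
        rw [h3, smul_smul]
        rcases Int.units_eq_one_or (Equiv.Perm.sign τ.symm) with h | h <;> simp [h]
      rw [h4]
      exact Submodule.smul_mem _ _ (Submodule.subset_span ⟨_, rfl⟩)
    -- Two edges have the same larger end; both other forests in the three-term relation have a
    -- smaller sum of levels.
    · obtain ⟨a, b, hab, hne⟩ : ∃ a b, y a = y b ∧ a ≠ b := by
        simpa [Function.Injective] using hinj
      have hxne : x a ≠ x b := by
        intro h
        exact hne (hf.1 (by rw [hxy a, hxy b, h, hab]))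
      have hla := hlt a
      have hlb := hlt b
      rw [← hab] at hlb
      set w := y a with hw
      have haw : x a ≠ some w := fun h => by rw [h] at hla; exact lt_irrefl _ hla
      have hbw : x b ≠ some w := fun h => by rw [h] at hlb; exact lt_irrefl _ hlb
      set e₁ := Function.update (Function.update e a s(x a, x b)) b s(x a, some w) with he₁
      set e₂ := Function.update (Function.update e a s(x b, some w)) b s(x a, x b) with he₂
      have htri : Triangle e₁ e₂ e a b (x a) (x b) (some w) := by
        refine ⟨hne, hxne, haw, hbw, ?_, ?_, ?_, ?_, hxy a, ?_, ?_⟩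
        · simp [he₁, hne]
        · simp [he₁]
        · simp [he₂, hne]
        · simp [he₂]
        · rw [hxy b, ← hab]
        · intro c hca hcb
          simp [he₁, he₂, hca, hcb]
      have hsum : ∀ e' : Fin p → Sym2 (Option W), (∀ c, c ≠ a → c ≠ b → e' c = e c) →
          edgeLevel std (e' a) + edgeLevel std (e' b) <
            edgeLevel std (e a) + edgeLevel std (e b) →
          ∑ c, edgeLevel std (e' c) < N := by
        intro e' h1 h2
        rw [← hN, ← Finset.add_sum_erase _ _ (Finset.mem_univ a),
          ← Finset.add_sum_erase _ _ (Finset.mem_univ a),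
          ← Finset.add_sum_erase _ _ (Finset.mem_erase.2 ⟨hne.symm, Finset.mem_univ b⟩),
          ← Finset.add_sum_erase _ _ (Finset.mem_erase.2 ⟨hne.symm, Finset.mem_univ b⟩)]
        have : ∑ c ∈ (Finset.univ.erase a).erase b, edgeLevel std (e' c) =
            ∑ c ∈ (Finset.univ.erase a).erase b, edgeLevel std (e c) := by
          refine Finset.sum_congr rfl fun c hc => ?_
          simp only [Finset.mem_erase] at hc
          rw [h1 c hc.2.1 hc.1]
        omega
      have hleva : edgeLevel std (e a) = level std (some w) := hlev a
      have hlevb : edgeLevel std (e b) = level std (some w) := by rw [hlev b, ← hab]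
      have m₁ := ih _ (hsum e₁ (fun c hca hcb => by simp [he₁, hca, hcb]) (by
        rw [htri.2.2.2.2.1, htri.2.2.2.2.2.1, hleva, hlevb, edgeLevel_mk, edgeLevel_mk]
        omega)) e₁ rfl
      have m₂ := ih _ (hsum e₂ (fun c hca hcb => by simp [he₂, hca, hcb]) (by
        rw [htri.2.2.2.2.2.2.1, htri.2.2.2.2.2.2.2.1, hleva, hlevb, edgeLevel_mk,
          edgeLevel_mk]
        omega)) e₂ rfl
      have := cls_triangle htri
      have h5 : cls e = - cls e₁ - cls e₂ := by
        rw [← sub_eq_zero, ← this]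
        abel
      rw [h5]
      exact Submodule.sub_mem _ (Submodule.neg_mem _ m₁) m₂

theorem span_decreasingForest (std : Fin p ≃ W) :
    Submodule.span ℂ (Set.range fun x => cls (decreasingForest std x)) = ⊤ := by
  rw [eq_top_iff]
  rintro u -
  obtain ⟨u, rfl⟩ := Submodule.mkQ_surjective _ u
  induction u using Finsupp.induction_linear with
  | zero => rw [map_zero]; exact Submodule.zero_mem _
  | add u v hu hv => rw [map_add]; exact Submodule.add_mem _ hu hv
  | single T c =>
    rw [← mul_one c, ← smul_eq_mul, ← Finsupp.smul_single, map_smul]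
    refine Submodule.smul_mem _ _ ?_
    have := cls_mem_span_decreasingForest std _ T.1 rfl
    rwa [cls_of_forest T.2] at this

theorem finiteDimensional_OS (std : Fin p ≃ W) : FiniteDimensional ℂ (OS (Option W) p) :=
  Module.Finite.of_fg_top (span_decreasingForest std ▸ Submodule.fg_span (Set.finite_range _))

/-- By the strings, the dimension of the space of trees is at least the number of orderings, and by
the spanning set of decreasing forests it is not larger. -/
theorem eq_zero_of_ordRes [DecidableEq W] (std : Fin p ≃ W) (u : OS (Option W) p)
    (h : ∀ w, ordRes std w u = 0) : u = 0 := by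
  have := finiteDimensional_OS std
  have : Finite (Fin p ≃ W) := Finite.of_equiv _ (Equiv.equivCongr (Equiv.refl (Fin p)) std)
  have : Fintype (Fin p ≃ W) := Fintype.ofFinite _
  set R : OS (Option W) p →ₗ[ℂ] ((Fin p ≃ W) → ℂ) := LinearMap.pi (ordRes std) with hR
  have hsurj : Function.Surjective R := by
    classical
    rw [← LinearMap.range_eq_top, eq_top_iff, ← (Pi.basisFun ℂ (Fin p ≃ W)).span_eq,
      Submodule.span_le]
    rintro _ ⟨w, rfl⟩
    refine ⟨ordSign std w • cls (strEdges w), ?_⟩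
    funext w'
    rw [hR, LinearMap.pi_apply, map_smul, ordRes_strEdges, Pi.basisFun_apply, smul_eq_mul]
    by_cases hw : w = w'
    · subst hw; simp [ordSign_mul_self]
    · simp [hw]
  have h1 : Module.finrank ℂ (OS (Option W) p) ≤ p.factorial := by
    have := finrank_range_le_card (R := ℂ) fun x => cls (decreasingForest std x)
    rw [Set.finrank, span_decreasingForest, finrank_top] at this
    refine this.trans (le_of_eq ?_)
    rw [Fintype.card_pi]
    simp only [Fintype.card_fin]
    rw [Fin.prod_univ_eq_prod_range (fun a => a + 1), Finset.prod_range_add_one_eq_factorial]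
  have h2 : Module.finrank ℂ ((Fin p ≃ W) → ℂ) = p.factorial := by
    rw [Module.finrank_fintype_fun_eq_card, ← Nat.card_eq_fintype_card,
      Nat.card_congr (Equiv.equivCongr (Equiv.refl (Fin p)) std.symm), Nat.card_eq_fintype_card,
      Fintype.card_perm, Fintype.card_fin]
  have h3 : Module.finrank ℂ (OS (Option W) p) = Module.finrank ℂ ((Fin p ≃ W) → ℂ) :=
    le_antisymm (h1.trans h2.ge) (LinearMap.finrank_le_finrank_of_surjective hsurj)
  -- The dimensions agree, so that the surjective map `R` is injective.
  have h4 := (LinearMap.injective_iff_surjective_of_finrank_eq_finrank h3).2 hsurj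
  apply h4
  rw [map_zero]
  funext w
  exact h w

end Orderings

/-! ### Signs as numbers of inversions -/

/-- The sign `(-1) ^ m`, where `m` is the number of inversions of a list. -/
def invSign {α : Type} [LinearOrder α] : List α → ℂ
  | [] => 1
  | a :: l => (-1) ^ (l.countP fun b => decide (b < a)) * invSign l

theorem invSign_map {α β : Type} [LinearOrder α] [LinearOrder β] (f : α → β) (l : List α)
    (h : ∀ a ∈ l, ∀ b ∈ l, f a < f b ↔ a < b) : invSign (l.map f) = invSign l := by
  induction l with
  | nil => rfl
  | cons a l ih =>
    rw [List.map_cons, invSign, invSign, ih fun b hb c hc => h b (by simp [hb]) c (by simp [hc]),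
      List.countP_map]
    congr 2
    refine List.countP_congr fun b hb => ?_
    simp [h b (by simp [hb]) a (by simp)]

theorem prod_neg_one_eq_pow_countP {α : Type} {p : ℕ} (f : Fin p → α) (P : α → Bool) :
    ∏ j, (if P (f j) then (-1 : ℂ) else 1) = (-1) ^ (List.ofFn f).countP P := by
  induction p with
  | zero => simp
  | succ p ih =>
    rw [Fin.prod_univ_succ, ih, List.ofFn_succ, List.countP_cons]
    split_ifs <;> simp [pow_succ]

theorem invSign_ofFn {α : Type} [LinearOrder α] {p : ℕ} (f : Fin p → α) :
    invSign (List.ofFn f) = ∏ i, ∏ j, if i < j ∧ f j < f i then (-1 : ℂ) else 1 := by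
  induction p with
  | zero => simp [invSign]
  | succ p ih =>
    rw [List.ofFn_succ, invSign, ih, Fin.prod_univ_succ, Fin.prod_univ_succ,
      ← prod_neg_one_eq_pow_countP]
    congr 1
    · simp
    · refine Finset.prod_congr rfl fun i _ => ?_
      rw [Fin.prod_univ_succ]
      simp

theorem prod_inversions_eq_pow {p : ℕ} (P : Fin p → Fin p → Prop) [∀ i j, Decidable (P i j)] :
    ∏ i, ∏ j, (if P i j then (-1 : ℂ) else 1) =
      (-1) ^ (Finset.univ.filter fun ab : Fin p × Fin p => P ab.1 ab.2).card := by
  rw [← Fintype.prod_prod_type' (fun i j => if P i j then (-1 : ℂ) else 1), Finset.prod_ite]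
  simp

/-- The sign of an ordering of the vertices is computed by counting inversions of any labels that
increase along the reference order. -/
theorem ordSign_eq_invSign {W α : Type} [LinearOrder α] {p : ℕ} (std w : Fin p ≃ W) (f : W → α)
    (hf : ∀ x y, f x < f y ↔ std.symm x < std.symm y) :
    ordSign std w = invSign (List.ofFn fun a => f (w a)) := by
  rw [ordSign, Equiv.Perm.sign_eq_prod_prod_Ioi, invSign_ofFn]
  push_cast
  refine Finset.prod_congr rfl fun i _ => ?_
  have : ∀ j, (if i < j ∧ f (w j) < f (w i) then (-1 : ℂ) else 1) =
      if j ∈ Finset.Ioi i then (if (w.trans std.symm) i < (w.trans std.symm) j then 1 else -1)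
        else 1 := by
    intro j
    by_cases hij : i < j
    · have hne : std.symm (w i) ≠ std.symm (w j) := by simp [hij.ne]
      simp only [hij, hf, true_and, Finset.mem_Ioi, if_true, Equiv.trans_apply]
      rcases lt_or_gt_of_ne hne with h | h
      · simp [h, h.asymm]
      · simp [h, h.asymm]
    · simp [hij]
  simp only [this]
  rw [Finset.prod_ite_mem, Finset.univ_inter]
  refine Finset.prod_congr rfl fun j _ => ?_
  split_ifs <;> simp

/-! ### The skew-invariant part -/

section Skew

variable {n : ℕ} {k : Fin n → ℕ}

/-- The reference order of the variables: they are ordered by their colours, and those of the same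
colour by their numbers. -/
def stdOrd (k : Fin n → ℕ) : Fin (∑ i, k i) ≃ Var k := finSigmaFinEquiv.symm

theorem stdOrd_symm_lt (x y : Var k) :
    (stdOrd k).symm x < (stdOrd k).symm y ↔
      x.1 < y.1 ∨ x.1 = y.1 ∧ (x.2 : ℕ) < y.2 := by
  set N : ℕ → ℕ := fun i => if h : i < n then k ⟨i, h⟩ else 0 with hN
  have hval : ∀ x : Var k, ((stdOrd k).symm x : ℕ) = ∑ i ∈ Finset.range x.1, N i + x.2 := by
    intro x
    rw [stdOrd, Equiv.symm_symm, finSigmaFinEquiv_apply, Finset.sum_range]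
    congr 1
    refine Finset.sum_congr rfl fun i _ => ?_
    rw [hN]
    simp only
    rw [dif_pos (i.2.trans x.1.2)]
    rfl
  have hlt : ∀ x y : Var k, x.1 < y.1 → ((stdOrd k).symm x : ℕ) < (stdOrd k).symm y := by
    intro x y h
    rw [hval, hval]
    have h1 : ∑ i ∈ Finset.range (x.1 + 1), N i ≤ ∑ i ∈ Finset.range y.1, N i :=
      Finset.sum_le_sum_of_subset (Finset.range_subset_range.2 h)
    rw [Finset.sum_range_succ] at h1
    have h2 : N x.1 = k x.1 := by simp [hN]
    have := x.2.2
    omega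
  rw [Fin.lt_def]
  rcases lt_trichotomy x.1 y.1 with h | h | h
  · simp [h, hlt x y h]
  · rw [hval, hval, show (x.1 : ℕ) = y.1 from congrArg Fin.val h]
    simp [h]
  · simp only [h.asymm, h.ne', false_and, or_self, iff_false, not_lt]
    exact (hlt y x h).le

/-- The permutation of the variables given by an element of `G_k`. -/
def permVar (π : ColorPerm k) : Equiv.Perm (Var k) := Equiv.sigmaCongrRight π

theorem sign_permVar (π : ColorPerm k) : ((Equiv.Perm.sign (permVar π) : ℤ) : ℂ) = colorSign π := by
  have h : (Equiv.Perm.sign.comp (Equiv.Perm.sigmaCongrRightHom fun i => Fin (k i))) π =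
      ∏ i, Equiv.Perm.sign (π i) := by
    set F : ColorPerm k →* ℤˣ := ∏ i, Equiv.Perm.sign.comp (Pi.evalMonoidHom _ i) with hF
    have : Equiv.Perm.sign.comp (Equiv.Perm.sigmaCongrRightHom fun i => Fin (k i)) = F := by
      refine MonoidHom.pi_ext fun i σ => ?_
      induction σ using Equiv.Perm.swap_induction_on' with
      | one => simp
      | mul_swap f x y hxy ih =>
        rw [Pi.mulSingle_mul, map_mul, map_mul, ih]
        congr 1
        have h1 : Equiv.Perm.sigmaCongrRightHom (fun i => Fin (k i))
            (Pi.mulSingle i (Equiv.swap x y)) = Equiv.swap (⟨i, x⟩ : Var k) ⟨i, y⟩ := by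
          ext1 ⟨j, a⟩
          change (⟨j, (Pi.mulSingle i (Equiv.swap x y) : ColorPerm k) j a⟩ : Var k) = _
          by_cases hj : j = i
          · subst hj
            rw [Pi.mulSingle_eq_same]
            by_cases hx : a = x
            · subst hx; simp
            · by_cases hy : a = y
              · subst hy; simp
              · rw [Equiv.swap_apply_of_ne_of_ne hx hy, Equiv.swap_apply_of_ne_of_ne] <;>
                  simpa
          · rw [Pi.mulSingle_eq_of_ne hj, Equiv.swap_apply_of_ne_of_ne]
            · rfl
            · intro h; exact hj (congrArg Sigma.fst h)
            · intro h; exact hj (congrArg Sigma.fst h)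
        rw [MonoidHom.comp_apply, h1, Equiv.Perm.sign_swap (by simpa using hxy), hF,
          MonoidHom.finsetProd_apply, Finset.prod_eq_single i]
        · simp [Equiv.Perm.sign_swap hxy]
        · intro j _ hj
          simp [Pi.mulSingle_eq_of_ne hj]
        · simp
    rw [this, hF, MonoidHom.finsetProd_apply]
    rfl
  have h2 : Equiv.Perm.sign (permVar π) = ∏ i, Equiv.Perm.sign (π i) := h
  rw [h2, colorSign]
  push_cast
  rfl

/-- The normalized residue along an ordering of the variables, relative to the standard order. -/
abbrev nres (w : Fin (∑ i, k i) ≃ Var k) : OS (Vert k) (∑ i, k i) →ₗ[ℂ] ℂ := ordRes (stdOrd k) w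

theorem headDet_map {W W' : Type} {p : ℕ} (std : Fin p ≃ W) (std' : Fin p ≃ W') (f : W ≃ W')
    (ρ : W' → ℕ) (e : Fin p → Sym2 (Option W)) :
    headDet std' ρ (Sym2.map (Equiv.optionCongr f) ∘ e) =
      ((Equiv.Perm.sign ((std'.trans f.symm).trans std.symm) : ℤ) : ℂ) *
        headDet std (ρ ∘ f) e := by
  classical
  have : (Matrix.of fun a b => if IsHead ρ ((Sym2.map (Equiv.optionCongr f) ∘ e) b) (std' a)
      then (1 : ℂ) else 0) = (Matrix.of fun a b => if IsHead (ρ ∘ f) (e b) (std a)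
      then (1 : ℂ) else 0).submatrix ((std'.trans f.symm).trans std.symm) id := by
    ext a b
    simp only [Matrix.submatrix_apply, Matrix.of_apply, Equiv.trans_apply, id,
      Equiv.apply_symm_apply, Function.comp_apply]
    congr 1
    apply propext
    constructor
    · rintro ⟨x, hx, hlt⟩
      refine ⟨(Equiv.optionCongr f).symm x, ?_, fun y hy => ?_⟩
      · apply Sym2.map.injective (Equiv.optionCongr f).injective
        rw [hx, Sym2.map_mk]
        simp
      · rw [Equiv.symm_apply_eq] at hy
        simpa using hlt (f y) (by simpa using hy)
    · rintro ⟨x, hx, hlt⟩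
      refine ⟨Equiv.optionCongr f x, ?_, fun y hy => ?_⟩
      · rw [hx, Sym2.map_mk]
        simp
      · cases x with
        | none => simp at hy
        | some x =>
          have : f x = y := by simpa using hy
          simpa [← this] using hlt x rfl
  rw [headDet, this, Matrix.det_permute, headDet]

/-- Permuting the variables of the same colour changes the ordering along which residues are taken,
and the sign. -/
theorem nres_act (π : ColorPerm k) (w : Fin (∑ i, k i) ≃ Var k) (u : OS (Vert k) (∑ i, k i)) :
    nres (w.trans (permVar π)) (act π u) = colorSign π * nres w u := by
  have : nres (w.trans (permVar π)) ∘ₗ act π = colorSign π • nres w := by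
    apply OS.hom_ext
    intro e he
    rw [LinearMap.comp_apply, LinearMap.smul_apply, act, OS.map_cls _ he, nres, ordRes_cls,
      ordRes_cls, smul_eq_mul]
    have h1 : (permVert π).toEmbedding = (Equiv.optionCongr (permVar π)).toEmbedding := rfl
    rw [h1, Equiv.coe_toEmbedding, headDet_map (stdOrd k) (stdOrd k) (permVar π)]
    congr 1
    · rw [Equiv.Perm.sign_trans_trans_symm, Equiv.Perm.sign_symm, sign_permVar]
    · apply headDet_congr
      intro y y'
      simp
  exact LinearMap.congr_fun this u

/-- On skew-invariant elements, the normalized residue depends only on the colours of the ordering.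
-/
theorem nres_skew (π : ColorPerm k) (w : Fin (∑ i, k i) ≃ Var k) (u : skew k) :
    nres (w.trans (permVar π)) u = nres w (u : OS (Vert k) (∑ i, k i)) := by
  have h := nres_act π w (u : OS (Vert k) (∑ i, k i))
  rw [u.2 π, map_smul, smul_eq_mul] at h
  have h2 := congrArg (colorSign π * ·) h
  simp only [← mul_assoc, colorSign_sq, one_mul] at h2
  exact h2

theorem exists_permVar (τ : Equiv.Perm (Var k)) (h : ∀ v, (τ v).1 = v.1) :
    ∃ π : ColorPerm k, τ = permVar π := by
  have aux : ∀ (v : Var k) (i : Fin n) (hi : v.1 = i),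
      (⟨i, Fin.cast (congrArg k hi) v.2⟩ : Var k) = v := by
    rintro v i rfl; rfl
  have hinj : ∀ i, Function.Injective fun a => Fin.cast (congrArg k (h ⟨i, a⟩)) (τ ⟨i, a⟩).2 := by
    intro i a b hab
    have h1 := aux (τ ⟨i, a⟩) i (h ⟨i, a⟩)
    have h2 := aux (τ ⟨i, b⟩) i (h ⟨i, b⟩)
    have h3 : τ ⟨i, a⟩ = τ ⟨i, b⟩ := by
      rw [← h1, ← h2]
      exact congrArg _ hab
    simpa using τ.injective h3
  refine ⟨fun i => Equiv.ofBijective _ (Finite.injective_iff_bijective.1 (hinj i)), ?_⟩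
  ext1 ⟨i, a⟩
  exact (aux _ _ (h ⟨i, a⟩)).symm

theorem permVar_injective : Function.Injective (permVar (k := k)) := by
  intro π σ h
  funext i
  ext1 a
  simpa [permVar] using DFunLike.congr_fun h (⟨i, a⟩ : Var k)

/-- The list of the colours of an ordering of the variables. -/
def colors (w : Fin (∑ i, k i) ≃ Var k) : List (Fin n) := List.ofFn fun a => (w a).1

/-- Two orderings have the same colours if and only if they differ by a permutation in `G_k`. -/
theorem colors_eq_iff {w w' : Fin (∑ i, k i) ≃ Var k} :
    colors w = colors w' ↔ ∃ π : ColorPerm k, w' = w.trans (permVar π) := by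
  constructor
  · intro h
    rw [colors, colors, List.ofFn_inj] at h
    obtain ⟨π, hπ⟩ := exists_permVar (w.symm.trans w') fun v => by
      have := congrFun h (w.symm v)
      simpa using this.symm
    refine ⟨π, ?_⟩
    rw [← hπ, ← Equiv.trans_assoc, Equiv.self_trans_symm, Equiv.refl_trans]
  · rintro ⟨π, rfl⟩
    rfl

open Classical in
/-- The coefficient of an element of `A(k)` at a list of colours: the normalized residue along any
ordering of the variables that has these colours, and 0 if there is none. -/
def coeff (k : Fin n → ℕ) (L : List (Fin n)) : skew k →ₗ[ℂ] ℂ :=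
  if h : ∃ w : Fin (∑ i, k i) ≃ Var k, colors w = L then nres h.choose ∘ₗ (skew k).subtype else 0

theorem coeff_colors (w : Fin (∑ i, k i) ≃ Var k) (u : skew k) :
    coeff k (colors w) u = nres w (u : OS (Vert k) (∑ i, k i)) := by
  have h : ∃ w' : Fin (∑ i, k i) ≃ Var k, colors w' = colors w := ⟨w, rfl⟩
  rw [coeff, dif_pos h]
  obtain ⟨π, hπ⟩ := colors_eq_iff.1 h.choose_spec.symm
  rw [LinearMap.comp_apply, Submodule.subtype_apply]
  conv_lhs => rw [hπ]
  rw [nres_skew]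

theorem coeff_eq_zero {L : List (Fin n)} (h : ¬ ∃ w : Fin (∑ i, k i) ≃ Var k, colors w = L) :
    coeff k L = 0 := dif_neg h

/-- The sign in the antisymmetrization cancels against the sign of the normalized residue. -/
theorem nres_asym (w : Fin (∑ i, k i) ≃ Var k) (x : OS (Vert k) (∑ i, k i)) :
    nres w (asym k x : OS (Vert k) (∑ i, k i)) =
      ∑ π : ColorPerm k, nres (w.trans (permVar π)) x := by
  have h1 : (asym k x : OS (Vert k) (∑ i, k i)) = ∑ π : ColorPerm k, colorSign π • act π x := by
    rw [asym]
    refine (LinearMap.codRestrict_apply _ _ _).trans ?_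
    rw [LinearMap.sum_apply]
    rfl
  rw [h1, map_sum, ← Equiv.sum_comp (Equiv.inv (ColorPerm k))]
  refine Finset.sum_congr rfl fun π _ => ?_
  rw [map_smul, smul_eq_mul, Equiv.inv_apply]
  have h2 : w = (w.trans (permVar π)).trans (permVar π⁻¹) := by
    ext1 a
    simp [permVar]
  conv_lhs => rw [h2]
  rw [nres_act, ← mul_assoc, colorSign_sq, one_mul]

/-- The antisymmetrization of a string is, up to a sign, the functional that takes the value 1 at
the sequence of the colours of the string, and 0 at all other sequences. -/
theorem coeff_asym_strEdges (w : Fin (∑ i, k i) ≃ Var k) (L : List (Fin n)) :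
    coeff k L (asym k (cls (strEdges w))) = if L = colors w then ordSign (stdOrd k) w else 0 := by
  by_cases h : ∃ w' : Fin (∑ i, k i) ≃ Var k, colors w' = L
  · obtain ⟨w', rfl⟩ := h
    rw [coeff_colors, nres_asym]
    simp only [nres, ordRes_strEdges]
    by_cases hc : colors w' = colors w
    · obtain ⟨π, hπ⟩ := colors_eq_iff.1 hc
      rw [if_pos hc, Finset.sum_eq_single π, if_pos hπ]
      · intro σ _ hσ
        rw [if_neg]
        rintro rfl
        apply hσ
        apply permVar_injective
        ext1 v
        have := DFunLike.congr_fun hπ (w'.symm v)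
        simpa using this
      · simp
    · rw [if_neg hc, Finset.sum_eq_zero]
      intro π _
      rw [if_neg]
      intro h
      exact hc (colors_eq_iff.2 ⟨π, h⟩)
  · rw [coeff_eq_zero h, LinearMap.zero_apply, if_neg]
    rintro rfl
    exact h ⟨w, rfl⟩

/-! ### Multiindices and the canonical element -/

theorem Multiindex.var_injective (J : Multiindex k) : Function.Injective J.var := by
  have hlt : ∀ a b, a < b → J.var a ≠ J.var b := by
    intro a b hab h
    have h1 : J.1 a = J.1 b := congrArg Sigma.fst h
    have h2 : (J.var a).2.1 = (J.var b).2.1 := by rw [h]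
    simp only [Multiindex.var] at h2
    refine absurd h2 (ne_of_lt (Finset.card_lt_card ?_))
    rw [Finset.ssubset_iff_of_subset]
    · refine ⟨a, ?_, ?_⟩
      · simp [hab, h1]
      · simp
    · intro c
      simp only [Finset.mem_filter, Finset.mem_univ, true_and]
      exact fun hc => ⟨hc.1.trans hab, hc.2.trans h1⟩
  intro a b hab
  rcases lt_trichotomy a b with h | h | h
  · exact absurd hab (hlt a b h)
  · exact h
  · exact absurd hab.symm (hlt b a h)

/-- The ordering of the variables given by a multiindex. -/
def Multiindex.ordering (J : Multiindex k) : Fin (∑ i, k i) ≃ Var k :=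
  Equiv.ofBijective J.var
    ((Fintype.bijective_iff_injective_and_card _).2 ⟨J.var_injective, by simp⟩)

theorem Multiindex.colors_ordering (J : Multiindex k) : colors J.ordering = List.ofFn J.1 := rfl

theorem Multiindex.sgn_eq (J : Multiindex k) : J.sgn = ordSign (stdOrd k) J.ordering := by
  have h1 : ordSign (stdOrd k) J.ordering =
      invSign (List.ofFn fun a => (stdOrd k).symm (J.ordering a)) :=
    ordSign_eq_invSign _ _ _ fun _ _ => Iff.rfl
  rw [h1, invSign_ofFn, Multiindex.sgn, prod_inversions_eq_pow]
  congr 2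
  ext ⟨a, b⟩
  simp only [Finset.mem_filter, Finset.mem_univ, true_and, stdOrd_symm_lt]
  refine and_congr_right fun hab => ?_
  change J.1 b < J.1 a ↔ J.1 b < J.1 a ∨ J.1 b = J.1 a ∧
    (Finset.univ.filter fun c => c < b ∧ J.1 c = J.1 b).card <
      (Finset.univ.filter fun c => c < a ∧ J.1 c = J.1 a).card
  constructor
  · exact Or.inl
  · rintro (h | ⟨h, h'⟩)
    · exact h
    · exfalso
      refine absurd h' (not_lt.2 (Finset.card_le_card ?_))
      intro c
      simp only [Finset.mem_filter, Finset.mem_univ, true_and]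
      exact fun hc => ⟨hc.1.trans hab, hc.2.trans h.symm⟩

/-- The pairing with a monomial is a coefficient: the sign of the multiindex is the normalizing sign
of the residues. -/
theorem Multiindex.pairing_eq (J : Multiindex k) : J.pairing = coeff k (List.ofFn J.1) := by
  ext u
  rw [← J.colors_ordering, coeff_colors, nres, ordRes, ← J.sgn_eq]
  rfl

theorem count_ofFn {α : Type} [DecidableEq α] {p : ℕ} (f : Fin p → α) (x : α) :
    (List.ofFn f).count x = (Finset.univ.filter fun a => f a = x).card := by
  rw [List.ofFn_eq_map, ← Multiset.coe_count, ← Multiset.map_coe, Multiset.count_map]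
  simp only [eq_comm (a := x)]
  rfl

theorem length_eq_sum_count (L : List (Fin n)) : L.length = ∑ i, L.count i := by
  have := Multiset.sum_count_eq_card (s := Finset.univ) (m := (L : Multiset (Fin n)))
    (fun a _ => Finset.mem_univ a)
  simpa using this.symm

/-- The multiindex given by a list of colours. -/
theorem exists_multiindex {L : List (Fin n)} (h : ∀ i, L.count i = k i) :
    ∃ J : Multiindex k, List.ofFn J.1 = L := by
  have hlen : L.length = ∑ i, k i := by
    rw [length_eq_sum_count]
    exact Finset.sum_congr rfl fun i _ => h i
  have h1 : List.ofFn (fun a : Fin (∑ i, k i) => L.get (a.cast hlen.symm)) = L := by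
    conv_rhs => rw [← List.ofFn_get L]
    rw [List.ofFn_congr hlen.symm]
    rfl
  refine ⟨⟨fun a => L.get (a.cast hlen.symm), fun i => ?_⟩, h1⟩
  rw [← count_ofFn, h1, h]

/-- The sequences of colours of orderings of `T(k)` are the sequences with `k i` terms equal to `i`.
-/
theorem exists_colors_iff {L : List (Fin n)} :
    (∃ w : Fin (∑ i, k i) ≃ Var k, colors w = L) ↔ ∀ i, L.count i = k i := by
  constructor
  · rintro ⟨w, rfl⟩ i
    rw [colors, count_ofFn, ← Finset.card_map w.toEmbedding]
    have : (Finset.univ.filter fun a => (w a).1 = i).map w.toEmbedding =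
        Finset.univ.map (Function.Embedding.sigmaMk (β := fun i => Fin (k i)) i) := by
      ext ⟨j, a⟩
      simp only [Finset.mem_map, Finset.mem_filter, Finset.mem_univ, true_and,
        Equiv.coe_toEmbedding, Function.Embedding.sigmaMk_apply]
      constructor
      · rintro ⟨b, h1, h2⟩
        rw [h2] at h1
        subst h1
        exact ⟨a, rfl⟩
      · rintro ⟨b, h⟩
        refine ⟨w.symm ⟨j, a⟩, ?_, by simp⟩
        rw [Equiv.apply_symm_apply, ← h]
    rw [this, Finset.card_map, Finset.card_univ, Fintype.card_fin]
  · intro h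
    obtain ⟨J, rfl⟩ := exists_multiindex h
    exact ⟨J.ordering, rfl⟩

/-- An element of `A(k)` is determined by its coefficients. -/
theorem eq_of_coeff {u v : skew k} (h : ∀ L, coeff k L u = coeff k L v) : u = v := by
  rw [← sub_eq_zero]
  apply Subtype.ext
  apply eq_zero_of_ordRes (stdOrd k)
  intro w
  have := coeff_colors w (u - v)
  rw [map_sub, h, sub_self] at this
  exact this.symm

theorem multiindex_ext {J J' : Multiindex k} (h : List.ofFn J.1 = List.ofFn J'.1) : J = J' :=
  Subtype.ext (List.ofFn_inj.1 h)

instance : Finite (Multiindex k) := Subtype.finite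

instance : Fintype (Multiindex k) := Fintype.ofFinite _

/-- The basis of `A(k)` dual to the monomials of degree `k`. -/
def Multiindex.dual (J : Multiindex k) : skew k :=
  J.sgn • asym k (cls (strEdges J.ordering))

/-- The elements `J.dual` form the basis dual to the coefficients. -/
theorem coeff_dual (J : Multiindex k) (L : List (Fin n)) :
    coeff k L J.dual = if L = List.ofFn J.1 then 1 else 0 := by
  rw [Multiindex.dual, map_smul, coeff_asym_strEdges, J.colors_ordering, J.sgn_eq, smul_eq_mul]
  split_ifs
  · exact ordSign_mul_self _ _
  · simp

theorem pairing_dual [DecidableEq (Multiindex k)] (J J' : Multiindex k) :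
    J'.pairing J.dual = if J = J' then 1 else 0 := by
  rw [J'.pairing_eq, coeff_dual]
  congr 1
  apply propext
  exact ⟨fun h => (multiindex_ext h).symm, fun h => by rw [h]⟩

theorem sum_coeff_smul_dual (u : skew k) :
    ∑ J : Multiindex k, coeff k (List.ofFn J.1) u • J.dual = u := by
  classical
  apply eq_of_coeff
  intro L
  rw [map_sum]
  simp only [map_smul, coeff_dual, smul_eq_mul, mul_ite, mul_one, mul_zero]
  by_cases h : ∃ J : Multiindex k, List.ofFn J.1 = L
  · obtain ⟨J, rfl⟩ := h
    rw [Finset.sum_eq_single J]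
    · simp
    · intro J' _ h
      rw [if_neg]
      intro h'
      exact h (multiindex_ext h'.symm)
    · simp
  · rw [Finset.sum_eq_zero fun J _ => if_neg fun h' => h ⟨J, h'.symm⟩, coeff_eq_zero,
      LinearMap.zero_apply]
    rw [exists_colors_iff]
    exact fun h' => h (exists_multiindex h')

/-- The monomial of a multiindex as an element of `U[k]`. -/
def Multiindex.freeMonomial (J : Multiindex k) : freePart k :=
  ⟨J.monomial, Submodule.subset_span ⟨J, rfl⟩⟩

theorem eq_sum_of_isCanonical {Ω : skew k ⊗[ℂ] freePart k} (h : IsCanonical k Ω) :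
    Ω = ∑ J : Multiindex k, J.dual ⊗ₜ[ℂ] J.freeMonomial := by
  have key : ∀ Ω : skew k ⊗[ℂ] freePart k, Ω = ∑ J : Multiindex k, J.dual ⊗ₜ[ℂ]
      (TensorProduct.lid ℂ (freePart k) (LinearMap.rTensor (freePart k) J.pairing Ω)) := by
    intro Ω
    induction Ω using TensorProduct.induction_on with
    | zero => simp
    | add x y hx hy =>
      conv_lhs => rw [hx, hy]
      simp only [map_add, TensorProduct.tmul_add, Finset.sum_add_distrib]
    | tmul u x =>
      simp only [LinearMap.rTensor_tmul, TensorProduct.lid_tmul, Multiindex.pairing_eq,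
        TensorProduct.tmul_smul, TensorProduct.smul_tmul', ← TensorProduct.sum_tmul]
      rw [sum_coeff_smul_dual]
  conv_lhs => rw [key Ω]
  refine Finset.sum_congr rfl fun J _ => ?_
  congr 1
  exact Subtype.ext (h J)

/-- The canonical element in terms of dual bases. -/
theorem isCanonical_sum : IsCanonical k (∑ J : Multiindex k, J.dual ⊗ₜ[ℂ] J.freeMonomial) := by
  classical
  intro J
  rw [map_sum, map_sum]
  simp only [LinearMap.rTensor_tmul, TensorProduct.lid_tmul, pairing_dual]
  simp [Multiindex.freeMonomial]

theorem existsUnique_isCanonical (k : Fin n → ℕ) :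
    ∃! Ω : skew k ⊗[ℂ] freePart k, IsCanonical k Ω :=
  ⟨_, isCanonical_sum, fun _ h => eq_sum_of_isCanonical h⟩

end Skew

/-! ### Shuffles -/

/-- All ways to split a list into two complementary sublists. -/
def splits {α : Type*} : List α → List (List α × List α)
  | [] => [([], [])]
  | a :: l => ((splits l).map fun AB => (a :: AB.1, AB.2)) ++
      (splits l).map fun AB => (AB.1, a :: AB.2)

theorem perm_of_mem_splits {α : Type*} {l : List α} {AB : List α × List α} (h : AB ∈ splits l) :
    (AB.1 ++ AB.2).Perm l := by
  induction l generalizing AB with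
  | nil =>
    obtain rfl : AB = ([], []) := by simpa [splits] using h
    simp
  | cons a l ih =>
    simp only [splits, List.mem_append, List.mem_map] at h
    rcases h with ⟨CD, h, rfl⟩ | ⟨CD, h, rfl⟩
    · simpa using ih h
    · exact List.perm_middle.trans ((ih h).cons a)

theorem sublist_of_mem_splits {α : Type*} {l : List α} {AB : List α × List α}
    (h : AB ∈ splits l) : AB.1.Sublist l ∧ AB.2.Sublist l := by
  induction l generalizing AB with
  | nil =>
    obtain rfl : AB = ([], []) := by simpa [splits] using h
    simp
  | cons a l ih =>
    simp only [splits, List.mem_append, List.mem_map] at h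
    rcases h with ⟨CD, h, rfl⟩ | ⟨CD, h, rfl⟩
    · exact ⟨(ih h).1.cons_cons a, (ih h).2.cons a⟩
    · exact ⟨(ih h).1.cons a, (ih h).2.cons_cons a⟩

/-- The subsequence of the terms of `K` that are marked by `c`. -/
def pick {α : Type*} {p : ℕ} (K : Fin p → α) (c : Fin p → Bool) : List α :=
  (List.finRange p).filterMap fun a => if c a then some (K a) else none

theorem pick_cons {α : Type*} {p : ℕ} (K : Fin (p + 1) → α) (b : Bool) (c : Fin p → Bool) :
    pick K (Fin.cons b c : Fin (p + 1) → Bool) =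
      if b then K 0 :: pick (fun a => K a.succ) c else pick (fun a => K a.succ) c := by
  unfold pick
  rw [List.finRange_succ, List.filterMap_cons, List.filterMap_map]
  cases b <;> simp

/-- The two ways to describe the splittings of a sequence, by marks on its positions and by
recursion, give the same sums. -/
theorem sum_pick_eq_sum_splits {α : Type*} {p : ℕ} (K : Fin p → α) (g : List α → List α → ℂ) :
    ∑ c : Fin p → Bool, g (pick K c) (pick K fun a => !c a) =
      ((splits (List.ofFn K)).map fun AB => g AB.1 AB.2).sum := by
  induction p generalizing g with
  | zero => simp [splits, pick]
  | succ p ih =>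
    rw [← (Fin.consEquiv fun _ : Fin (p + 1) => Bool).sum_comp, Fintype.sum_prod_type,
      Fintype.sum_bool, List.ofFn_succ, splits, List.map_append, List.sum_append, List.map_map,
      List.map_map]
    have hneg : ∀ (b : Bool) (c : Fin p → Bool),
        (fun a => !(Fin.consEquiv (fun _ : Fin (p + 1) => Bool) (b, c)) a) =
          (Fin.cons (!b) (fun a => !c a) : Fin (p + 1) → Bool) := by
      intro b c
      funext a
      refine Fin.cases rfl (fun a => rfl) a
    have hc : ∀ (b : Bool) (c : Fin p → Bool),
        Fin.consEquiv (fun _ : Fin (p + 1) => Bool) (b, c) =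
          (Fin.cons b c : Fin (p + 1) → Bool) := fun b c => rfl
    simp only [hneg]
    simp only [hc, pick_cons]
    congr 1
    · exact ih (fun a => K a.succ) fun A B => g (K 0 :: A) B
    · exact ih (fun a => K a.succ) fun A B => g A (K 0 :: B)

theorem count_pick {α : Type*} [DecidableEq α] {p : ℕ} (K : Fin p → α) (c : Fin p → Bool) (x : α) :
    (pick K c).count x = (Finset.univ.filter fun a => K a = x ∧ c a = true).card := by
  induction p with
  | zero => simp [pick]
  | succ p ih =>
    obtain ⟨⟨b, c⟩, rfl⟩ := (Fin.consEquiv fun _ : Fin (p + 1) => Bool).surjective c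
    change (pick K (Fin.cons b c : Fin (p + 1) → Bool)).count x = (Finset.univ.filter fun a =>
      K a = x ∧ (Fin.cons b c : Fin (p + 1) → Bool) a = true).card
    rw [pick_cons, Fin.card_filter_univ_succ']
    simp only [Fin.cons_zero, Fin.cons_succ, ← ih]
    cases b <;> simp [List.count_cons, add_comm]

theorem exists_ofFn_eq {W : Type} [DecidableEq W] {p : ℕ} {l : List W} (hnd : l.Nodup)
    (hmem : ∀ x, x ∈ l) (hlen : l.length = p) : ∃ w : Fin p ≃ W, List.ofFn w = l := by
  subst hlen
  refine ⟨hnd.getEquivOfForallMemList l hmem, ?_⟩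
  exact List.ofFn_get l

/-- The permutations that carry a map with given fibres to another one whose fibres have the same
cardinalities. -/
theorem card_perm_comp_eq {α ι : Type} [Fintype α] [DecidableEq α] [Fintype ι] [DecidableEq ι]
    (f d : α → ι) (h : ∀ i, Fintype.card {a // d a = i} = Fintype.card {a // f a = i}) :
    Fintype.card {τ : Equiv.Perm α // f ∘ τ = d} =
      ∏ i, (Fintype.card {a // f a = i}).factorial := by
  rw [← DomMulAct.stabilizer_card f]
  obtain ⟨τ₀, h₀⟩ : ∃ τ₀ : Equiv.Perm α, f ∘ τ₀ = d := by
    refine ⟨(Equiv.sigmaFiberEquiv d).symm.trans ((Equiv.sigmaCongrRight fun i =>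
      Fintype.equivOfCardEq (h i)).trans (Equiv.sigmaFiberEquiv f)), ?_⟩
    funext x
    exact (Fintype.equivOfCardEq (h (d x)) ⟨x, rfl⟩).2
  refine Fintype.card_congr (Equiv.subtypeEquiv (Equiv.mulRight τ₀⁻¹) fun τ => ?_)
  rw [Equiv.coe_mulRight, Equiv.Perm.coe_mul, ← Function.comp_assoc]
  constructor
  · rintro h
    rw [h, ← h₀, Function.comp_assoc, ← Equiv.Perm.coe_mul, mul_inv_cancel]
    rfl
  · intro h
    have h1 := congrArg (· ∘ τ₀) h
    have h2 : (⇑(τ * τ₀⁻¹) : α → α) ∘ ⇑τ₀ = τ := by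
      rw [← Equiv.Perm.coe_mul, inv_mul_cancel_right]
    rw [← h₀, ← h1, Function.comp_assoc, Function.comp_assoc, ← Function.comp_assoc (⇑τ),
      ← Equiv.Perm.coe_mul, h2]

/-! ### The star-product -/

section Star

variable {n : ℕ} (k l : Fin n → ℕ)

/-- The variables of `T(k + l)` are those of `T(k)` and the shifted ones of `T(l)`. -/
def varSplit : Var k ⊕ Var l ≃ Var (k + l) :=
  ((Equiv.sigmaCongrRight fun _ => finSumFinEquiv.symm).trans (Equiv.sigmaSumDistrib _ _)).symm

/-- The sign that occurs in the star-product. -/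
def starSign : ℂ := (-1) ^ (∑ i, ∑ j, if j < i then k i * l j else 0)

theorem sum_add_eq : ∑ i, k i + ∑ i, l i = ∑ i, (k + l) i := by
  simp [Finset.sum_add_distrib]

/-- The reference order of `T(k)` followed by that of `T(l)`. -/
def gluedOrd : Fin (∑ i, (k + l) i) ≃ Var (k + l) :=
  (finSumFinEquiv.trans (finCongr (sum_add_eq k l))).symm.trans
    ((Equiv.sumCongr (stdOrd k) (stdOrd l)).trans (varSplit k l))

theorem stdOrd_inl_lt_inl (x y : Var k) :
    (stdOrd (k + l)).symm (varSplit k l (Sum.inl x)) <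
      (stdOrd (k + l)).symm (varSplit k l (Sum.inl y)) ↔ (stdOrd k).symm x < (stdOrd k).symm y := by
  rw [stdOrd_symm_lt, stdOrd_symm_lt]
  rfl

theorem stdOrd_inr_lt_inr (x y : Var l) :
    (stdOrd (k + l)).symm (varSplit k l (Sum.inr x)) <
      (stdOrd (k + l)).symm (varSplit k l (Sum.inr y)) ↔ (stdOrd l).symm x < (stdOrd l).symm y := by
  rw [stdOrd_symm_lt, stdOrd_symm_lt]
  refine or_congr_right (and_congr_right fun h => ?_)
  obtain ⟨i, a⟩ := x
  obtain ⟨j, b⟩ := y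
  obtain rfl : i = j := h
  exact Nat.add_lt_add_iff_left

theorem stdOrd_inr_lt_inl (x : Var l) (y : Var k) :
    (stdOrd (k + l)).symm (varSplit k l (Sum.inr x)) <
      (stdOrd (k + l)).symm (varSplit k l (Sum.inl y)) ↔ x.1 < y.1 := by
  rw [stdOrd_symm_lt]
  refine or_iff_left ?_
  obtain ⟨i, a⟩ := x
  obtain ⟨j, b⟩ := y
  rintro ⟨h, h'⟩
  obtain rfl : i = j := h
  change k i + (a : ℕ) < b at h'
  have := b.2
  omega

theorem ordSign_gluedOrd : ordSign (stdOrd (k + l)) (gluedOrd k l) = starSign k l := by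
  set c := finSumFinEquiv.trans (finCongr (sum_add_eq k l)) with hc
  have hg : ∀ s, gluedOrd k l (c s) = varSplit k l (Sum.map (stdOrd k) (stdOrd l) s) := by
    intro s
    simp [gluedOrd, ← hc]
  have hcll : ∀ a b, c (Sum.inl a) < c (Sum.inl b) ↔ a < b := fun a b => Iff.rfl
  have hcrr : ∀ a b, c (Sum.inr a) < c (Sum.inr b) ↔ a < b := fun a b =>
    Nat.add_lt_add_iff_left
  have hclr : ∀ a b, c (Sum.inl a) < c (Sum.inr b) := fun a b =>
    a.2.trans_le (Nat.le_add_right _ _)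
  have hcrl : ∀ a b, ¬ c (Sum.inr a) < c (Sum.inl b) := fun a b => (hclr b a).asymm
  rw [ordSign_eq_invSign _ _ (stdOrd (k + l)).symm (fun _ _ => Iff.rfl), invSign_ofFn,
    ← c.prod_comp]
  simp only [← c.prod_comp (fun j => ite _ (-1 : ℂ) 1), Fintype.prod_sum_type, hg, Sum.map_inl,
    Sum.map_inr, stdOrd_inl_lt_inl, stdOrd_inr_lt_inr, stdOrd_inr_lt_inl, hcll, hcrr, hclr, hcrl,
    Equiv.symm_apply_apply, true_and, false_and, if_false,
    (fun {_} a b => iff_false_intro fun h => lt_asymm h.1 h.2 :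
      ∀ {m : ℕ} (a b : Fin m), a < b ∧ b < a ↔ False), Finset.prod_const_one, one_mul, mul_one]
  have h1 : ∀ i : Fin n, ∏ b, (if (stdOrd l b).1 < i then (-1 : ℂ) else 1) =
      ∏ j, if j < i then (-1) ^ l j else 1 := by
    intro i
    rw [(stdOrd l).prod_comp fun y : Var l => if y.1 < i then (-1 : ℂ) else 1, Fintype.prod_sigma]
    refine Finset.prod_congr rfl fun j _ => ?_
    by_cases hj : j < i <;> simp [hj]
  simp only [h1]
  rw [(stdOrd k).prod_comp fun x : Var k => ∏ j, if j < x.1 then (-1 : ℂ) ^ l j else 1,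
    Fintype.prod_sigma, starSign, ← Finset.prod_pow_eq_pow_sum]
  refine Finset.prod_congr rfl fun i _ =>
    (Finset.prod_const (∏ j, if j < i then (-1 : ℂ) ^ l j else 1)).trans ?_
  rw [← Finset.prod_pow_eq_pow_sum, ← Finset.prod_pow, Finset.card_univ, Fintype.card_fin]
  refine Finset.prod_congr rfl fun j _ => ?_
  split_ifs
  · rw [← pow_mul, mul_comm]
  · simp

/-- The determinant of a glued tree is the product of the determinants of its two parts, up to the
sign that sorts the vertices: with the vertices of the first part before those of the second, the
matrix is block diagonal. -/
theorem headDet_append (ρ : Var (k + l) → ℕ) (e : Fin (∑ i, k i) → Sym2 (Vert k))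
    (e' : Fin (∑ i, l i) → Sym2 (Vert l)) :
    headDet (stdOrd (k + l)) ρ (Fin.append (Sym2.map (inlVert k l) ∘ e)
      (Sym2.map (inrVert k l) ∘ e') ∘ Fin.cast (sum_add_eq k l).symm) =
      starSign k l * (headDet (stdOrd k) (fun x => ρ (varSplit k l (Sum.inl x))) e *
        headDet (stdOrd l) (fun x => ρ (varSplit k l (Sum.inr x))) e') := by
  classical
  set c := finSumFinEquiv.trans (finCongr (sum_add_eq k l)) with hc
  set E := Fin.append (Sym2.map (inlVert k l) ∘ e)
      (Sym2.map (inrVert k l) ∘ e') ∘ Fin.cast (sum_add_eq k l).symm with hE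
  set M : Matrix (Fin (∑ i, (k + l) i)) (Fin (∑ i, (k + l) i)) ℂ :=
    Matrix.of fun a b => if IsHead ρ (E b) (stdOrd (k + l) a) then 1 else 0 with hM
  have hEl : ∀ b, E (c (Sum.inl b)) = (e b).map (inlVert k l) := by
    intro b
    simp [hE, hc]
  have hEr : ∀ b, E (c (Sum.inr b)) = (e' b).map (inrVert k l) := by
    intro b
    simp [hE, hc]
  have hr : ∀ s, stdOrd (k + l) (((gluedOrd k l).trans (stdOrd (k + l)).symm) (c s)) =
      varSplit k l (Sum.map (stdOrd k) (stdOrd l) s) := by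
    intro s
    simp [gluedOrd, ← hc]
  have headl : ∀ (f : Sym2 (Vert k)) (x : Var k), IsHead ρ (f.map (inlVert k l))
      (varSplit k l (Sum.inl x)) ↔ IsHead (fun x => ρ (varSplit k l (Sum.inl x))) f x := by
    intro f x
    constructor
    · rintro ⟨y, hy, hlt⟩
      have : y ∈ f.map (inlVert k l) := by rw [hy]; exact Sym2.mem_mk_left _ _
      obtain ⟨y', -, rfl⟩ := Sym2.mem_map.1 this
      refine ⟨y', Sym2.map.injective (inlVert k l).injective hy, fun z hz => hlt _ ?_⟩
      rw [hz]
      rfl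
    · rintro ⟨y, rfl, hlt⟩
      refine ⟨inlVert k l y, rfl, fun z hz => ?_⟩
      cases y with
      | none => cases hz
      | some y =>
        obtain rfl : varSplit k l (Sum.inl y) = z := Option.some_injective _ hz
        exact hlt y rfl
  have headr : ∀ (f : Sym2 (Vert l)) (x : Var l), IsHead ρ (f.map (inrVert k l))
      (varSplit k l (Sum.inr x)) ↔ IsHead (fun x => ρ (varSplit k l (Sum.inr x))) f x := by
    intro f x
    constructor
    · rintro ⟨y, hy, hlt⟩
      have : y ∈ f.map (inrVert k l) := by rw [hy]; exact Sym2.mem_mk_left _ _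
      obtain ⟨y', -, rfl⟩ := Sym2.mem_map.1 this
      refine ⟨y', Sym2.map.injective (inrVert k l).injective hy, fun z hz => hlt _ ?_⟩
      rw [hz]
      rfl
    · rintro ⟨y, rfl, hlt⟩
      refine ⟨inrVert k l y, rfl, fun z hz => ?_⟩
      cases y with
      | none => cases hz
      | some y =>
        obtain rfl : varSplit k l (Sum.inr y) = z := Option.some_injective _ hz
        exact hlt y rfl
  have headlr : ∀ (f : Sym2 (Vert k)) (x : Var l), ¬ IsHead ρ (f.map (inlVert k l))
      (varSplit k l (Sum.inr x)) := by
    rintro f x ⟨y, hy, -⟩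
    have : some (varSplit k l (Sum.inr x)) ∈ f.map (inlVert k l) := by
      rw [hy]; exact Sym2.mem_mk_right _ _
    obtain ⟨y', -, h⟩ := Sym2.mem_map.1 this
    cases y' with
    | none => cases h
    | some y' =>
      have h2 : varSplit k l (Sum.inl y') = varSplit k l (Sum.inr x) := Option.some_injective _ h
      simp at h2
  have headrl : ∀ (f : Sym2 (Vert l)) (x : Var k), ¬ IsHead ρ (f.map (inrVert k l))
      (varSplit k l (Sum.inl x)) := by
    rintro f x ⟨y, hy, -⟩
    have : some (varSplit k l (Sum.inl x)) ∈ f.map (inrVert k l) := by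
      rw [hy]; exact Sym2.mem_mk_right _ _
    obtain ⟨y', -, h⟩ := Sym2.mem_map.1 this
    cases y' with
    | none => cases h
    | some y' =>
      have h2 : varSplit k l (Sum.inr y') = varSplit k l (Sum.inl x) := Option.some_injective _ h
      simp at h2
  have h1 := Matrix.det_permute ((gluedOrd k l).trans (stdOrd (k + l)).symm) M
  rw [← Matrix.det_submatrix_equiv_self c, Matrix.submatrix_submatrix] at h1
  have h2 : M.submatrix (((gluedOrd k l).trans (stdOrd (k + l)).symm) ∘ c) (id ∘ c) =
      Matrix.fromBlocks
        (Matrix.of fun a b => if IsHead (fun x => ρ (varSplit k l (Sum.inl x))) (e b) (stdOrd k a)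
          then 1 else 0) 0 0
        (Matrix.of fun a b => if IsHead (fun x => ρ (varSplit k l (Sum.inr x))) (e' b) (stdOrd l a)
          then 1 else 0) := by
    ext (a | a) (b | b)
    · simp only [Matrix.submatrix_apply, hM, Matrix.of_apply, Function.comp_apply, hr, id, hEl,
        Sum.map_inl, headl, Matrix.fromBlocks_apply₁₁]
    · simp only [Matrix.submatrix_apply, hM, Matrix.of_apply, Function.comp_apply, hr, id, hEr,
        Sum.map_inl, headrl, Matrix.fromBlocks_apply₁₂, if_false, Matrix.zero_apply]
    · simp only [Matrix.submatrix_apply, hM, Matrix.of_apply, Function.comp_apply, hr, id, hEl,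
        Sum.map_inr, headlr, Matrix.fromBlocks_apply₂₁, if_false, Matrix.zero_apply]
    · simp only [Matrix.submatrix_apply, hM, Matrix.of_apply, Function.comp_apply, hr, id, hEr,
        Sum.map_inr, headr, Matrix.fromBlocks_apply₂₂]
  rw [h2, Matrix.det_fromBlocks_zero₂₁, ← ordSign, ordSign_gluedOrd] at h1
  have h3 : starSign k l * starSign k l = 1 := by
    rw [← ordSign_gluedOrd]
    exact ordSign_mul_self _ _
  rw [headDet, headDet, headDet, h1, ← mul_assoc, h3, one_mul]

theorem OS.cast_cls {V : Type} {p q : ℕ} (h : p = q) (e : Fin p → Sym2 V) :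
    OS.cast h (cls e) = cls (e ∘ Fin.cast h.symm) := by
  subst h
  rfl

theorem OS.join_cls {V : Type} {p q : ℕ} {e : Fin p → Sym2 V} {e' : Fin q → Sym2 V}
    (h : IsForest e) (h' : IsForest e') : OS.join (cls e) (cls e') = cls (Fin.append e e') := by
  rw [OS.join, OS.lift_cls _ _ _ h, OS.lift_cls _ _ _ h']

variable {k l}

/-- An ordering of `T(k + l)` induces orderings of `T(k)` and `T(l)`, and the normalized residue of
the tree glued from two trees is the product of their normalized residues. -/
theorem nres_join {w : Fin (∑ i, (k + l) i) ≃ Var (k + l)} {w₁ : Fin (∑ i, k i) ≃ Var k}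
    {w₂ : Fin (∑ i, l i) ≃ Var l}
    (h₁ : ∀ x y, w.symm (varSplit k l (Sum.inl x)) < w.symm (varSplit k l (Sum.inl y)) ↔
      w₁.symm x < w₁.symm y)
    (h₂ : ∀ x y, w.symm (varSplit k l (Sum.inr x)) < w.symm (varSplit k l (Sum.inr y)) ↔
      w₂.symm x < w₂.symm y)
    (u : OS (Vert k) (∑ i, k i)) (v : OS (Vert l) (∑ i, l i)) :
    nres w (OS.cast (sum_add_eq k l) (OS.join (OS.map (inlVert k l) u) (OS.map (inrVert k l) v))) =
      starSign k l * (nres w₁ u * nres w₂ v) := by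
  have : ((OS.join.compl₁₂ (OS.map (inlVert k l)) (OS.map (inrVert k l))).compr₂
      (nres w ∘ₗ OS.cast (sum_add_eq k l))) =
      starSign k l • (LinearMap.mul ℂ ℂ).compl₁₂ (nres w₁) (nres w₂) := by
    apply OS.hom_ext
    intro e he
    apply OS.hom_ext
    intro e' he'
    simp only [LinearMap.compr₂_apply, LinearMap.compl₁₂_apply, LinearMap.comp_apply,
      LinearMap.smul_apply, LinearMap.mul_apply', smul_eq_mul]
    rw [OS.map_cls _ he, OS.map_cls _ he', OS.join_cls (isForest_map _ he) (isForest_map _ he'),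
      OS.cast_cls, nres, ordRes_cls, headDet_append, nres, nres, ordRes_cls, ordRes_cls]
    congr 2
    · exact headDet_congr _ h₁ _
    · exact headDet_congr _ h₂ _
  exact LinearMap.congr_fun (LinearMap.congr_fun this u) v

/-- Whether a variable of `T(k + l)` comes from `T(k)`. -/
def isLeft (v : Var (k + l)) : Bool := ((varSplit k l).symm v).isLeft

/-- An ordering of `T(k + l)` restricts to orderings of `T(k)` and of `T(l)`. -/
theorem exists_sub_ordering (w : Fin (∑ i, (k + l) i) ≃ Var (k + l)) :
    (∃ w₁ : Fin (∑ i, k i) ≃ Var k, (∀ x y, w.symm (varSplit k l (Sum.inl x)) <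
      w.symm (varSplit k l (Sum.inl y)) ↔ w₁.symm x < w₁.symm y) ∧
        colors w₁ = pick (fun a => (w a).1) fun a => isLeft (w a)) ∧
    (∃ w₂ : Fin (∑ i, l i) ≃ Var l, (∀ x y, w.symm (varSplit k l (Sum.inr x)) <
      w.symm (varSplit k l (Sum.inr y)) ↔ w₂.symm x < w₂.symm y) ∧
        colors w₂ = pick (fun a => (w a).1) fun a => !isLeft (w a)) := by
  have key : ∀ (m : Fin n → ℕ) (f : Var (k + l) → Option (Var m)) (g : Var m → Var (k + l))
      (c : Var (k + l) → Bool) (hf : ∀ v x, f v = some x ↔ v = g x)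
      (hcol : ∀ v, (f v).map Sigma.fst = if c v then some v.1 else none),
      ∃ w₁ : Fin (∑ i, m i) ≃ Var m, (∀ x y, w.symm (g x) < w.symm (g y) ↔
        w₁.symm x < w₁.symm y) ∧ colors w₁ = pick (fun a => (w a).1) fun a => c (w a) := by
    intro m f g c hf hcol
    have hpw : (List.ofFn w).Pairwise fun v v' => w.symm v < w.symm v' := by
      rw [List.pairwise_ofFn]
      intro i j hij
      simpa using hij
    have hpw' : ((List.ofFn w).filterMap f).Pairwise fun x y => w.symm (g x) < w.symm (g y) := by
      refine hpw.filterMap f ?_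
      intro v v' hvv' x hx y hy
      rwa [← (hf v x).1 hx, ← (hf v' y).1 hy]
    have hnd : ((List.ofFn w).filterMap f).Nodup :=
      hpw'.imp fun h h' => by rw [h'] at h; exact lt_irrefl _ h
    have hmem : ∀ x, x ∈ (List.ofFn w).filterMap f := by
      intro x
      rw [List.mem_filterMap]
      exact ⟨g x, List.mem_ofFn.2 ⟨w.symm (g x), by simp⟩, (hf _ _).2 rfl⟩
    have hlen : ((List.ofFn w).filterMap f).length = ∑ i, m i := by
      have h1 := List.toFinset_card_of_nodup hnd
      have h2 : ((List.ofFn w).filterMap f).toFinset = Finset.univ := by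
        ext x
        simp only [List.mem_toFinset, hmem, Finset.mem_univ]
      rw [← h1, h2, Finset.card_univ]
      simp
    obtain ⟨w₁, hw₁⟩ := exists_ofFn_eq hnd hmem hlen
    refine ⟨w₁, ?_, ?_⟩
    · rw [← hw₁, List.pairwise_ofFn] at hpw'
      have hm : StrictMono fun a => w.symm (g (w₁ a)) := fun a b h => hpw' h
      intro x y
      have := hm.lt_iff_lt (a := w₁.symm x) (b := w₁.symm y)
      simpa using this
    · have h1 : colors w₁ = (List.ofFn w₁).map Sigma.fst := by
        rw [List.map_ofFn]
        rfl
      rw [h1, hw₁, List.map_filterMap, List.ofFn_eq_map, List.filterMap_map, pick]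
      simp only [Function.comp_def, hcol]
  constructor
  · refine key k (fun v => ((varSplit k l).symm v).getLeft?) (fun x => varSplit k l (Sum.inl x))
      isLeft ?_ ?_
    · intro v x
      rw [Sum.getLeft?_eq_some_iff, Equiv.symm_apply_eq]
    · intro v
      obtain ⟨s, rfl⟩ := (varSplit k l).surjective v
      rcases s with x | x
      · simp [isLeft]
        rfl
      · simp [isLeft]
  · refine key l (fun v => ((varSplit k l).symm v).getRight?) (fun x => varSplit k l (Sum.inr x))
      (fun v => !isLeft v) ?_ ?_
    · intro v x
      rw [Sum.getRight?_eq_some_iff, Equiv.symm_apply_eq]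
    · intro v
      obtain ⟨s, rfl⟩ := (varSplit k l).surjective v
      rcases s with x | x
      · simp [isLeft]
      · simp [isLeft]
        rfl

theorem isLeft_inl (x : Var k) : isLeft (varSplit k l (Sum.inl x)) = true := by simp [isLeft]

theorem isLeft_inr (x : Var l) : isLeft (varSplit k l (Sum.inr x)) = false := by simp [isLeft]

theorem card_isLeft (i : Fin n) (b : Bool) :
    Fintype.card {v : Var (k + l) // (v.1, isLeft v) = (i, b)} = if b then k i else l i := by
  cases b
  · rw [if_neg (by simp), ← Fintype.card_fin (l i)]
    refine (Fintype.card_of_bijective (f := fun a : Fin (l i) =>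
      (⟨varSplit k l (Sum.inr ⟨i, a⟩), by rw [isLeft_inr]; rfl⟩ :
        {v : Var (k + l) // (v.1, isLeft v) = (i, false)})) ⟨?_, ?_⟩).symm
    · intro a b hab
      simpa using hab
    · rintro ⟨v, hv⟩
      obtain ⟨s, rfl⟩ := (varSplit k l).surjective v
      rcases s with ⟨j, x⟩ | ⟨j, x⟩
      · rw [isLeft_inl] at hv
        simp at hv
      · obtain rfl : j = i := congrArg Prod.fst hv
        exact ⟨x, rfl⟩
  · rw [if_pos rfl, ← Fintype.card_fin (k i)]
    refine (Fintype.card_of_bijective (f := fun a : Fin (k i) =>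
      (⟨varSplit k l (Sum.inl ⟨i, a⟩), by rw [isLeft_inl]; rfl⟩ :
        {v : Var (k + l) // (v.1, isLeft v) = (i, true)})) ⟨?_, ?_⟩).symm
    · intro a b hab
      simpa using hab
    · rintro ⟨v, hv⟩
      obtain ⟨s, rfl⟩ := (varSplit k l).surjective v
      rcases s with ⟨j, x⟩ | ⟨j, x⟩
      · obtain rfl : j = i := congrArg Prod.fst hv
        exact ⟨x, rfl⟩
      · rw [isLeft_inr] at hv
        simp at hv

theorem count_eq_of_coeff_ne_zero {L : List (Fin n)} {u : skew k} (h : coeff k L u ≠ 0)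
    (i : Fin n) :
    L.count i = k i := by
  refine exists_colors_iff.1 ?_ i
  by_contra h'
  rw [coeff_eq_zero h'] at h
  exact h rfl

/-- The number of colour-preserving permutations that mark given positions of an ordering as coming
from `T(k)`. -/
theorem card_permVar_isLeft (w : Fin (∑ i, (k + l) i) ≃ Var (k + l))
    (c : Fin (∑ i, (k + l) i) → Bool) (hk : ∀ i, (pick (fun a => (w a).1) c).count i = k i)
    (hl : ∀ i, (pick (fun a => (w a).1) fun a => !c a).count i = l i) :
    (Finset.univ.filter fun π : ColorPerm (k + l) =>
      (fun a => isLeft (permVar π (w a))) = c).card = ∏ i, ((k i).factorial * (l i).factorial) := by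
  have hd : ∀ ib : Fin n × Bool, Fintype.card {v : Var (k + l) // (v.1, c (w.symm v)) = ib} =
      Fintype.card {v : Var (k + l) // (v.1, isLeft v) = ib} := by
    rintro ⟨i, b⟩
    rw [card_isLeft, Fintype.card_subtype]
    have h1 : (Finset.univ.filter fun v : Var (k + l) => (v.1, c (w.symm v)) = (i, b)).card =
        (Finset.univ.filter fun a => (w a).1 = i ∧ c a = b).card := by
      refine (Finset.card_bij (fun a _ => w a) ?_ ?_ ?_).symm
      · intro a
        simp
      · intro a _ b _ hab
        exact w.injective hab
      · intro v hv
        exact ⟨w.symm v, by simpa using hv, by simp⟩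
    rw [h1]
    cases b
    · rw [if_neg (by simp), ← hl, count_pick]
      simp
    · rw [if_pos rfl, ← hk, count_pick]
  have h := card_perm_comp_eq (fun v : Var (k + l) => (v.1, isLeft v))
      (fun v => (v.1, c (w.symm v))) hd
  simp only [card_isLeft, Fintype.prod_prod_type, Fintype.prod_bool, if_true,
    Bool.false_eq_true, if_false] at h
  rw [← h, ← Fintype.card_subtype]
  refine Fintype.card_of_bijective (f := fun π => ⟨permVar π.1, ?_⟩) ⟨?_, ?_⟩
  · funext v
    have := congrFun π.2 (w.symm v)
    simp only [Equiv.apply_symm_apply] at this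
    exact Prod.ext rfl this
  · intro π σ hπσ
    exact Subtype.ext (permVar_injective (congrArg Subtype.val hπσ))
  · rintro ⟨τ, hτ⟩
    obtain ⟨π, rfl⟩ := exists_permVar τ fun v => congrArg Prod.fst (congrFun hτ v)
    refine ⟨⟨π, ?_⟩, rfl⟩
    funext a
    have := congrArg Prod.snd (congrFun hτ (w a))
    simpa using this

/-- A sum over the colour-preserving permutations of a quantity that depends only on the positions
of the variables from `T(k)` is a sum over these positions. -/
theorem sum_permVar_isLeft (w : Fin (∑ i, (k + l) i) ≃ Var (k + l))
    (F : (Fin (∑ i, (k + l) i) → Bool) → ℂ)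
    (hk : ∀ c, F c ≠ 0 → ∀ i, (pick (fun a => (w a).1) c).count i = k i)
    (hl : ∀ c, F c ≠ 0 → ∀ i, (pick (fun a => (w a).1) fun a => !c a).count i = l i) :
    ∑ π : ColorPerm (k + l), F (fun a => isLeft (permVar π (w a))) =
      ((∏ i, ((k i).factorial * (l i).factorial) : ℕ) : ℂ) * ∑ c, F c := by
  rw [← Finset.sum_fiberwise Finset.univ
    (fun π : ColorPerm (k + l) => fun a => isLeft (permVar π (w a))), Finset.mul_sum]
  refine Finset.sum_congr rfl fun c _ => ?_
  rw [Finset.sum_congr rfl fun π hπ => congrArg F (Finset.mem_filter.1 hπ).2, Finset.sum_const,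
    nsmul_eq_mul]
  by_cases hc : F c = 0
  · rw [hc, mul_zero, mul_zero]
  · rw [card_permVar_isLeft w c (hk c hc) (hl c hc)]

/-- In terms of the coefficients, the star-product is the shuffle product. -/
theorem coeff_star (L : List (Fin n)) (u : skew k) (v : skew l) :
    coeff (k + l) L (star k l u v) =
      ((splits L).map fun AB => coeff k AB.1 u * coeff l AB.2 v).sum := by
  by_cases h : ∃ w : Fin (∑ i, (k + l) i) ≃ Var (k + l), colors w = L
  · obtain ⟨w, rfl⟩ := h
    set K : Fin (∑ i, (k + l) i) → Fin n := fun a => (w a).1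
    set F : (Fin (∑ i, (k + l) i) → Bool) → ℂ := fun c =>
      coeff k (pick K c) u * coeff l (pick K fun a => !c a) v with hF
    have h1 : star k l u v = starCoeff k l • asym (k + l) (OS.cast (sum_add_eq k l)
        (OS.join (OS.map (inlVert k l) u.1) (OS.map (inrVert k l) v.1))) := rfl
    have h2 : ∀ π : ColorPerm (k + l), nres (w.trans (permVar π)) (OS.cast (sum_add_eq k l)
        (OS.join (OS.map (inlVert k l) u.1) (OS.map (inrVert k l) v.1))) =
          starSign k l * F fun a => isLeft (permVar π (w a)) := by
      intro π
      obtain ⟨⟨w₁, hw₁, hc₁⟩, w₂, hw₂, hc₂⟩ := exists_sub_ordering (w.trans (permVar π))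
      rw [nres_join hw₁ hw₂, ← coeff_colors, ← coeff_colors, hc₁, hc₂]
      rfl
    have h3 : starCoeff k l * starSign k l * ((∏ i, ((k i).factorial * (l i).factorial) : ℕ) : ℂ) =
        1 := by
      have h4 : starSign k l * starSign k l = 1 := by
        rw [← ordSign_gluedOrd]
        exact ordSign_mul_self _ _
      have h5 : ((∏ i, ((k i).factorial * (l i).factorial) : ℕ) : ℂ) ≠ 0 := by
        rw [Nat.cast_ne_zero, Finset.prod_ne_zero_iff]
        intro i _
        positivity
      have h6 : starCoeff k l =
          starSign k l / ((∏ i, ((k i).factorial * (l i).factorial) : ℕ) : ℂ) := by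
        push_cast
        rfl
      rw [h6]
      field_simp
      linear_combination h4
    rw [coeff_colors, h1, Submodule.coe_smul, map_smul, nres_asym, smul_eq_mul]
    simp only [h2]
    rw [← Finset.mul_sum, sum_permVar_isLeft w F
      (fun c hc => count_eq_of_coeff_ne_zero (left_ne_zero_of_mul hc))
      (fun c hc => count_eq_of_coeff_ne_zero (right_ne_zero_of_mul hc)), ← mul_assoc, ← mul_assoc,
        h3,
      one_mul]
    exact sum_pick_eq_sum_splits K fun A B => coeff k A u * coeff l B v
  · rw [coeff_eq_zero h, LinearMap.zero_apply, eq_comm]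
    apply List.sum_eq_zero
    intro x hx
    obtain ⟨AB, hAB, rfl⟩ := List.mem_map.1 hx
    by_contra hne
    apply h
    rw [exists_colors_iff]
    intro i
    rw [← (perm_of_mem_splits hAB).count_eq, List.count_append,
      count_eq_of_coeff_ne_zero (left_ne_zero_of_mul hne),
      count_eq_of_coeff_ne_zero (right_ne_zero_of_mul hne)]
    rfl

end Star

/-! ### The coefficients of elements of the direct sum -/

section Total

variable {n : ℕ}

/-- The coefficient at a list of colours of an element of the direct sum. -/
def tcoeff (L : List (Fin n)) : (⨁ k : Fin n → ℕ, skew k) →ₗ[ℂ] ℂ :=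
  coeff (fun i => L.count i) L ∘ₗ DirectSum.component ℂ _ (fun k => skew k) fun i => L.count i

theorem tcoeff_eq {L : List (Fin n)} {k : Fin n → ℕ} (h : ∀ i, L.count i = k i)
    (u : ⨁ k : Fin n → ℕ, skew k) : tcoeff L u = coeff k L (u k) := by
  obtain rfl : (fun i => L.count i) = k := funext h
  rfl

theorem tcoeff_lof (L : List (Fin n)) (k : Fin n → ℕ) (u : skew k) :
    tcoeff L (DirectSum.lof ℂ (Fin n → ℕ) (fun k => skew k) k u) = coeff k L u := by
  by_cases h : ∀ i, L.count i = k i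
  · rw [tcoeff_eq h, DirectSum.lof_eq_of, DirectSum.of_eq_same]
  · rw [tcoeff_eq (fun _ => rfl), DirectSum.lof_eq_of, DirectSum.of_eq_of_ne, map_zero,
      coeff_eq_zero, LinearMap.zero_apply]
    · rwa [exists_colors_iff]
    · intro h'
      exact h fun i => congrFun h' i

theorem starTotal_lof (k l : Fin n → ℕ) (u : skew k) (v : skew l) :
    starTotal n (DirectSum.lof ℂ (Fin n → ℕ) (fun k => skew k) k u)
      (DirectSum.lof ℂ (Fin n → ℕ) (fun k => skew k) l v) =
      DirectSum.lof ℂ (Fin n → ℕ) (fun k => skew k) (k + l) (star k l u v) := by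
  rw [starTotal, DirectSum.toModule_lof, LinearMap.flip_apply, DirectSum.toModule_lof,
    LinearMap.flip_apply]
  rfl

/-- In the direct sum of all `A(k)`, the star-product is the shuffle product on coefficients. -/
theorem tcoeff_starTotal (L : List (Fin n)) (u v : ⨁ k : Fin n → ℕ, skew k) :
    tcoeff L (starTotal n u v) = ((splits L).map fun AB => tcoeff AB.1 u * tcoeff AB.2 v).sum := by
  induction u using DirectSum.induction_on with
  | zero => simp
  | add u u' hu hu' =>
    rw [map_add, LinearMap.add_apply, map_add, hu, hu', ← List.sum_map_add]
    simp only [map_add, add_mul]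
  | of k u =>
    induction v using DirectSum.induction_on with
    | zero => simp
    | add v v' hv hv' =>
      rw [map_add, map_add, hv, hv', ← List.sum_map_add]
      simp only [map_add, mul_add]
    | of l v =>
      rw [← DirectSum.lof_eq_of ℂ, ← DirectSum.lof_eq_of ℂ, starTotal_lof, tcoeff_lof, coeff_star]
      simp only [tcoeff_lof]

theorem tcoeff_starOne (L : List (Fin n)) :
    tcoeff L (starOne n) = if L = [] then 1 else 0 := by
  rw [starOne, tcoeff_lof]
  have e : Fin (∑ i : Fin n, (0 : Fin n → ℕ) i) ≃ Var (0 : Fin n → ℕ) := stdOrd 0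
  have h0 : ∑ i : Fin n, (0 : Fin n → ℕ) i = 0 := by simp
  have : IsEmpty (Fin (∑ i : Fin n, (0 : Fin n → ℕ) i)) := by rw [h0]; infer_instance
  have h1 : colors e = [] := by
    rw [colors, ← List.length_eq_zero_iff, List.length_ofFn, h0]
  have h2 : (OS.cast h0.symm (cls (p := 0) Fin.elim0) : OS (Vert (0 : Fin n → ℕ)) _) =
      cls (strEdges e) := by
    rw [OS.cast_cls]
    congr 1
    funext a
    exact isEmptyElim a
  have h3 : ordSign (stdOrd (0 : Fin n → ℕ)) e = 1 := by
    rw [ordSign, Subsingleton.elim (e.trans (stdOrd 0).symm) 1]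
    simp
  rw [h2, coeff_asym_strEdges, h1, h3]

end Total

/-! ### The coproduct of an enveloping algebra and convolution of functionals -/

section Enveloping

attribute [local instance] LieRing.ofAssociativeRing

variable {𝔫 : Type*} [LieRing 𝔫] [LieAlgebra ℂ 𝔫]

/-- The primitive coproduct `x ↦ x ⊗ 1 + 1 ⊗ x`. -/
def primitive (𝔫 : Type*) [LieRing 𝔫] [LieAlgebra ℂ 𝔫] : 𝔫 →ₗ⁅ℂ⁆
    UniversalEnvelopingAlgebra ℂ 𝔫 ⊗[ℂ] UniversalEnvelopingAlgebra ℂ 𝔫 where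
  toFun x := UniversalEnvelopingAlgebra.ι ℂ x ⊗ₜ 1 + 1 ⊗ₜ UniversalEnvelopingAlgebra.ι ℂ x
  map_add' x y := by
    rw [map_add, TensorProduct.add_tmul, TensorProduct.tmul_add]
    abel
  map_smul' c x := by
    rw [map_smul, TensorProduct.tmul_smul, ← TensorProduct.smul_tmul', RingHom.id_apply, smul_add]
  map_lie' {x y} := by
    rw [LieHom.map_lie, LieRing.of_associative_ring_bracket, LieRing.of_associative_ring_bracket,
      TensorProduct.sub_tmul, TensorProduct.tmul_sub]
    simp only [mul_add, add_mul, Algebra.TensorProduct.tmul_mul_tmul, one_mul, mul_one]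
    abel

/-- The coproduct of an enveloping algebra. -/
def comul (𝔫 : Type*) [LieRing 𝔫] [LieAlgebra ℂ 𝔫] : UniversalEnvelopingAlgebra ℂ 𝔫 →ₐ[ℂ]
    UniversalEnvelopingAlgebra ℂ 𝔫 ⊗[ℂ] UniversalEnvelopingAlgebra ℂ 𝔫 :=
  UniversalEnvelopingAlgebra.lift ℂ (primitive 𝔫)

theorem comul_ι (x : 𝔫) : comul 𝔫 (UniversalEnvelopingAlgebra.ι ℂ x) =
    UniversalEnvelopingAlgebra.ι ℂ x ⊗ₜ 1 + 1 ⊗ₜ UniversalEnvelopingAlgebra.ι ℂ x :=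
  UniversalEnvelopingAlgebra.lift_ι_apply ℂ (primitive 𝔫) x

/-- The convolution product of linear functionals on an enveloping algebra. -/
def conv (ψ χ : UniversalEnvelopingAlgebra ℂ 𝔫 →ₗ[ℂ] ℂ) :
    UniversalEnvelopingAlgebra ℂ 𝔫 →ₗ[ℂ] ℂ :=
  LinearMap.mul' ℂ ℂ ∘ₗ TensorProduct.map ψ χ ∘ₗ (comul 𝔫).toLinearMap

/-- The product of the elements `g a` of a Lie algebra, with `a` running through a list. -/
def listProd {α : Type*} (g : α → 𝔫) (L : List α) : UniversalEnvelopingAlgebra ℂ 𝔫 :=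
  (L.map fun a => UniversalEnvelopingAlgebra.ι ℂ (g a)).prod

/-- The product of the elements `g a` of a Lie algebra, with `a` running through a list from its
end to its beginning. -/
def revProd {α : Type*} (g : α → 𝔫) (L : List α) : UniversalEnvelopingAlgebra ℂ 𝔫 :=
  listProd g L.reverse

theorem listProd_cons {α : Type*} (g : α → 𝔫) (a : α) (L : List α) :
    listProd g (a :: L) = UniversalEnvelopingAlgebra.ι ℂ (g a) * listProd g L := by
  rw [listProd, List.map_cons, List.prod_cons]
  rfl

theorem listProd_append {α : Type*} (g : α → 𝔫) (L L' : List α) :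
    listProd g (L ++ L') = listProd g L * listProd g L' := by
  rw [listProd, List.map_append, List.prod_append]
  rfl

theorem revProd_cons {α : Type*} (g : α → 𝔫) (a : α) (L : List α) :
    revProd g (a :: L) = revProd g L * UniversalEnvelopingAlgebra.ι ℂ (g a) := by
  rw [revProd, List.reverse_cons, listProd_append, revProd]
  simp [listProd]

theorem comul_listProd {α : Type*} (g : α → 𝔫) (L : List α) : comul 𝔫 (listProd g L) =
    ((splits L).map fun AB => listProd g AB.1 ⊗ₜ[ℂ] listProd g AB.2).sum := by
  induction L with
  | nil => simp [listProd, splits, Algebra.TensorProduct.one_def]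
  | cons a L ih =>
    rw [listProd_cons, map_mul, ih, comul_ι, add_mul, splits, List.map_append, List.sum_append,
      List.map_map, List.map_map, ← List.sum_map_mul_left, ← List.sum_map_mul_left]
    simp only [Function.comp_def, Algebra.TensorProduct.tmul_mul_tmul, one_mul, listProd_cons]

theorem comul_revProd {α : Type*} (g : α → 𝔫) (L : List α) : comul 𝔫 (revProd g L) =
    ((splits L).map fun AB => revProd g AB.1 ⊗ₜ[ℂ] revProd g AB.2).sum := by
  induction L with
  | nil => simp [revProd, listProd, splits, Algebra.TensorProduct.one_def]
  | cons a L ih =>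
    rw [revProd_cons, map_mul, ih, comul_ι, mul_add, splits, List.map_append, List.sum_append,
      List.map_map, List.map_map, ← List.sum_map_mul_right, ← List.sum_map_mul_right]
    simp only [Function.comp_def, Algebra.TensorProduct.tmul_mul_tmul, mul_one, revProd_cons]

/-- As the elements of `𝔫` are primitive, the coproduct of a product is the sum over all splittings.
-/
theorem conv_listProd {α : Type*} (ψ χ : UniversalEnvelopingAlgebra ℂ 𝔫 →ₗ[ℂ] ℂ) (g : α → 𝔫)
    (L : List α) : conv ψ χ (listProd g L) =
      ((splits L).map fun AB => ψ (listProd g AB.1) * χ (listProd g AB.2)).sum := by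
  rw [conv, LinearMap.comp_apply, LinearMap.comp_apply, AlgHom.toLinearMap_apply, comul_listProd,
    map_list_sum, map_list_sum, List.map_map, List.map_map]
  rfl

theorem conv_revProd {α : Type*} (ψ χ : UniversalEnvelopingAlgebra ℂ 𝔫 →ₗ[ℂ] ℂ) (g : α → 𝔫)
    (L : List α) : conv ψ χ (revProd g L) =
      ((splits L).map fun AB => ψ (revProd g AB.1) * χ (revProd g AB.2)).sum := by
  rw [conv, LinearMap.comp_apply, LinearMap.comp_apply, AlgHom.toLinearMap_apply, comul_revProd,
    map_list_sum, map_list_sum, List.map_map, List.map_map]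
  rfl

/-- The counit of an enveloping algebra. -/
def counit (𝔫 : Type*) [LieRing 𝔫] [LieAlgebra ℂ 𝔫] : UniversalEnvelopingAlgebra ℂ 𝔫 →ₐ[ℂ] ℂ :=
  UniversalEnvelopingAlgebra.lift ℂ 0

theorem counit_listProd {α : Type*} (g : α → 𝔫) (L : List α) :
    counit 𝔫 (listProd g L) = if L = [] then 1 else 0 := by
  cases L with
  | nil => simp [listProd]
  | cons a L =>
    rw [listProd_cons, map_mul, counit, UniversalEnvelopingAlgebra.lift_ι_apply]
    simp

theorem adjoin_range_ι : Algebra.adjoin ℂ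
    (Set.range (UniversalEnvelopingAlgebra.ι ℂ : 𝔫 → UniversalEnvelopingAlgebra ℂ 𝔫)) = ⊤ := by
  set S := Algebra.adjoin ℂ
    (Set.range (UniversalEnvelopingAlgebra.ι ℂ : 𝔫 → UniversalEnvelopingAlgebra ℂ 𝔫)) with hS
  set f : 𝔫 →ₗ⁅ℂ⁆ S :=
    { toFun := fun x => ⟨UniversalEnvelopingAlgebra.ι ℂ x, Algebra.subset_adjoin ⟨x, rfl⟩⟩
      map_add' := fun x y => Subtype.ext (map_add _ x y)
      map_smul' := fun c x => Subtype.ext (map_smul _ c x)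
      map_lie' := fun {x y} => Subtype.ext (LieHom.map_lie _ x y) } with hf
  have h : S.val.comp (UniversalEnvelopingAlgebra.lift ℂ f) =
      AlgHom.id ℂ (UniversalEnvelopingAlgebra ℂ 𝔫) := by
    apply UniversalEnvelopingAlgebra.hom_ext
    ext x
    change S.val (UniversalEnvelopingAlgebra.lift ℂ f (UniversalEnvelopingAlgebra.ι ℂ x)) = _
    rw [UniversalEnvelopingAlgebra.lift_ι_apply]
    rfl
  rw [eq_top_iff]
  intro u _
  have := AlgHom.congr_fun h u
  rw [AlgHom.id_apply] at this
  rw [← this]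
  exact (UniversalEnvelopingAlgebra.lift ℂ f u).2

/-! ### Ordered monomials -/

variable {m : ℕ} {F : Fin m → 𝔫}

theorem span_range_listProd (hF : Submodule.span ℂ (Set.range F) = ⊤) :
    Submodule.span ℂ (Set.range (listProd F)) = ⊤ := by
  set S := Submodule.span ℂ (Set.range (listProd F)) with hS
  have h1 : ∀ x : 𝔫, ∀ u ∈ S, UniversalEnvelopingAlgebra.ι ℂ x * u ∈ S := by
    intro x u hu
    induction hu using Submodule.span_induction with
    | zero => simp
    | add u v _ _ hu hv => rw [mul_add]; exact S.add_mem hu hv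
    | smul c u _ hu => rw [mul_smul_comm]; exact S.smul_mem c hu
    | mem u hu =>
      obtain ⟨L, rfl⟩ := hu
      have hx : x ∈ Submodule.span ℂ (Set.range F) := by rw [hF]; trivial
      induction hx using Submodule.span_induction with
      | zero => simp
      | add x y _ _ hx hy => rw [map_add, add_mul]; exact S.add_mem hx hy
      | smul c x _ hx => rw [map_smul, smul_mul_assoc]; exact S.smul_mem c hx
      | mem x hx =>
        obtain ⟨j, rfl⟩ := hx
        rw [← listProd_cons]
        exact Submodule.subset_span ⟨_, rfl⟩
  have h2 : ∀ v ∈ Algebra.adjoin ℂ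
      (Set.range (UniversalEnvelopingAlgebra.ι ℂ : 𝔫 → UniversalEnvelopingAlgebra ℂ 𝔫)),
      ∀ u ∈ S, v * u ∈ S := by
    intro v hv
    induction hv using Algebra.adjoin_induction with
    | mem v hv =>
      obtain ⟨x, rfl⟩ := hv
      exact h1 x
    | algebraMap c =>
      intro u hu
      rw [← Algebra.smul_def]
      exact S.smul_mem c hu
    | add v w _ _ hv hw =>
      intro u hu
      rw [add_mul]
      exact S.add_mem (hv u hu) (hw u hu)
    | mul v w _ _ hv hw =>
      intro u hu
      rw [mul_assoc]
      exact hv _ (hw u hu)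
  rw [eq_top_iff]
  intro u _
  rw [← mul_one u]
  refine h2 u (by rw [adjoin_range_ι]; trivial) 1 (Submodule.subset_span ⟨[], ?_⟩)
  simp [listProd]

/-- Permuting the factors of a product changes it by products with fewer factors. -/
theorem listProd_sub_mem (hF : Submodule.span ℂ (Set.range F) = ⊤) {L L' : List (Fin m)}
    (h : L.Perm L') : listProd F L - listProd F L' ∈
      Submodule.span ℂ (listProd F '' {K | K.length < L.length}) := by
  induction h with
  | nil => simp
  | @cons a L L' _ ih =>
    rw [listProd_cons, listProd_cons, ← mul_sub]
    have : ∀ u ∈ Submodule.span ℂ (listProd F '' {K | K.length < L.length}),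
        UniversalEnvelopingAlgebra.ι ℂ (F a) * u ∈
          Submodule.span ℂ (listProd F '' {K | K.length < (a :: L).length}) := by
      intro u hu
      induction hu using Submodule.span_induction with
      | zero => simp
      | add u v _ _ hu hv => rw [mul_add]; exact Submodule.add_mem _ hu hv
      | smul c u _ hu => rw [mul_smul_comm]; exact Submodule.smul_mem _ c hu
      | mem u hu =>
        obtain ⟨K, hK, rfl⟩ := hu
        rw [← listProd_cons]
        exact Submodule.subset_span ⟨_, by simpa using hK, rfl⟩
    exact this _ ih
  | swap a b L =>
    have h1 : listProd F (b :: a :: L) - listProd F (a :: b :: L) =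
        UniversalEnvelopingAlgebra.ι ℂ ⁅F b, F a⁆ * listProd F L := by
      rw [LieHom.map_lie, LieRing.of_associative_ring_bracket]
      simp only [listProd_cons, sub_mul, mul_assoc]
    rw [h1]
    generalize ⁅F b, F a⁆ = x
    have hx : x ∈ Submodule.span ℂ (Set.range F) := by rw [hF]; trivial
    induction hx using Submodule.span_induction with
    | zero => simp
    | add x y _ _ hx hy => rw [map_add, add_mul]; exact Submodule.add_mem _ hx hy
    | smul c x _ hx => rw [map_smul, smul_mul_assoc]; exact Submodule.smul_mem _ c hx
    | mem x hx =>
      obtain ⟨j, rfl⟩ := hx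
      rw [← listProd_cons]
      exact Submodule.subset_span ⟨_, by simp, rfl⟩
  | trans h₁ _ ih₁ ih₂ =>
    rw [← h₁.length_eq] at ih₂
    simpa using Submodule.add_mem _ ih₁ ih₂

/-- The easy half of the Poincaré–Birkhoff–Witt theorem: sorting a product changes it by shorter
ones. -/
theorem span_sorted_listProd (hF : Submodule.span ℂ (Set.range F) = ⊤) :
    Submodule.span ℂ (listProd F '' {L | L.Pairwise (· ≤ ·)}) = ⊤ := by
  have h : ∀ (N : ℕ) (L : List (Fin m)), L.length < N →
      listProd F L ∈ Submodule.span ℂ (listProd F '' {L | L.Pairwise (· ≤ ·)}) := by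
    intro N
    induction N with
    | zero => intro L hL; omega
    | succ N ih =>
      intro L hL
      have h1 := listProd_sub_mem hF (List.perm_insertionSort (· ≤ ·) L).symm
      have h2 : Submodule.span ℂ (listProd F '' {K | K.length < L.length}) ≤
          Submodule.span ℂ (listProd F '' {L | L.Pairwise (· ≤ ·)}) := by
        rw [Submodule.span_le]
        rintro _ ⟨K, hK, rfl⟩
        refine ih K ?_
        have : K.length < L.length := hK
        omega
      have h3 := Submodule.add_mem _ (h2 h1) (Submodule.subset_span
        ⟨L.insertionSort (· ≤ ·), List.pairwise_insertionSort (· ≤ ·) L, rfl⟩)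
      simpa using h3
  rw [eq_top_iff, ← span_range_listProd hF, Submodule.span_le]
  rintro _ ⟨L, rfl⟩
  exact h _ L (Nat.lt_succ_self _)

/-- The nondecreasing list with given multiplicities. -/
def expList (p : Fin m → ℕ) : List (Fin m) :=
  (List.finRange m).flatMap fun j => List.replicate (p j) j

theorem count_expList (p : Fin m → ℕ) (j : Fin m) : (expList p).count j = p j := by
  rw [expList, List.count_flatMap]
  have : ((List.count j) ∘ fun i => List.replicate (p i) i) =
      fun i => if i = j then p j else 0 := by
    funext i
    rw [Function.comp_apply, List.count_replicate]
    by_cases h : i = j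
    · subst h; simp
    · simp [h]
  rw [this, ← List.ofFn_eq_map, List.sum_ofFn]
  simp

theorem pairwise_expList (p : Fin m → ℕ) : (expList p).Pairwise (· ≤ ·) := by
  rw [expList, List.pairwise_flatMap]
  refine ⟨fun j _ => by simp [List.pairwise_replicate], ?_⟩
  refine (List.pairwise_lt_finRange m).imp ?_
  intro i j hij x hx y hy
  rw [List.eq_of_mem_replicate hx, List.eq_of_mem_replicate hy]
  exact hij.le

theorem eq_expList {L : List (Fin m)} (h : L.Pairwise (· ≤ ·)) : L =
    expList fun j => L.count j := by
  refine List.Perm.eq_of_pairwise' h (pairwise_expList _) (List.perm_iff_count.2 fun j => ?_)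
  rw [count_expList]

/-- A functional on the enveloping algebra is dual to a multiset of indices if it vanishes on all
ordered monomials except for the one given by the multiset. -/
def IsDualTo (F : Fin m → 𝔫) (χ : UniversalEnvelopingAlgebra ℂ 𝔫 →ₗ[ℂ] ℂ) (M : List (Fin m)) :
    Prop :=
  ∀ L : List (Fin m), L.Pairwise (· ≤ ·) → χ (listProd F L) =
    if L.Perm M then ∏ j, ((M.count j).factorial : ℂ) else 0

/-- Of the splittings of `L`, those with first part `[j]` remove one occurrence of `j`. -/
theorem sum_splits_singleton {α : Type*} [DecidableEq α] (j : α) (f : List α → ℂ)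
    (hf : ∀ L L' : List α, L.Perm L' → f L = f L') (L : List α) :
    ((splits L).map fun AB => (if AB.1 = [j] then 1 else 0) * f AB.2).sum =
      L.count j * f (L.erase j) := by
  have h0 : ∀ (f : List α → ℂ) (L : List α),
      ((splits L).map fun AB => (if AB.1 = [] then 1 else 0) * f AB.2).sum = f L := by
    intro f L
    induction L generalizing f with
    | nil => simp [splits]
    | cons a L ih =>
      rw [splits, List.map_append, List.sum_append, List.map_map, List.map_map]
      have := ih fun B => f (a :: B)
      simpa [Function.comp_def] using this
  induction L generalizing f with
  | nil => simp [splits]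
  | cons a L ih =>
    rw [splits, List.map_append, List.sum_append, List.map_map, List.map_map]
    simp only [Function.comp_def, List.cons.injEq]
    rw [ih (fun B => f (a :: B)) fun K K' h => hf _ _ (h.cons a)]
    by_cases h : a = j
    · subst h
      simp only [true_and, h0, List.count_cons_self, List.erase_cons_head]
      by_cases ha : a ∈ L
      · rw [hf _ _ (List.perm_cons_erase ha).symm]
        push_cast
        ring
      · rw [List.count_eq_zero_of_not_mem ha]
        simp
    · simp only [h, false_and, if_false, zero_mul, List.map_const', List.sum_replicate, smul_zero,
        zero_add]
      rw [List.count_cons_of_ne h, List.erase_cons_tail (by simpa using h)]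

/-- Convolution with a functional that is dual to a single index adds this index to the multiset. -/
theorem IsDualTo.conv {ψ χ : UniversalEnvelopingAlgebra ℂ 𝔫 →ₗ[ℂ] ℂ} {j : Fin m}
    {M : List (Fin m)} (hψ : ∀ L : List (Fin m), L.Pairwise (· ≤ ·) →
      ψ (listProd F L) = if L = [j] then 1 else 0) (hχ : IsDualTo F χ M) :
    IsDualTo F (conv ψ χ) (j :: M) := by
  intro L hL
  rw [conv_listProd]
  set f : List (Fin m) → ℂ := fun B => if B.Perm M then ∏ j, ((M.count j).factorial : ℂ) else 0
    with hf
  have h1 : ((splits L).map fun AB => ψ (listProd F AB.1) * χ (listProd F AB.2)) =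
      (splits L).map fun AB => (if AB.1 = [j] then 1 else 0) * f AB.2 := by
    refine List.map_congr_left fun AB hAB => ?_
    obtain ⟨hA, hB⟩ := sublist_of_mem_splits hAB
    rw [hψ _ (hL.sublist hA), hχ _ (hL.sublist hB)]
  rw [h1, sum_splits_singleton j f]
  · simp only [hf]
    by_cases hj : j ∈ L
    · have h2 : (L.erase j).Perm M ↔ L.Perm (j :: M) := by
        rw [← List.perm_cons j]
        exact ⟨fun h => (List.perm_cons_erase hj).trans h,
          fun h => (List.perm_cons_erase hj).symm.trans h⟩
      simp only [h2]
      split_ifs with h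
      · rw [h.count_eq, ← Finset.mul_prod_erase _ _ (Finset.mem_univ j),
          ← Finset.mul_prod_erase _ _ (Finset.mem_univ j), List.count_cons_self, Nat.factorial_succ]
        have : ∀ i ∈ Finset.univ.erase j, (((j :: M).count i).factorial : ℂ) =
            ((M.count i).factorial : ℂ) := by
          intro i hi
          rw [List.count_cons_of_ne (Finset.ne_of_mem_erase hi).symm]
        rw [Finset.prod_congr rfl this]
        push_cast
        ring
      · simp
    · have h2 : ¬ L.Perm (j :: M) := fun h => hj (h.mem_iff.2 (by simp))
      rw [List.count_eq_zero_of_not_mem hj, if_neg h2]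
      simp
  · intro K K' h
    have : K.Perm M ↔ K'.Perm M := ⟨fun h' => h.symm.trans h', fun h' => h.trans h'⟩
    simp only [hf, this]

theorem isDualTo_counit : IsDualTo F (counit 𝔫).toLinearMap [] := by
  intro L _
  rw [AlgHom.toLinearMap_apply, counit_listProd]
  simp

/-- A convolution product of functionals. -/
def convList (ψ : Fin m → UniversalEnvelopingAlgebra ℂ 𝔫 →ₗ[ℂ] ℂ) (M : List (Fin m)) :
    UniversalEnvelopingAlgebra ℂ 𝔫 →ₗ[ℂ] ℂ :=
  M.foldr (fun j χ => conv (ψ j) χ) (counit 𝔫).toLinearMap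

theorem isDualTo_convList {ψ : Fin m → UniversalEnvelopingAlgebra ℂ 𝔫 →ₗ[ℂ] ℂ}
    (hψ : ∀ j, ∀ L : List (Fin m), L.Pairwise (· ≤ ·) →
      ψ j (listProd F L) = if L = [j] then 1 else 0) (M : List (Fin m)) :
    IsDualTo F (convList ψ M) M := by
  induction M with
  | nil => exact isDualTo_counit
  | cons j M ih => exact ih.conv (hψ j)

/-- A convolution product of the functionals is dual to an ordered monomial, up to factorials. -/
theorem convList_expList {ψ : Fin m → UniversalEnvelopingAlgebra ℂ 𝔫 →ₗ[ℂ] ℂ}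
    (hψ : ∀ j, ∀ L : List (Fin m), L.Pairwise (· ≤ ·) →
      ψ j (listProd F L) = if L = [j] then 1 else 0) (p p' : Fin m → ℕ) :
    convList ψ (expList p) (listProd F (expList p')) =
      if p' = p then ∏ j, ((p j).factorial : ℂ) else 0 := by
  rw [isDualTo_convList hψ _ _ (pairwise_expList p')]
  have : (expList p').Perm (expList p) ↔ p' = p := by
    rw [List.perm_iff_count]
    simp only [count_expList]
    exact ⟨fun h => funext h, fun h j => congrFun h j⟩
  simp only [this, count_expList]

/-- Functionals that are dual to the factors have convolution products that are dual to the ordered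
monomials, up to factorials. So the ordered monomials are linearly independent. -/
theorem linearIndependent_listProd {ψ : Fin m → UniversalEnvelopingAlgebra ℂ 𝔫 →ₗ[ℂ] ℂ}
    (hψ : ∀ j, ∀ L : List (Fin m), L.Pairwise (· ≤ ·) →
      ψ j (listProd F L) = if L = [j] then 1 else 0) :
    LinearIndependent ℂ fun p : Fin m → ℕ => listProd F (expList p) := by
  rw [linearIndependent_iff']
  intro s c hc p hp
  have h := congrArg (convList ψ (expList p)) hc
  rw [map_sum, map_zero] at h
  simp only [map_smul, convList_expList hψ, smul_eq_mul, mul_ite, mul_zero] at h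
  rw [Finset.sum_ite_eq' s p, if_pos hp] at h
  refine (mul_eq_zero.1 h).resolve_right (Finset.prod_ne_zero_iff.2 fun j _ => ?_)
  exact_mod_cast Nat.factorial_ne_zero _

theorem span_range_listProd_expList (hF : Submodule.span ℂ (Set.range F) = ⊤) :
    Submodule.span ℂ (Set.range fun p : Fin m → ℕ => listProd F (expList p)) = ⊤ := by
  rw [eq_top_iff, ← span_sorted_listProd hF]
  refine Submodule.span_mono ?_
  rintro _ ⟨L, hL, rfl⟩
  exact ⟨fun j => L.count j, congrArg (listProd F) (eq_expList hL).symm⟩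

/-- The expansion of an element in ordered monomials, when the coefficients are known to vanish
outside a finite set. -/
theorem eq_sum_listProd (hF : Submodule.span ℂ (Set.range F) = ⊤)
    {ψ : Fin m → UniversalEnvelopingAlgebra ℂ 𝔫 →ₗ[ℂ] ℂ}
    (hψ : ∀ j, ∀ L : List (Fin m), L.Pairwise (· ≤ ·) →
      ψ j (listProd F L) = if L = [j] then 1 else 0)
    (u : UniversalEnvelopingAlgebra ℂ 𝔫) (s : Finset (Fin m → ℕ))
    (hs : ∀ p, p ∉ s → convList ψ (expList p) u = 0) :
    u = ∑ p ∈ s, ((∏ j, ((p j).factorial : ℂ))⁻¹ * convList ψ (expList p) u) •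
      listProd F (expList p) := by
  have hu : u ∈ Submodule.span ℂ (Set.range fun p : Fin m → ℕ => listProd F (expList p)) := by
    rw [span_range_listProd_expList hF]; trivial
  obtain ⟨c, rfl⟩ := (Finsupp.mem_span_range_iff_exists_finsupp).1 hu
  have hfac : ∀ p : Fin m → ℕ, ∏ j, ((p j).factorial : ℂ) ≠ 0 := fun p =>
    Finset.prod_ne_zero_iff.2 fun j _ => by exact_mod_cast Nat.factorial_ne_zero _
  have h1 : ∀ p, convList ψ (expList p) (c.sum fun p a => a • listProd F (expList p)) =
      c p * ∏ j, ((p j).factorial : ℂ) := by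
    intro p
    rw [Finsupp.sum, map_sum]
    simp only [map_smul, convList_expList hψ, smul_eq_mul, mul_ite, mul_zero]
    rw [Finset.sum_ite_eq']
    split_ifs with h
    · rfl
    · rw [Finsupp.notMem_support_iff.1 h, zero_mul]
  have h2 : ∀ p, (∏ j, ((p j).factorial : ℂ))⁻¹ *
      convList ψ (expList p) (c.sum fun p a => a • listProd F (expList p)) = c p := by
    intro p
    rw [h1, mul_comm, mul_assoc, mul_inv_cancel₀ (hfac p), mul_one]
  simp only [h2]
  rw [Finsupp.sum_of_support_subset c _ _ (by simp)]
  intro p hp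
  by_contra hps
  have := hs p hps
  rw [h1, mul_eq_zero] at this
  exact (Finsupp.mem_support_iff.1 hp) (this.resolve_right (hfac p))

end Enveloping

/-! ### The product formula from dual functionals -/

section Product

variable {n : ℕ}

theorem eq_of_tcoeff {u v : ⨁ k : Fin n → ℕ, skew k} (h : ∀ L, tcoeff L u = tcoeff L v) :
    u = v := by
  apply DFinsupp.ext
  intro k
  apply eq_of_coeff
  intro L
  by_cases hL : ∀ i, L.count i = k i
  · rw [← tcoeff_eq hL, ← tcoeff_eq hL, h]
  · rw [coeff_eq_zero, LinearMap.zero_apply, LinearMap.zero_apply]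
    rwa [exists_colors_iff]

theorem starTotal_starOne (u : ⨁ k : Fin n → ℕ, skew k) : starTotal n u (starOne n) = u := by
  apply eq_of_tcoeff
  intro L
  rw [tcoeff_starTotal]
  simp only [tcoeff_starOne]
  generalize tcoeff (n := n) = f
  have : ∀ (L : List (Fin n)) (g : List (Fin n) → ℂ),
      ((splits L).map fun AB => g AB.1 * if AB.2 = [] then 1 else 0).sum = g L := by
    intro L
    induction L with
    | nil => simp [splits]
    | cons a L ih =>
      intro g
      rw [splits, List.map_append, List.sum_append, List.map_map, List.map_map]
      have := ih fun A => g (a :: A)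
      simpa [Function.comp_def] using this
  exact this L fun L => f L u

variable {𝔤 : Type*} [LieRing 𝔤] [LieAlgebra ℂ 𝔤] {𝔥 : LieSubalgebra ℂ 𝔤}

theorem quotMap_monomial (b : LieAlgebra.Basis (Fin n) 𝔥) {k : Fin n → ℕ} (J : Multiindex k) :
    quotMap b J.monomial = revProd (gen b) (List.ofFn J.1) := by
  rw [Multiindex.monomial, revProd, listProd, map_list_prod, List.map_reverse, List.map_reverse,
    List.map_ofFn, List.map_ofFn]
  congr 3
  funext a
  exact FreeAlgebra.lift_ι_apply _ _

/-- The image of the canonical element in `A(k) ⊗ U(𝔫)`, in terms of dual bases. -/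
theorem project_canonical (b : LieAlgebra.Basis (Fin n) 𝔥) {k : Fin n → ℕ}
    {Ω : skew k ⊗[ℂ] freePart k} (h : IsCanonical k Ω) :
    project b k Ω = ∑ J : Multiindex k, J.dual ⊗ₜ revProd (gen b) (List.ofFn J.1) := by
  rw [eq_sum_of_isCanonical h, map_sum]
  refine Finset.sum_congr rfl fun J _ => ?_
  rw [← quotMap_monomial]
  rfl

/-- An iterated star-product. -/
def starList {m : ℕ} {d : Fin m → Fin n → ℕ} (η : ∀ j, skew (d j)) (M : List (Fin m)) :
    ⨁ k : Fin n → ℕ, skew k :=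
  M.foldr (fun j u => starTotal n (DirectSum.lof ℂ (Fin n → ℕ) (fun k => skew k) _ (η j)) u)
    (starOne n)

theorem starList_cons {m : ℕ} {d : Fin m → Fin n → ℕ} (η : ∀ j, skew (d j)) (j : Fin m)
    (M : List (Fin m)) : starList η (j :: M) =
      starTotal n (DirectSum.lof ℂ (Fin n → ℕ) (fun k => skew k) _ (η j)) (starList η M) := rfl

theorem exists_starList_eq_lof {m : ℕ} {d : Fin m → Fin n → ℕ} (η : ∀ j, skew (d j))
    (M : List (Fin m)) : ∃ u, starList η M =
      DirectSum.lof ℂ (Fin n → ℕ) (fun k => skew k) (M.map d).sum u := by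
  induction M with
  | nil => exact ⟨_, rfl⟩
  | cons j M ih =>
    obtain ⟨u, hu⟩ := ih
    rw [starList_cons, hu, starTotal_lof]
    exact ⟨_, rfl⟩

/-- A star-product of elements that represent functionals on the enveloping algebra represents
their convolution product. -/
theorem tcoeff_starList (b : LieAlgebra.Basis (Fin n) 𝔥) {m : ℕ} {d : Fin m → Fin n → ℕ}
    {η : ∀ j, skew (d j)} {ψ : Fin m → U b →ₗ[ℂ] ℂ}
    (h : ∀ j L, coeff (d j) L (η j) = ψ j (revProd (gen b) L)) (M : List (Fin m))
    (L : List (Fin n)) : tcoeff L (starList η M) = convList ψ M (revProd (gen b) L) := by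
  induction M generalizing L with
  | nil =>
    have h1 : convList ψ [] (revProd (gen b) L) = counit (lowerNil b) (revProd (gen b) L) := rfl
    have h2 : starList η [] = starOne n := rfl
    rw [h1, h2, tcoeff_starOne, revProd, counit_listProd]
    simp
  | cons j M ih =>
    have h1 : convList ψ (j :: M) = conv (ψ j) (convList ψ M) := rfl
    rw [starList_cons, tcoeff_starTotal, h1, conv_revProd]
    simp only [tcoeff_lof, h, ih]

theorem foldr_flatMap_replicate {α β : Type*} (g : α → β → β) (p : α → ℕ) (l : List α) (u : β) :
    (l.flatMap fun j => List.replicate (p j) j).foldr g u =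
      l.foldr (fun j u => (g j)^[p j] u) u := by
  have h : ∀ (j : α) (N : ℕ) (u : β), (List.replicate N j).foldr g u = (g j)^[N] u := by
    intro j N u
    induction N with
    | zero => rfl
    | succ N ih => rw [List.replicate_succ, List.foldr_cons, ih, Function.iterate_succ_apply']
  induction l with
  | nil => rfl
  | cons a l ih => rw [List.flatMap_cons, List.foldr_append, h, ih, List.foldr_cons]

variable {X : ClassicalType} {r : ℕ}

theorem starMonomial_eq (η : EtaFamily X r) (p : Fin (X.posRoots r).length → ℕ) :
    starMonomial η p = (∏ j, ((p j).factorial : ℂ))⁻¹ • starList η (expList p) := by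
  rw [starMonomial, starList, expList, foldr_flatMap_replicate]

theorem pbwMonomial_eq (b : LieAlgebra.Basis (Fin (X.rank r)) 𝔥)
    (p : Fin (X.posRoots r).length → ℕ) :
    pbwMonomial X r b p = listProd (fun j => rootVector X r b (X.root r j)) (expList p) := by
  have : ∀ l : List (Fin (X.posRoots r).length),
      listProd (fun j => rootVector X r b (X.root r j))
        (l.flatMap fun j => List.replicate (p j) j) =
      (l.map fun j =>
        UniversalEnvelopingAlgebra.ι ℂ (rootVector X r b (X.root r j)) ^ p j).prod := by
    intro l
    induction l with
    | nil => simp [listProd]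
    | cons a l ih =>
      rw [List.flatMap_cons, listProd_append, ih, List.map_cons, List.prod_cons]
      congr 1
      simp [listProd]
  rw [pbwMonomial, expList, this, List.ofFn_eq_map]

/-- The exponents are automatically bounded, because the degrees of the root vectors are not zero.
-/
theorem mem_exponents {k : Fin (X.rank r) → ℕ} {p : Fin (X.posRoots r).length → ℕ}
    (hdeg : ∀ j, X.deg r (X.root r j) ≠ 0) :
    p ∈ exponents X r k ↔ ((expList p).map fun j => X.deg r (X.root r j)).sum = k := by
  have h1 : ((expList p).map fun j => X.deg r (X.root r j)).sum =
      ∑ j, p j • X.deg r (X.root r j) := by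
    rw [Finset.sum_list_map_count]
    simp only [count_expList]
    refine Finset.sum_subset (Finset.subset_univ _) fun j _ hj => ?_
    rw [List.mem_toFinset, ← List.count_eq_zero, count_expList] at hj
    rw [hj, zero_smul]
  rw [h1, exponents, Finset.mem_filter, and_iff_right_iff_imp]
  rintro rfl
  rw [Fintype.mem_piFinset]
  intro j
  rw [Finset.mem_range, Nat.lt_succ_iff]
  obtain ⟨i, hi⟩ := Function.ne_iff.1 (hdeg j)
  have h2 : p j ≤ (∑ j, p j • X.deg r (X.root r j)) i := by
    rw [Finset.sum_apply]
    refine le_trans ?_ (Finset.single_le_sum (f := fun j => (p j • X.deg r (X.root r j)) i)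
      (fun _ _ => Nat.zero_le _) (Finset.mem_univ j))
    exact Nat.le_mul_of_pos_right _ (Nat.pos_of_ne_zero hi)
  exact h2.trans (Finset.single_le_sum (f := ∑ j, p j • X.deg r (X.root r j))
    (fun _ _ => Nat.zero_le _) (Finset.mem_univ i))

theorem starMonomial_apply_single (η : EtaFamily X r) (j : Fin (X.posRoots r).length) :
    starMonomial η (Pi.single j 1) (X.deg r (X.root r j)) = η j := by
  have h1 : expList (Pi.single j 1 : Fin (X.posRoots r).length → ℕ) = [j] := by
    refine List.Perm.eq_of_pairwise' (pairwise_expList _) (by simp)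
      (List.perm_iff_count.2 fun i => ?_)
    rw [count_expList, List.count_singleton]
    by_cases h : i = j
    · subst h; simp
    · simp [h, Ne.symm h]
  have h2 : (∏ i, (((Pi.single j 1 : Fin (X.posRoots r).length → ℕ) i).factorial : ℂ)) = 1 := by
    refine Finset.prod_eq_one fun i _ => ?_
    by_cases h : i = j
    · subst h; simp
    · simp [h]
  rw [starMonomial_eq, h1, h2, inv_one, one_smul]
  have h3 : starList η [j] = starTotal (X.rank r) (DirectSum.lof ℂ (Fin (X.rank r) → ℕ)
    (fun k => skew k) _ (η j)) (starOne _) := rfl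
  rw [h3, starTotal_starOne, DirectSum.lof_eq_of, DirectSum.of_eq_same]

/-- If the listed elements represent functionals on `U(𝔫)` each of which singles out one of the root
vectors among all ordered monomials, then the ordered monomials form a basis and the listed elements
are the only ones that satisfy the product formula. -/
theorem productFormula_of_functionals (b : LieAlgebra.Basis (Fin (X.rank r)) 𝔥)
    (hspan : Submodule.span ℂ (Set.range fun j => rootVector X r b (X.root r j)) = ⊤)
    (ψ : Fin (X.posRoots r).length → U b →ₗ[ℂ] ℂ)
    (hψ : ∀ j, ∀ L : List (Fin (X.posRoots r).length), L.Pairwise (· ≤ ·) →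
      ψ j (listProd (fun j => rootVector X r b (X.root r j)) L) = if L = [j] then 1 else 0)
    (hcoeff : ∀ j L, coeff _ L (listedEta X r j) = ψ j (revProd (gen b) L))
    (hdeg : ∀ j, X.deg r (X.root r j) ≠ 0) :
    (LinearIndependent ℂ (pbwMonomial X r b) ∧
      Submodule.span ℂ (Set.range (pbwMonomial X r b)) = ⊤) ∧
    (∀ η : EtaFamily X r, ProductFormula X r b η ↔ η = listedEta X r) := by
  have hpbw : pbwMonomial X r b =
      fun p => listProd (fun j => rootVector X r b (X.root r j)) (expList p) :=
    funext (pbwMonomial_eq b)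
  have hfac : ∀ p : Fin (X.posRoots r).length → ℕ, ∏ j, ((p j).factorial : ℂ) ≠ 0 := fun p =>
    Finset.prod_ne_zero_iff.2 fun j _ => by exact_mod_cast Nat.factorial_ne_zero _
  have hlisted : ProductFormula X r b (listedEta X r) := by
    intro k Ω hΩ
    have h1 : ∀ J : Multiindex k, revProd (gen b) (List.ofFn J.1) = ∑ p ∈ exponents X r k,
        coeff k (List.ofFn J.1) (starMonomial (listedEta X r) p k) • pbwMonomial X r b p := by
      intro J
      have hJ : ∀ i, (List.ofFn J.1).count i = k i := fun i => by rw [count_ofFn, J.2]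
      rw [hpbw]
      refine (eq_sum_listProd hspan hψ _ (exponents X r k) ?_).trans ?_
      · intro p hp
        rw [← tcoeff_starList b hcoeff]
        obtain ⟨u, hu⟩ := exists_starList_eq_lof (listedEta X r) (expList p)
        rw [hu, tcoeff_lof]
        by_contra hne
        apply hp
        rw [mem_exponents hdeg]
        funext i
        rw [← hJ, count_eq_of_coeff_ne_zero hne]
      · refine Finset.sum_congr rfl fun p _ => ?_
        rw [← tcoeff_eq hJ, starMonomial_eq, map_smul, tcoeff_starList b hcoeff, smul_eq_mul]
    rw [project_canonical b hΩ]
    calc ∑ J : Multiindex k, J.dual ⊗ₜ[ℂ] revProd (gen b) (List.ofFn J.1)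
        = ∑ J : Multiindex k, ∑ p ∈ exponents X r k,
          (coeff k (List.ofFn J.1) (starMonomial (listedEta X r) p k) • J.dual) ⊗ₜ[ℂ]
            pbwMonomial X r b p := by
          refine Finset.sum_congr rfl fun J _ => ?_
          rw [h1 J, TensorProduct.tmul_sum]
          refine Finset.sum_congr rfl fun p _ => ?_
          rw [TensorProduct.tmul_smul, TensorProduct.smul_tmul']
      _ = _ := by
          rw [Finset.sum_comm]
          refine Finset.sum_congr rfl fun p _ => ?_
          rw [← TensorProduct.sum_tmul, sum_coeff_smul_dual]
  refine ⟨⟨?_, ?_⟩, fun η => ⟨fun h => ?_, fun h => h ▸ hlisted⟩⟩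
  · rw [hpbw]
    exact linearIndependent_listProd hψ
  · rw [hpbw]
    exact span_range_listProd_expList hspan
  -- Applying the functional dual to `F_{β_j}` to the product formula of degree `k^{(j)}` recovers
  -- `η_j`, so that all families satisfying the formula agree with the listed one.
  · funext j
    set k := X.deg r (X.root r j)
    obtain ⟨Ω, hΩ, -⟩ := existsUnique_isCanonical k
    have h1 := (h k Ω hΩ).symm.trans (hlisted k Ω hΩ)
    set p : Fin (X.posRoots r).length → ℕ := Pi.single j 1
    have hp : p ∈ exponents X r k := by
      rw [exponents, Finset.mem_filter, Fintype.mem_piFinset]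
      have hk : ∑ i, p i • X.deg r (X.root r i) = k := by
        rw [Finset.sum_eq_single j]
        · simp [p, k]
        · intro i _ hi
          simp [p, hi]
        · simp
      refine ⟨fun i => ?_, hk⟩
      have h0 : ∑ i, k i ≠ 0 := by
        intro h0
        rw [Finset.sum_eq_zero_iff] at h0
        exact hdeg j (funext fun i => h0 i (Finset.mem_univ i))
      rw [Finset.mem_range]
      have : p i ≤ 1 := by
        by_cases hi : i = j
        · subst hi; simp [p]
        · simp [p, hi]
      omega
    have h2 : ∀ ζ : EtaFamily X r, TensorProduct.rid ℂ (skew k)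
        (LinearMap.lTensor (skew k) (convList ψ (expList p))
          (∑ p ∈ exponents X r k, starMonomial ζ p k ⊗ₜ[ℂ] pbwMonomial X r b p)) =
        (∏ j, ((p j).factorial : ℂ)) • starMonomial ζ p k := by
      intro ζ
      rw [map_sum, map_sum]
      simp only [LinearMap.lTensor_tmul, TensorProduct.rid_tmul, pbwMonomial_eq,
        convList_expList hψ, ite_smul, zero_smul]
      rw [Finset.sum_ite_eq', if_pos hp]
    have h3 := h2 η
    rw [h1, h2] at h3
    have h4 := smul_right_injective _ (hfac p) h3
    change starMonomial _ p k = starMonomial _ p k at h4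
    rw [starMonomial_apply_single, starMonomial_apply_single] at h4
    exact h4.symm

end Product

/-! ### Representations of the nilpotent subalgebra by matrices -/

attribute [local instance] LieRing.ofAssociativeRing

/-- If `x` acts on generators by the scalar `μ`, then on the subalgebra that they generate it acts
by multiples `(d + 1) μ`. -/
theorem lieSpan_le_iSup_eigenspace {L ι : Type*} [LieRing L] [LieAlgebra ℂ L] (x : L) (g : ι → L)
    (μ : ℂ) (hg : ∀ i, ⁅x, g i⁆ = μ • g i) (z : L)
      (hz : z ∈ LieSubalgebra.lieSpan ℂ L (Set.range g)) :
    z ∈ ⨆ d : ℕ, Module.End.eigenspace (LieAlgebra.ad ℂ L x : Module.End ℂ L) ((d + 1) * μ) := by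
  have hlie : ∀ u ∈ ⨆ d : ℕ, Module.End.eigenspace (LieAlgebra.ad ℂ L x : Module.End ℂ L)
        ((d + 1) * μ),
      ∀ v ∈ ⨆ d : ℕ, Module.End.eigenspace (LieAlgebra.ad ℂ L x : Module.End ℂ L) ((d + 1) * μ),
      ⁅u, v⁆ ∈ ⨆ d : ℕ, Module.End.eigenspace (LieAlgebra.ad ℂ L x : Module.End ℂ L)
        ((d + 1) * μ) := by
    intro u hu v hv
    induction hu using Submodule.iSup_induction' with
    | zero => rw [zero_lie]; exact Submodule.zero_mem _
    | add u u' _ _ hu hu' => rw [add_lie]; exact Submodule.add_mem _ hu hu'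
    | mem c u hu =>
      induction hv using Submodule.iSup_induction' with
      | zero => rw [lie_zero]; exact Submodule.zero_mem _
      | add v v' _ _ hv hv' => rw [lie_add]; exact Submodule.add_mem _ hv hv'
      | mem d v hv =>
        refine Submodule.mem_iSup_of_mem (c + d + 1) ?_
        rw [Module.End.mem_eigenspace_iff, LieAlgebra.ad_apply] at *
        rw [leibniz_lie, hu, hv, smul_lie, lie_smul, ← add_smul]
        congr 1
        push_cast
        ring
  induction hz using LieSubalgebra.lieSpan_induction with
  | mem u hu =>
    obtain ⟨i, rfl⟩ := hu
    refine Submodule.mem_iSup_of_mem 0 ?_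
    rw [Module.End.mem_eigenspace_iff, LieAlgebra.ad_apply, hg]
    simp
  | zero => exact Submodule.zero_mem _
  | add u v _ _ hu hv => exact Submodule.add_mem _ hu hv
  | smul c u _ hu => exact Submodule.smul_mem _ c hu
  | lie u v _ _ hu hv => exact hlie u hu v hv

/-- In a Lie algebra with Chevalley generators, let the element `x` act on all generators `e_i`,
`f_i` by nonzero scalars `μ` and `-μ`. Then its centralizer is the Cartan subalgebra. -/
theorem mem_cartan_of_lie_eq_zero {L : Type*} [LieRing L] [LieAlgebra ℂ L] {H : LieSubalgebra ℂ L}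
    {n : ℕ} (b : LieAlgebra.Basis (Fin n) H) {x : L} {μ : ℂ} (hμ : μ ≠ 0)
    (hx : ∀ y ∈ H, ⁅x, y⁆ = 0)
    (he : ∀ i, ⁅x, b.e i⁆ = μ • b.e i) (hf : ∀ i, ⁅x, b.f i⁆ = (-μ) • b.f i) {z : L}
    (hz : ⁅x, z⁆ = 0) : z ∈ H := by
  have h1 : z ∈ iSup ![H.toLieSubmodule, b.borelLower, b.borelUpper] := by
    rw [b.iSup_cartan_borelLower_borelUpper_eq_top]; trivial
  have h2 : iSup ![H.toLieSubmodule, b.borelLower, b.borelUpper] =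
    H.toLieSubmodule ⊔ b.borelLower ⊔ b.borelUpper := by simp
  rw [h2, LieSubmodule.mem_sup] at h1
  obtain ⟨cl, hcl, u, hu, rfl⟩ := h1
  rw [LieSubmodule.mem_sup] at hcl
  obtain ⟨c, hc, l, hl, rfl⟩ := hcl
  have hc' : c ∈ H := hc
  have hl' := lieSpan_le_iSup_eigenspace x b.f (-μ) hf l hl
  have hu' := lieSpan_le_iSup_eigenspace x b.e μ he u hu
  set E := Module.End.eigenspace (LieAlgebra.ad ℂ L x : Module.End ℂ L)
  have h3 : l + u ∈ ⨆ ν : ℂ, ⨆ _ : ν ≠ 0, E ν := by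
    refine Submodule.add_mem _ ?_ ?_
    · refine (iSup_le fun d => ?_ : (⨆ d : ℕ, E ((d + 1) * -μ)) ≤ _) hl'
      refine le_iSup_of_le ((d + 1) * -μ) (le_iSup_of_le ?_ le_rfl)
      exact mul_ne_zero (by exact_mod_cast Nat.succ_ne_zero d) (neg_ne_zero.2 hμ)
    · refine (iSup_le fun d => ?_ : (⨆ d : ℕ, E ((d + 1) * μ)) ≤ _) hu'
      refine le_iSup_of_le ((d + 1) * μ) (le_iSup_of_le ?_ le_rfl)
      exact mul_ne_zero (by exact_mod_cast Nat.succ_ne_zero d) hμ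
  have h4 : l + u ∈ E 0 := by
    rw [Module.End.mem_eigenspace_iff, LieAlgebra.ad_apply, zero_smul]
    rw [add_assoc, lie_add, hx c hc', zero_add] at hz
    exact hz
  have h5 := Submodule.disjoint_def.1
    ((Module.End.eigenspaces_iSupIndep (LieAlgebra.ad ℂ L x : Module.End ℂ L)) 0) _ h4 h3
  rw [add_assoc, h5, add_zero]
  exact hc'

/-- Matrices `f_i` that, together with multiples of their adjoints, satisfy the relations
of Chevalley generators (except for the Serre relations) with a given Cartan matrix. -/
structure ChevalleyMatrices {n : ℕ} (A : Matrix (Fin n) (Fin n) ℤ) (I : Type) [Fintype I]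
    [DecidableEq I] where
  f : Fin n → Matrix I I ℂ
  h : Fin n → Matrix I I ℂ
  c : Fin n → ℂ
  c_ne_zero : ∀ i, c i ≠ 0
  h_ne_zero : ∀ i, h i ≠ 0
  conjTranspose_h : ∀ i, (h i).conjTranspose = h i
  lie_e_f : ∀ i, ⁅c i • (f i).conjTranspose, f i⁆ = h i
  lie_e_f_ne : ∀ i j, i ≠ j → ⁅(f i).conjTranspose, f j⁆ = 0
  lie_h_h : ∀ i j, ⁅h i, h j⁆ = 0
  lie_h_f : ∀ i j, ⁅h j, f i⁆ = -A i j • f i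

theorem conjTranspose_lie {I : Type} [Fintype I] [DecidableEq I] (x y : Matrix I I ℂ) :
    (⁅x, y⁆).conjTranspose = ⁅y.conjTranspose, x.conjTranspose⁆ := by
  rw [LieRing.of_associative_ring_bracket, LieRing.of_associative_ring_bracket,
    Matrix.conjTranspose_sub, Matrix.conjTranspose_mul, Matrix.conjTranspose_mul]

section Hom

variable {n : ℕ} {𝔤 : Type*} [LieRing 𝔤] [LieAlgebra ℂ 𝔤] {𝔥 : LieSubalgebra ℂ 𝔤}
  (b : LieAlgebra.Basis (Fin n) 𝔥) {I : Type} [Fintype I] [DecidableEq I]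
  (C : ChevalleyMatrices b.A I)

namespace ChevalleyMatrices

variable {b}

/-- The raising matrices. -/
def e (i : Fin n) : Matrix I I ℂ := C.c i • (C.f i).conjTranspose

theorem lie_h_e (i j : Fin n) : ⁅C.h j, C.e i⁆ = b.A i j • C.e i := by
  have h1 := congrArg Matrix.conjTranspose (C.lie_h_f i j)
  rw [conjTranspose_lie, C.conjTranspose_h] at h1
  have h2 : (-b.A i j • C.f i).conjTranspose = -(b.A i j • (C.f i).conjTranspose) := by
    rw [neg_smul, Matrix.conjTranspose_neg, Matrix.conjTranspose_zsmul]
  rw [h2, ← lie_skew, neg_inj] at h1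
  rw [e, lie_smul, h1, smul_comm]

/-- The subalgebra of `𝔤 × 𝔤𝔩` generated by the pairs of corresponding Chevalley generators. -/
def graph : LieSubalgebra ℂ (𝔤 × Matrix I I ℂ) :=
  LieSubalgebra.lieSpan ℂ _ ((Set.range fun i => (b.e i, C.e i)) ∪
    Set.range fun i => (b.f i, C.f i))

/-- The generator of the graph over `e_i`. -/
def graphE (i : Fin n) : C.graph := ⟨(b.e i, C.e i), LieSubalgebra.subset_lieSpan (Or.inl ⟨i, rfl⟩)⟩

/-- The generator of the graph over `f_i`. -/
def graphF (i : Fin n) : C.graph := ⟨(b.f i, C.f i), LieSubalgebra.subset_lieSpan (Or.inr ⟨i, rfl⟩)⟩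

/-- The element of the graph over `h_i`. -/
def graphH (i : Fin n) : C.graph := ⁅C.graphE i, C.graphF i⁆

theorem coe_graphH (i : Fin n) : (C.graphH i : 𝔤 × Matrix I I ℂ) = (b.h i, C.h i) :=
  Prod.ext (b.sl2 i).lie_e_f (C.lie_e_f i)

/-- The Chevalley generators of the subalgebra that they generate. -/
def graphBasis : LieAlgebra.Basis (Fin n)
    (LieSubalgebra.lieSpan ℂ C.graph (Set.range C.graphH)) where
  A := b.A
  h := C.graphH
  e := C.graphE
  f := C.graphF
  cartan_eq_lieSpan := rfl
  span_ef := by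
    have h1 : Set.range C.graphE ∪ Set.range C.graphF = (((↑) : C.graph → 𝔤 × Matrix I I ℂ) ⁻¹'
        ((Set.range fun i => (b.e i, C.e i)) ∪ Set.range fun i => (b.f i, C.f i))) := by
      ext z
      simp only [Set.mem_union, Set.mem_range, Set.mem_preimage, graphE, graphF, Subtype.ext_iff]
    rw [h1]
    exact LieSubalgebra.lieSpan_lieSpan_coe_preimage
  linInd := by
    refine LinearIndependent.of_comp
      (LinearMap.fst ℂ 𝔤 (Matrix I I ℂ) ∘ₗ C.graph.toSubmodule.subtype) ?_
    have : ⇑(LinearMap.fst ℂ 𝔤 (Matrix I I ℂ) ∘ₗ C.graph.toSubmodule.subtype) ∘ C.graphH = b.h := by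
      funext i
      exact congrArg Prod.fst (C.coe_graphH i)
    rw [this]
    exact b.linInd
  nondegen := b.nondegen
  sl2 i :=
    { h_ne_zero := by
        intro h
        have := congrArg (fun z : C.graph => z.1.1) h
        simp only [C.coe_graphH] at this
        exact (b.sl2 i).h_ne_zero this
      lie_e_f := rfl
      lie_h_e_nsmul := by
        apply Subtype.ext
        rw [LieSubalgebra.coe_bracket, C.coe_graphH]
        have : IsAddTorsionFree 𝔤 := .of_isTorsionFree ℂ 𝔤
        have h1 := C.lie_h_e i i
        rw [b.A_diag_eq_two, ofNat_zsmul] at h1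
        exact Prod.ext (b.sl2 i).lie_h_e_nsmul h1
      lie_h_f_nsmul := by
        apply Subtype.ext
        rw [LieSubalgebra.coe_bracket, C.coe_graphH]
        have : IsAddTorsionFree 𝔤 := .of_isTorsionFree ℂ 𝔤
        have h1 := C.lie_h_f i i
        rw [b.A_diag_eq_two, neg_smul, ofNat_zsmul] at h1
        exact Prod.ext (b.sl2 i).lie_h_f_nsmul h1 }
  lie_h_h i j := by
    apply Subtype.ext
    rw [LieSubalgebra.coe_bracket, C.coe_graphH, C.coe_graphH]
    exact Prod.ext (b.lie_h_h i j) (C.lie_h_h i j)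
  lie_h_e i j := by
    apply Subtype.ext
    rw [LieSubalgebra.coe_bracket, C.coe_graphH]
    exact Prod.ext (b.lie_h_e i j) (C.lie_h_e i j)
  lie_h_f i j := by
    apply Subtype.ext
    rw [LieSubalgebra.coe_bracket, C.coe_graphH]
    exact Prod.ext (b.lie_h_f i j) (C.lie_h_f i j)
  lie_e_f_ne i j hij := by
    apply Subtype.ext
    refine Prod.ext (b.lie_e_f_ne i j hij) ?_
    change ⁅C.c i • (C.f i).conjTranspose, C.f j⁆ = 0
    rw [smul_lie, C.lie_e_f_ne i j hij, smul_zero]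

/-- The coefficients of a multiple of the element of the Cartan subalgebra that
acts on all simple root vectors by the same scalar. -/
def heightCoeff (A : Matrix (Fin n) (Fin n) ℤ) (j : Fin n) : ℤ := (A.adjugate.mulVec 1) j

theorem sum_heightCoeff (A : Matrix (Fin n) (Fin n) ℤ) (i : Fin n) :
    ∑ j, A i j * heightCoeff A j = A.det := by
  have : A.mulVec (A.adjugate.mulVec 1) = A.det • 1 := by
    rw [Matrix.mulVec_mulVec, Matrix.mul_adjugate, Matrix.smul_mulVec, Matrix.one_mulVec]
  have := congrFun this i
  rw [Pi.smul_apply, Pi.one_apply, smul_eq_mul, mul_one] at this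
  exact this

/-- The element of the Cartan subalgebra that measures the height, up to the factor `det A`. -/
def height : C.graph := ∑ j, heightCoeff b.A j • C.graphH j

theorem lie_height_graphE (i : Fin n) : ⁅C.height, C.graphE i⁆ = (b.A.det : ℂ) • C.graphE i := by
  have h1 : ∀ j, ⁅C.graphH j, C.graphE i⁆ = b.A i j • C.graphE i := C.graphBasis.lie_h_e i
  rw [height, sum_lie]
  simp only [zsmul_lie, h1, smul_smul]
  rw [← Finset.sum_smul, ← sum_heightCoeff b.A i, Int.cast_smul_eq_zsmul]
  congr 1
  exact Finset.sum_congr rfl fun j _ => mul_comm _ _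

theorem lie_height_graphF (i : Fin n) : ⁅C.height, C.graphF i⁆ = (-(b.A.det : ℂ)) • C.graphF i := by
  have h1 : ∀ j, ⁅C.graphH j, C.graphF i⁆ = -b.A i j • C.graphF i := C.graphBasis.lie_h_f i
  rw [height, sum_lie]
  simp only [zsmul_lie, h1, smul_smul]
  rw [← Finset.sum_smul, ← sum_heightCoeff b.A i, ← Int.cast_neg, Int.cast_smul_eq_zsmul,
    ← Finset.sum_neg_distrib]
  congr 1
  exact Finset.sum_congr rfl fun j _ => by ring

theorem det_ne_zero : (b.A.det : ℂ) ≠ 0 := by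
  exact_mod_cast b.nondegen.det_ne_zero

/-- The elements of height zero form the Cartan subalgebra of the graph. -/
theorem mem_span_graphH {z : C.graph} (hz : ⁅C.height, z⁆ = 0) :
    z ∈ Submodule.span ℂ (Set.range C.graphH) := by
  have h1 : z ∈ LieSubalgebra.lieSpan ℂ C.graph (Set.range C.graphH) := by
    refine mem_cartan_of_lie_eq_zero C.graphBasis (x := C.height) det_ne_zero ?_
      C.lie_height_graphE C.lie_height_graphF hz
    intro y hy
    have := C.graphBasis.isLieAbelian_cartan
    set K := LieSubalgebra.lieSpan ℂ C.graph (Set.range C.graphH)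
    have hH : C.height ∈ K :=
      sum_mem fun j _ => zsmul_mem (LieSubalgebra.subset_lieSpan (Set.mem_range_self j)) _
    have h2 : ∀ u v : K, ⁅u, v⁆ = 0 := fun u v => trivial_lie_zero K K u v
    exact congrArg Subtype.val (h2 ⟨_, hH⟩ ⟨y, hy⟩)
  rw [← LieSubalgebra.mem_toSubmodule, C.graphBasis.coe_cartan_eq_span] at h1
  exact h1

/-- In height zero, the graph is the graph of a map. -/
theorem eq_zero_of_fst_eq_zero {z : C.graph} (hz : ⁅C.height, z⁆ = 0) (h : z.1.1 = 0) : z = 0 := by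
  obtain ⟨a, rfl⟩ := (Submodule.mem_span_range_iff_exists_fun ℂ).1 (C.mem_span_graphH hz)
  have h1 : ∑ i, a i • b.h i = 0 := by
    rw [← h]
    have : ∀ z : C.graph, z.1.1 = (LinearMap.fst ℂ 𝔤 (Matrix I I ℂ) ∘ₗ
      C.graph.toSubmodule.subtype) z := fun _ => rfl
    rw [this, map_sum]
    refine Finset.sum_congr rfl fun i _ => ?_
    rw [map_smul, ← this, C.coe_graphH]
  refine Finset.sum_eq_zero fun i _ => ?_
  rw [Fintype.linearIndependent_iff.1 b.linInd a h1 i, zero_smul]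

/-- The second components of the graph are stable under adjoints, because the generators are. -/
theorem exists_conjTranspose (z : C.graph) : ∃ w : C.graph, w.1.2 = z.1.2.conjTranspose := by
  obtain ⟨z, hz⟩ := z
  simp only
  induction hz using LieSubalgebra.lieSpan_induction with
  | mem u hu =>
    rcases hu with ⟨i, rfl⟩ | ⟨i, rfl⟩
    · refine ⟨starRingEnd ℂ (C.c i) • C.graphF i, ?_⟩
      change starRingEnd ℂ (C.c i) • C.f i = (C.c i • (C.f i).conjTranspose).conjTranspose
      rw [Matrix.conjTranspose_smul, Matrix.conjTranspose_conjTranspose]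
      rfl
    · refine ⟨(C.c i)⁻¹ • C.graphE i, ?_⟩
      change (C.c i)⁻¹ • C.c i • (C.f i).conjTranspose = (C.f i).conjTranspose
      rw [smul_smul, inv_mul_cancel₀ (C.c_ne_zero i), one_smul]
  | zero => exact ⟨0, Matrix.conjTranspose_zero.symm⟩
  | add u v _ _ hu hv =>
    obtain ⟨u', hu'⟩ := hu
    obtain ⟨v', hv'⟩ := hv
    refine ⟨u' + v', ?_⟩
    change u'.1.2 + v'.1.2 = (u.2 + v.2).conjTranspose
    rw [hu', hv', Matrix.conjTranspose_add]
  | smul t u _ hu =>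
    obtain ⟨u', hu'⟩ := hu
    refine ⟨starRingEnd ℂ t • u', ?_⟩
    change starRingEnd ℂ t • u'.1.2 = (t • u.2).conjTranspose
    rw [hu', Matrix.conjTranspose_smul]
    rfl
  | lie u v _ _ hu hv =>
    obtain ⟨u', hu'⟩ := hu
    obtain ⟨v', hv'⟩ := hv
    refine ⟨⁅v', u'⁆, ?_⟩
    change ⁅v'.1.2, u'.1.2⁆ = (⁅u.2, v.2⁆).conjTranspose
    rw [hu', hv', conjTranspose_lie]

theorem height_snd : (C.height : 𝔤 × Matrix I I ℂ).2 = ∑ j, heightCoeff b.A j • C.h j := by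
  have : ∀ z : C.graph, z.1.2 = (LinearMap.snd ℂ 𝔤 (Matrix I I ℂ) ∘ₗ
    C.graph.toSubmodule.subtype) z := fun _ => rfl
  rw [this, height, map_sum]
  refine Finset.sum_congr rfl fun j _ => ?_
  rw [map_zsmul, ← this, C.coe_graphH]

theorem conjTranspose_height : (C.height : 𝔤 × Matrix I I ℂ).2.conjTranspose = C.height.1.2 := by
  rw [height_snd, Matrix.conjTranspose_sum]
  refine Finset.sum_congr rfl fun j _ => ?_
  rw [Matrix.conjTranspose_zsmul, C.conjTranspose_h]

open scoped ComplexOrder in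
/-- The positivity argument: if `(0, y)` lies in the subalgebra and has nonzero height, then the
commutator of `(0, y)` with an element `(x, y*)` has height zero, so that `y` commutes with its
adjoint `y*`; as `y` is an eigenvector of a commutator, this is only possible for `y = 0`. -/
theorem eq_zero_of_eigenvector {z : C.graph} {μ : ℝ} (hμ : μ ≠ 0) (hz : ⁅C.height, z⁆ = (μ : ℂ) • z)
    (h : z.1.1 = 0) : z = 0 := by
  obtain ⟨w, hw⟩ := C.exists_conjTranspose z
  set y := z.1.2 with hy
  set H := C.height.1.2 with hH
  have h1 : ⁅H, y⁆ = (μ : ℂ) • y := congrArg (fun z : C.graph => z.1.2) hz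
  have h2 : ⁅H, y.conjTranspose⁆ = (-(μ : ℂ)) • y.conjTranspose := by
    have := congrArg Matrix.conjTranspose h1
    rw [conjTranspose_lie, C.conjTranspose_height, Matrix.conjTranspose_smul, ← lie_skew] at this
    rw [neg_smul, ← neg_eq_iff_eq_neg, this]
    simp
  have h3 : ⁅C.height, ⁅z, w⁆⁆ = 0 := by
    apply Subtype.ext
    refine Prod.ext ?_ ?_
    · change ⁅C.height.1.1, ⁅z.1.1, w.1.1⁆⁆ = 0
      rw [h, zero_lie, lie_zero]
    · change ⁅H, ⁅y, w.1.2⁆⁆ = 0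
      rw [hw, leibniz_lie, h1, h2, smul_lie, lie_smul, neg_smul, add_neg_cancel]
  have h4 : ⁅z, w⁆ = 0 := by
    refine C.eq_zero_of_fst_eq_zero h3 ?_
    change ⁅z.1.1, w.1.1⁆ = 0
    rw [h, zero_lie]
  have h5 : y * y.conjTranspose = y.conjTranspose * y := by
    have : ⁅y, w.1.2⁆ = 0 := congrArg (fun z : C.graph => z.1.2) h4
    rw [hw, LieRing.of_associative_ring_bracket, sub_eq_zero] at this
    exact this
  have h6 : (μ : ℂ) * (y.conjTranspose * y).trace = 0 := by
    have h7 := congrArg (fun M => (y.conjTranspose * M).trace) h1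
    simp only [LieRing.of_associative_ring_bracket, mul_sub, Matrix.mul_smul, Matrix.trace_sub,
      Matrix.trace_smul, smul_eq_mul] at h7
    rw [← h7, Matrix.trace_mul_comm y.conjTranspose, ← mul_assoc y.conjTranspose,
      Matrix.trace_mul_comm _ H, mul_assoc, h5, sub_self]
  have h8 : y = 0 := by
    have := (mul_eq_zero.1 h6).resolve_left (by exact_mod_cast hμ)
    exact Matrix.trace_conjTranspose_mul_self_eq_zero_iff.1 this
  exact Subtype.ext (Prod.ext h h8)

/-- The subalgebra generated by the pairs of the lowering generators. -/
def graphLower : LieSubalgebra ℂ C.graph := LieSubalgebra.lieSpan ℂ C.graph (Set.range C.graphF)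

theorem lie_height_mem {z : C.graph} (hz : z ∈ C.graphLower) : ⁅C.height, z⁆ ∈ C.graphLower := by
  induction hz using LieSubalgebra.lieSpan_induction with
  | mem u hu =>
    obtain ⟨i, rfl⟩ := hu
    rw [C.lie_height_graphF]
    exact C.graphLower.smul_mem _ (LieSubalgebra.subset_lieSpan ⟨i, rfl⟩)
  | zero => rw [lie_zero]; exact C.graphLower.zero_mem
  | add u v _ _ hu hv => rw [lie_add]; exact C.graphLower.add_mem hu hv
  | smul t u _ hu => rw [lie_smul]; exact C.graphLower.smul_mem _ hu
  | lie u v hu hv hu' hv' =>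
    rw [leibniz_lie]
    exact C.graphLower.add_mem (C.graphLower.lie_mem hu' hv) (C.graphLower.lie_mem hu hv')

theorem exists_graphLower (x : lowerNil b) : ∃ z ∈ C.graphLower, z.1.1 = x := by
  obtain ⟨x, hx⟩ := x
  simp only
  induction hx using LieSubalgebra.lieSpan_induction with
  | mem u hu =>
    obtain ⟨i, rfl⟩ := hu
    exact ⟨C.graphF i, LieSubalgebra.subset_lieSpan ⟨i, rfl⟩, rfl⟩
  | zero => exact ⟨0, C.graphLower.zero_mem, rfl⟩
  | add u v _ _ hu hv =>
    obtain ⟨u', hu, rfl⟩ := hu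
    obtain ⟨v', hv, rfl⟩ := hv
    exact ⟨u' + v', C.graphLower.add_mem hu hv, rfl⟩
  | smul t u _ hu =>
    obtain ⟨u', hu, rfl⟩ := hu
    exact ⟨t • u', C.graphLower.smul_mem t hu, rfl⟩
  | lie u v _ _ hu hv =>
    obtain ⟨u', hu, rfl⟩ := hu
    obtain ⟨v', hv, rfl⟩ := hv
    exact ⟨⁅u', v'⁆, C.graphLower.lie_mem hu hv, rfl⟩

/-- The graph projects onto `𝔤`. -/
theorem surjective_fst (x : 𝔤) : ∃ z : C.graph, z.1.1 = x := by
  have hx : x ∈ LieSubalgebra.lieSpan ℂ 𝔤 (Set.range b.e ∪ Set.range b.f) := by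
    rw [b.span_ef]; trivial
  induction hx using LieSubalgebra.lieSpan_induction with
  | mem u hu =>
    rcases hu with ⟨i, rfl⟩ | ⟨i, rfl⟩
    · exact ⟨C.graphE i, rfl⟩
    · exact ⟨C.graphF i, rfl⟩
  | zero => exact ⟨0, rfl⟩
  | add u v _ _ hu hv =>
    obtain ⟨u', rfl⟩ := hu
    obtain ⟨v', rfl⟩ := hv
    exact ⟨u' + v', rfl⟩
  | smul t u _ hu =>
    obtain ⟨u', rfl⟩ := hu
    exact ⟨t • u', rfl⟩
  | lie u v _ _ hu hv =>
    obtain ⟨u', rfl⟩ := hu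
    obtain ⟨v', rfl⟩ := hv
    exact ⟨⁅u', v'⁆, rfl⟩

/-- The element of the graph over an element of the nilpotent subalgebra. -/
def lift (x : lowerNil b) : C.graph := (C.exists_graphLower x).choose

theorem lift_mem (x : lowerNil b) : C.lift x ∈ C.graphLower := (C.exists_graphLower x).choose_spec.1

theorem lift_fst (x : lowerNil b) : (C.lift x).1.1 = x := (C.exists_graphLower x).choose_spec.2

variable [FiniteDimensional ℂ 𝔤]

/-- The subalgebra generated by the pairs of lowering generators is the graph of a map on `𝔫`. An
element `(0, y)` is a sum of eigenvectors for the height, with nonzero real eigenvalues, that are of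
the same form, and all of them vanish. -/
theorem eq_zero_of_mem_graphLower {z : C.graph} (hz : z ∈ C.graphLower) (h : z.1.1 = 0) :
    z = 0 := by
  set φ : C.graph →ₗ[ℂ] 𝔤 := LinearMap.fst ℂ 𝔤 (Matrix I I ℂ) ∘ₗ C.graph.toSubmodule.subtype
  set p : Submodule ℂ C.graph := C.graphLower.toSubmodule ⊓ LinearMap.ker φ with hp
  set T : Module.End ℂ C.graph := LieAlgebra.ad ℂ C.graph C.height with hT
  have hstab : ∀ x ∈ p, T x ∈ p := by
    rintro x ⟨hx, hx'⟩
    refine ⟨C.lie_height_mem hx, ?_⟩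
    change ⁅C.height.1.1, x.1.1⁆ = 0
    have : x.1.1 = 0 := hx'
    rw [this, lie_zero]
  have h1 := lieSpan_le_iSup_eigenspace C.height C.graphF _ C.lie_height_graphF z hz
  have h2 : z ∈ p ⊓ ⨆ μ, Module.End.genEigenspace T μ 1 := by
    refine ⟨⟨hz, h⟩, ?_⟩
    refine (iSup_le fun d => ?_ :
      (⨆ d : ℕ, Module.End.eigenspace T ((d + 1) * -(b.A.det : ℂ))) ≤ _) h1
    exact le_iSup (fun μ => Module.End.genEigenspace T μ 1) _
  rw [Submodule.inf_iSup_genEigenspace hstab] at h2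
  have h3 : ∀ μ, p ⊓ Module.End.genEigenspace T μ 1 = ⊥ := by
    intro μ
    rw [eq_bot_iff]
    rintro x ⟨⟨hx, hx'⟩, hxμ⟩
    rw [Submodule.mem_bot]
    have hxμ' : T x = μ • x := Module.End.mem_eigenspace_iff.1 hxμ
    by_cases hμ : ∃ d : ℕ, μ = (d + 1) * -(b.A.det : ℂ)
    · obtain ⟨d, hd⟩ := hμ
      have hreal : μ = (((d + 1) * -(b.A.det : ℝ) : ℝ) : ℂ) := by
        rw [hd]
        simp only [Complex.ofReal_mul, Complex.ofReal_add, Complex.ofReal_neg,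
          Complex.ofReal_natCast, Complex.ofReal_one, Complex.ofReal_intCast]
      refine C.eq_zero_of_eigenvector (μ := (d + 1) * -(b.A.det : ℝ)) ?_
        (by rw [← hreal]; exact hxμ') hx'
      refine mul_ne_zero (by exact_mod_cast Nat.succ_ne_zero d) (neg_ne_zero.2 ?_)
      exact_mod_cast b.nondegen.det_ne_zero
    · push Not at hμ
      refine Submodule.disjoint_def.1 ((Module.End.eigenspaces_iSupIndep T) μ) x
        (Module.End.mem_eigenspace_iff.2 hxμ') ?_
      have hx1 := lieSpan_le_iSup_eigenspace C.height C.graphF _ C.lie_height_graphF x hx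
      refine (iSup_le fun d => ?_ :
        (⨆ d : ℕ, Module.End.eigenspace T ((d + 1) * -(b.A.det : ℂ))) ≤ _) hx1
      exact le_iSup_of_le _ (le_iSup_of_le (hμ d).symm le_rfl)
  simpa [h3] using h2

theorem eq_lift {x : lowerNil b} {z : C.graph} (hz : z ∈ C.graphLower) (h : z.1.1 = x) :
    C.lift x = z := by
  rw [← sub_eq_zero]
  refine C.eq_zero_of_mem_graphLower (C.graphLower.sub_mem (C.lift_mem x) hz) ?_
  change (C.lift x).1.1 - z.1.1 = 0
  rw [C.lift_fst, h, sub_self]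

/-- The representation of the nilpotent subalgebra with `f_i ↦ C.f i`. -/
def rep : lowerNil b →ₗ⁅ℂ⁆ Matrix I I ℂ where
  toFun x := (C.lift x).1.2
  map_add' x y := by
    rw [C.eq_lift (x := x + y) (C.graphLower.add_mem (C.lift_mem x) (C.lift_mem y))
      (congrArg₂ (· + ·) (C.lift_fst x) (C.lift_fst y))]
    rfl
  map_smul' c x := by
    rw [C.eq_lift (x := c • x) (C.graphLower.smul_mem c (C.lift_mem x))
      (congrArg (c • ·) (C.lift_fst x))]
    rfl
  map_lie' {x y} := by
    rw [C.eq_lift (x := ⁅x, y⁆) (C.graphLower.lie_mem (C.lift_mem x) (C.lift_mem y))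
      (congrArg₂ (⁅·, ·⁆) (C.lift_fst x) (C.lift_fst y))]
    rfl

theorem rep_gen (i : Fin n) : C.rep (gen b i) = C.f i := by
  change (C.lift (gen b i)).1.2 = C.f i
  rw [C.eq_lift (x := gen b i) (z := C.graphF i) (LieSubalgebra.subset_lieSpan ⟨i, rfl⟩) rfl]
  rfl

/-- The representation is faithful when the Lie algebra is simple: its kernel lies in the ideal of
all `x` with `(x, 0)` in the graph, and this ideal does not contain `h_i`. -/
theorem rep_injective [LieAlgebra.IsSimple ℂ 𝔤] (i : Fin n) : Function.Injective C.rep := by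
  set J : LieIdeal ℂ 𝔤 :=
    { carrier := {x | ∃ z : C.graph, z.1 = (x, 0)}
      add_mem' := by
        rintro x y ⟨z, hz⟩ ⟨w, hw⟩
        refine ⟨z + w, ?_⟩
        change z.1 + w.1 = _
        rw [hz, hw, Prod.mk_add_mk, add_zero]
      zero_mem' := ⟨0, rfl⟩
      smul_mem' := by
        rintro c x ⟨z, hz⟩
        refine ⟨c • z, ?_⟩
        change c • z.1 = _
        rw [hz, Prod.smul_mk, smul_zero]
      lie_mem := by
        rintro x y ⟨z, hz⟩
        obtain ⟨w, rfl⟩ := C.surjective_fst x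
        refine ⟨⁅w, z⁆, ?_⟩
        change ⁅w.1, z.1⁆ = _
        rw [hz, LieAlgebra.Prod.bracket_apply, lie_zero] } with hJ
  have hbot : J = ⊥ := by
    refine (LieAlgebra.IsSimple.eq_bot_or_eq_top J).resolve_right fun htop => ?_
    have hi : b.h i ∈ J := by rw [htop]; trivial
    obtain ⟨z, hz⟩ := hi
    have h1 : ⁅C.height, z⁆ = 0 := by
      have h2 : ∀ j, ⁅C.graphH j, z⁆ = 0 := by
        intro j
        apply Subtype.ext
        rw [LieSubalgebra.coe_bracket, C.coe_graphH, hz]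
        exact Prod.ext (b.lie_h_h j i) (lie_zero _)
      rw [height, sum_lie]
      exact Finset.sum_eq_zero fun j _ => by rw [zsmul_lie, h2, smul_zero]
    have h3 : C.graphH i - z = 0 := by
      refine C.eq_zero_of_fst_eq_zero ?_ ?_
      · have h4 : ⁅C.height, C.graphH i⁆ = 0 := by
          have h2 : ∀ j, ⁅C.graphH j, C.graphH i⁆ = 0 := fun j => C.graphBasis.lie_h_h j i
          rw [height, sum_lie]
          exact Finset.sum_eq_zero fun j _ => by rw [zsmul_lie, h2, smul_zero]
        rw [lie_sub, h1, h4, sub_zero]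
      · change (C.graphH i).1.1 - z.1.1 = 0
        rw [C.coe_graphH, hz, sub_self]
    have h5 := congrArg (fun z : C.graph => z.1.2) h3
    change (C.graphH i).1.2 - z.1.2 = 0 at h5
    rw [C.coe_graphH, hz, sub_zero] at h5
    exact C.h_ne_zero i h5
  rw [injective_iff_map_eq_zero]
  intro x hx
  have h6 : (x : 𝔤) ∈ J := ⟨C.lift x, Prod.ext (C.lift_fst x) hx⟩
  rw [hbot] at h6
  exact Subtype.ext ((LieSubmodule.mem_bot _).1 h6)

end ChevalleyMatrices

end Hom

/-! ### The standard representations of the classical Lie algebras -/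

/-- The index set `-r, …, r` of the matrices for the four types. The basis vector with the index
`a > 0` has weight `e_a` or `-e_a`, and that with the index `-a` the opposite weight. -/
abbrev Ix (r : ℕ) : Type := {a : ℤ // a ∈ Finset.Icc (-(r : ℤ)) r}

theorem Ix.abs_le {r : ℕ} (x : Ix r) : |x.1| ≤ r := _root_.abs_le.2 (Finset.mem_Icc.1 x.2)

theorem abs_le_mem {r : ℕ} {a : ℤ} (h : |a| ≤ r) : a ∈ Finset.Icc (-(r : ℤ)) r :=
  Finset.mem_Icc.2 (_root_.abs_le.1 h)

/-- The matrix unit with the only nonzero entry in row `a` and column `b`; it is zero if `a` or `b`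
is out of range. -/
def unitMatrix (r : ℕ) (a b : ℤ) : Matrix (Ix r) (Ix r) ℂ :=
  Matrix.of fun x y => if x.1 = a ∧ y.1 = b then 1 else 0

theorem unitMatrix_apply {r : ℕ} (a b : ℤ) (x y : Ix r) :
    unitMatrix r a b x y = if x.1 = a ∧ y.1 = b then 1 else 0 := rfl

theorem unitMatrix_mul {r : ℕ} (a b c d : ℤ) (hb : |b| ≤ r) :
    unitMatrix r a b * unitMatrix r c d = if b = c then unitMatrix r a d else 0 := by
  ext x y
  rw [Matrix.mul_apply, Finset.sum_eq_single ⟨b, abs_le_mem hb⟩]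
  · by_cases h : b = c <;> by_cases hx : x.1 = a <;> by_cases hy : y.1 = d <;>
      simp [unitMatrix_apply, h, hx, hy]
  · intro z _ hz
    rw [unitMatrix_apply, if_neg (fun h => hz (Subtype.ext h.2)), zero_mul]
  · simp

/-- The signs in the invariant bilinear form: this form is skew for type `C`, else symmetric. -/
def formSign : ClassicalType → ℤ → ℂ
  | .C, a => if a < 0 then -1 else 1
  | _, _ => 1

theorem formSign_mul_self (X : ClassicalType) (a : ℤ) : formSign X a * formSign X a = 1 := by
  cases X <;> simp only [formSign] <;> (try split_ifs) <;> norm_num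

theorem formSign_pos (X : ClassicalType) {a : ℤ} (h : 0 ≤ a) : formSign X a = 1 := by
  cases X <;> simp [formSign, h]

theorem star_formSign (X : ClassicalType) (a : ℤ) : Star.star (formSign X a) = formSign X a := by
  cases X <;> simp only [formSign] <;> (try split_ifs) <;> simp

/-- Negation of both indices does not change a product of two signs. The index `0` does not
occur in type `C`. -/
theorem formSign_neg_mul (X : ClassicalType) {a b : ℤ} (h : X = .C → a ≠ 0 ∧ b ≠ 0) :
    formSign X (-a) * formSign X (-b) = formSign X a * formSign X b := by
  cases X
  all_goals try rfl
  obtain ⟨ha, hb⟩ := h rfl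
  simp only [formSign]
  split_ifs <;> first | rfl | omega | norm_num

/-- The basic elements `E_{a,b} ∓ E_{-b,-a}` of the orthogonal or symplectic Lie algebra. -/
def skewUnit (X : ClassicalType) (r : ℕ) (a b : ℤ) : Matrix (Ix r) (Ix r) ℂ :=
  unitMatrix r a b - (formSign X a * formSign X b) • unitMatrix r (-b) (-a)

theorem skewUnit_apply (X : ClassicalType) {r : ℕ} (a b : ℤ) (x y : Ix r) :
    skewUnit X r a b x y = (if x.1 = a ∧ y.1 = b then 1 else 0) -
      (formSign X a * formSign X b) * (if x.1 = -b ∧ y.1 = -a then 1 else 0) := rfl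

theorem conjTranspose_skewUnit (X : ClassicalType) (r : ℕ) (a b : ℤ) :
    (skewUnit X r a b).conjTranspose = skewUnit X r b a := by
  ext x y
  rw [Matrix.conjTranspose_apply, skewUnit_apply, skewUnit_apply, star_sub, star_mul', star_mul',
    star_formSign, star_formSign, mul_comm (formSign X b)]
  congr 2
  · by_cases h1 : y.1 = a <;> by_cases h2 : x.1 = b <;> simp [h1, h2]
  · by_cases h1 : y.1 = -b <;> by_cases h2 : x.1 = -a <;> simp [h1, h2]

theorem skewUnit_mul_aux (X : ClassicalType) {r : ℕ} {a b c d : ℤ} (hb : |b| ≤ r)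
    (hc : |c| ≤ r) :
    unitMatrix r a b * unitMatrix r c d + (formSign X a * formSign X b * (formSign X c *
      formSign X d)) • -(unitMatrix r (-d) (-c) * unitMatrix r (-b) (-a)) =
      if b = c then skewUnit X r a d else 0 := by
  rw [unitMatrix_mul _ _ _ _ hb, unitMatrix_mul _ _ _ _ (by rwa [abs_neg])]
  by_cases h : b = c
  · subst h
    rw [if_pos rfl, if_pos rfl, if_pos rfl, skewUnit, sub_eq_add_neg, smul_neg]
    congr 3
    have := formSign_mul_self X b
    linear_combination (formSign X a * formSign X d) * this
  · rw [if_neg h, if_neg h, if_neg (fun h' => h (neg_injective h').symm)]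
    simp

theorem lie_skewUnit (X : ClassicalType) {r : ℕ} {a b c d : ℤ} (ha : |a| ≤ r) (hb : |b| ≤ r)
    (hc : |c| ≤ r) (hd : |d| ≤ r) (h0 : X = .C → a ≠ 0 ∧ b ≠ 0 ∧ c ≠ 0 ∧ d ≠ 0) :
    ⁅skewUnit X r a b, skewUnit X r c d⁆ =
      (if b = c then skewUnit X r a d else 0) - (if d = a then skewUnit X r c b else 0)
      - (formSign X c * formSign X d) • (if b = -d then skewUnit X r a (-c) else 0)
      + (formSign X c * formSign X d) • (if -c = a then skewUnit X r (-d) b else 0) := by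
  have hn : |-c| ≤ r := by rwa [abs_neg]
  have hn' : |-d| ≤ r := by rwa [abs_neg]
  have e1 := formSign_mul_self X c
  have e2 := formSign_mul_self X d
  have e3 : formSign X (-c) * formSign X (-d) = formSign X c * formSign X d :=
    formSign_neg_mul X fun h => ⟨(h0 h).2.2.1, (h0 h).2.2.2⟩
  rw [← skewUnit_mul_aux X hb hc, ← skewUnit_mul_aux X hd ha,
    ← skewUnit_mul_aux X hb hn', ← skewUnit_mul_aux X hn ha,
    mul_comm (formSign X (-d)) (formSign X (-c)), e3, neg_neg, neg_neg,
    LieRing.of_associative_ring_bracket, skewUnit, skewUnit]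
  simp only [sub_mul, mul_sub, smul_mul_assoc, mul_smul_comm, smul_sub, smul_add, smul_neg,
    smul_smul]
  have e4 : formSign X c * formSign X d * (formSign X c * formSign X d) = 1 := by
    linear_combination e1 + formSign X c * formSign X c * e2
  have e5 : formSign X c * formSign X d * (formSign X a * formSign X b *
      (formSign X c * formSign X d)) = formSign X a * formSign X b := by
    linear_combination (formSign X a * formSign X b) * e4
  have e5' : formSign X c * formSign X d * (formSign X c * formSign X d *
      (formSign X a * formSign X b)) = formSign X a * formSign X b := by
    linear_combination (formSign X a * formSign X b) * e4
  rw [e5, e5',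
    mul_comm (formSign X a * formSign X b) (formSign X c * formSign X d)]
  abel

theorem skewUnit_neg (X : ClassicalType) (r : ℕ) {a b : ℤ} (h0 : X = .C → a ≠ 0 ∧ b ≠ 0) :
    skewUnit X r (-b) (-a) = -(formSign X a * formSign X b) • skewUnit X r a b := by
  have e : formSign X a * formSign X b * (formSign X a * formSign X b) = 1 := by
    linear_combination formSign_mul_self X a + formSign X a * formSign X a * formSign_mul_self X b
  rw [skewUnit, skewUnit, neg_neg, neg_neg, mul_comm (formSign X (-b)), formSign_neg_mul X h0,
    neg_smul, smul_sub, smul_smul, e, one_smul]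
  abel

/-- The diagonal matrix with the entries `d a`. -/
def diagMatrix (r : ℕ) (d : ℤ → ℂ) : Matrix (Ix r) (Ix r) ℂ := Matrix.diagonal fun x => d x.1

theorem lie_diagMatrix_skewUnit (X : ClassicalType) (r : ℕ) {d : ℤ → ℂ} (hd : ∀ a, d (-a) = -d a)
    (a b : ℤ) : ⁅diagMatrix r d, skewUnit X r a b⁆ = (d a - d b) • skewUnit X r a b := by
  ext x y
  rw [LieRing.of_associative_ring_bracket, Matrix.sub_apply, diagMatrix, Matrix.diagonal_mul,
    Matrix.mul_diagonal, Matrix.smul_apply, skewUnit_apply, smul_eq_mul]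
  by_cases h1 : x.1 = a ∧ y.1 = b <;> by_cases h2 : x.1 = -b ∧ y.1 = -a
  · have e1 : d x.1 = -d b := by rw [h2.1, hd]
    have e2 : d y.1 = -d a := by rw [h2.2, hd]
    have e3 : d x.1 = d a := by rw [h1.1]
    have e4 : d y.1 = d b := by rw [h1.2]
    rw [if_pos h1, if_pos h2, e3, e4]
    ring
  · rw [if_pos h1, if_neg h2, h1.1, h1.2]
    ring
  · rw [if_neg h1, if_pos h2, h2.1, h2.2, hd, hd]
    ring
  · rw [if_neg h1, if_neg h2]
    ring

theorem skewUnit_self (X : ClassicalType) (r : ℕ) (a : ℤ) : skewUnit X r a a =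
    diagMatrix r fun x => (if x = a then 1 else 0) - (if x = -a then 1 else 0) := by
  ext x y
  rw [skewUnit_apply, formSign_mul_self, one_mul, diagMatrix, Matrix.diagonal_apply]
  by_cases h : x = y
  · subst h
    simp
  · rw [if_neg h, if_neg, if_neg, sub_zero]
    · rintro ⟨h1, h2⟩; exact h (Subtype.ext (h1.trans h2.symm))
    · rintro ⟨h1, h2⟩; exact h (Subtype.ext (h1.trans h2.symm))

/-- The `m`-th coordinate of the weight `e_a`, where `e_{-a} = -e_a` and `e_0 = 0`. -/
def weight (a m : ℤ) : ℤ := (if m = a then 1 else 0) - (if m = -a then 1 else 0)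

theorem weight_neg (a m : ℤ) : weight a (-m) = -weight a m := by
  unfold weight
  split_ifs <;> omega

theorem sum_weight_mul {r : ℕ} {a : ℤ} (ha : |a| ≤ r) (g : ℤ → ℤ) (hg : ∀ m, g (-m) = -g m) :
    ∑ m ∈ Finset.Icc 1 r, weight a m * g m = g a := by
  have hr := _root_.abs_le.1 ha
  have h0 : g 0 = 0 := by have := hg 0; simp at this; omega
  rcases lt_trichotomy a 0 with h | rfl | h
  · rw [Finset.sum_eq_single a.natAbs]
    · have : (a.natAbs : ℤ) = -a := by omega
      rw [this, hg, weight, if_pos rfl, if_neg (by omega)]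
      ring
    · intro m _ hm'
      rw [weight, if_neg (by omega), if_neg (by omega)]
      simp
    · intro hm
      exact absurd (Finset.mem_Icc.2 (by omega)) hm
  · rw [h0]
    exact Finset.sum_eq_zero fun m _ => by simp [weight]
  · rw [Finset.sum_eq_single a.natAbs]
    · have : (a.natAbs : ℤ) = a := by omega
      rw [this, weight, if_pos rfl, if_neg (by omega)]
      ring
    · intro m _ hm'
      rw [weight, if_neg (by omega), if_neg (by omega)]
      simp
    · intro hm
      exact absurd (Finset.mem_Icc.2 (by omega)) hm

/-- The column index of the matrix of `f_l`; the simple root `α_l` is the difference of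
the weights `weight (ClassicalType.col l)` and `weight (ClassicalType.row l)`. -/
def ClassicalType.col : ClassicalType → ℕ → ℕ → ℤ
  | .D, _, l => if l = 1 then 2 else l
  | _, _, l => l

/-- The row index of the matrix of `f_l`. -/
def ClassicalType.row : ClassicalType → ℕ → ℕ → ℤ
  | .A, _, l => l + 1
  | .B, r, l => if l = r then 0 else l + 1
  | .C, r, l => if l = r then -r else l + 1
  | .D, _, l => if l = 1 then -1 else l - 1

/-- The matrix of `f_l`, with `l` counted from 1. -/
def ClassicalType.lowering (X : ClassicalType) (r l : ℕ) : Matrix (Ix r) (Ix r) ℂ :=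
  skewUnit X r (X.row r l) (X.col r l)

theorem coord_simpleRoot (X : ClassicalType) (r : ℕ) {l m : ℕ} (hl : 1 ≤ l) (hm : 1 ≤ m) :
    (X.simpleRoot r l).coord m = weight (X.col r l) m - weight (X.row r l) m := by
  cases X <;> simp only [ClassicalType.simpleRoot, ClassicalType.col, ClassicalType.row] <;>
    (try split_ifs) <;> simp only [Root.coord, weight] <;> split_ifs <;>
    first | omega | contradiction

variable {X : ClassicalType} {r : ℕ}

theorem abs_col_le (hr : X.minSize ≤ r) {l : ℕ} (hl : l ≤ X.rank r) : |X.col r l| ≤ r := by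
  rw [abs_le]
  cases X <;> simp only [ClassicalType.col, ClassicalType.minSize, ClassicalType.rank] at * <;>
    (try split_ifs) <;> omega

theorem abs_row_le (hr : X.minSize ≤ r) {l : ℕ} (hl1 : 1 ≤ l) (hl : l ≤ X.rank r) :
    |X.row r l| ≤ r := by
  rw [abs_le]
  cases X <;> simp only [ClassicalType.row, ClassicalType.minSize, ClassicalType.rank] at * <;>
    (try split_ifs) <;> omega

theorem col_ne_zero_of_C {l : ℕ} (hl1 : 1 ≤ l) : X.col r l ≠ 0 := by
  cases X <;> simp only [ClassicalType.col] <;> (try split_ifs) <;> omega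

theorem row_ne_zero_of_C (hr : X.minSize ≤ r) (hX : X = .C) {l : ℕ} : X.row r l ≠ 0 := by
  subst hX
  simp only [ClassicalType.row, ClassicalType.minSize] at *
  split_ifs <;> omega

/-- The inner products of the simple roots are read off from the rows and columns of the lowering
matrices. -/
theorem inner_simpleRoot (hr : X.minSize ≤ r) {l l' : ℕ} (hl1 : 1 ≤ l) (hl : l ≤ X.rank r)
    (hl1' : 1 ≤ l') : Root.inner r (X.simpleRoot r l) (X.simpleRoot r l') =
    (weight (X.col r l') (X.col r l) - weight (X.row r l') (X.col r l)) -
      (weight (X.col r l') (X.row r l) - weight (X.row r l') (X.row r l)) := by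
  rw [Root.inner, ← sum_weight_mul (abs_col_le hr hl)
    (fun m => weight (X.col r l') m - weight (X.row r l') m),
      ← sum_weight_mul (abs_row_le hr hl1 hl)
    (fun m => weight (X.col r l') m - weight (X.row r l') m), ← Finset.sum_sub_distrib]
  · refine Finset.sum_congr rfl fun m hm => ?_
    rw [coord_simpleRoot X r hl1 (Finset.mem_Icc.1 hm).1,
      coord_simpleRoot X r hl1' (Finset.mem_Icc.1 hm).1]
    ring
  all_goals
    intro m
    rw [weight_neg, weight_neg]
    ring

theorem lie_raising_lowering_ne (hr : X.minSize ≤ r) {l m : ℕ} (hl1 : 1 ≤ l) (hl : l ≤ X.rank r)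
    (hm1 : 1 ≤ m) (hm : m ≤ X.rank r) (hlm : l ≠ m) :
    ⁅skewUnit X r (X.col r l) (X.row r l), X.lowering r m⁆ = 0 := by
  rw [ClassicalType.lowering, lie_skewUnit X (abs_col_le hr hl) (abs_row_le hr hl1 hl)
    (abs_row_le hr hm1 hm) (abs_col_le hr hm) fun hX => ⟨col_ne_zero_of_C hl1,
      row_ne_zero_of_C hr hX, row_ne_zero_of_C hr hX, col_ne_zero_of_C hm1⟩]
  have h1 : X.row r l ≠ X.row r m := by
    cases X <;> simp only [ClassicalType.row, ClassicalType.rank] at * <;> (try split_ifs) <;> omega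
  have h2 : X.row r l ≠ -X.col r m := by
    cases X <;> simp only [ClassicalType.row, ClassicalType.col, ClassicalType.rank,
      ClassicalType.minSize] at * <;>
      (try split_ifs) <;> omega
  have h3 : -X.row r m ≠ X.col r l := by
    cases X <;> simp only [ClassicalType.row, ClassicalType.col, ClassicalType.rank,
      ClassicalType.minSize] at * <;>
      (try split_ifs) <;> omega
  rw [if_neg h1, if_neg h2, if_neg h3]
  simp only [smul_zero, zero_sub, sub_zero, add_zero, neg_eq_zero, ite_eq_right_iff]
  intro h4
  have h5 : X = .D ∧ X.row r m = -X.row r l := by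
    clear h1 h2 h3
    cases X <;> simp only [ClassicalType.row, ClassicalType.col, ClassicalType.rank,
      ClassicalType.minSize] at hr hl hm h4 ⊢
    case D =>
      refine ⟨trivial, ?_⟩
      split_ifs at h4 ⊢ <;> omega
    all_goals omega
  obtain ⟨rfl, h6⟩ := h5
  rw [h6, skewUnit, neg_neg]
  simp [formSign]

/-- The factor that normalizes the raising matrix. -/
def chevalleyFactor (X : ClassicalType) (r l : ℕ) : ℂ :=
  match X with
  | .B => if l = r then 2 else 1
  | .C => if l = r then 1 / 4 else 1
  | _ => 1

/-- The diagonal entries of the matrix of `h_l`. -/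
def corootEntry (X : ClassicalType) (r l : ℕ) (a : ℤ) : ℂ :=
  2 / (Root.inner r (X.simpleRoot r l) (X.simpleRoot r l) : ℂ) *
    ((weight (X.col r l) a - weight (X.row r l) a : ℤ) : ℂ)

theorem inner_simpleRoot_self (hr : X.minSize ≤ r) {l : ℕ} (hl1 : 1 ≤ l) (hl : l ≤ X.rank r) :
    Root.inner r (X.simpleRoot r l) (X.simpleRoot r l) =
      match X with
      | .B => if l = r then 1 else 2
      | .C => if l = r then 4 else 2
      | _ => 2 := by
  rw [inner_simpleRoot hr hl1 hl hl1]
  cases X <;> simp only [ClassicalType.row, ClassicalType.col, weight] at * <;> split_ifs <;> first | omega | contradiction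

theorem lie_raising_lowering (hr : X.minSize ≤ r) {l : ℕ} (hl1 : 1 ≤ l) (hl : l ≤ X.rank r) :
    ⁅chevalleyFactor X r l • skewUnit X r (X.col r l) (X.row r l), X.lowering r l⁆ =
      diagMatrix r (corootEntry X r l) := by
  rw [smul_lie, ClassicalType.lowering, lie_skewUnit X (abs_col_le hr hl) (abs_row_le hr hl1 hl)
    (abs_row_le hr hl1 hl) (abs_col_le hr hl) fun hX => ⟨col_ne_zero_of_C hl1,
      row_ne_zero_of_C hr hX, row_ne_zero_of_C hr hX, col_ne_zero_of_C hl1⟩,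
    if_pos rfl, if_pos rfl]
  by_cases h : X.row r l = -X.col r l
  · have h5 : X = .C ∧ l = r := by
      cases X <;> simp only [ClassicalType.row, ClassicalType.col, ClassicalType.rank,
        ClassicalType.minSize] at hr hl h <;> (try split_ifs at h) <;>
        first | omega | exact ⟨rfl, ‹_›⟩
    obtain ⟨rfl, rfl⟩ := h5
    have hr' : 1 ≤ l := hr
    have h1 : ClassicalType.C.row l l = -l := by simp [ClassicalType.row]
    have h2 : ClassicalType.C.col l l = l := rfl
    rw [h1, h2, if_pos rfl, if_pos (neg_neg _), neg_neg, skewUnit_self, skewUnit_self]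
    ext x y
    simp only [chevalleyFactor, if_true, formSign, Matrix.smul_apply, Matrix.add_apply,
      Matrix.sub_apply, diagMatrix, Matrix.diagonal_apply, corootEntry,
      inner_simpleRoot_self hr hl1 hl, weight, h1, h2, neg_neg]
    have s1 : -(l : ℤ) < 0 := by omega
    have s2 : ¬ (l : ℤ) < 0 := by omega
    simp only [if_pos s1, if_neg s2]
    by_cases hxy : x = y
    · simp only [hxy, if_true, smul_eq_mul]
      push_cast
      ring
    · simp [hxy]
  · rw [if_neg h, if_neg (fun h' => h (by rw [← h', neg_neg])), skewUnit_self, skewUnit_self]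
    have h1 : chevalleyFactor X r l =
        2 / (Root.inner r (X.simpleRoot r l) (X.simpleRoot r l) : ℂ) := by
      rw [inner_simpleRoot_self hr hl1 hl]
      cases X
      case C =>
        have : l ≠ r := by
          rintro rfl
          simp [ClassicalType.row, ClassicalType.col] at h
        simp [chevalleyFactor, this]
      case B =>
        simp only [chevalleyFactor]
        split_ifs <;> simp
      all_goals simp [chevalleyFactor]
    ext x y
    simp only [Matrix.smul_apply, Matrix.sub_apply, diagMatrix,
      Matrix.diagonal_apply, corootEntry, weight, h1, smul_zero, sub_zero, add_zero]
    by_cases hxy : x = y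
    · simp only [hxy, if_true, smul_eq_mul]
      push_cast
      ring
    · simp [hxy]

/-- The matrices of the Chevalley generators. -/
def chevalleyMatrices (hr : X.minSize ≤ r) (A : Matrix (Fin (X.rank r)) (Fin (X.rank r)) ℤ)
    (hA : ∀ i j : Fin (X.rank r),
      A i j * Root.inner r (X.simpleRoot r ((j : ℕ) + 1)) (X.simpleRoot r ((j : ℕ) + 1)) =
        2 * Root.inner r (X.simpleRoot r ((i : ℕ) + 1)) (X.simpleRoot r ((j : ℕ) + 1))) :
    ChevalleyMatrices A (Ix r) where
  f i := X.lowering r (i + 1)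
  h i := diagMatrix r (corootEntry X r (i + 1))
  c i := chevalleyFactor X r (i + 1)
  c_ne_zero i := by
    cases X <;> simp only [chevalleyFactor] <;> (try split_ifs) <;> norm_num
  h_ne_zero i h := by
    have hi : (i : ℕ) + 1 ≤ X.rank r := i.2
    have h1 := congrFun (congrFun h ⟨_, abs_le_mem (abs_col_le hr hi)⟩)
        ⟨_, abs_le_mem (abs_col_le hr hi)⟩
    have h2 := inner_simpleRoot_self hr (Nat.le_add_left 1 i) hi
    rw [diagMatrix, Matrix.diagonal_apply_eq, corootEntry, h2] at h1
    rw [Matrix.zero_apply, mul_eq_zero] at h1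
    rcases h1 with h1 | h1
    · cases X <;> simp only at h1 <;> (try split_ifs at h1) <;> norm_num at h1
    · rw [Int.cast_eq_zero] at h1
      cases X <;> simp only [ClassicalType.row, ClassicalType.col, weight] at h1 <;>
        (try split_ifs at h1) <;> omega
  conjTranspose_h i := by
    rw [diagMatrix, Matrix.diagonal_conjTranspose]
    congr 1
    funext x
    simp [corootEntry]
  lie_e_f i := by
    rw [ClassicalType.lowering, conjTranspose_skewUnit]
    exact lie_raising_lowering hr (Nat.le_add_left 1 i) i.2
  lie_e_f_ne i j hij := by
    rw [ClassicalType.lowering, conjTranspose_skewUnit]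
    exact lie_raising_lowering_ne hr (Nat.le_add_left 1 i) i.2 (Nat.le_add_left 1 j) j.2
      fun h => hij (Fin.ext (by omega))
  lie_h_h i j := by
    rw [LieRing.of_associative_ring_bracket, diagMatrix, diagMatrix, Matrix.diagonal_mul_diagonal,
      Matrix.diagonal_mul_diagonal, sub_eq_zero]
    congr 1
    funext x
    exact mul_comm _ _
  lie_h_f i j := by
    have hi : (i : ℕ) + 1 ≤ X.rank r := i.2
    have hj : (j : ℕ) + 1 ≤ X.rank r := j.2
    have h0 :
        (Root.inner r (X.simpleRoot r ((j : ℕ) + 1)) (X.simpleRoot r ((j : ℕ) + 1)) : ℂ) ≠ 0 := by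
      rw [inner_simpleRoot_self hr (Nat.le_add_left 1 j) hj]
      cases X <;> simp only <;> (try split_ifs) <;> norm_num
    have h1 : (A i j : ℂ) * Root.inner r (X.simpleRoot r ((j : ℕ) + 1))
        (X.simpleRoot r ((j : ℕ) + 1)) =
        2 * Root.inner r (X.simpleRoot r ((i : ℕ) + 1)) (X.simpleRoot r ((j : ℕ) + 1)) := by
      exact_mod_cast hA i j
    rw [ClassicalType.lowering, lie_diagMatrix_skewUnit, ← Int.cast_smul_eq_zsmul ℂ]
    · congr 1
      rw [inner_simpleRoot hr (Nat.le_add_left 1 i) hi (Nat.le_add_left 1 j)] at h1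
      rw [corootEntry, corootEntry]
      push_cast at h1 ⊢
      field_simp
      linear_combination h1
    · intro a
      rw [corootEntry, corootEntry, weight_neg, weight_neg]
      push_cast
      ring

/-! ### The matrices of the root vectors -/

section LeftComm

variable {L : Type*} [LieRing L]

theorem leftComm_concat {l : List L} (hl : l ≠ []) (x : L) :
    leftComm (l ++ [x]) = ⁅leftComm l, x⁆ := by
  obtain ⟨a, l, rfl⟩ := List.exists_cons_of_ne_nil hl
  simp [leftComm]

theorem up_eq_nil {a b : ℕ} (h : b < a) : up a b = [] := by
  rw [up, Nat.sub_eq_zero_of_le h, List.range'_zero]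

theorem up_eq_cons {a b : ℕ} (h : a ≤ b) : up a b = a :: up (a + 1) b := by
  rw [up, up, show b + 1 - a = (b - a) + 1 by omega, show b + 1 - (a + 1) = b - a by omega,
    List.range'_succ]

theorem up_concat {a b : ℕ} (h : a ≤ b + 1) : up a (b + 1) = up a b ++ [b + 1] := by
  rw [up, up, show b + 1 + 1 - a = (b + 1 - a) + 1 by omega, List.range'_concat]
  congr 2
  omega

theorem down_eq_nil {a b : ℕ} (h : a < b) : down a b = [] := by
  rw [down, up_eq_nil h, List.reverse_nil]

theorem down_concat {a b : ℕ} (h : b ≤ a) : down a b = down a (b + 1) ++ [b] := by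
  rw [down, up_eq_cons h, List.reverse_cons, down]

theorem down_succ {a b : ℕ} (h : b ≤ a + 1) : down (a + 1) b = (a + 1) :: down a b := by
  rw [down, up_concat h, List.reverse_append]
  rfl

theorem mem_up {a b m : ℕ} : m ∈ up a b ↔ a ≤ m ∧ m ≤ b := by
  rw [up, List.mem_range'_1]
  omega

theorem mem_down {a b m : ℕ} : m ∈ down a b ↔ b ≤ m ∧ m ≤ a := by
  rw [down, List.mem_reverse, mem_up]

theorem leftComm_append_up {l : List L} (hl : l ≠ []) (g : ℕ → L) (P : ℕ → L) {a b : ℕ}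
    (hab : a ≤ b + 1) (h0 : leftComm l = P a)
    (h : ∀ m, a ≤ m → m ≤ b → ⁅P m, g m⁆ = P (m + 1)) :
    leftComm (l ++ (up a b).map g) = P (b + 1) := by
  induction b with
  | zero =>
    rcases Nat.lt_or_ge 0 a with ha | ha
    · obtain rfl : a = 1 := by omega
      simpa [up_eq_nil] using h0
    · obtain rfl : a = 0 := by omega
      have : up 0 0 = [0] := rfl
      rw [this, List.map_singleton, leftComm_concat hl, h0, h 0 le_rfl le_rfl]
  | succ b ih =>
    rcases Nat.lt_or_ge (b + 1) a with ha | ha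
    · obtain rfl : a = b + 1 + 1 := by omega
      rw [up_eq_nil (by omega), List.map_nil, List.append_nil, h0]
    · rw [up_concat ha, List.map_append, ← List.append_assoc, List.map_singleton,
        leftComm_concat (by simp [hl]), ih ha fun m h1 h2 => h m h1 (by omega), h _ ha le_rfl]

theorem leftComm_append_down {l : List L} (hl : l ≠ []) (g : ℕ → L) (P : ℕ → L) {a b : ℕ}
    (hab : b ≤ a + 1) (h0 : leftComm l = P (a + 1))
    (h : ∀ m, b ≤ m → m ≤ a → ⁅P (m + 1), g m⁆ = P m) :
    leftComm (l ++ (down a b).map g) = P b := by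
  obtain ⟨d, hd⟩ : ∃ d, b + d = a + 1 := ⟨a + 1 - b, by omega⟩
  induction d generalizing b with
  | zero =>
    obtain rfl : b = a + 1 := by omega
    rw [down_eq_nil (by omega), List.map_nil, List.append_nil, h0]
  | succ d ih =>
    rw [down_concat (by omega), List.map_append, ← List.append_assoc, List.map_singleton,
      leftComm_concat (by simp [hl]), ih (b := b + 1) (by omega) (fun m h1 h2 => h m (by omega) h2)
        (by omega), h _ le_rfl (by omega)]

theorem map_leftComm {R L' : Type*} [CommRing R] [LieAlgebra R L] [LieRing L'] [LieAlgebra R L']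
    (φ : L →ₗ⁅R⁆ L') (l : List L) : φ (leftComm l) = leftComm (l.map φ) := by
  induction l using List.reverseRecOn with
  | nil => exact map_zero φ
  | append_singleton l x ih =>
    rcases eq_or_ne l [] with rfl | hl
    · rfl
    · rw [leftComm_concat hl, List.map_append, List.map_singleton, leftComm_concat (by simpa),
        LieHom.map_lie, ih]

end LeftComm

variable {X : ClassicalType} {r : ℕ}

theorem lie_skewUnit_of_eq {a b d : ℤ} (ha : |a| ≤ r) (hb : |b| ≤ r) (hd : |d| ≤ r)
    (h0 : X = .C → a ≠ 0 ∧ b ≠ 0 ∧ d ≠ 0) (h1 : d ≠ a) (h2 : b ≠ -d) (h3 : -b ≠ a) :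
    ⁅skewUnit X r a b, skewUnit X r b d⁆ = skewUnit X r a d := by
  rw [lie_skewUnit X ha hb hb hd fun h => ⟨(h0 h).1, (h0 h).2.1, (h0 h).2.1, (h0 h).2.2⟩,
    if_pos rfl,
    if_neg h1, if_neg h2, if_neg h3]
  simp

theorem lie_skewUnit_of_eq' {a b c : ℤ} (ha : |a| ≤ r) (hb : |b| ≤ r) (hc : |c| ≤ r)
    (h0 : X = .C → a ≠ 0 ∧ b ≠ 0 ∧ c ≠ 0) (h1 : b ≠ c) (h2 : b ≠ -a) (h3 : -c ≠ a) :
    ⁅skewUnit X r a b, skewUnit X r c a⁆ = -skewUnit X r c b := by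
  rw [lie_skewUnit X ha hb hc ha fun h => ⟨(h0 h).1, (h0 h).2.1, (h0 h).2.2, (h0 h).1⟩, if_pos rfl,
    if_neg h1, if_neg h2, if_neg h3]
  simp

theorem lie_skewUnit_neg {b c d : ℤ} (hb : |b| ≤ r) (hc : |c| ≤ r) (hd : |d| ≤ r)
    (h0 : X = .C → b ≠ 0 ∧ c ≠ 0 ∧ d ≠ 0) (h1 : b ≠ c) (h2 : d ≠ -c) (h3 : b ≠ -d) (hc0 : 0 ≤ c)
    (hd0 : 0 ≤ d) :
    ⁅skewUnit X r (-c) b, skewUnit X r c d⁆ = skewUnit X r (-d) b := by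
  rw [lie_skewUnit X (by rwa [abs_neg]) hb hc hd fun h => ⟨neg_ne_zero.2 (h0 h).2.1, (h0 h).1,
    (h0 h).2.1, (h0 h).2.2⟩, if_pos rfl,
    if_neg h1, if_neg h2, if_neg h3, formSign_pos X hc0, formSign_pos X hd0]
  simp

/-- The first index in the name of a root. -/
def Root.fst : Root → ℕ
  | .diff i _ => i
  | .sum i _ => i
  | .single i => i
  | .double i => i

/-- The root `β` is the difference of the weights `weight β.fst` and `weight β.tgt`. -/
def Root.tgt : Root → ℤ
  | .diff _ j => j
  | .sum _ j => -j
  | .single _ => 0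
  | .double i => -i

/-- The positive roots. -/
def ClassicalType.IsPos : ClassicalType → ℕ → Root → Prop
  | .A, r, .diff i j => 1 ≤ i ∧ i < j ∧ j ≤ r
  | .B, r, .diff i j => 1 ≤ i ∧ i < j ∧ j ≤ r
  | .B, r, .sum i j => 1 ≤ i ∧ i < j ∧ j ≤ r
  | .B, r, .single i => 1 ≤ i ∧ i ≤ r
  | .C, r, .diff i j => 1 ≤ i ∧ i < j ∧ j ≤ r
  | .C, r, .sum i j => 1 ≤ i ∧ i < j ∧ j ≤ r
  | .C, r, .double i => 1 ≤ i ∧ i ≤ r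
  | .D, r, .diff j i => 1 ≤ i ∧ i < j ∧ j ≤ r
  | .D, r, .sum j i => 1 ≤ i ∧ i < j ∧ j ≤ r
  | _, _, _ => False

/-- The coefficient of the matrix of `F_β` with respect to a basic matrix. -/
def ClassicalType.rootScalar : ClassicalType → ℕ → Root → ℂ
  | .B, _, .sum i j => (-1) ^ ((j - i + 1).choose 2 + (j - i) + 1)
  | .C, _, .sum i j => 2 * (-1) ^ (j - i)
  | .C, r, .double i => if i = r then 1 / 2 else 1
  | .D, _, .diff j i => (-1) ^ (j - i - 1)
  | .D, _, .sum j _ => (-1) ^ j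
  | _, _, _ => 1

theorem rootScalar_ne_zero (β : Root) : X.rootScalar r β ≠ 0 := by
  cases X <;> cases β <;> simp only [ClassicalType.rootScalar] <;> (try split_ifs) <;> simp

/-- The matrix of the root vector `F_β`. -/
def ClassicalType.rootMatrix (X : ClassicalType) (r : ℕ) (β : Root) : Matrix (Ix r) (Ix r) ℂ :=
  X.rootScalar r β • skewUnit X r β.tgt β.fst

theorem neg_one_pow_eq {a b : ℕ} (h : a % 2 = b % 2) : (-1 : ℂ) ^ a = (-1) ^ b := by
  rw [neg_one_pow_eq_pow_mod_two, h, ← neg_one_pow_eq_pow_mod_two]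

theorem leftComm_lowering_diff (hX : X ≠ .D) {i j : ℕ} (hi : 1 ≤ i) (hij : i < j) (hj : j ≤ r) :
    leftComm ((down (j - 1) i).map (X.lowering r)) = skewUnit X r j i := by
  obtain ⟨j, rfl⟩ : ∃ m, j = m + 1 := ⟨j - 1, by omega⟩
  obtain ⟨j, rfl⟩ : ∃ m, j = m + 1 := ⟨j - 1, by omega⟩
  have hlow : ∀ m : ℕ, m < r → X.lowering r m = skewUnit X r (m + 1) m := by
    intro m hm
    cases X
    all_goals try exact absurd rfl hX
    all_goals simp only [ClassicalType.lowering, ClassicalType.row, ClassicalType.col]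
    all_goals rw [if_neg (by omega)]
  rw [Nat.add_sub_cancel, down_succ (by omega), List.map_cons]
  refine leftComm_append_down (l := [X.lowering r (j + 1)]) (by simp) _
    (fun m => skewUnit X r ((j + 1 + 1 : ℕ) : ℤ) m) (by omega) ?_ ?_
  · exact_mod_cast hlow (j + 1) (by omega)
  · intro m h1 h2
    rw [hlow m (by omega)]
    push_cast
    exact lie_skewUnit_of_eq (abs_le.2 ⟨by omega, by omega⟩) (abs_le.2 ⟨by omega, by omega⟩)
      (abs_le.2 ⟨by omega, by omega⟩) (fun _ => by omega) (by omega) (by omega) (by omega)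

/-- The commutators with the generators `f_i, …, f_{r-1}` in types `B` and `C`. -/
theorem leftComm_lowering_up (hX : X = .B ∨ X = .C) {i : ℕ} (hi : 1 ≤ i) (hir : i < r) :
    leftComm ((up i (r - 1)).map (X.lowering r)) = (-1 : ℂ) ^ (r - i - 1) • skewUnit X r r i := by
  obtain ⟨r, rfl⟩ : ∃ m, r = m + 1 := ⟨r - 1, by omega⟩
  have hlow : ∀ m : ℕ, m < r + 1 → X.lowering (r + 1) m = skewUnit X (r + 1) (m + 1) m := by
    intro m hm
    rcases hX with rfl | rfl <;>
      simp only [ClassicalType.lowering, ClassicalType.row, ClassicalType.col] <;>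
      rw [if_neg (by omega)]
  rw [Nat.add_sub_cancel, up_eq_cons (by omega), List.map_cons]
  refine leftComm_append_up (l := [X.lowering (r + 1) i]) (by simp) _
    (fun m => (-1 : ℂ) ^ (m - i - 1) • skewUnit X (r + 1) m i) (by omega) ?_ ?_
  · rw [show i + 1 - i - 1 = 0 by omega, pow_zero, one_smul]
    exact_mod_cast hlow i (by omega)
  · intro m h1 h2
    rw [hlow m (by omega), smul_lie, lie_skewUnit_of_eq' (abs_le.2 ⟨by omega, by omega⟩)
      (abs_le.2 ⟨by omega, by omega⟩) (abs_le.2 ⟨by omega, by omega⟩) (fun _ => by omega)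
      (by omega) (by omega) (by omega), show m + 1 - i - 1 = (m - i - 1) + 1 by omega, pow_succ]
    simp

theorem leftComm_lowering_B_single {i : ℕ} (hi : 1 ≤ i) (hir : i ≤ r) :
    leftComm ((down r i).map (ClassicalType.B.lowering r)) = skewUnit .B r 0 i := by
  obtain ⟨r, rfl⟩ : ∃ m, r = m + 1 := ⟨r - 1, by omega⟩
  rw [down_succ (by omega), List.map_cons]
  refine leftComm_append_down (l := [ClassicalType.B.lowering (r + 1) (r + 1)]) (by simp) _
    (fun m => skewUnit .B (r + 1) 0 m) (by omega) ?_ ?_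
  · simp [leftComm, ClassicalType.lowering, ClassicalType.row, ClassicalType.col]
  · intro m h1 h2
    have hlow : ClassicalType.B.lowering (r + 1) m = skewUnit .B (r + 1) (m + 1) m := by
      simp only [ClassicalType.lowering, ClassicalType.row, ClassicalType.col]
      rw [if_neg (by omega)]
    rw [hlow]
    push_cast
    exact lie_skewUnit_of_eq (abs_le.2 ⟨by omega, by omega⟩) (abs_le.2 ⟨by omega, by omega⟩)
      (abs_le.2 ⟨by omega, by omega⟩) (fun h => by simp at h) (by omega) (by omega) (by omega)

theorem leftComm_lowering_B_sum {i j : ℕ} (hi : 1 ≤ i) (hij : i < j) (hj : j ≤ r) :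
    leftComm ((up i r ++ down r j).map (ClassicalType.B.lowering r)) =
      (-1 : ℂ) ^ (r - i) • skewUnit .B r (-j) i := by
  obtain ⟨r, rfl⟩ : ∃ m, r = m + 1 := ⟨r - 1, by omega⟩
  have h1 := leftComm_lowering_up (X := .B) (r := r + 1) (Or.inl rfl) hi (by omega)
  rw [Nat.add_sub_cancel] at h1
  have hne : (up i r).map (ClassicalType.B.lowering (r + 1)) ≠ [] := by
    rw [up_eq_cons (by omega)]; simp
  have hlast : ClassicalType.B.lowering (r + 1) (r + 1) = skewUnit .B (r + 1) 0 (r + 1 : ℕ) := by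
    simp [ClassicalType.lowering, ClassicalType.row, ClassicalType.col]
  rw [up_concat (by omega), down_succ (by omega), List.append_assoc, List.map_append,
    List.singleton_append, List.map_cons, List.map_cons, List.append_cons, List.append_cons]
  refine leftComm_append_down (by simp) _
    (fun m => (-1 : ℂ) ^ (r + 1 - i) • skewUnit .B (r + 1) (-m) i) (by omega) ?_ ?_
  · rw [leftComm_concat (by simp), leftComm_concat hne, h1, hlast, smul_lie, lie_skewUnit_of_eq'
      (abs_le.2 ⟨by omega, by omega⟩) (abs_le.2 ⟨by omega, by omega⟩)
        (abs_le.2 ⟨by omega, by omega⟩)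
      (fun _ => by simp_all) (by omega) (by omega) (by omega), smul_neg, neg_lie, smul_lie]
    have h2 := lie_skewUnit_neg (X := .B) (r := r + 1) (b := i) (c := 0) (d := (r + 1 : ℕ))
      (abs_le.2 ⟨by omega, by omega⟩) (abs_le.2 ⟨by omega, by omega⟩)
        (abs_le.2 ⟨by omega, by omega⟩)
      (fun h => by simp at h) (by omega) (by omega) (by omega) le_rfl (by omega)
    rw [neg_zero] at h2
    rw [h2, show r + 1 - i = (r + 1 - i - 1) + 1 by omega, pow_succ]
    simp
  · intro m h1 h2
    have hlow : ClassicalType.B.lowering (r + 1) m = skewUnit .B (r + 1) (m + 1 : ℕ) m := by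
      simp only [ClassicalType.lowering, ClassicalType.row, ClassicalType.col]
      rw [if_neg (by omega)]
      push_cast
      rfl
    rw [hlow, smul_lie]
    congr 1
    exact lie_skewUnit_neg (abs_le.2 ⟨by omega, by omega⟩) (abs_le.2 ⟨by omega, by omega⟩)
      (abs_le.2 ⟨by omega, by omega⟩) (fun h => by simp at h) (by omega) (by omega) (by omega)
      (by omega) (by omega)

theorem leftComm_lowering_C {i j : ℕ} (hi : 1 ≤ i) (hij : i ≤ j) (hir : i < r) (hj : j ≤ r) :
    leftComm ((up i r ++ down (r - 1) j).map (ClassicalType.C.lowering r)) =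
      (2 * (-1 : ℂ) ^ (r - i)) • skewUnit .C r (-j) i := by
  obtain ⟨r, rfl⟩ : ∃ m, r = m + 1 := ⟨r - 1, by omega⟩
  have h1 := leftComm_lowering_up (X := .C) (r := r + 1) (Or.inr rfl) hi (by omega)
  rw [Nat.add_sub_cancel] at h1 ⊢
  have hne : (up i r).map (ClassicalType.C.lowering (r + 1)) ≠ [] := by
    rw [up_eq_cons (by omega)]; simp
  have hlast : ClassicalType.C.lowering (r + 1) (r + 1) =
      skewUnit .C (r + 1) (-(r + 1 : ℕ)) (r + 1 : ℕ) := by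
    simp [ClassicalType.lowering, ClassicalType.row, ClassicalType.col]
  rw [up_concat (by omega), List.map_append, List.map_append, List.map_singleton]
  refine leftComm_append_down (by simp) _
    (fun m => (2 * (-1 : ℂ) ^ (r + 1 - i)) • skewUnit .C (r + 1) (-m) i) (by omega) ?_ ?_
  · have s1 : formSign .C (-((r + 1 : ℕ) : ℤ)) = -1 := if_pos (by omega)
    rw [leftComm_concat hne, h1, hlast, smul_lie, lie_skewUnit .C
      (abs_le.2 ⟨by omega, by omega⟩) (abs_le.2 ⟨by omega, by omega⟩)
        (abs_le.2 ⟨by omega, by omega⟩)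
      (abs_le.2 ⟨by omega, by omega⟩) (fun _ => by omega), if_neg (by omega), if_pos rfl,
      if_neg (by omega), if_pos (neg_neg _), s1, formSign_pos .C (by omega),
      show r + 1 - i = (r + 1 - i - 1) + 1 by omega, pow_succ]
    simp only [smul_zero, sub_zero, zero_sub, mul_one, neg_smul, one_smul, Nat.add_sub_cancel]
    rw [← neg_add, ← two_smul ℂ, smul_neg, smul_smul, ← neg_smul]
    congr 1
    ring
  · intro m h1 h2
    have hlow : ClassicalType.C.lowering (r + 1) m = skewUnit .C (r + 1) (m + 1 : ℕ) m := by
      simp only [ClassicalType.lowering, ClassicalType.row, ClassicalType.col]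
      rw [if_neg (by omega)]
      push_cast
      rfl
    rw [hlow, smul_lie]
    congr 1
    exact lie_skewUnit_neg (abs_le.2 ⟨by omega, by omega⟩) (abs_le.2 ⟨by omega, by omega⟩)
      (abs_le.2 ⟨by omega, by omega⟩) (fun _ => by omega) (by omega) (by omega) (by omega)
      (by omega) (by omega)

theorem lowering_D {m : ℕ} (hm : 2 ≤ m) :
    ClassicalType.D.lowering r m = skewUnit .D r ((m - 1 : ℕ) : ℤ) m := by
  simp only [ClassicalType.lowering, ClassicalType.row, ClassicalType.col]
  rw [if_neg (by omega), if_neg (by omega)]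
  congr 1
  omega

theorem lowering_D_one : ClassicalType.D.lowering r 1 = skewUnit .D r (-1) 2 := rfl

theorem leftComm_lowering_D_diff {i j : ℕ} (hi : 1 ≤ i) (hij : i < j) (hj : j ≤ r) :
    leftComm ((down j (i + 1)).map (ClassicalType.D.lowering r)) =
      (-1 : ℂ) ^ (j - i - 1) • skewUnit .D r i j := by
  obtain ⟨j, rfl⟩ : ∃ m, j = m + 1 := ⟨j - 1, by omega⟩
  rw [down_succ (by omega), List.map_cons]
  refine leftComm_append_down (l := [ClassicalType.D.lowering r (j + 1)]) (by simp) _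
    (fun m => (-1 : ℂ) ^ (j + 1 - m) • skewUnit .D r ((m - 1 : ℕ) : ℤ) (j + 1 : ℕ)) (by omega) ?_ ?_
  · rw [leftComm, List.foldl_nil, lowering_D (by omega)]
    simp
  · intro m h1 h2
    rw [lowering_D (by omega), smul_lie, Nat.add_sub_cancel, lie_skewUnit_of_eq'
      (abs_le.2 ⟨by omega, by omega⟩)
      (abs_le.2 ⟨by omega, by omega⟩) (abs_le.2 ⟨by omega, by omega⟩) (fun h => by simp at h)
      (by omega) (by omega) (by omega), show j + 1 - m = (j + 1 - (m + 1)) + 1 by omega, pow_succ]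
    simp

theorem leftComm_lowering_D_sum_one {j : ℕ} (hij : 1 < j) (hj : j ≤ r) :
    leftComm ((down j 3 ++ [1]).map (ClassicalType.D.lowering r)) =
      (-1 : ℂ) ^ j • skewUnit .D r (-1) j := by
  rcases Nat.lt_or_ge j 3 with h | h
  · obtain rfl : j = 2 := by omega
    rw [down_eq_nil (by omega)]
    simp [leftComm, lowering_D_one]
  · rw [List.map_append, List.map_singleton, leftComm_concat (by
      rw [down_concat h]; simp), leftComm_lowering_D_diff (i := 2) (by omega) (by omega) hj,
      lowering_D_one, smul_lie, Nat.cast_ofNat, lie_skewUnit_of_eq' (abs_le.2 ⟨by omega, by omega⟩)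
      (abs_le.2 ⟨by omega, by omega⟩) (abs_le.2 ⟨by omega, by omega⟩) (fun h => by simp at h)
      (by omega) (by omega) (by omega), smul_neg, ← neg_smul]
    congr 1
    rw [show j = (j - 2 - 1) + 3 by omega, pow_add]
    simp
    ring

theorem leftComm_lowering_D_sum {i j : ℕ} (hi : 2 ≤ i) (hij : i < j) (hj : j ≤ r) :
    leftComm ((down j 1 ++ up 3 i).map (ClassicalType.D.lowering r)) =
      (-1 : ℂ) ^ j • skewUnit .D r (-i) j := by
  have hne : (down j 2).map (ClassicalType.D.lowering r) ≠ [] := by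
    rw [down_concat (by omega)]; simp
  rw [down_concat (by omega), List.map_append, List.map_append, List.map_singleton]
  have h1 := leftComm_append_up (a := 3) (b := i)
    (l := (down j 2).map (ClassicalType.D.lowering r) ++ [ClassicalType.D.lowering r 1])
    (by simp) (ClassicalType.D.lowering r)
    (fun m => (-1 : ℂ) ^ j • skewUnit .D r (-((m - 1 : ℕ) : ℤ)) j) (by omega) ?_ ?_
  · simpa using h1
  · rw [leftComm_concat hne, leftComm_lowering_D_diff (i := 1) le_rfl (by omega) hj,
      lowering_D_one, smul_lie, show j = (j - 1 - 1) + 2 by omega, pow_add]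
    have h2 := lie_skewUnit (r := r) .D (a := 1) (b := j) (c := -1) (d := 2)
      (abs_le.2 ⟨by omega, by omega⟩) (abs_le.2 ⟨by omega, by omega⟩)
      (abs_le.2 ⟨by omega, by omega⟩) (abs_le.2 ⟨by omega, by omega⟩) (fun h => by simp at h)
    rw [if_neg (by omega), if_neg (by omega), if_neg (by omega), if_pos (by omega)] at h2
    rw [← show j = (j - 1 - 1) + 2 by omega, Nat.cast_one, h2]
    simp [formSign]
  · intro m h1 h2
    rw [lowering_D (by omega), smul_lie, lie_skewUnit_neg (abs_le.2 ⟨by omega, by omega⟩)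
      (abs_le.2 ⟨by omega, by omega⟩)
      (abs_le.2 ⟨by omega, by omega⟩) (fun h => by simp at h) (by omega) (by omega) (by omega)
      (by omega) (by omega), Nat.add_sub_cancel]

/-- The iterated commutator of lowering matrices that defines a root vector is the root matrix. -/
theorem leftComm_lowering_word {β : Root} (hβ : X.IsPos r β) :
    X.wordCoeff r β • leftComm ((X.word r β).map (X.lowering r)) = X.rootMatrix r β := by
  cases X <;> cases β <;> simp only [ClassicalType.IsPos] at hβ <;>
    simp only [ClassicalType.wordCoeff, ClassicalType.word, ClassicalType.rootMatrix,
      ClassicalType.rootScalar, one_smul, Root.fst, Root.tgt]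
  case A.diff i j => exact leftComm_lowering_diff (by simp) hβ.1 hβ.2.1 hβ.2.2
  case B.diff i j => exact leftComm_lowering_diff (by simp) hβ.1 hβ.2.1 hβ.2.2
  case C.diff i j => exact leftComm_lowering_diff (by simp) hβ.1 hβ.2.1 hβ.2.2
  case B.single i => exact leftComm_lowering_B_single hβ.1 hβ.2
  case B.sum i j =>
    rw [leftComm_lowering_B_sum hβ.1 hβ.2.1 hβ.2.2, smul_smul, ← pow_add]
    congr 1
    exact neg_one_pow_eq (by omega)
  case C.sum i j =>
    rw [leftComm_lowering_C hβ.1 hβ.2.1.le (by omega) hβ.2.2, smul_smul, mul_left_comm, ← pow_add]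
    congr 2
    exact neg_one_pow_eq (by omega)
  case C.double i =>
    split_ifs with h
    · subst h
      have h1 : up i i = [i] := by rw [up_eq_cons le_rfl, up_eq_nil (by omega)]
      rw [down_eq_nil (by omega), h1]
      simp [leftComm, ClassicalType.lowering, ClassicalType.row, ClassicalType.col]
    · rw [leftComm_lowering_C hβ.1 le_rfl (by omega) hβ.2, smul_smul]
      congr 1
      have : (-1 : ℂ) ^ (r - i) * (-1) ^ (r - i) = 1 := by rw [← mul_pow]; simp
      linear_combination this
  case D.diff j i => exact leftComm_lowering_D_diff hβ.1 hβ.2.1 hβ.2.2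
  case D.sum j i =>
    split_ifs with h
    · subst h
      exact leftComm_lowering_D_sum_one hβ.2.1 hβ.2.2
    · exact leftComm_lowering_D_sum (by omega) hβ.2.1 hβ.2.2

variable {X : ClassicalType} {r : ℕ}

/-! ### The order of the positive roots -/

theorem mem_posRoots {β : Root} : β ∈ X.posRoots r ↔ X.IsPos r β := by
  cases X <;> cases β <;>
    simp [ClassicalType.posRoots, ClassicalType.IsPos, mem_up, mem_down] <;> omega

/-- The first of two numbers by which the positive roots are ordered lexicographically. -/
def ClassicalType.blockKey : ClassicalType → Root → ℤ
  | .A, β => β.fst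
  | .B, β => -β.fst
  | .C, β => -β.fst
  | .D, β => β.fst

/-- The second of two numbers by which the positive roots are ordered lexicographically. -/
def ClassicalType.innerKey : ClassicalType → ℕ → Root → ℤ
  | .A, _, .diff _ j => j
  | .D, _, .diff _ i => i
  | .D, _, .sum _ i => -i
  | _, _, .sum _ j => j
  | _, r, .diff _ j => 2 * r + 2 - j
  | _, r, _ => r + 1

/-- The order of the positive roots. -/
def ClassicalType.Precedes (X : ClassicalType) (r : ℕ) (β γ : Root) : Prop :=
  X.blockKey β < X.blockKey γ ∨ X.blockKey β = X.blockKey γ ∧ X.innerKey r β < X.innerKey r γ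

theorem pairwise_lt_up (a b : ℕ) : (up a b).Pairwise (· < ·) := List.pairwise_lt_range' ..

theorem pairwise_gt_down (a b : ℕ) : (down a b).Pairwise (· > ·) :=
  List.pairwise_reverse.2 (pairwise_lt_up b a)

/-- The list of positive roots is sorted. -/
theorem pairwise_posRoots : (X.posRoots r).Pairwise (X.Precedes r) := by
  cases X
  case A =>
    refine List.pairwise_flatMap.2 ⟨fun i _ => ?_, ?_⟩
    · rw [List.pairwise_map]
      refine (pairwise_lt_up _ _).imp fun {a b} h => Or.inr ⟨rfl, ?_⟩
      simpa [ClassicalType.innerKey] using h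
    · refine (pairwise_lt_up _ _).imp fun {a b} h => ?_
      simp only [List.mem_map]
      rintro _ ⟨x, -, rfl⟩ _ ⟨y, -, rfl⟩
      exact Or.inl (by simpa [ClassicalType.blockKey, Root.fst] using h)
  case D =>
    refine List.pairwise_flatMap.2 ⟨fun i _ => ?_, ?_⟩
    · rw [List.pairwise_append, List.pairwise_map, List.pairwise_map]
      refine ⟨?_, ?_, ?_⟩
      · refine (pairwise_gt_down _ _).imp fun {a b} h => Or.inr ⟨rfl, ?_⟩
        simpa [ClassicalType.innerKey] using h
      · refine (pairwise_lt_up _ _).imp fun {a b} h => Or.inr ⟨rfl, ?_⟩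
        simpa [ClassicalType.innerKey] using h
      · simp only [List.mem_map, mem_up, mem_down]
        rintro _ ⟨x, hx, rfl⟩ _ ⟨y, hy, rfl⟩
        refine Or.inr ⟨rfl, ?_⟩
        simp only [ClassicalType.innerKey]
        omega
    · refine (pairwise_lt_up _ _).imp fun {a b} h => ?_
      intro β hβ γ hγ
      have h1 : β.fst = a := by
        simp only [List.mem_append, List.mem_map] at hβ
        obtain ⟨x, -, rfl⟩ | ⟨x, -, rfl⟩ := hβ <;> rfl
      have h2 : γ.fst = b := by
        simp only [List.mem_append, List.mem_map] at hγ
        obtain ⟨x, -, rfl⟩ | ⟨x, -, rfl⟩ := hγ <;> rfl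
      exact Or.inl (by simpa [ClassicalType.blockKey, h1, h2] using h)
  all_goals
    refine List.pairwise_flatMap.2 ⟨fun i _ => ?_, ?_⟩
    · rw [List.pairwise_append, List.pairwise_append, List.pairwise_map, List.pairwise_map]
      refine ⟨⟨?_, List.pairwise_singleton _ _, ?_⟩, ?_, ?_⟩
      · refine (pairwise_lt_up _ _).imp fun {a b} h => Or.inr ⟨rfl, ?_⟩
        simpa [ClassicalType.innerKey] using h
      · simp only [List.mem_map, List.mem_singleton, mem_up]
        rintro _ ⟨x, hx, rfl⟩ _ rfl
        refine Or.inr ⟨rfl, ?_⟩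
        simp only [ClassicalType.innerKey]
        omega
      · refine (pairwise_gt_down _ _).imp fun {a b} h => Or.inr ⟨rfl, ?_⟩
        simpa [ClassicalType.innerKey] using h
      · simp only [List.mem_append, List.mem_map, List.mem_singleton, mem_up, mem_down]
        rintro _ (⟨x, hx, rfl⟩ | rfl) _ ⟨y, hy, rfl⟩
        all_goals
          refine Or.inr ⟨rfl, ?_⟩
          simp only [ClassicalType.innerKey]
          omega
    · refine (pairwise_gt_down _ _).imp fun {a b} h => ?_
      intro β hβ γ hγ
      have h1 : β.fst = a := by
        simp only [List.mem_append, List.mem_map, List.mem_singleton] at hβ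
        obtain (⟨x, -, rfl⟩ | rfl) | ⟨x, -, rfl⟩ := hβ <;> rfl
      have h2 : γ.fst = b := by
        simp only [List.mem_append, List.mem_map, List.mem_singleton] at hγ
        obtain (⟨x, -, rfl⟩ | rfl) | ⟨x, -, rfl⟩ := hγ <;> rfl
      exact Or.inl (by simpa [ClassicalType.blockKey, h1, h2] using h)

theorem isPos_root (j : Fin (X.posRoots r).length) : X.IsPos r (X.root r j) :=
  mem_posRoots.1 (List.get_mem _ _)

theorem exists_root_eq {β : Root} (h : X.IsPos r β) : ∃ j, X.root r j = β :=
  List.get_of_mem (mem_posRoots.2 h)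

theorem precedes_root {i j : Fin (X.posRoots r).length} (h : i < j) :
    X.Precedes r (X.root r i) (X.root r j) :=
  List.pairwise_iff_get.1 pairwise_posRoots _ _ h

theorem root_injective : Function.Injective (X.root r) := by
  intro i j h
  by_contra hij
  have h1 : ∀ β, ¬ X.Precedes r β β := fun β h => by
    unfold ClassicalType.Precedes at h
    omega
  rcases lt_or_gt_of_ne hij with h' | h'
  · have := precedes_root h'
    rw [h] at this
    exact h1 _ this
  · have := precedes_root h'
    rw [h] at this
    exact h1 _ this

theorem blockKey_mono {i j : Fin (X.posRoots r).length} (h : i ≤ j) :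
    X.blockKey (X.root r i) ≤ X.blockKey (X.root r j) := by
  rcases h.lt_or_eq with h | rfl
  · rcases precedes_root h with h | h
    · exact h.le
    · exact h.1.le
  · exact le_rfl

theorem mem_word {β : Root} (hβ : X.IsPos r β) {l : ℕ} (hl : l ∈ X.word r β) :
    1 ≤ l ∧ l ≤ X.rank r := by
  cases X <;> cases β <;> simp only [ClassicalType.IsPos] at hβ <;>
    simp only [ClassicalType.word, ClassicalType.rank, List.mem_append, mem_up, mem_down] at hl ⊢
  case D.sum j i =>
    split_ifs at hl
    · simp only [List.mem_append, mem_down, List.mem_singleton] at hl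
      omega
    · simp only [List.mem_append, mem_down, mem_up] at hl
      omega
  all_goals omega

theorem word_ne_nil {β : Root} (hβ : X.IsPos r β) : X.word r β ≠ [] := by
  cases X <;> cases β <;> simp only [ClassicalType.IsPos] at hβ <;>
    simp only [ClassicalType.word]
  case D.sum j i =>
    split_ifs
    · simp
    · rw [down_concat (by omega)]
      simp
  all_goals first
    | (rw [down_concat (by omega)]; simp)
    | (rw [up_eq_cons (by omega)]; simp)

theorem deg_ne_zero (j : Fin (X.posRoots r).length) : X.deg r (X.root r j) ≠ 0 := by
  intro h
  obtain ⟨l, hl⟩ := List.exists_mem_of_ne_nil _ (word_ne_nil (isPos_root j))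
  obtain ⟨h1, h2⟩ := mem_word (isPos_root j) hl
  have h3 := congrFun h ⟨l - 1, by omega⟩
  simp only [ClassicalType.deg, Pi.zero_apply, List.count_eq_zero, Nat.sub_add_cancel h1] at h3
  exact h3 hl

/-! ### The root vectors span -/

instance : Neg (Ix r) := ⟨fun x => ⟨-x.1, abs_le_mem (by rw [abs_neg]; exact x.abs_le)⟩⟩

theorem Ix.coe_neg (x : Ix r) : (-x).1 = -x.1 := rfl

theorem Ix.neg_neg (x : Ix r) : - -x = x := Subtype.ext (_root_.neg_neg x.1)

/-- The rows and columns in which the matrices in the image of `𝔫` have nonzero entries, for a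
suitable order of the index set: `1, …, r, 0, -r, …, -1` for types `B` and `C` (and for type `A`
with separate blocks for both signs), and `-r, …, r` for type `D`. -/
def IsLower : ClassicalType → ℕ → ℤ → ℤ → Prop
  | .A, _, a, b => b < a ∧ (0 < b ∨ a < 0)
  | .B, r, a, b => (if 0 < b then b else if b = 0 then r + 1 else 2 * r + 2 + b) <
      if 0 < a then a else if a = 0 then r + 1 else 2 * r + 2 + a
  | .C, r, a, b => (if 0 < b then b else 2 * r + 2 + b) < (if 0 < a then a else 2 * r + 2 + a) ∧
      a ≠ 0 ∧ b ≠ 0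
  | .D, _, a, b => a < b ∧ a ≠ 0 ∧ b ≠ 0

theorem IsLower.trans {a b c : ℤ} (h : IsLower X r a b) (h' : IsLower X r b c) :
    IsLower X r a c := by
  cases X <;> simp only [IsLower] at * <;> (try split_ifs at *) <;> omega

/-- The matrices that belong to the orthogonal or symplectic Lie algebra and are triangular in the
sense of `IsLower`. -/
def lowerMatrices (X : ClassicalType) (r : ℕ) : LieSubalgebra ℂ (Matrix (Ix r) (Ix r) ℂ) where
  carrier := {M | (∀ x y, M (-y) (-x) = -(formSign X (-x.1) * formSign X (-y.1)) * M x y) ∧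
    ∀ x y, M x y ≠ 0 → IsLower X r x.1 y.1}
  zero_mem' := ⟨by simp, by simp⟩
  add_mem' := by
    rintro M N ⟨h1, h2⟩ ⟨h3, h4⟩
    refine ⟨fun x y => ?_, fun x y h => ?_⟩
    · rw [Matrix.add_apply, Matrix.add_apply, h1, h3]
      ring
    · by_cases h5 : M x y = 0
      · rw [Matrix.add_apply, h5, zero_add] at h
        exact h4 x y h
      · exact h2 x y h5
  smul_mem' := by
    rintro c M ⟨h1, h2⟩
    refine ⟨fun x y => ?_, fun x y h => h2 x y fun h5 => h ?_⟩
    · rw [Matrix.smul_apply, Matrix.smul_apply, h1, smul_eq_mul, smul_eq_mul]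
      ring
    · rw [Matrix.smul_apply, h5, smul_zero]
  lie_mem' := by
    rintro M N ⟨h1, h2⟩ ⟨h3, h4⟩
    have key : ∀ (M N : Matrix (Ix r) (Ix r) ℂ),
        (∀ x y, M (-y) (-x) = -(formSign X (-x.1) * formSign X (-y.1)) * M x y) →
        (∀ x y, N (-y) (-x) = -(formSign X (-x.1) * formSign X (-y.1)) * N x y) → ∀ x y,
        (M * N) (-y) (-x) = (formSign X (-x.1) * formSign X (-y.1)) * (N * M) x y := by
      intro M N h1 h3 x y
      rw [Matrix.mul_apply, Matrix.mul_apply, Finset.mul_sum]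
      refine Finset.sum_bij' (fun z _ => -z) (fun z _ => -z) (by simp) (by simp)
        (fun z _ => z.neg_neg) (fun z _ => z.neg_neg) fun z _ => ?_
      have e1 := h1 (-z) y
      have e3 := h3 x (-z)
      rw [z.neg_neg] at e1 e3
      rw [e1, e3]
      linear_combination (formSign X (-x.1) * formSign X (-y.1) * M (-z) y * N x (-z)) *
        formSign_mul_self X (-(-z).1)
    have key2 : ∀ (M N : Matrix (Ix r) (Ix r) ℂ), (∀ x y, M x y ≠ 0 → IsLower X r x.1 y.1) →
        (∀ x y, N x y ≠ 0 → IsLower X r x.1 y.1) → ∀ x y, (M * N) x y ≠ 0 →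
          IsLower X r x.1 y.1 := by
      intro M N h2 h4 x y h
      rw [Matrix.mul_apply] at h
      obtain ⟨z, -, hz⟩ := Finset.exists_ne_zero_of_sum_ne_zero h
      exact (h2 x z (left_ne_zero_of_mul hz)).trans (h4 z y (right_ne_zero_of_mul hz))
    refine ⟨fun x y => ?_, fun x y h => ?_⟩
    · rw [LieRing.of_associative_ring_bracket, Matrix.sub_apply, Matrix.sub_apply, key M N h1 h3,
        key N M h3 h1]
      ring
    · rw [LieRing.of_associative_ring_bracket, Matrix.sub_apply] at h
      by_cases h5 : (M * N) x y = 0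
      · rw [h5, zero_sub, neg_ne_zero] at h
        exact key2 N M h4 h2 x y h
      · exact key2 M N h2 h4 x y h5

theorem skewUnit_apply_neg {a b : ℤ} (h0 : X = .C → a ≠ 0 ∧ b ≠ 0) (x y : Ix r) :
    skewUnit X r a b (-y) (-x) =
      -(formSign X (-x.1) * formSign X (-y.1)) * skewUnit X r a b x y := by
  have k1 : (-y).1 = a ∧ (-x).1 = b ↔ x.1 = -b ∧ y.1 = -a := by
    rw [Ix.coe_neg, Ix.coe_neg]; omega
  have k2 : (-y).1 = -b ∧ (-x).1 = -a ↔ x.1 = a ∧ y.1 = b := by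
    rw [Ix.coe_neg, Ix.coe_neg]; omega
  rw [skewUnit_apply, skewUnit_apply, if_congr k1 rfl rfl, if_congr k2 rfl rfl]
  by_cases h1 : x.1 = a ∧ y.1 = b <;> by_cases h2 : x.1 = -b ∧ y.1 = -a
  · have e1 : formSign X (-x.1) * formSign X (-y.1) = formSign X a * formSign X b := by
      rw [h1.1, h1.2, formSign_neg_mul X h0]
    rw [if_pos h1, if_pos h2, e1]
    linear_combination -formSign_mul_self X a - formSign X a * formSign X a * formSign_mul_self X b
  · rw [if_pos h1, if_neg h2, h1.1, h1.2, formSign_neg_mul X h0]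
    ring
  · rw [if_neg h1, if_pos h2, h2.1, h2.2, neg_neg, neg_neg]
    linear_combination -formSign_mul_self X a - formSign X a * formSign X a * formSign_mul_self X b
  · rw [if_neg h1, if_neg h2]
    ring

theorem lowering_mem_lowerMatrices (hr : X.minSize ≤ r) {l : ℕ} (hl1 : 1 ≤ l) (hl : l ≤ X.rank r) :
    X.lowering r l ∈ lowerMatrices X r := by
  refine ⟨skewUnit_apply_neg fun hX => ⟨row_ne_zero_of_C hr hX, col_ne_zero_of_C hl1⟩,
    fun x y h => ?_⟩
  have h1 : x.1 = X.row r l ∧ y.1 = X.col r l ∨ x.1 = -X.col r l ∧ y.1 = -X.row r l := by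
    by_contra! h1
    apply h
    rw [ClassicalType.lowering, skewUnit_apply, if_neg (by tauto), if_neg (by tauto)]
    simp
  rcases h1 with ⟨h1, h2⟩ | ⟨h1, h2⟩ <;> rw [h1, h2] <;> clear h h1 h2 <;>
  cases X <;> simp only [ClassicalType.row, ClassicalType.col, ClassicalType.rank,
    ClassicalType.minSize, IsLower] at hr hl ⊢ <;> (try split_ifs) <;> omega

/-- The triangular matrices of the orthogonal or symplectic Lie algebra are combinations of the
elements `skewUnit`. The factor 1/2 is there because each of them occurs twice, up to sign. -/
theorem eq_sum_skewUnit {M : Matrix (Ix r) (Ix r) ℂ} (hM : M ∈ lowerMatrices X r) :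
    M = (1 / 2 : ℂ) • ∑ x : Ix r, ∑ y : Ix r, M x y • skewUnit X r x.1 y.1 := by
  ext u v
  have h1 : ∑ x : Ix r, ∑ y : Ix r, M x y * (if u.1 = x.1 ∧ v.1 = y.1 then 1 else 0) = M u v := by
    rw [Finset.sum_eq_single u, Finset.sum_eq_single v]
    · simp
    · intro y _ hy
      rw [if_neg (fun h => hy (Subtype.ext h.2.symm)), mul_zero]
    · simp
    · intro x _ hx
      exact Finset.sum_eq_zero fun y _ => by
        rw [if_neg (fun h => hx (Subtype.ext h.1.symm)), mul_zero]
    · simp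
  have h2 : ∑ x : Ix r, ∑ y : Ix r, M x y * ((formSign X x.1 * formSign X y.1) *
      (if u.1 = -y.1 ∧ v.1 = -x.1 then 1 else 0)) = -M u v := by
    rw [Finset.sum_eq_single (-v), Finset.sum_eq_single (-u)]
    · rw [hM.1 u v, Ix.coe_neg, Ix.coe_neg, neg_neg, neg_neg, if_pos ⟨rfl, rfl⟩]
      linear_combination (-M u v) * formSign_mul_self X (-u.1) -
        M u v * formSign X (-u.1) * formSign X (-u.1) * formSign_mul_self X (-v.1)
    · intro y _ hy
      rw [if_neg, mul_zero, mul_zero]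
      rintro ⟨h, -⟩
      exact hy (Subtype.ext (by rw [Ix.coe_neg, h, neg_neg]))
    · simp
    · intro x _ hx
      refine Finset.sum_eq_zero fun y _ => ?_
      rw [if_neg, mul_zero, mul_zero]
      rintro ⟨-, h⟩
      exact hx (Subtype.ext (by rw [Ix.coe_neg, h, neg_neg]))
    · simp
  simp only [Matrix.smul_apply, Matrix.sum_apply, skewUnit_apply, smul_eq_mul, mul_sub,
    Finset.sum_sub_distrib, h1, h2]
  ring

/-- All triangular elements `skewUnit` are multiples of root matrices. -/
theorem skewUnit_mem_span {N : Submodule ℂ (Matrix (Ix r) (Ix r) ℂ)}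
    (hN : ∀ β, X.IsPos r β → X.rootMatrix r β ∈ N) {a b : ℤ} (ha : |a| ≤ r) (hb : |b| ≤ r)
    (h : IsLower X r a b) : skewUnit X r a b ∈ N := by
  rw [abs_le] at ha hb
  have h1 : ∀ β, X.IsPos r β → β.tgt = a → (β.fst : ℤ) = b → skewUnit X r a b ∈ N := by
    rintro β hβ rfl rfl
    have h2 := N.smul_mem (X.rootScalar r β)⁻¹ (hN β hβ)
    rwa [ClassicalType.rootMatrix, smul_smul, inv_mul_cancel₀ (rootScalar_ne_zero β),
      one_smul] at h2
  have h2 : ∀ β, X.IsPos r β → -(β.fst : ℤ) = a → -β.tgt = b → skewUnit X r a b ∈ N := by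
    rintro β hβ rfl rfl
    rw [skewUnit_neg]
    · refine N.smul_mem _ ?_
      have h2 := N.smul_mem (X.rootScalar r β)⁻¹ (hN β hβ)
      rwa [ClassicalType.rootMatrix, smul_smul, inv_mul_cancel₀ (rootScalar_ne_zero β),
        one_smul] at h2
    · rintro rfl
      cases β <;> simp only [ClassicalType.IsPos] at hβ <;> simp only [Root.fst, Root.tgt] <;> omega
  cases X <;> simp only [IsLower, ClassicalType.IsPos] at h h1 h2
  case A =>
    rcases h.2 with hb0 | ha0
    · exact h1 (.diff b.toNat a.toNat) (by omega) (by simp only [Root.tgt]; omega)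
        (by simp only [Root.fst]; omega)
    · exact h2 (.diff (-a).toNat (-b).toNat) (by omega) (by simp only [Root.fst]; omega)
        (by simp only [Root.tgt]; omega)
  case D =>
    rcases lt_trichotomy a (-b) with hab | hab | hab
    · rcases lt_or_ge b 0 with hb0 | hb0
      · exact h2 (.diff (-a).toNat (-b).toNat) (by omega) (by simp only [Root.fst]; omega)
          (by simp only [Root.tgt]; omega)
      · exact h2 (.sum (-a).toNat b.toNat) (by omega) (by simp only [Root.fst]; omega)
          (by simp only [Root.tgt]; omega)
    · subst hab
      rw [skewUnit]
      simp [formSign]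
    · rcases lt_or_ge a 0 with ha0 | ha0
      · exact h1 (.sum b.toNat (-a).toNat) (by omega) (by simp only [Root.tgt]; omega)
          (by simp only [Root.fst]; omega)
      · exact h1 (.diff b.toNat a.toNat) (by omega) (by simp only [Root.tgt]; omega)
          (by simp only [Root.fst]; omega)
  case B =>
    rcases lt_trichotomy b 0 with hb0 | rfl | hb0
    · refine h2 (.diff (-a).toNat (-b).toNat) ?_ ?_ ?_ <;> simp only [Root.fst, Root.tgt] <;>
        split_ifs at h <;> omega
    · refine h2 (.single (-a).toNat) ?_ ?_ ?_ <;> simp only [Root.fst, Root.tgt] <;>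
        split_ifs at h <;> omega
    · rcases lt_trichotomy a 0 with ha0 | rfl | ha0
      · rcases lt_trichotomy (-a) b with hab | hab | hab
        · refine h2 (.sum (-a).toNat b.toNat) ?_ ?_ ?_ <;> simp only [Root.fst, Root.tgt] <;> omega
        · subst hab
          rw [skewUnit]
          simp [formSign]
        · refine h1 (.sum b.toNat (-a).toNat) ?_ ?_ ?_ <;> simp only [Root.fst, Root.tgt] <;> omega
      · refine h1 (.single b.toNat) ?_ ?_ ?_ <;> simp only [Root.fst, Root.tgt] <;> omega
      · refine h1 (.diff b.toNat a.toNat) ?_ ?_ ?_ <;> simp only [Root.fst, Root.tgt] <;>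
          split_ifs at h <;> omega
  case C =>
    rcases lt_or_ge b 0 with hb0 | hb0
    · refine h2 (.diff (-a).toNat (-b).toNat) ?_ ?_ ?_ <;> simp only [Root.fst, Root.tgt] <;>
        split_ifs at h <;> omega
    · rcases lt_or_ge a 0 with ha0 | ha0
      · rcases lt_trichotomy (-a) b with hab | hab | hab
        · refine h2 (.sum (-a).toNat b.toNat) ?_ ?_ ?_ <;> simp only [Root.fst, Root.tgt] <;> omega
        · refine h1 (.double b.toNat) ?_ ?_ ?_ <;> simp only [Root.fst, Root.tgt] <;> omega
        · refine h1 (.sum b.toNat (-a).toNat) ?_ ?_ ?_ <;> simp only [Root.fst, Root.tgt] <;> omega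
      · refine h1 (.diff b.toNat a.toNat) ?_ ?_ ?_ <;> simp only [Root.fst, Root.tgt] <;>
          split_ifs at h <;> omega

section Rep

variable {𝔤 : Type*} [LieRing 𝔤] [LieAlgebra ℂ 𝔤] [FiniteDimensional ℂ 𝔤]
  {𝔥 : LieSubalgebra ℂ 𝔤} (b : LieAlgebra.Basis (Fin (X.rank r)) 𝔥)

/-- The representation of `𝔫` by matrices. -/
def matrixRep (hr : X.minSize ≤ r) (hb : IsOfType X r b) :
    lowerNil b →ₗ⁅ℂ⁆ Matrix (Ix r) (Ix r) ℂ := (chevalleyMatrices hr b.A hb).rep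

variable {b} (hr : X.minSize ≤ r) (hb : IsOfType X r b)

theorem matrixRep_gen (i : Fin (X.rank r)) :
    matrixRep b hr hb (gen b i) = X.lowering r (i + 1) :=
  (chevalleyMatrices hr b.A hb).rep_gen i

theorem matrixRep_genNat {l : ℕ} (hl1 : 1 ≤ l) (hl : l ≤ X.rank r) :
    matrixRep b hr hb (genNat b l) = X.lowering r l := by
  rw [genNat, dif_pos (by omega), matrixRep_gen]
  congr 1
  exact Nat.sub_add_cancel hl1

/-- The root vectors act by the root matrices. -/
theorem matrixRep_rootVector {β : Root} (hβ : X.IsPos r β) :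
    matrixRep b hr hb (rootVector X r b β) = X.rootMatrix r β := by
  rw [rootVector, map_smul, map_leftComm, List.map_map, ← leftComm_lowering_word hβ]
  congr 2
  refine List.map_congr_left fun l hl => ?_
  exact matrixRep_genNat hr hb (mem_word hβ hl).1 (mem_word hβ hl).2

theorem matrixRep_mem (x : lowerNil b) : matrixRep b hr hb x ∈ lowerMatrices X r := by
  obtain ⟨x, hx⟩ := x
  induction hx using LieSubalgebra.lieSpan_induction with
  | mem u hu =>
    obtain ⟨i, rfl⟩ := hu
    have := lowering_mem_lowerMatrices hr (Nat.le_add_left 1 i) i.2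
    rwa [← matrixRep_gen hr hb i] at this
  | zero =>
    have : matrixRep b hr hb 0 ∈ lowerMatrices X r := by
      rw [map_zero]
      exact zero_mem _
    exact this
  | add u v hu hv hu' hv' =>
    have := add_mem hu' hv'
    rwa [← map_add] at this
  | smul t u hu hu' =>
    have := (lowerMatrices X r).smul_mem t hu'
    rwa [← map_smul] at this
  | lie u v hu hv hu' hv' =>
    have := (lowerMatrices X r).lie_mem hu' hv'
    rwa [← LieHom.map_lie] at this

/-- The root vectors span `𝔫`: their images span the triangular matrices, which contain the image of
`𝔫`, and the representation is faithful. -/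
theorem span_rootVector [LieAlgebra.IsSimple ℂ 𝔤] (hr : X.minSize ≤ r) (hb : IsOfType X r b) :
    Submodule.span ℂ (Set.range fun j => rootVector X r b (X.root r j)) = ⊤ := by
  set S := Submodule.span ℂ (Set.range fun j => rootVector X r b (X.root r j))
  have hN : ∀ β, X.IsPos r β → X.rootMatrix r β ∈
      S.map (matrixRep b hr hb : lowerNil b →ₗ[ℂ] Matrix (Ix r) (Ix r) ℂ) := by
    intro β hβ
    obtain ⟨j, rfl⟩ := exists_root_eq hβ
    exact ⟨_, Submodule.subset_span ⟨j, rfl⟩, matrixRep_rootVector hr hb hβ⟩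
  rw [eq_top_iff]
  intro x _
  have h1 : matrixRep b hr hb x ∈
      S.map (matrixRep b hr hb : lowerNil b →ₗ[ℂ] Matrix (Ix r) (Ix r) ℂ) := by
    have hx := matrixRep_mem hr hb x
    rw [eq_sum_skewUnit hx]
    refine Submodule.smul_mem _ _ (sum_mem fun u _ => sum_mem fun v _ => ?_)
    by_cases h0 : matrixRep b hr hb x u v = 0
    · rw [h0, zero_smul]
      exact zero_mem _
    · exact Submodule.smul_mem _ _ (skewUnit_mem_span hN u.abs_le v.abs_le (hx.2 u v h0))
  obtain ⟨y, hy, hxy⟩ := h1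
  have hrank : 0 < X.rank r := by
    cases X <;> simp only [ClassicalType.minSize, ClassicalType.rank] at hr ⊢ <;> omega
  have h2 : y = x := (chevalleyMatrices hr b.A hb).rep_injective ⟨0, hrank⟩ hxy
  rwa [← h2]

end Rep

variable {X : ClassicalType} {r : ℕ}

/-! ### Matrix entries as functionals on the enveloping algebra -/

/-- The entry of a matrix in row `a` and column `b`, zero if these are out of range. -/
def entry (r : ℕ) (a b : ℤ) : Matrix (Ix r) (Ix r) ℂ →ₗ[ℂ] ℂ :=
  if h : |a| ≤ r ∧ |b| ≤ r then
    Matrix.entryLinearMap ℂ ℂ (⟨a, abs_le_mem h.1⟩ : Ix r) ⟨b, abs_le_mem h.2⟩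
  else 0

theorem entry_coe (M : Matrix (Ix r) (Ix r) ℂ) (x y : Ix r) : entry r x.1 y.1 M = M x y := by
  rw [entry, dif_pos ⟨x.abs_le, y.abs_le⟩]
  rfl

theorem exists_entry_eq {a b : ℤ} {M : Matrix (Ix r) (Ix r) ℂ} (h : entry r a b M ≠ 0) :
    ∃ x y : Ix r, x.1 = a ∧ y.1 = b ∧ entry r a b M = M x y := by
  by_cases hab : |a| ≤ r ∧ |b| ≤ r
  · refine ⟨⟨a, abs_le_mem hab.1⟩, ⟨b, abs_le_mem hab.2⟩, rfl, rfl, ?_⟩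
    rw [entry, dif_pos hab]
    rfl
  · rw [entry, dif_neg hab] at h
    exact absurd rfl h

theorem entry_one {a b : ℤ} (ha : |a| ≤ r) (hb : |b| ≤ r) :
    entry r a b 1 = if a = b then 1 else 0 := by
  have h := entry_coe (1 : Matrix (Ix r) (Ix r) ℂ) ⟨a, abs_le_mem ha⟩ ⟨b, abs_le_mem hb⟩
  simp only at h
  rw [h, Matrix.one_apply]
  simp only [Subtype.mk.injEq]

theorem entry_skewUnit {a b x y : ℤ} (hx : |x| ≤ r) (hy : |y| ≤ r) :
    entry r x y (skewUnit X r a b) = (if x = a ∧ y = b then 1 else 0) -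
      (formSign X a * formSign X b) * (if x = -b ∧ y = -a then 1 else 0) :=
  (entry_coe (skewUnit X r a b) ⟨x, abs_le_mem hx⟩ ⟨y, abs_le_mem hy⟩).trans
    (skewUnit_apply _ _ _ _ _)

theorem entry_mul_unitMatrix (M : Matrix (Ix r) (Ix r) ℂ) {x y : ℤ} (a b : ℤ) (hy : |y| ≤ r) :
    entry r x y (M * unitMatrix r a b) = if y = b then entry r x a M else 0 := by
  by_cases hx : |x| ≤ r
  · have h := entry_coe (M * unitMatrix r a b) ⟨x, abs_le_mem hx⟩ ⟨y, abs_le_mem hy⟩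
    simp only at h
    rw [h, Matrix.mul_apply]
    by_cases hyb : y = b
    · rw [if_pos hyb]
      by_cases ha : |a| ≤ r
      · have h' := entry_coe M ⟨x, abs_le_mem hx⟩ ⟨a, abs_le_mem ha⟩
        simp only at h'
        rw [h', Finset.sum_eq_single ⟨a, abs_le_mem ha⟩]
        · rw [unitMatrix_apply, if_pos ⟨rfl, hyb⟩, mul_one]
        · intro z _ hz
          rw [unitMatrix_apply, if_neg (fun h => hz (Subtype.ext h.1)), mul_zero]
        · simp
      · rw [entry, dif_neg (fun h => ha h.2), LinearMap.zero_apply]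
        refine Finset.sum_eq_zero fun z _ => ?_
        rw [unitMatrix_apply, if_neg (by rintro ⟨h, -⟩; exact ha (h ▸ z.abs_le)), mul_zero]
    · rw [if_neg hyb]
      refine Finset.sum_eq_zero fun z _ => ?_
      rw [unitMatrix_apply, if_neg (fun h => hyb h.2), mul_zero]
  · simp [entry, hx]

theorem entry_mul_skewUnit (M : Matrix (Ix r) (Ix r) ℂ) {x y : ℤ} (a b : ℤ) (hy : |y| ≤ r) :
    entry r x y (M * skewUnit X r a b) = (if y = b then entry r x a M else 0) -
      (formSign X a * formSign X b) * (if y = -a then entry r x (-b) M else 0) := by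
  rw [skewUnit, mul_sub, mul_smul_comm, map_sub, map_smul, entry_mul_unitMatrix _ _ _ hy,
    entry_mul_unitMatrix _ _ _ hy, smul_eq_mul]

theorem rootMatrix_apply_ne_zero {β : Root} {x y : Ix r} (h : X.rootMatrix r β x y ≠ 0) :
    x.1 = β.tgt ∧ y.1 = β.fst ∨ x.1 = -β.fst ∧ y.1 = -β.tgt := by
  by_contra! h1
  apply h
  rw [ClassicalType.rootMatrix, Matrix.smul_apply, skewUnit_apply, if_neg (by tauto),
    if_neg (by tauto)]
  simp

/-- A product of matrices along a list has the entry `(x₀, y₀)` equal to zero, unless it has at most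
one factor, in the following situation: rows outside of `P` are moved into the set `S` by those
factors that are `low`, nothing but `low` factors come after the first one, the first one leads from
`x₀` out of `P`, and `y₀` is not in `S`. -/
theorem prod_apply_ne_zero {ι I : Type*} [Fintype I] [DecidableEq I] {M : ι → Matrix I I ℂ}
    {low : ι → Prop} {P S : I → Prop} {x₀ y₀ : I}
    (h1 : ∀ γ y, M γ x₀ y ≠ 0 → low γ ∧ ¬ P y)
    (h2 : ∀ γ x y, low γ → ¬ P x → M γ x y ≠ 0 → S y) (hSP : ∀ y, S y → ¬ P y) (hy₀ : ¬ S y₀)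
    {L : List ι} (hL : L.Pairwise fun γ δ => low γ → low δ) (hne : (L.map M).prod x₀ y₀ ≠ 0) :
    (L = [] ∧ x₀ = y₀) ∨ ∃ γ, L = [γ] := by
  have claim : ∀ L : List ι, (∀ γ ∈ L, low γ) → ∀ y, S y → (L.map M).prod y y₀ ≠ 0 → S y₀ := by
    intro L
    induction L with
    | nil =>
      intro _ y hy h
      rw [List.map_nil, List.prod_nil, Matrix.one_apply] at h
      split_ifs at h with h3
      · rwa [← h3]
      · exact absurd rfl h
    | cons γ L ih =>
      intro hlow y hy h
      rw [List.map_cons, List.prod_cons, Matrix.mul_apply] at h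
      obtain ⟨z, -, hz⟩ := Finset.exists_ne_zero_of_sum_ne_zero h
      exact ih (fun δ hδ => hlow δ (List.mem_cons_of_mem _ hδ)) z
        (h2 γ y z (hlow γ List.mem_cons_self) (hSP y hy) (left_ne_zero_of_mul hz))
        (right_ne_zero_of_mul hz)
  match L, hL, hne with
  | [], _, hne =>
    left
    rw [List.map_nil, List.prod_nil, Matrix.one_apply] at hne
    split_ifs at hne with h3
    · exact ⟨rfl, h3⟩
    · exact absurd rfl hne
  | [γ], _, _ => exact Or.inr ⟨γ, rfl⟩
  | γ :: δ :: L, hL, hne =>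
    exfalso
    rw [List.map_cons, List.prod_cons, Matrix.mul_apply] at hne
    obtain ⟨y, -, hy⟩ := Finset.exists_ne_zero_of_sum_ne_zero hne
    obtain ⟨hγ, hyP⟩ := h1 γ y (left_ne_zero_of_mul hy)
    have hy' := right_ne_zero_of_mul hy
    rw [List.map_cons, List.prod_cons, Matrix.mul_apply] at hy'
    obtain ⟨z, -, hz⟩ := Finset.exists_ne_zero_of_sum_ne_zero hy'
    rw [List.pairwise_cons] at hL
    exact hy₀ (claim L (fun ε hε => hL.1 ε (List.mem_cons_of_mem _ hε) hγ) z
      (h2 δ y z (hL.1 δ List.mem_cons_self hγ) hyP (left_ne_zero_of_mul hz))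
      (right_ne_zero_of_mul hz))

/-- The row of the matrix entry that detects the root vector `F_β`. -/
def ClassicalType.detRow : ClassicalType → Root → ℤ
  | .A, β => β.tgt
  | _, β => -β.fst

/-- The column of the matrix entry that detects the root vector `F_β`. -/
def ClassicalType.detCol : ClassicalType → Root → ℤ
  | .A, β => β.fst
  | _, β => -β.tgt

/-- The detecting matrix entry vanishes at all other root vectors. -/
theorem eq_of_entry_ne_zero {β γ : Root} (hβ : X.IsPos r β) (hγ : X.IsPos r γ)
    (hβ' : ∀ i, β ≠ .double i)
    (h : entry r (X.detRow β) (X.detCol β) (X.rootMatrix r γ) ≠ 0) : γ = β := by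
  obtain ⟨x, y, hx, hy, h1⟩ := exists_entry_eq h
  rw [h1] at h
  have h2 := rootMatrix_apply_ne_zero h
  rw [hx, hy] at h2
  clear h h1 hx hy
  cases X <;> cases β <;> simp only [ClassicalType.IsPos] at hβ <;>
    simp only [ClassicalType.detRow, ClassicalType.detCol] at h2
  all_goals try exact absurd rfl (hβ' _)
  all_goals
    cases γ <;> simp only [ClassicalType.IsPos] at hγ <;>
      simp only [Root.fst, Root.tgt, Root.diff.injEq, Root.sum.injEq, Root.single.injEq,
        reduceCtorEq]
        at h2 ⊢ <;>
      omega

theorem abs_fst_le {β : Root} (hβ : X.IsPos r β) : |(β.fst : ℤ)| ≤ r := by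
  rw [abs_le]
  cases X <;> cases β <;> simp only [ClassicalType.IsPos] at hβ <;> simp only [Root.fst] <;> omega

theorem abs_tgt_le {β : Root} (hβ : X.IsPos r β) : |β.tgt| ≤ r := by
  rw [abs_le]
  cases X <;> cases β <;> simp only [ClassicalType.IsPos] at hβ <;> simp only [Root.tgt] <;> omega

theorem abs_detRow_le {β : Root} (hβ : X.IsPos r β) : |X.detRow β| ≤ r := by
  cases X <;> simp only [ClassicalType.detRow, abs_neg, abs_tgt_le hβ, abs_fst_le hβ]

theorem abs_detCol_le {β : Root} (hβ : X.IsPos r β) : |X.detCol β| ≤ r := by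
  cases X <;> simp only [ClassicalType.detCol, abs_neg, abs_tgt_le hβ, abs_fst_le hβ]

/-- The value of the matrix entry that detects the root vector `F_β` at this root vector. -/
def ClassicalType.detScalar (X : ClassicalType) (r : ℕ) (β : Root) : ℂ :=
  match X, β with
  | .A, _ => 1
  | .C, .sum i j => ClassicalType.C.rootScalar r (.sum i j)
  | X, β => -X.rootScalar r β

/-- The detecting matrix entry at the root vector itself. -/
theorem entry_rootMatrix {β : Root} (hβ : X.IsPos r β) (hβ' : ∀ i, β ≠ .double i) :
    entry r (X.detRow β) (X.detCol β) (X.rootMatrix r β) = X.detScalar r β := by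
  rw [ClassicalType.rootMatrix, map_smul, entry_skewUnit (abs_detRow_le hβ) (abs_detCol_le hβ),
    smul_eq_mul]
  by_cases hX : X = .A
  · subst hX
    rw [if_pos ⟨rfl, rfl⟩, if_neg]
    · cases β <;> simp only [ClassicalType.IsPos] at hβ
      simp [ClassicalType.rootScalar, ClassicalType.detScalar]
    · cases β <;> simp only [ClassicalType.IsPos] at hβ
      simp only [ClassicalType.detRow, ClassicalType.detCol, Root.fst, Root.tgt]
      omega
  · have h1 : ¬ (X.detRow β = β.tgt ∧ X.detCol β = β.fst) := by
      cases X <;> cases β <;> simp only [ClassicalType.IsPos] at hβ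
      all_goals first
        | exact absurd rfl hX
        | exact absurd rfl (hβ' _)
        | (simp only [ClassicalType.detRow, ClassicalType.detCol, Root.fst, Root.tgt]; omega)
    have h2 : X.detRow β = -(β.fst : ℤ) ∧ X.detCol β = -β.tgt := by
      cases X <;> first | exact absurd rfl hX | exact ⟨rfl, rfl⟩
    rw [if_neg h1, if_pos h2]
    clear h1 h2
    cases X <;> cases β <;> simp only [ClassicalType.IsPos] at hβ
    all_goals first
      | exact absurd rfl hX
      | exact absurd rfl (hβ' _)
      | skip
    case C.sum i j =>
      have hj : 0 < j := by omega
      have hi : ¬ (i : ℤ) < 0 := by omega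
      simp [ClassicalType.detScalar, formSign, Root.fst, Root.tgt, hi, hj]
    case C.diff i j =>
      have hj : ¬ (j : ℤ) < 0 := by omega
      have hi : ¬ (i : ℤ) < 0 := by omega
      simp [ClassicalType.detScalar, formSign, Root.fst, Root.tgt, hi, hj]
    all_goals simp [ClassicalType.detScalar, formSign]

theorem detScalar_ne_zero (β : Root) : X.detScalar r β ≠ 0 := by
  cases X <;> cases β <;> simp only [ClassicalType.detScalar] <;>
    simp [rootScalar_ne_zero]

/-- The detecting matrix entry vanishes at all ordered products of root vectors except `F_β`. This
is where the order of the roots enters: the first factor leads from the row of the entry to a column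
from which the later factors, which cannot come from earlier blocks, never lead to the column of the
entry. -/
theorem prod_rootMatrix_eq_zero {β : Root} (hβ : X.IsPos r β) (hβ' : ∀ i, β ≠ .double i)
    {L : List Root} (hL : ∀ γ ∈ L, X.IsPos r γ)
    (hs : L.Pairwise fun γ δ => X.blockKey γ ≤ X.blockKey δ) (hne : L ≠ [β]) :
    entry r (X.detRow β) (X.detCol β) ((L.map (X.rootMatrix r)).prod) = 0 := by
  by_contra hne0
  have hone : ∀ γ, L = [γ] → False := by
    rintro γ rfl
    simp only [List.map_singleton, List.prod_singleton] at hne0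
    exact hne (by rw [eq_of_entry_ne_zero hβ (hL γ (by simp)) hβ' hne0])
  have hrc : X.detRow β ≠ X.detCol β := by
    cases X <;> cases β <;> simp only [ClassicalType.IsPos] at hβ <;>
      simp only [ClassicalType.detRow, ClassicalType.detCol, Root.fst, Root.tgt] <;> omega
  obtain ⟨x₀, y₀, hx₀, hy₀, h1⟩ := exists_entry_eq hne0
  rw [h1] at hne0
  -- The matrices are set to zero for the names that are not positive roots.
  classical
  set M : Root → Matrix (Ix r) (Ix r) ℂ := fun γ =>
    if X.IsPos r γ then X.rootMatrix r γ else 0 with hM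
  have hMne : ∀ γ x y, M γ x y ≠ 0 → X.IsPos r γ ∧
      (x.1 = γ.tgt ∧ y.1 = γ.fst ∨ x.1 = -γ.fst ∧ y.1 = -γ.tgt) := by
    intro γ x y h
    by_cases hγ : X.IsPos r γ
    · rw [hM] at h
      simp only [if_pos hγ] at h
      exact ⟨hγ, rootMatrix_apply_ne_zero h⟩
    · simp [hM, if_neg hγ] at h
  have hLM : L.map (X.rootMatrix r) = L.map M :=
    List.map_congr_left fun γ hγ => (if_pos (hL γ hγ)).symm
  rw [hLM] at hne0
  -- In type `A` the factor that is forced into the block of `β` is the last one, so that the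
  -- transposed product is used.
  cases X
  case A =>
    have h2 : ((L.reverse).map fun γ => (M γ).transpose).prod y₀ x₀ ≠ 0 := by
      rw [← Matrix.transpose_apply (M := (L.map M).prod), Matrix.transpose_list_prod, List.map_map,
        ← List.map_reverse] at hne0
      exact hne0
    refine (prod_apply_ne_zero (low := fun γ => γ.fst ≤ β.fst)
      (P := fun x : Ix r => 1 ≤ x.1 ∧ x.1 ≤ β.fst) (S := fun y : Ix r => y.1 ≤ -1)
      ?_ ?_ ?_ ?_ ?_ h2).elim
      (fun h3 => hrc (by rw [← hx₀, ← hy₀, h3.2]))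
        (fun ⟨γ, h3⟩ => hone γ (by rw [← List.reverse_inj, h3]; rfl))
    · intro γ y h
      obtain ⟨hγ, h⟩ := hMne γ y y₀ h
      cases β <;> simp only [ClassicalType.IsPos] at hβ
      cases γ <;> simp only [ClassicalType.IsPos] at hγ
      simp only [ClassicalType.detRow, ClassicalType.detCol, Root.fst, Root.tgt] at *
      omega
    · intro γ x y hlow hx h
      obtain ⟨hγ, h⟩ := hMne γ y x h
      cases γ <;> simp only [ClassicalType.IsPos] at hγ
      simp only [Root.fst, Root.tgt] at *
      omega
    · intro y hy
      omega
    · rw [hx₀]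
      cases β <;> simp only [ClassicalType.IsPos] at hβ
      simp only [ClassicalType.detRow, Root.tgt]
      omega
    · rw [List.pairwise_reverse]
      refine hs.imp fun {γ δ} h h' => ?_
      simp only [ClassicalType.blockKey] at h
      omega
  case D =>
    refine (prod_apply_ne_zero (low := fun γ => β.fst ≤ γ.fst)
      (P := fun x : Ix r => x.1 ≤ -β.fst) (S := fun y : Ix r => (β.fst : ℤ) ≤ y.1)
      ?_ ?_ ?_ ?_ ?_ hne0).elim
      (fun h3 => hrc (by rw [← hx₀, ← hy₀, h3.2])) (fun ⟨γ, h3⟩ => hone γ h3)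
    · intro γ y h
      obtain ⟨hγ, h⟩ := hMne γ x₀ y h
      cases β <;> simp only [ClassicalType.IsPos] at hβ <;>
        cases γ <;> simp only [ClassicalType.IsPos] at hγ <;>
        simp only [ClassicalType.detRow, ClassicalType.detCol, Root.fst, Root.tgt] at * <;>
        omega
    · intro γ x y hlow hx h
      obtain ⟨hγ, h⟩ := hMne γ x y h
      omega
    · intro y hy
      cases β <;> simp only [ClassicalType.IsPos] at hβ <;> simp only [Root.fst] at * <;> omega
    · rw [hy₀]
      cases β <;> simp only [ClassicalType.IsPos] at hβ <;>
        simp only [ClassicalType.detCol, Root.tgt, Root.fst] <;> omega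
    · refine hs.imp fun {γ δ} h h' => ?_
      simp only [ClassicalType.blockKey] at h
      omega
  all_goals
    refine (prod_apply_ne_zero (low := fun γ => γ.fst ≤ β.fst)
      (P := fun x : Ix r => -(β.fst : ℤ) ≤ x.1 ∧ x.1 ≤ -1)
      (S := fun y : Ix r => 1 ≤ y.1 ∧ y.1 ≤ β.fst) ?_ ?_ ?_ ?_ ?_ hne0).elim
      (fun h3 => hrc (by rw [← hx₀, ← hy₀, h3.2])) (fun ⟨γ, h3⟩ => hone γ h3)
    · intro γ y h
      obtain ⟨hγ, h⟩ := hMne γ x₀ y h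
      have hf : 1 ≤ β.fst := by
        cases β <;> simp only [ClassicalType.IsPos] at hβ <;> simp only [Root.fst] <;> omega
      simp only [ClassicalType.detRow] at hx₀
      generalize β.fst = f at hf hx₀ ⊢
      cases γ <;> simp only [ClassicalType.IsPos] at hγ <;>
        simp only [Root.fst, Root.tgt] at h ⊢ <;> omega
    · intro γ x y hlow hx h
      obtain ⟨hγ, h⟩ := hMne γ x y h
      have hf : 1 ≤ γ.fst := by
        cases γ <;> simp only [ClassicalType.IsPos] at hγ <;> simp only [Root.fst] <;> omega
      omega
    · intro y hy
      omega
    · rw [hy₀]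
      cases β <;> simp only [ClassicalType.IsPos] at hβ <;>
        simp only [ClassicalType.detCol, Root.tgt, Root.fst]
      all_goals try exact absurd rfl (hβ' _)
      all_goals omega
    · refine hs.imp fun {γ δ} h h' => ?_
      simp only [ClassicalType.blockKey] at h
      omega

section Functional

variable {𝔤 : Type*} [LieRing 𝔤] [LieAlgebra ℂ 𝔤] [FiniteDimensional ℂ 𝔤]
  {𝔥 : LieSubalgebra ℂ 𝔤} {b : LieAlgebra.Basis (Fin (X.rank r)) 𝔥} (hr : X.minSize ≤ r)
  (hb : IsOfType X r b)

/-- The representation of the enveloping algebra. -/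
def uRep : U b →ₐ[ℂ] Matrix (Ix r) (Ix r) ℂ :=
  UniversalEnvelopingAlgebra.lift ℂ (matrixRep b hr hb)

theorem uRep_listProd {α : Type*} (g : α → lowerNil b) (L : List α) :
    uRep hr hb (listProd g L) = (L.map fun a => matrixRep b hr hb (g a)).prod := by
  rw [listProd, map_list_prod, List.map_map]
  congr 1
  refine List.map_congr_left fun a _ => ?_
  exact UniversalEnvelopingAlgebra.lift_ι_apply ℂ _ _

/-- The product of the matrices of the letters of a word, with the first letter acting first. -/
def ClassicalType.wordMatrix (X : ClassicalType) (r : ℕ) (W : List ℕ) : Matrix (Ix r) (Ix r) ℂ :=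
  (W.reverse.map (X.lowering r)).prod

theorem wordMatrix_nil : X.wordMatrix r [] = 1 := rfl

theorem wordMatrix_cons (l : ℕ) (W : List ℕ) :
    X.wordMatrix r (l :: W) = X.wordMatrix r W * X.lowering r l := by
  simp [ClassicalType.wordMatrix]

theorem uRep_revProd (L : List (Fin (X.rank r))) :
    uRep hr hb (revProd (gen b) L) =
      X.wordMatrix r (L.map (fun i : Fin (X.rank r) => (i : ℕ) + 1)) := by
  rw [revProd, uRep_listProd, ClassicalType.wordMatrix, ← List.map_reverse, List.map_map]
  congr 1
  refine List.map_congr_left fun i _ => ?_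
  exact matrixRep_gen hr hb i

/-- The functional that is dual to the root vector `F_β`, for `β` different from `2 e_i`. -/
def entryFunctional (β : Root) : U b →ₗ[ℂ] ℂ :=
  (X.detScalar r β)⁻¹ • (entry r (X.detRow β) (X.detCol β) ∘ₗ (uRep hr hb).toLinearMap)

theorem entryFunctional_revProd (β : Root) (L : List (Fin (X.rank r))) :
    entryFunctional hr hb β (revProd (gen b) L) = (X.detScalar r β)⁻¹ *
      entry r (X.detRow β) (X.detCol β)
        (X.wordMatrix r (L.map (fun i : Fin (X.rank r) => (i : ℕ) + 1))) := by
  rw [← uRep_revProd hr hb]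
  rfl

theorem map_root_eq_singleton {L : List (Fin (X.posRoots r).length)} {j} :
    L.map (X.root r) = [X.root r j] ↔ L = [j] := by
  rw [← List.map_singleton, (List.map_injective_iff.2 root_injective).eq_iff]

theorem uRep_listProd_rootVector (L : List (Fin (X.posRoots r).length)) :
    uRep hr hb (listProd (fun j => rootVector X r b (X.root r j)) L) =
      ((L.map (X.root r)).map (X.rootMatrix r)).prod := by
  rw [uRep_listProd, List.map_map]
  congr 1
  exact List.map_congr_left fun j _ => matrixRep_rootVector hr hb (isPos_root j)

theorem entryFunctional_listProd (j : Fin (X.posRoots r).length)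
    (hj : ∀ i, X.root r j ≠ .double i) (L : List (Fin (X.posRoots r).length))
    (hL : L.Pairwise (· ≤ ·)) :
    entryFunctional hr hb (X.root r j) (listProd (fun j => rootVector X r b (X.root r j)) L) =
      if L = [j] then 1 else 0 := by
  rw [entryFunctional, LinearMap.smul_apply, LinearMap.comp_apply, AlgHom.toLinearMap_apply,
    uRep_listProd_rootVector]
  split_ifs with h
  · subst h
    rw [List.map_singleton, List.map_singleton, List.prod_singleton,
      entry_rootMatrix (isPos_root j) hj,
      smul_eq_mul, inv_mul_cancel₀ (detScalar_ne_zero _)]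
  · rw [prod_rootMatrix_eq_zero (isPos_root j) hj, smul_zero]
    · intro γ hγ
      obtain ⟨i, -, rfl⟩ := List.mem_map.1 hγ
      exact isPos_root i
    · rw [List.pairwise_map]
      exact hL.imp blockKey_mono
    · rwa [Ne, map_root_eq_singleton]

end Functional

variable {X : ClassicalType} {r : ℕ}

/-! ### Entries of products of lowering matrices -/

theorem cons_eq_up {a b l : ℕ} {W : List ℕ} :
    l :: W = up a b ↔ l = a ∧ a ≤ b ∧ W = up (a + 1) b := by
  by_cases h : a ≤ b
  · rw [up_eq_cons h, List.cons_eq_cons]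
    tauto
  · rw [up_eq_nil (by omega)]
    simp [h]

theorem cons_eq_up_append {a b l : ℕ} {W V : List ℕ} (h : a ≤ b) :
    l :: W = up a b ++ V ↔ l = a ∧ W = up (a + 1) b ++ V := by
  rw [up_eq_cons h, List.cons_append, List.cons_eq_cons]

theorem cons_eq_down {a b l : ℕ} {W : List ℕ} (ha : 1 ≤ a) :
    l :: W = down a b ↔ l = a ∧ b ≤ a ∧ W = down (a - 1) b := by
  obtain ⟨a, rfl⟩ : ∃ c, a = c + 1 := ⟨a - 1, by omega⟩
  by_cases h : b ≤ a + 1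
  · rw [down_succ h, List.cons_eq_cons, Nat.add_sub_cancel]
    tauto
  · rw [down_eq_nil (by omega)]
    simp [h]

theorem nil_eq_up {a b : ℕ} : [] = up a b ↔ b < a := by
  refine ⟨fun h => ?_, fun h => (up_eq_nil h).symm⟩
  by_contra h'
  rw [up_eq_cons (by omega)] at h
  simp at h

theorem nil_eq_down {a b : ℕ} : [] = down a b ↔ a < b := by
  rw [down, eq_comm, List.reverse_eq_nil_iff, eq_comm, nil_eq_up]

/-- The first letter of a word is the last factor of the product, and acts on the column index. -/
theorem entry_wordMatrix_cons (l : ℕ) (W : List ℕ) {x y a c : ℤ} (hy : |y| ≤ r)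
    (ha : X.row r l = a) (hc : X.col r l = c) :
    entry r x y (X.wordMatrix r (l :: W)) =
      (if y = c then entry r x a (X.wordMatrix r W) else 0) -
      (formSign X a * formSign X c) *
        (if y = -a then entry r x (-c) (X.wordMatrix r W) else 0) := by
  subst ha hc
  rw [wordMatrix_cons, ClassicalType.lowering, entry_mul_skewUnit _ _ _ hy]

/-- Reading a word from the left, the column index moves towards the row index; here it moves from
`-m` to `-i`, and only the letters `m - 1, …, i` in this order achieve this. -/
theorem entry_wordMatrix_neg_neg (hX : X = .B ∨ X = .C) {i : ℕ} (hi : 1 ≤ i) (hir : i ≤ r)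
    (W : List ℕ) {m : ℕ} (hm : 1 ≤ m) (hmr : m ≤ r) (hW : ∀ l ∈ W, 1 ≤ l) :
    entry r (-i) (-m) (X.wordMatrix r W) =
      if i ≤ m ∧ W = down (m - 1) i then (-1) ^ (m - i) else 0 := by
  have habs : |(-m : ℤ)| ≤ r := _root_.abs_le.2 ⟨by omega, by omega⟩
  induction W generalizing m with
  | nil =>
    rw [wordMatrix_nil, entry_one (_root_.abs_le.2 ⟨by omega, by omega⟩) habs]
    simp only [nil_eq_down]
    by_cases h : i = m
    · subst h
      rw [if_pos rfl, if_pos ⟨le_rfl, by omega⟩, Nat.sub_self, pow_zero]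
    · rw [if_neg (by omega), if_neg (by omega)]
  | cons l W ih =>
    have hl := hW l List.mem_cons_self
    have hcol : X.col r l = l := by rcases hX with rfl | rfl <;> rfl
    by_cases hlm : m = l + 1
    · have hrow : X.row r l = (l + 1 : ℕ) := by
        rcases hX with rfl | rfl <;> simp only [ClassicalType.row] <;> rw [if_neg (by omega)] <;>
          push_cast <;> rfl
      rw [entry_wordMatrix_cons l W habs hrow hcol, if_neg (by omega), zero_sub, if_pos (by omega),
        formSign_pos X (by omega), formSign_pos X (by omega), one_mul,
        one_mul, ih hl (by omega) (fun l h => hW l (List.mem_cons_of_mem _ h))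
          (_root_.abs_le.2 ⟨by omega, by omega⟩)]
      subst hlm
      rw [Nat.add_sub_cancel]
      by_cases h : i ≤ l ∧ W = down (l - 1) i
      · rw [if_pos h, if_pos ⟨by omega, (cons_eq_down hl).2 ⟨rfl, h⟩⟩,
          show l + 1 - i = (l - i) + 1 by omega, pow_succ]
        ring
      · rw [if_neg h, if_neg (fun h' => h ((cons_eq_down hl).1 h'.2).2), neg_zero]
    · have hrow : -(m : ℤ) ≠ -X.row r l := by
        rcases hX with rfl | rfl <;> simp only [ClassicalType.row] <;> split_ifs <;> omega
      rw [entry_wordMatrix_cons l W habs rfl hcol, if_neg (by omega), zero_sub, if_neg hrow,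
        mul_zero, neg_zero, if_neg]
      rintro ⟨h1, h2⟩
      by_cases hm1 : 1 ≤ m - 1
      · rw [cons_eq_down hm1] at h2
        omega
      · rw [down_eq_nil (by omega)] at h2
        simp at h2

/-- Words that move the column index from 0 to `-i`, in type `B`. -/
theorem entry_wordMatrix_B_zero {i : ℕ} (hi : 1 ≤ i) (hir : i ≤ r) (W : List ℕ)
    (hW : ∀ l ∈ W, 1 ≤ l) :
    entry r (-i) 0 (ClassicalType.B.wordMatrix r W) =
      if W = down r i then -(-1) ^ (r - i) else 0 := by
  have habs : |(0 : ℤ)| ≤ r := by simp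
  cases W with
  | nil =>
    rw [wordMatrix_nil, entry_one (_root_.abs_le.2 ⟨by omega, by omega⟩) habs]
    simp only [nil_eq_down]
    rw [if_neg (by omega), if_neg (by omega)]
  | cons l W =>
    have hl := hW l List.mem_cons_self
    simp only [cons_eq_down (hi.trans hir)]
    by_cases hlr : l = r
    · subst hlr
      rw [entry_wordMatrix_cons (X := .B) (c := l) l W habs (if_pos rfl) rfl, if_neg (by omega),
        if_pos (by simp), entry_wordMatrix_neg_neg (.inl rfl) hi hir W hl le_rfl
        (fun l h => hW l (List.mem_cons_of_mem _ h))]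
      simp only [formSign, true_and]
      split_ifs <;> ring
    · rw [entry_wordMatrix_cons (X := .B) (c := l) l W habs (if_neg hlr) rfl, if_neg (by omega),
        if_neg (by omega), if_neg (by tauto), mul_zero, sub_zero]

/-- Words that move the column index from `m` to `-i`, in type `B`; they pass through 0, by two
letters `r`. -/
theorem entry_wordMatrix_B_pos {i : ℕ} (hi : 1 ≤ i) (hir : i ≤ r) (W : List ℕ) {m : ℕ} (hm : 1 ≤ m)
    (hmr : m ≤ r) (hW : ∀ l ∈ W, 1 ≤ l) :
    entry r (-i) m (ClassicalType.B.wordMatrix r W) =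
      if W = up m r ++ down r i then -(-1) ^ (r - i) else 0 := by
  have habs : |(m : ℤ)| ≤ r := _root_.abs_le.2 ⟨by omega, by omega⟩
  induction W generalizing m with
  | nil =>
    rw [wordMatrix_nil, entry_one (_root_.abs_le.2 ⟨by omega, by omega⟩) habs, up_eq_cons hmr,
      if_neg (by omega), if_neg (by simp)]
  | cons l W ih =>
    have hl := hW l List.mem_cons_self
    have hW' : ∀ l ∈ W, 1 ≤ l := fun l h => hW l (List.mem_cons_of_mem _ h)
    simp only [cons_eq_up_append hmr]
    by_cases hlr : l = r
    · rw [entry_wordMatrix_cons (X := .B) (c := l) l W habs (if_pos hlr) rfl,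
        if_neg (by omega : ¬ (m : ℤ) = -0), mul_zero,
        sub_zero, entry_wordMatrix_B_zero hi hir W hW']
      by_cases hlm : l = m
      · rw [if_pos (by omega), up_eq_nil (by omega), List.nil_append]
        simp only [hlm, true_and]
      · rw [if_neg (by omega), if_neg (by tauto)]
    · have h1 := entry_wordMatrix_cons (X := .B) (c := l) (x := -i) l W habs (if_neg hlr) rfl
      rw [h1, if_neg (by omega : ¬ (m : ℤ) = -((l : ℤ) + 1)), mul_zero, sub_zero]
      by_cases hlm : l = m
      · subst hlm
        have := ih (m := l + 1) (by omega) (by omega) hW' (_root_.abs_le.2 ⟨by omega, by omega⟩)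
        push_cast at this
        rw [if_pos rfl, this]
        simp only [true_and]
      · rw [if_neg (by omega), if_neg (by tauto)]

/-- Words that move the column index from `m` to `-i`, in type `C`; they pass from `r` to `-r` by
one letter `r`. -/
theorem entry_wordMatrix_C_pos {i : ℕ} (hi : 1 ≤ i) (hir : i ≤ r) (W : List ℕ) {m : ℕ} (hm : 1 ≤ m)
    (hmr : m ≤ r) (hW : ∀ l ∈ W, 1 ≤ l) :
    entry r (-i) m (ClassicalType.C.wordMatrix r W) =
      if W = up m r ++ down (r - 1) i then 2 * (-1) ^ (r - i) else 0 := by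
  have habs : |(m : ℤ)| ≤ r := _root_.abs_le.2 ⟨by omega, by omega⟩
  induction W generalizing m with
  | nil =>
    rw [wordMatrix_nil, entry_one (_root_.abs_le.2 ⟨by omega, by omega⟩) habs, up_eq_cons hmr,
      if_neg (by omega), if_neg (by simp)]
  | cons l W ih =>
    have hl := hW l List.mem_cons_self
    have hW' : ∀ l ∈ W, 1 ≤ l := fun l h => hW l (List.mem_cons_of_mem _ h)
    simp only [cons_eq_up_append hmr]
    by_cases hlr : l = r
    · subst hlr
      rw [entry_wordMatrix_cons (X := .C) (c := l) l W habs (if_pos rfl) rfl]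
      by_cases hlm : l = m
      · subst hlm
        have h1 : -(l : ℤ) < 0 := by omega
        have h2 : ¬ (l : ℤ) < 0 := by omega
        rw [if_pos rfl, if_pos (neg_neg _).symm, up_eq_nil (Nat.lt_succ_self _), List.nil_append,
          entry_wordMatrix_neg_neg (.inr rfl) hi hir W hl le_rfl hW']
        simp only [formSign, h1, h2, if_true, if_false, hir, true_and]
        split_ifs <;> ring
      · rw [if_neg (by omega), if_neg (by omega), if_neg (by tauto), mul_zero, sub_zero]
    · have h1 := entry_wordMatrix_cons (X := .C) (c := l) (x := -i) l W habs (if_neg hlr) rfl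
      rw [h1, if_neg (by omega : ¬ (m : ℤ) = -((l : ℤ) + 1)), mul_zero, sub_zero]
      by_cases hlm : l = m
      · subst hlm
        have := ih (m := l + 1) (by omega) (by omega) hW' (_root_.abs_le.2 ⟨by omega, by omega⟩)
        push_cast at this
        rw [if_pos rfl, this]
        simp only [true_and]
      · rw [if_neg (by omega), if_neg (by tauto)]

/-- Words that move the column index from `m` to `j`, in type `A`. -/
theorem entry_wordMatrix_A {j : ℕ} (hj : j ≤ r) (W : List ℕ) {m : ℕ} (hm : 1 ≤ m) (hmr : m ≤ r)
    (hW : ∀ l ∈ W, 1 ≤ l ∧ l < r) :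
    entry r j m (ClassicalType.A.wordMatrix r W) =
      if m ≤ j ∧ W = up m (j - 1) then 1 else 0 := by
  have habs : |(m : ℤ)| ≤ r := _root_.abs_le.2 ⟨by omega, by omega⟩
  induction W generalizing m with
  | nil =>
    rw [wordMatrix_nil, entry_one (_root_.abs_le.2 ⟨by omega, by omega⟩) habs]
    simp only [nil_eq_up]
    exact if_congr (by omega) rfl rfl
  | cons l W ih =>
    have hl := hW l List.mem_cons_self
    rw [entry_wordMatrix_cons (a := (l + 1 : ℕ)) (c := l) l W habs rfl rfl,
      if_neg (by omega : ¬ ((m : ℤ) = -_)),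
      mul_zero, sub_zero]
    simp only [cons_eq_up]
    by_cases hlm : l = m
    · subst hlm
      rw [if_pos rfl, ih (m := l + 1) (by omega) (by omega)
        (fun l h => hW l (List.mem_cons_of_mem _ h)) (_root_.abs_le.2 ⟨by omega, by omega⟩)]
      refine if_congr ⟨fun h => ⟨by omega, rfl, by omega, h.2⟩,
        fun h => ⟨by omega, h.2.2.2⟩⟩ rfl rfl
    · rw [if_neg (by omega), if_neg (by tauto)]

theorem row_D {l : ℕ} (hl : 2 ≤ l) : ClassicalType.D.row r l = (l : ℤ) - 1 := if_neg (by omega)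

theorem col_D {l : ℕ} (hl : 2 ≤ l) : ClassicalType.D.col r l = (l : ℤ) := if_neg (by omega)

/-- Words that move the column index from `-m` to `-j`, in type `D`. -/
theorem entry_wordMatrix_D_neg_neg {j : ℕ} (hj : j ≤ r) (W : List ℕ) {m : ℕ} (hm : 1 ≤ m)
    (hmr : m ≤ r) (hW : ∀ l ∈ W, 1 ≤ l ∧ l ≤ r) :
    entry r (-j) (-m) (ClassicalType.D.wordMatrix r W) =
      if m ≤ j ∧ W = up (m + 1) j then (-1) ^ (j - m) else 0 := by
  have habs : |(-m : ℤ)| ≤ r := _root_.abs_le.2 ⟨by omega, by omega⟩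
  induction W generalizing m with
  | nil =>
    rw [wordMatrix_nil, entry_one (_root_.abs_le.2 ⟨by omega, by omega⟩) habs]
    simp only [nil_eq_up]
    by_cases h : j = m
    · subst h
      rw [if_pos rfl, if_pos ⟨le_rfl, by omega⟩, Nat.sub_self, pow_zero]
    · rw [if_neg (by omega), if_neg (by omega)]
  | cons l W ih =>
    have hl := hW l List.mem_cons_self
    simp only [cons_eq_up]
    rcases eq_or_lt_of_le hl.1 with rfl | hl2
    · rw [entry_wordMatrix_cons (a := -1) (c := 2) 1 W habs rfl rfl, if_neg (by omega),
        if_neg (by omega),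
        if_neg (by omega), mul_zero, sub_zero]
    rw [entry_wordMatrix_cons l W habs (row_D hl2) (col_D hl2), if_neg (by omega)]
    simp only [formSign, one_mul, zero_sub]
    by_cases hlm : l = m + 1
    · subst hlm
      rw [if_pos (by push_cast; omega),
        ih (by omega) hl.2 (fun l h => hW l (List.mem_cons_of_mem _ h))
          (_root_.abs_le.2 ⟨by omega, by omega⟩)]
      by_cases h : m + 1 ≤ j ∧ W = up (m + 1 + 1) j
      · rw [if_pos h, if_pos ⟨by omega, rfl, h⟩, show j - m = (j - (m + 1)) + 1 by omega, pow_succ]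
        ring
      · rw [if_neg h, if_neg (by tauto), neg_zero]
    · rw [if_neg (by omega), neg_zero, if_neg (by tauto)]

/-- Words that move the column index from 1 to `-j`, in type `D`. -/
theorem entry_wordMatrix_D_one {j : ℕ} (hj2 : 2 ≤ j) (hj : j ≤ r) (W : List ℕ)
    (hW : ∀ l ∈ W, 1 ≤ l ∧ l ≤ r) :
    entry r (-j) 1 (ClassicalType.D.wordMatrix r W) =
      if W = 1 :: up 3 j then -(-1) ^ j else 0 := by
  have habs : |(1 : ℤ)| ≤ r := _root_.abs_le.2 ⟨by omega, by omega⟩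
  cases W with
  | nil =>
    rw [wordMatrix_nil, entry_one (_root_.abs_le.2 ⟨by omega, by omega⟩) habs, if_neg (by omega),
      if_neg (by simp)]
  | cons l W =>
    have hl := hW l List.mem_cons_self
    simp only [List.cons_eq_cons]
    rcases eq_or_lt_of_le hl.1 with rfl | hl2
    · have h2 := entry_wordMatrix_D_neg_neg hj W (m := 2) (by omega) (by omega)
        (fun l h => hW l (List.mem_cons_of_mem _ h))
      push_cast at h2
      rw [entry_wordMatrix_cons (a := -1) (c := 2) 1 W habs rfl rfl, if_neg (by omega),
        if_pos (by norm_num), h2]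
      obtain ⟨j, rfl⟩ : ∃ c, j = c + 2 := ⟨j - 2, by omega⟩
      simp only [hj2, true_and, Nat.add_sub_cancel, pow_add, formSign]
      split_ifs <;> simp
    · rw [entry_wordMatrix_cons l W habs (row_D hl2) (col_D hl2), if_neg (by omega),
        if_neg (by omega), if_neg (by omega), mul_zero, sub_zero]

/-- Words that move the column index from `m` to `-j`, in type `D`. There are two of them, passing
from 2 to `-1` through `-2` or through 1, since the letters 1 and 2 can be interchanged. -/
theorem entry_wordMatrix_D_pos {j : ℕ} (hj3 : 2 < j) (hj : j ≤ r) (W : List ℕ) {m : ℕ} (hm : 2 ≤ m)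
    (hmr : m ≤ r) (hW : ∀ l ∈ W, 1 ≤ l ∧ l ≤ r) :
    entry r (-j) m (ClassicalType.D.wordMatrix r W) =
      -(-1) ^ j * ((if W = down m 3 ++ 1 :: 2 :: up 3 j then 1 else 0) +
        (if W = down m 3 ++ 2 :: 1 :: up 3 j then 1 else 0)) := by
  have habs : |(m : ℤ)| ≤ r := _root_.abs_le.2 ⟨by omega, by omega⟩
  induction W generalizing m with
  | nil =>
    rw [wordMatrix_nil, entry_one (_root_.abs_le.2 ⟨by omega, by omega⟩) habs, if_neg (by omega),
      if_neg (by simp), if_neg (by simp)]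
    ring
  | cons l W ih =>
    have hl := hW l List.mem_cons_self
    have hW' : ∀ l ∈ W, 1 ≤ l ∧ l ≤ r := fun l h => hW l (List.mem_cons_of_mem _ h)
    rcases Nat.lt_or_ge 2 m with hm3 | hm2
    · obtain ⟨m, rfl⟩ : ∃ c, m = c + 1 := ⟨m - 1, by omega⟩
      rw [down_succ (by omega), List.cons_append, List.cons_append]
      simp only [List.cons_eq_cons]
      rcases eq_or_lt_of_le hl.1 with rfl | hl2
      · rw [entry_wordMatrix_cons (a := -1) (c := 2) 1 W habs rfl rfl, if_neg (by omega),
          if_neg (by omega), if_neg (by omega), if_neg (by omega)]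
        ring
      rw [entry_wordMatrix_cons l W habs (row_D hl2) (col_D hl2),
        if_neg (by omega : ¬ ((m + 1 : ℕ) : ℤ) = -((l : ℤ) - 1)), mul_zero, sub_zero]
      by_cases hlm : l = m + 1
      · subst hlm
        have := ih (m := m) (by omega) (by omega) hW' (_root_.abs_le.2 ⟨by omega, by omega⟩)
        simpa using this
      · rw [if_neg (by omega), if_neg (by tauto), if_neg (by tauto)]
        ring
    · obtain rfl : m = 2 := by omega
      rw [down_eq_nil (by omega)]
      simp only [List.nil_append, List.cons_eq_cons]
      rcases eq_or_lt_of_le hl.1 with rfl | hl2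
      · have h2 := entry_wordMatrix_D_neg_neg hj W (m := 1) (by omega) (by omega) hW'
        push_cast at h2
        rw [entry_wordMatrix_cons (a := -1) (c := 2) 1 W habs rfl rfl, if_pos (by norm_num), h2,
          up_eq_cons (by omega)]
        obtain ⟨j, rfl⟩ : ∃ c, j = c + 1 := ⟨j - 1, by omega⟩
        simp only [(by omega : 1 ≤ j + 1), true_and, Nat.add_sub_cancel, pow_add]
        simp
      · have h1 := entry_wordMatrix_D_one (by omega : 2 ≤ j) hj W hW'
        rw [entry_wordMatrix_cons l W habs (row_D hl2) (col_D hl2),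
          if_neg (by omega : ¬ ((2 : ℕ) : ℤ) = -((l : ℤ) - 1)), mul_zero, sub_zero]
        by_cases hl2' : l = 2
        · subst hl2'
          simpa using h1
        · rw [if_neg (by omega), if_neg (by omega), if_neg (by omega)]
          ring

/-! ### Inversions in ascending and descending lists -/

theorem length_up (a b : ℕ) : (up a b).length = b + 1 - a := by rw [up, List.length_range']

theorem length_down (a b : ℕ) : (down a b).length = a + 1 - b := by
  rw [down, List.length_reverse, length_up]

theorem nodup_up (a b : ℕ) : (up a b).Nodup := List.nodup_range' (step := 1)

theorem nodup_down (a b : ℕ) : (down a b).Nodup := List.nodup_reverse.2 (nodup_up b a)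

theorem count_up (a b m : ℕ) : (up a b).count m = if a ≤ m ∧ m ≤ b then 1 else 0 := by
  rw [(nodup_up a b).count]
  simp only [mem_up]

theorem count_down (a b m : ℕ) : (down a b).count m = if b ≤ m ∧ m ≤ a then 1 else 0 := by
  rw [(nodup_down a b).count]
  simp only [mem_down]

theorem up_append {a b c : ℕ} (h1 : a ≤ c + 1) (h2 : c ≤ b) : up a b = up a c ++ up (c + 1) b := by
  induction b, h2 using Nat.le_induction with
  | base => rw [up_eq_nil (Nat.lt_succ_self c), List.append_nil]
  | succ b hb ih => rw [up_concat (by omega), up_concat (by omega), ih, List.append_assoc]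

theorem countP_up {a b c : ℕ} (h1 : a ≤ c + 1) (h2 : c ≤ b) :
    (up a b).countP (fun m => decide (m ≤ c)) = c + 1 - a := by
  rw [up_append h1 h2, List.countP_append, List.countP_eq_length.2, List.countP_eq_zero.2,
    length_up, add_zero]
  · intro m hm
    rw [mem_up] at hm
    simp only [decide_eq_true_eq]
    omega
  · intro m hm
    rw [mem_up] at hm
    simp only [decide_eq_true_eq]
    omega

theorem countP_down {a b c : ℕ} (h1 : a ≤ c + 1) (h2 : c ≤ b) :
    (down b a).countP (fun m => decide (m ≤ c)) = c + 1 - a := by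
  rw [down, (List.reverse_perm _).countP_eq, countP_up h1 h2]

theorem invSign_eq_one {α : Type} [LinearOrder α] {l : List α} (h : l.Pairwise (· < ·)) :
    invSign l = 1 := by
  induction h with
  | nil => rfl
  | cons h _ ih =>
    rw [invSign, ih, List.countP_eq_zero.2]
    · simp
    · intro b hb
      simpa using (h b hb).le

theorem invSign_down (a b : ℕ) : invSign (down a b) = (-1) ^ (a + 1 - b).choose 2 := by
  induction a with
  | zero =>
    by_cases hb : b = 0
    · subst hb
      simp [down, up, invSign]
    · rw [down_eq_nil (by omega), Nat.sub_eq_zero_of_le (by omega)]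
      rfl
  | succ a ih =>
    by_cases hb : b ≤ a + 1
    · rw [down_succ hb, invSign, ih, show a + 1 + 1 - b = (a + 1 - b) + 1 by omega,
        Nat.choose_succ_succ' _ 1, Nat.choose_one_right, pow_add, List.countP_eq_length.2,
          length_down]
      intro m hm
      rw [mem_down] at hm
      simp only [decide_eq_true_eq]
      omega
    · rw [down_eq_nil (by omega), Nat.sub_eq_zero_of_le (by omega)]
      rfl

theorem lex_lt {x y : ℕ × ℕ} : toLex x < toLex y ↔ x.1 < y.1 ∨ x.1 = y.1 ∧ x.2 < y.2 :=
  Prod.Lex.toLex_lt_toLex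

theorem invSign_map_pair (l : List ℕ) (c : ℕ) :
    invSign ((l.map fun m => (m, c)).map toLex) = invSign l := by
  rw [List.map_map]
  refine invSign_map _ l fun a _ b _ => ?_
  simp [lex_lt]

theorem invSign_up_append_down {i j s t : ℕ} (hij : i ≤ j) (hjs : j ≤ s + 1) (hst : s ≤ t) :
    invSign (((up j s).map (fun m => (m, 2)) ++ (down t i).map (fun m => (m, 1))).map toLex) =
      (-1) ^ ((j - i + 1).choose 2 + (s + 1 - i + 1).choose 2 + (t + 1 - i).choose 2) := by
  induction hjs using Nat.decreasingInduction with
  | self =>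
    rw [up_eq_nil (Nat.lt_succ_self s), List.map_nil, List.nil_append, invSign_map_pair,
      invSign_down,
      pow_add, ← two_mul, pow_mul]
    simp
  | of_succ j hj ih =>
    rw [up_eq_cons (by omega), List.map_cons, List.cons_append, List.map_cons, invSign,
      ih (by omega), List.map_append, List.countP_append, List.map_map, List.map_map,
      List.countP_map, List.countP_map, List.countP_eq_zero.2]
    · have h1 : (down t i).countP ((fun b => decide (b < toLex (j, 2))) ∘
          toLex ∘ fun m : ℕ => (m, 1)) = j - i + 1 := by
        rw [show j - i + 1 = j + 1 - i by omega, ← countP_down (a := i) (b := t) (c := j) (by omega)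
          (by omega)]
        refine List.countP_congr fun m _ => ?_
        simp only [Function.comp_apply, decide_eq_true_eq, lex_lt]
        omega
      rw [h1, zero_add, show j + 1 - i + 1 = (j - i + 1) + 1 by omega, Nat.choose_succ_succ' _ 1,
        Nat.choose_one_right, one_add_one_eq_two, ← pow_add]
      exact neg_one_pow_eq (by omega)
    · intro m hm
      rw [mem_up] at hm
      simp only [Function.comp_apply, decide_eq_true_eq, lex_lt]
      omega

theorem invSign_D {i j x y : ℕ} (hi : 2 ≤ i) (hij : i < j) (hx : x = 1 ∧ y = 2 ∨ x = 2 ∧ y = 1) :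
    invSign (((down i 3).map (fun m => (m, 2)) ++
      (x, 1) :: (y, 1) :: (up 3 j).map (fun m => (m, 1))).map toLex) =
      (-1) ^ i * if x = 1 then 1 else -1 := by
  induction i, hi using Nat.le_induction with
  | base =>
    have h3 : invSign (up 3 j) = 1 := invSign_eq_one (pairwise_lt_up 3 j)
    have h4 : ∀ z, z ≤ 2 → (List.map toLex ((up 3 j).map fun m : ℕ => (m, 1))).countP
        (fun b => decide (b < toLex (z, 1))) = 0 := by
      intro z hz
      rw [List.map_map, List.countP_map, List.countP_eq_zero]
      intro m hm
      rw [mem_up] at hm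
      simp only [Function.comp_apply, decide_eq_true_eq, lex_lt]
      omega
    rw [down_eq_nil (by omega), List.map_nil, List.nil_append, List.map_cons, List.map_cons,
      invSign,
      invSign, invSign_map_pair, h3, List.countP_cons, h4 x (by omega), h4 y (by omega)]
    rcases hx with ⟨rfl, rfl⟩ | ⟨rfl, rfl⟩ <;> simp [lex_lt]
  | succ i hi ih =>
    rw [down_succ (by omega), List.map_cons, List.cons_append, List.map_cons, invSign,
      ih (by omega), List.map_append, List.countP_append, List.map_cons, List.map_cons,
      List.countP_cons, List.countP_cons, List.map_map, List.map_map, List.countP_map,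
        List.countP_map,
      List.countP_eq_length.2, length_down]
    · have h1 : (up 3 j).countP ((fun b => decide (b < toLex (i + 1, 2))) ∘
          toLex ∘ fun m : ℕ => (m, 1)) = i - 1 := by
        rw [show i - 1 = i + 1 + 1 - 3 by omega, ← countP_up (a := 3) (b := j) (c := i + 1)
          (by omega) (by omega)]
        refine List.countP_congr fun m _ => ?_
        simp only [Function.comp_apply, decide_eq_true_eq, lex_lt]
        omega
      rw [h1, if_pos, if_pos, ← mul_assoc]
      · rw [← pow_add]
        congr 1
        exact neg_one_pow_eq (by omega)
      · simp only [decide_eq_true_eq, lex_lt]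
        omega
      · simp only [decide_eq_true_eq, lex_lt]
        omega
    · intro m hm
      rw [mem_down] at hm
      simp only [Function.comp_apply, decide_eq_true_eq, lex_lt]
      omega

/-! ### Residues of antisymmetrized strings -/

section Strings

variable {n : ℕ} {k : Fin n → ℕ}

/-- The two indices of a variable, counted from 1. -/
def varCode (x : Var k) : ℕ × ℕ := (x.1 + 1, x.2 + 1)

theorem varCode_injective : Function.Injective (varCode (k := k)) := by
  rintro ⟨i, a⟩ ⟨j, b⟩ h
  simp only [varCode, Prod.mk.injEq, Nat.add_right_cancel_iff] at h
  obtain rfl : i = j := Fin.ext h.1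
  obtain rfl : a = b := Fin.ext h.2
  rfl

theorem tvar_varCode (x : Var k) : tvar k (varCode x).1 (varCode x).2 = some x := by
  rw [tvar, dif_pos ⟨by simp [varCode], by simp [varCode]⟩]
  rfl

theorem exists_varCode_eq {v : ℕ × ℕ} (h2 : 1 ≤ v.2)
    (h : ∃ i : Fin n, (i : ℕ) + 1 = v.1 ∧ v.2 ≤ k i) : ∃ x : Var k, varCode x = v := by
  obtain ⟨i, hi, h3⟩ := h
  exact ⟨⟨i, ⟨v.2 - 1, by omega⟩⟩, Prod.ext hi (Nat.sub_add_cancel h2)⟩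

theorem lex_varCode (x y : Var k) :
    toLex (varCode x) < toLex (varCode y) ↔ (stdOrd k).symm x < (stdOrd k).symm y := by
  rw [stdOrd_symm_lt, lex_lt, Fin.lt_def, Fin.ext_iff]
  simp [varCode]

/-- A list of pairs `(i, j)` that names each variable `t^{(i)}_j` once is an ordering of the
variables. -/
theorem exists_ordering {vs : List (ℕ × ℕ)} (hnd : vs.Nodup)
    (hv : ∀ v ∈ vs, 1 ≤ v.1 ∧ v.1 ≤ n ∧ 1 ≤ v.2 ∧ v.2 ≤ (vs.map Prod.fst).count v.1)
    (hk : ∀ i : Fin n, k i = (vs.map Prod.fst).count ((i : ℕ) + 1)) :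
    ∃ w : Fin (∑ i, k i) ≃ Var k, (List.ofFn w).map varCode = vs := by
  classical
  have hr : vs ∈ Set.range (List.map (varCode (k := k))) := by
    rw [Set.range_list_map]
    intro v hvs
    obtain ⟨h1, h2, h3, h4⟩ := hv v hvs
    refine exists_varCode_eq h3 ⟨⟨v.1 - 1, by omega⟩, by simp only; omega, ?_⟩
    rw [hk]
    simpa only [Nat.sub_add_cancel h1] using h4
  obtain ⟨l, rfl⟩ := hr
  have hl : l.Nodup := hnd.of_map
  have hlen : l.length = ∑ i, k i := by
    have h1 := length_eq_sum_count (l.map Sigma.fst)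
    rw [List.length_map] at h1
    rw [h1]
    refine Finset.sum_congr rfl fun i _ => ?_
    rw [hk, List.map_map,
      ← List.count_map_of_injective (l.map Sigma.fst) (fun i : Fin n => (i : ℕ) + 1)
      (fun a b h => Fin.ext (Nat.add_right_cancel h)), List.map_map]
    rfl
  have hmem : ∀ x, x ∈ l := by
    have h1 : l.toFinset = Finset.univ := by
      rw [← Finset.card_eq_iff_eq_univ, List.toFinset_card_of_nodup hl, hlen]
      simp [Var]
    intro x
    rw [← List.mem_toFinset, h1]
    exact Finset.mem_univ x
  obtain ⟨w, hw⟩ := exists_ofFn_eq hl hmem hlen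
  exact ⟨w, by rw [hw]⟩

theorem asymTree_eq {es : List (Sym2 (Vert k))} {e : Fin (∑ i, k i) → Sym2 (Vert k)}
    (h : es = List.ofFn e) : asymTree k es = asym k (cls e) := by
  subst h
  rw [asymTree, dif_pos (List.length_ofFn)]
  congr 2
  funext a
  simp

theorem pathEdges_ofFn {W : Type} {p : ℕ} (w : Fin p → W) :
    pathEdges (none :: (List.ofFn w).map some) = List.ofFn (strEdges w) := by
  apply List.ext_getElem
  · simp [pathEdges]
  · intro a h1 h2
    rw [List.length_ofFn] at h2
    simp only [pathEdges, List.tail_cons, List.getElem_zipWith, List.getElem_map, List.getElem_ofFn,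
      strEdges, strTail]
    rcases a with _ | a
    · simp
    · simp

theorem map_succ_colors (w : Fin (∑ i, k i) ≃ Var k) :
    (colors w).map (fun i : Fin n => (i : ℕ) + 1) = ((List.ofFn w).map varCode).map Prod.fst := by
  rw [colors, List.map_ofFn, List.map_ofFn, List.map_ofFn]
  rfl

theorem eq_colors_iff (L : List (Fin n)) (w : Fin (∑ i, k i) ≃ Var k) :
    L = colors w ↔ L.map (fun i : Fin n => (i : ℕ) + 1) =
      ((List.ofFn w).map varCode).map Prod.fst := by
  rw [← map_succ_colors]
  refine (List.map_injective_iff.2 fun a b h => ?_).eq_iff.symm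
  exact Fin.ext (Nat.add_right_cancel h)

theorem ordSign_stdOrd (w : Fin (∑ i, k i) ≃ Var k) :
    ordSign (stdOrd k) w = invSign (((List.ofFn w).map varCode).map toLex) := by
  rw [ordSign_eq_invSign (stdOrd k) w (fun x => toLex (varCode x)) lex_varCode, List.map_map,
    List.map_ofFn]
  rfl

/-- The residues of an antisymmetrized string with the vertices `t^{(i)}_j`, for the pairs `(i, j)`
in a list. -/
theorem coeff_asymStr {vs : List (ℕ × ℕ)} (hnd : vs.Nodup)
    (hv : ∀ v ∈ vs, 1 ≤ v.1 ∧ v.1 ≤ n ∧ 1 ≤ v.2 ∧ v.2 ≤ (vs.map Prod.fst).count v.1)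
    (hk : ∀ i : Fin n, k i = (vs.map Prod.fst).count ((i : ℕ) + 1)) (L : List (Fin n)) :
    coeff k L (asymStr k (vs.map fun v => tvar k v.1 v.2)) =
      if L.map (fun i : Fin n => (i : ℕ) + 1) = vs.map Prod.fst
        then invSign (vs.map toLex) else 0 := by
  obtain ⟨w, rfl⟩ := exists_ordering hnd hv hk
  have h1 : ((List.ofFn w).map varCode).map (fun v => tvar k v.1 v.2) = (List.ofFn w).map some := by
    rw [List.map_map]
    exact List.map_congr_left fun x _ => tvar_varCode x
  rw [asymStr, h1, pathEdges_ofFn, asymTree_eq rfl, coeff_asym_strEdges, ordSign_stdOrd]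
  exact if_congr (eq_colors_iff L w) rfl rfl

/-- The residues of a string all of whose vertices have different colours. -/
theorem coeff_asymStr_of_nodup {ms : List ℕ} (hnd : ms.Nodup) (hm : ∀ m ∈ ms, 1 ≤ m ∧ m ≤ n)
    (hk : ∀ i : Fin n, k i = ms.count ((i : ℕ) + 1)) (L : List (Fin n)) :
    coeff k L (asymStr k (ms.map fun m => tvar k m 1)) =
      if L.map (fun i : Fin n => (i : ℕ) + 1) = ms then invSign ms else 0 := by
  have h1 : (ms.map fun m => (m, 1)).map Prod.fst = ms := by
    rw [List.map_map]
    exact List.map_id ms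
  have h := coeff_asymStr (k := k) (vs := ms.map fun m => (m, 1))
    (hnd.map fun a b h => congrArg Prod.fst h) (fun v hv => ?_) (fun i => by rw [h1, hk]) L
  · rw [h1, invSign_map_pair, List.map_map] at h
    exact h
  · obtain ⟨m, hm', rfl⟩ := List.mem_map.1 hv
    rw [h1, hnd.count, if_pos hm']
    exact ⟨(hm m hm').1, (hm m hm').2, le_rfl, le_rfl⟩

/-- The residues of a string with two vertices of some colours, beginning with those whose second
index is 2. -/
theorem coeff_asymStr_append {as bs : List ℕ} (ha : as.Nodup) (hb : bs.Nodup) (hab : as ⊆ bs)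
    (hm : ∀ m ∈ bs, 1 ≤ m ∧ m ≤ n)
    (hk : ∀ i : Fin n, k i = (as ++ bs).count ((i : ℕ) + 1)) (L : List (Fin n)) :
    coeff k L (asymStr k ((as.map fun m => tvar k m 2) ++ bs.map fun m => tvar k m 1)) =
      if L.map (fun i : Fin n => (i : ℕ) + 1) = as ++ bs then
        invSign (((as.map fun m => (m, 2)) ++ bs.map fun m => (m, 1)).map toLex) else 0 := by
  have h1 : ((as.map fun m => (m, 2)) ++ bs.map fun m => (m, 1)).map Prod.fst = as ++ bs := by
    rw [List.map_append, List.map_map, List.map_map]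
    exact congrArg₂ _ (List.map_id as) (List.map_id bs)
  have h := coeff_asymStr (k := k) (vs := (as.map fun m => (m, 2)) ++ bs.map fun m => (m, 1))
    ?_ (fun v hv => ?_) (fun i => by rw [h1, hk]) L
  · rw [h1, List.map_append, List.map_map, List.map_map] at h
    exact h
  · refine List.Nodup.append (ha.map fun a b h => congrArg Prod.fst h)
      (hb.map fun a b h => congrArg Prod.fst h) ?_
    intro v hv hv'
    obtain ⟨m, -, rfl⟩ := List.mem_map.1 hv
    obtain ⟨m', -, h⟩ := List.mem_map.1 hv'
    simp at h
  · rw [h1, List.count_append]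
    rcases List.mem_append.1 hv with hv | hv <;> obtain ⟨m, hm', rfl⟩ := List.mem_map.1 hv
    · rw [ha.count, hb.count, if_pos hm', if_pos (hab hm')]
      exact ⟨(hm m (hab hm')).1, (hm m (hab hm')).2, by simp, le_rfl⟩
    · rw [hb.count, if_pos hm']
      exact ⟨(hm m hm').1, (hm m hm').2, le_rfl, Nat.le_add_left _ _⟩

end Strings

/-! ### The listed strings are dual to matrix entries -/

theorem choose_two_succ (m : ℕ) : (m + 1).choose 2 = m + m.choose 2 := by
  rw [Nat.choose_succ_succ' _ 1, Nat.choose_one_right]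

theorem letters_bound {n : ℕ} (L : List (Fin n)) :
    ∀ l ∈ L.map (fun i : Fin n => (i : ℕ) + 1), 1 ≤ l ∧ l ≤ n := by
  intro l hl
  obtain ⟨i, -, rfl⟩ := List.mem_map.1 hl
  exact ⟨Nat.le_add_left _ _, i.2⟩

variable {r : ℕ}

theorem coeff_listed_A {i j : ℕ} (h : ClassicalType.A.IsPos r (.diff i j))
    (L : List (Fin (ClassicalType.A.rank r))) :
    ClassicalType.A.detScalar r (.diff i j) *
      coeff _ L (listed (ClassicalType.A.deg r (.diff i j)) .A r (.diff i j)) =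
    entry r (ClassicalType.A.detRow (.diff i j)) (ClassicalType.A.detCol (.diff i j))
      (ClassicalType.A.wordMatrix r
        (L.map fun i : Fin (ClassicalType.A.rank r) => (i : ℕ) + 1)) := by
  obtain ⟨h1, h2, h3⟩ : 1 ≤ i ∧ i < j ∧ j ≤ r := h
  have hL := letters_bound L
  have hT := coeff_asymStr_of_nodup (k := ClassicalType.A.deg r (.diff i j)) (nodup_up i (j - 1))
    (fun m hm => by rw [mem_up] at hm; simp only [ClassicalType.rank]; omega)
    (fun m => by
      simp only [ClassicalType.deg, ClassicalType.word, count_up, count_down]) L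
  simp only [listed, hT, ClassicalType.detRow, ClassicalType.detCol, ClassicalType.detScalar,
    Root.fst, Root.tgt]
  rw [entry_wordMatrix_A h3 _ h1 (by omega)
    (fun l hl => ⟨(hL l hl).1, by have : l ≤ r - 1 := (hL l hl).2; omega⟩),
    invSign_eq_one (pairwise_lt_up _ _), one_mul]
  simp only [h2.le, true_and]

theorem coeff_listed_BC_diff {X : ClassicalType} (hX : X = .B ∨ X = .C) {i j : ℕ}
    (h : X.IsPos r (.diff i j)) (L : List (Fin (X.rank r))) :
    X.detScalar r (.diff i j) * coeff _ L (listed (X.deg r (.diff i j)) X r (.diff i j)) =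
    entry r (X.detRow (.diff i j)) (X.detCol (.diff i j))
      (X.wordMatrix r (L.map fun i : Fin (X.rank r) => (i : ℕ) + 1)) := by
  obtain ⟨h1, h2, h3⟩ : 1 ≤ i ∧ i < j ∧ j ≤ r := by rcases hX with rfl | rfl <;> exact h
  have hL := letters_bound L
  have hrank : X.rank r = r := by rcases hX with rfl | rfl <;> rfl
  have hT := coeff_asymStr_of_nodup (k := X.deg r (.diff i j)) (nodup_down (j - 1) i)
    (fun m hm => by rw [mem_down] at hm; omega)
    (fun m => by rcases hX with rfl | rfl <;> simp only [ClassicalType.deg, ClassicalType.word]) L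
  have hl : listed (X.deg r (.diff i j)) X r (.diff i j) = (-1 : ℂ) ^ (j - i - 1).choose 2 •
      asymStr _ ((down (j - 1) i).map fun m => tvar _ m 1) := by
    rcases hX with rfl | rfl <;> rfl
  have hs : X.detScalar r (.diff i j) = -1 := by rcases hX with rfl | rfl <;> rfl
  have he : entry r (X.detRow (.diff i j)) (X.detCol (.diff i j)) = entry r (-i) (-j) := by
    rcases hX with rfl | rfl <;> rfl
  rw [hl, hs, he, map_smul, hT, entry_wordMatrix_neg_neg hX h1 (by omega) _ (by omega) h3
    (fun l hl => (hL l hl).1), invSign_down, smul_eq_mul]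
  simp only [h2.le, true_and]
  split_ifs
  · rw [neg_one_mul, ← pow_add, ← neg_one_mul, ← pow_succ']
    apply neg_one_pow_eq
    have := choose_two_succ (j - i - 1)
    rw [show j - i - 1 + 1 = j - 1 + 1 - i by omega] at this
    omega
  · simp

theorem coeff_listed_B_single {i : ℕ} (h : ClassicalType.B.IsPos r (.single i))
    (L : List (Fin (ClassicalType.B.rank r))) :
    ClassicalType.B.detScalar r (.single i) *
      coeff _ L (listed (ClassicalType.B.deg r (.single i)) .B r (.single i)) =
    entry r (ClassicalType.B.detRow (.single i)) (ClassicalType.B.detCol (.single i))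
      (ClassicalType.B.wordMatrix r
        (L.map fun i : Fin (ClassicalType.B.rank r) => (i : ℕ) + 1)) := by
  obtain ⟨h1, h2⟩ : 1 ≤ i ∧ i ≤ r := h
  have hL := letters_bound L
  have hT := coeff_asymStr_of_nodup (k := ClassicalType.B.deg r (.single i)) (nodup_down r i)
    (fun m hm => by rw [mem_down] at hm; simp only [ClassicalType.rank]; omega)
    (fun m => by simp only [ClassicalType.deg, ClassicalType.word]) L
  have hs : ClassicalType.B.detScalar r (.single i) = -1 := rfl
  simp only [listed, map_smul, hT, ClassicalType.detRow, ClassicalType.detCol, hs, Root.fst,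
    Root.tgt, neg_zero]
  rw [entry_wordMatrix_B_zero h1 h2 _ (fun l hl => (hL l hl).1), invSign_down, smul_eq_mul]
  split_ifs
  · rw [neg_one_mul, ← pow_add, neg_inj]
    apply neg_one_pow_eq
    have := choose_two_succ (r - i)
    rw [show r - i + 1 = r + 1 - i by omega] at this
    omega
  · simp

theorem coeff_listed_B_sum {i j : ℕ} (h : ClassicalType.B.IsPos r (.sum i j))
    (L : List (Fin (ClassicalType.B.rank r))) :
    ClassicalType.B.detScalar r (.sum i j) *
      coeff _ L (listed (ClassicalType.B.deg r (.sum i j)) .B r (.sum i j)) =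
    entry r (ClassicalType.B.detRow (.sum i j)) (ClassicalType.B.detCol (.sum i j))
      (ClassicalType.B.wordMatrix r
        (L.map fun i : Fin (ClassicalType.B.rank r) => (i : ℕ) + 1)) := by
  obtain ⟨h1, h2, h3⟩ : 1 ≤ i ∧ i < j ∧ j ≤ r := h
  have hL := letters_bound L
  have hT := coeff_asymStr_append (k := ClassicalType.B.deg r (.sum i j)) (nodup_up j r)
    (nodup_down r i)
    (fun m hm => by rw [mem_up] at hm; rw [mem_down]; omega)
    (fun m hm => by rw [mem_down] at hm; simp only [ClassicalType.rank]; omega)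
    (fun m => by
      simp only [ClassicalType.deg, ClassicalType.word, List.count_append, count_up, count_down]
      omega) L
  have hs : ClassicalType.B.detScalar r (.sum i j) = -(-1) ^ ((j - i + 1).choose 2 + (j - i) + 1) :=
    rfl
  simp only [listed, map_smul, hT, ClassicalType.detRow, ClassicalType.detCol, hs, Root.fst,
    Root.tgt, neg_neg]
  rw [entry_wordMatrix_B_pos h1 (by omega) _ (by omega) h3 (fun l hl => (hL l hl).1),
    invSign_up_append_down h2.le (by omega) le_rfl, smul_eq_mul]
  split_ifs
  · rw [neg_mul, ← pow_add, ← pow_add, neg_inj]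
    apply neg_one_pow_eq
    have := choose_two_succ (r + 1 - i)
    omega
  · simp

theorem coeff_listed_C_sum {i j : ℕ} (h : ClassicalType.C.IsPos r (.sum i j))
    (L : List (Fin (ClassicalType.C.rank r))) :
    ClassicalType.C.detScalar r (.sum i j) *
      coeff _ L (listed (ClassicalType.C.deg r (.sum i j)) .C r (.sum i j)) =
    entry r (ClassicalType.C.detRow (.sum i j)) (ClassicalType.C.detCol (.sum i j))
      (ClassicalType.C.wordMatrix r
        (L.map fun i : Fin (ClassicalType.C.rank r) => (i : ℕ) + 1)) := by
  obtain ⟨h1, h2, h3⟩ : 1 ≤ i ∧ i < j ∧ j ≤ r := h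
  have hL := letters_bound L
  have hT := coeff_asymStr_append (k := ClassicalType.C.deg r (.sum i j)) (nodup_up j (r - 1))
    (nodup_down r i)
    (fun m hm => by rw [mem_up] at hm; rw [mem_down]; omega)
    (fun m hm => by rw [mem_down] at hm; simp only [ClassicalType.rank]; omega)
    (fun m => by
      simp only [ClassicalType.deg, ClassicalType.word, List.count_append, count_up, count_down]
      split_ifs <;> omega) L
  have hs : ClassicalType.C.detScalar r (.sum i j) = 2 * (-1) ^ (j - i) := rfl
  have hw : up j r ++ down (r - 1) i = up j (r - 1) ++ down r i := by
    obtain ⟨s, rfl⟩ : ∃ s, r = s + 1 := ⟨r - 1, by omega⟩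
    rw [Nat.add_sub_cancel, up_concat (by omega), down_succ (by omega), List.append_assoc]
    rfl
  simp only [listed, map_smul, hT, ClassicalType.detRow, ClassicalType.detCol, hs, Root.fst,
    Root.tgt, neg_neg]
  rw [entry_wordMatrix_C_pos h1 (by omega) _ (by omega) h3 (fun l hl => (hL l hl).1),
    invSign_up_append_down h2.le (by omega) (Nat.sub_le r 1), smul_eq_mul, hw]
  split_ifs
  · rw [mul_assoc, ← pow_add, ← pow_add]
    congr 1
    apply neg_one_pow_eq
    rw [show r - 1 + 1 - i + 1 = r + 1 - i by omega]
    omega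
  · simp

theorem coeff_listed_D_diff {i j : ℕ} (h : ClassicalType.D.IsPos r (.diff j i))
    (L : List (Fin (ClassicalType.D.rank r))) :
    ClassicalType.D.detScalar r (.diff j i) *
      coeff _ L (listed (ClassicalType.D.deg r (.diff j i)) .D r (.diff j i)) =
    entry r (ClassicalType.D.detRow (.diff j i)) (ClassicalType.D.detCol (.diff j i))
      (ClassicalType.D.wordMatrix r
        (L.map fun i : Fin (ClassicalType.D.rank r) => (i : ℕ) + 1)) := by
  obtain ⟨h1, h2, h3⟩ : 1 ≤ i ∧ i < j ∧ j ≤ r := h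
  have hL := letters_bound L
  have hT := coeff_asymStr_of_nodup (k := ClassicalType.D.deg r (.diff j i)) (nodup_up (i + 1) j)
    (fun m hm => by rw [mem_up] at hm; simp only [ClassicalType.rank]; omega)
    (fun m => by simp only [ClassicalType.deg, ClassicalType.word, count_up, count_down]) L
  have hs : ClassicalType.D.detScalar r (.diff j i) = -(-1) ^ (j - i - 1) := rfl
  simp only [listed, hT, ClassicalType.detRow, ClassicalType.detCol, hs, Root.fst, Root.tgt]
  rw [entry_wordMatrix_D_neg_neg h3 _ h1 (by omega) hL, invSign_eq_one (pairwise_lt_up _ _)]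
  simp only [h2.le, true_and]
  split_ifs
  · rw [mul_one, ← neg_one_mul, ← pow_succ']
    exact neg_one_pow_eq (by omega)
  · simp

theorem coeff_listed_D_sum_one {j : ℕ} (h : ClassicalType.D.IsPos r (.sum j 1))
    (L : List (Fin (ClassicalType.D.rank r))) :
    ClassicalType.D.detScalar r (.sum j 1) *
      coeff _ L (listed (ClassicalType.D.deg r (.sum j 1)) .D r (.sum j 1)) =
    entry r (ClassicalType.D.detRow (.sum j 1)) (ClassicalType.D.detCol (.sum j 1))
      (ClassicalType.D.wordMatrix r
        (L.map fun i : Fin (ClassicalType.D.rank r) => (i : ℕ) + 1)) := by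
  obtain ⟨-, h2, h3⟩ : 1 ≤ 1 ∧ 1 < j ∧ j ≤ r := h
  have hL := letters_bound L
  have hlt : ∀ m ∈ up 3 j, 1 < m := fun m hm => by rw [mem_up] at hm; omega
  have hT := coeff_asymStr_of_nodup (k := ClassicalType.D.deg r (.sum j 1)) (ms := 1 :: up 3 j)
    (List.nodup_cons.2 ⟨fun hm => lt_irrefl _ (hlt 1 hm), nodup_up 3 j⟩)
    (fun m hm => by
      rw [List.mem_cons, mem_up] at hm
      simp only [ClassicalType.rank]
      omega)
    (fun m => by
      simp only [ClassicalType.deg, ClassicalType.word, if_true, List.count_append, count_up,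
        count_down, List.count_cons, List.count_nil]
      omega) L
  have hs : ClassicalType.D.detScalar r (.sum j 1) = -(-1) ^ j := rfl
  rw [List.map_cons] at hT
  have he := entry_wordMatrix_D_one h2 h3 _ hL
  simp only [listed, if_true, hT, ClassicalType.detRow, ClassicalType.detCol, hs, Root.fst,
    Root.tgt,
    neg_neg, Nat.cast_one]
  rw [he, invSign_eq_one (List.pairwise_cons.2 ⟨hlt, pairwise_lt_up _ _⟩)]
  split_ifs <;> simp

theorem coeff_listed_D_sum {i j : ℕ} (hi : 2 ≤ i) (h : ClassicalType.D.IsPos r (.sum j i))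
    (L : List (Fin (ClassicalType.D.rank r))) :
    ClassicalType.D.detScalar r (.sum j i) *
      coeff _ L (listed (ClassicalType.D.deg r (.sum j i)) .D r (.sum j i)) =
    entry r (ClassicalType.D.detRow (.sum j i)) (ClassicalType.D.detCol (.sum j i))
      (ClassicalType.D.wordMatrix r
        (L.map fun i : Fin (ClassicalType.D.rank r) => (i : ℕ) + 1)) := by
  obtain ⟨-, h2, h3⟩ : 1 ≤ i ∧ i < j ∧ j ≤ r := h
  have hL := letters_bound L
  have hT : ∀ x y : ℕ, x = 1 ∧ y = 2 ∨ x = 2 ∧ y = 1 →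
      coeff _ L (asymStr (ClassicalType.D.deg r (.sum j i))
        (((down i 3).map fun m => tvar _ m 2) ++
          tvar _ x 1 :: tvar _ y 1 :: (up 3 j).map fun m => tvar _ m 1)) =
      if L.map (fun i : Fin _ => (i : ℕ) + 1) = down i 3 ++ x :: y :: up 3 j then
        (-1) ^ i * if x = 1 then 1 else -1 else 0 := by
    intro x y hxy
    have := coeff_asymStr_append (k := ClassicalType.D.deg r (.sum j i)) (as := down i 3)
      (bs := x :: y :: up 3 j) (nodup_down i 3)
      (by
        rw [List.nodup_cons, List.nodup_cons, List.mem_cons, mem_up, mem_up]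
        exact ⟨by omega, by omega, nodup_up 3 j⟩)
      (fun m hm => by
        rw [mem_down] at hm
        rw [List.mem_cons, List.mem_cons, mem_up]
        omega)
      (fun m hm => by
        rw [List.mem_cons, List.mem_cons, mem_up] at hm
        simp only [ClassicalType.rank]
        omega)
      (fun m => by
        simp only [ClassicalType.deg, ClassicalType.word, if_neg (by omega : ¬ i = 1),
          List.count_append, count_up, count_down, List.count_cons, beq_iff_eq]
        split_ifs <;> omega) L
    rw [← invSign_D hi h2 hxy]
    exact this
  have hs : ClassicalType.D.detScalar r (.sum j i) = -(-1) ^ j := rfl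
  simp only [listed, if_neg (by omega : ¬ i = 1), map_smul, map_sub, hT 1 2 (.inl ⟨rfl, rfl⟩),
    hT 2 1 (.inr ⟨rfl, rfl⟩), ClassicalType.detRow, ClassicalType.detCol, hs, Root.fst, Root.tgt,
    neg_neg]
  rw [entry_wordMatrix_D_pos (by omega) h3 _ hi (by omega) hL, smul_eq_mul]
  congr 1
  have hsq : (-1 : ℂ) ^ i * (-1) ^ i = 1 := by rw [← mul_pow]; simp
  rw [if_pos trivial, if_neg (by norm_num : ¬ (2 : ℕ) = 1), mul_sub, mul_ite, mul_ite, mul_zero,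
    mul_one, mul_neg_one, mul_neg,
    hsq]
  split_ifs <;> norm_num

/-- The listed elements for all roots except the long roots of type `C`: their coefficients are
matrix entries of the standard representation. -/
theorem coeff_listed {X : ClassicalType} {β : Root} (hβ : X.IsPos r β) (hβ' : ∀ i, β ≠ .double i)
    (L : List (Fin (X.rank r))) :
    coeff _ L (listed (X.deg r β) X r β) = (X.detScalar r β)⁻¹ * entry r (X.detRow β) (X.detCol β)
      (X.wordMatrix r (L.map fun i : Fin (X.rank r) => (i : ℕ) + 1)) := by
  rw [eq_inv_mul_iff_mul_eq₀ (detScalar_ne_zero β)]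
  cases β with
  | double i => exact absurd rfl (hβ' i)
  | single i =>
    cases X with
    | B => exact coeff_listed_B_single hβ L
    | _ => exact hβ.elim
  | diff i j =>
    cases X with
    | A => exact coeff_listed_A hβ L
    | B => exact coeff_listed_BC_diff (.inl rfl) hβ L
    | C => exact coeff_listed_BC_diff (.inr rfl) hβ L
    | D => exact coeff_listed_D_diff hβ L
  | sum i j =>
    cases X with
    | A => exact hβ.elim
    | B => exact coeff_listed_B_sum hβ L
    | C => exact coeff_listed_C_sum hβ L
    | D =>
      have h1 : 1 ≤ j := hβ.1
      rcases eq_or_lt_of_le h1 with rfl | h1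
      · exact coeff_listed_D_sum_one hβ L
      · exact coeff_listed_D_sum h1 hβ L

variable {r : ℕ}

/-! ### Iterated commutators with the sign matrix -/

/-- The diagonal matrix with entries `1` at the positive and `-1` at the other indices. The adjoint
action on it of the lower triangular symplectic matrices gives a module over the enveloping algebra
that detects the long roots `2 e_i`, which no entry of a product of matrices does. -/
def signMatrix (r : ℕ) : Matrix (Ix r) (Ix r) ℂ :=
  Matrix.diagonal fun x => if 0 < x.1 then 1 else -1

/-- The iterated commutator `[M_1, [M_2, … [M_s, Z]]]`, where `Z` is the sign matrix. -/
def adNest (Ms : List (Matrix (Ix r) (Ix r) ℂ)) : Matrix (Ix r) (Ix r) ℂ :=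
  Ms.foldr (fun M N => ⁅M, N⁆) (signMatrix r)

/-- The matrices all of whose nonzero entries have a positive column and a nonpositive row index. -/
def IsLowerBlock (M : Matrix (Ix r) (Ix r) ℂ) : Prop :=
  signMatrix r * M = -M ∧ M * signMatrix r = M

theorem IsLowerBlock.zero : IsLowerBlock (0 : Matrix (Ix r) (Ix r) ℂ) := ⟨by simp, by simp⟩

theorem IsLowerBlock.smul {M : Matrix (Ix r) (Ix r) ℂ} (h : IsLowerBlock M) (c : ℂ) :
    IsLowerBlock (c • M) :=
  ⟨by rw [mul_smul_comm, h.1, smul_neg], by rw [smul_mul_assoc, h.2]⟩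

theorem IsLowerBlock.mul_eq_zero {M N : Matrix (Ix r) (Ix r) ℂ} (hM : IsLowerBlock M)
    (hN : IsLowerBlock N) : M * N = 0 := by
  have h : M * N = -(M * N) := by
    conv_lhs => rw [← hM.2, mul_assoc, hN.1, mul_neg]
  ext x y
  exact self_eq_neg.1 (congrFun (congrFun h x) y)

theorem IsLowerBlock.lie_eq_zero {M N : Matrix (Ix r) (Ix r) ℂ} (hM : IsLowerBlock M)
    (hN : IsLowerBlock N) : ⁅M, N⁆ = 0 := by
  rw [LieRing.of_associative_ring_bracket, hM.mul_eq_zero hN, hN.mul_eq_zero hM, sub_zero]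

theorem IsLowerBlock.lie_signMatrix {M : Matrix (Ix r) (Ix r) ℂ} (hM : IsLowerBlock M) :
    ⁅M, signMatrix r⁆ = (2 : ℂ) • M := by
  rw [LieRing.of_associative_ring_bracket, hM.1, hM.2, sub_neg_eq_add, two_smul]

theorem IsLowerBlock.lie {M N : Matrix (Ix r) (Ix r) ℂ} (hM : Commute M (signMatrix r))
    (hN : IsLowerBlock N) : IsLowerBlock ⁅M, N⁆ := by
  constructor
  · rw [LieRing.of_associative_ring_bracket, mul_sub, ← mul_assoc, ← hM.eq, mul_assoc, hN.1,
      ← mul_assoc, hN.1, mul_neg, neg_mul, neg_sub]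
    abel
  · rw [LieRing.of_associative_ring_bracket, sub_mul, mul_assoc, hN.2, mul_assoc, hM.eq,
      ← mul_assoc,
      hN.2]

/-- An iterated commutator with the sign matrix lies in the lower left block. -/
theorem isLowerBlock_adNest {Ms : List (Matrix (Ix r) (Ix r) ℂ)}
    (h : ∀ M ∈ Ms, IsLowerBlock M ∨ Commute M (signMatrix r)) (hne : Ms ≠ []) :
    IsLowerBlock (adNest Ms) := by
  induction Ms with
  | nil => exact absurd rfl hne
  | cons M Ms ih =>
    have hM := h M List.mem_cons_self
    by_cases hMs : Ms = []
    · subst hMs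
      rcases hM with hM | hM
      · rw [show adNest [M] = ⁅M, signMatrix r⁆ from rfl, hM.lie_signMatrix]
        exact hM.smul 2
      · rw [adNest, List.foldr_cons, List.foldr_nil, hM.lie_eq]
        exact .zero
    · have hN := ih (fun N hN => h N (List.mem_cons_of_mem _ hN)) hMs
      rcases hM with hM | hM
      · have : adNest (M :: Ms) = 0 := hM.lie_eq_zero hN
        rw [this]
        exact .zero
      · exact IsLowerBlock.lie hM hN

theorem adNest_cons_of_isLowerBlock {M : Matrix (Ix r) (Ix r) ℂ}
    {Ms : List (Matrix (Ix r) (Ix r) ℂ)}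
    (hM : IsLowerBlock M) (h : ∀ M ∈ Ms, IsLowerBlock M ∨ Commute M (signMatrix r)) :
    adNest (M :: Ms) = if Ms = [] then (2 : ℂ) • M else 0 := by
  split_ifs with hMs
  · subst hMs
    exact hM.lie_signMatrix
  · exact hM.lie_eq_zero (isLowerBlock_adNest h hMs)

theorem commute_skewUnit_signMatrix {a c : ℤ} (ha : 1 ≤ a) (hc : 1 ≤ c) :
    Commute (skewUnit .C r a c) (signMatrix r) := by
  ext x y
  rw [signMatrix, Matrix.mul_diagonal, Matrix.diagonal_mul, skewUnit_apply]
  by_cases h1 : x.1 = a ∧ y.1 = c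
  · rw [if_pos (by omega : 0 < y.1), if_pos (by omega : 0 < x.1), mul_one, one_mul]
  · by_cases h2 : x.1 = -c ∧ y.1 = -a
    · rw [if_neg (by omega : ¬ 0 < y.1), if_neg (by omega : ¬ 0 < x.1), mul_comm]
    · rw [if_neg h1, if_neg h2]
      simp

theorem isLowerBlock_skewUnit {a c : ℤ} (ha : 1 ≤ a) (hc : 1 ≤ c) :
    IsLowerBlock (skewUnit .C r (-a) c) := by
  have h : ∀ x y : Ix r, ¬ (x.1 = -a ∧ y.1 = c) → ¬ (x.1 = -c ∧ y.1 = - -a) →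
      skewUnit .C r (-a) c x y = 0 := by
    intro x y h1 h2
    rw [skewUnit_apply, if_neg h1, if_neg h2]
    simp
  constructor
  · ext x y
    rw [signMatrix, Matrix.diagonal_mul, Matrix.neg_apply]
    by_cases hx : 0 < x.1
    · rw [h x y (by omega) (by omega), mul_zero, neg_zero]
    · rw [if_neg hx, neg_one_mul]
  · ext x y
    rw [signMatrix, Matrix.mul_diagonal]
    by_cases hy : 0 < y.1
    · rw [if_pos hy, mul_one]
    · rw [h x y (by omega) (by omega), zero_mul]

theorem entry_transpose (M : Matrix (Ix r) (Ix r) ℂ) (a b : ℤ) :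
    entry r a b M.transpose = entry r b a M := by
  by_cases h : |a| ≤ r ∧ |b| ≤ r
  · rw [entry, entry, dif_pos h, dif_pos h.symm]
    rfl
  · rw [entry, entry, dif_neg h, dif_neg (fun h' => h h'.symm)]
    rfl

theorem transpose_unitMatrix (a b : ℤ) : (unitMatrix r a b).transpose = unitMatrix r b a := by
  ext x y
  rw [Matrix.transpose_apply, unitMatrix_apply, unitMatrix_apply]
  exact if_congr and_comm rfl rfl

theorem entry_unitMatrix_mul (M : Matrix (Ix r) (Ix r) ℂ) {x y : ℤ} (a b : ℤ) (hx : |x| ≤ r) :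
    entry r x y (unitMatrix r a b * M) = if x = a then entry r b y M else 0 := by
  rw [← entry_transpose, Matrix.transpose_mul, transpose_unitMatrix, entry_mul_unitMatrix _ _ _ hx,
    entry_transpose]

theorem entry_lie_skewUnit (M : Matrix (Ix r) (Ix r) ℂ) {x y a c : ℕ} (hx : x ≤ r) (hy : y ≤ r)
    (hx1 : 1 ≤ x) (hy1 : 1 ≤ y) :
    entry r (-x) y ⁅skewUnit .C r a c, M⁆ =
      -(if x = c then entry r (-a) y M else 0) - (if y = c then entry r (-x) a M else 0) := by
  rw [LieRing.of_associative_ring_bracket, map_sub,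
    entry_mul_skewUnit _ _ _ (_root_.abs_le.2 ⟨by omega, by omega⟩), skewUnit, sub_mul,
      smul_mul_assoc,
    map_sub, map_smul, entry_unitMatrix_mul _ _ _ (_root_.abs_le.2 ⟨by omega, by omega⟩),
    entry_unitMatrix_mul _ _ _ (_root_.abs_le.2 ⟨by omega, by omega⟩), formSign_pos _ (by omega),
    formSign_pos _ (by omega), if_neg (by omega : ¬ -(x : ℤ) = a),
      if_neg (by omega : ¬ (y : ℤ) = -a)]
  simp only [neg_inj, Nat.cast_inj, one_mul, one_smul, mul_zero, sub_zero, zero_sub]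

theorem entry_skewUnit_neg {x y a c : ℕ} (hx : x ≤ r) (hy : y ≤ r) (ha : 1 ≤ a) :
    entry r (-x) y (skewUnit .C r (-a) c) =
      (if x = a ∧ y = c then 1 else 0) + (if x = c ∧ y = a then 1 else 0) := by
  have h1 : -(a : ℤ) < 0 := by omega
  have h2 : ¬ (c : ℤ) < 0 := by omega
  rw [entry_skewUnit (_root_.abs_le.2 ⟨by omega, by omega⟩) (_root_.abs_le.2 ⟨by omega, by omega⟩)]
  simp only [formSign, h1, h2, if_true, if_false, neg_inj, Nat.cast_inj, neg_neg]
  ring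

/-! ### Iterated commutators of the root vectors of type C -/

theorem rootMatrix_C_diff (i j : ℕ) :
    ClassicalType.C.rootMatrix r (.diff i j) = skewUnit .C r j i := one_smul _ _

theorem isLowerBlock_rootMatrix {γ : Root} (hγ : ClassicalType.C.IsPos r γ)
    (h : ∀ i j, γ ≠ .diff i j) : IsLowerBlock (ClassicalType.C.rootMatrix r γ) := by
  refine IsLowerBlock.smul ?_ _
  cases γ with
  | diff i j => exact absurd rfl (h i j)
  | single i => exact hγ.elim
  | sum i j =>
    obtain ⟨h1, h2, h3⟩ : 1 ≤ i ∧ i < j ∧ j ≤ r := hγ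
    exact isLowerBlock_skewUnit (by omega) (by simp only [Root.fst]; omega)
  | double i =>
    obtain ⟨h1, h2⟩ : 1 ≤ i ∧ i ≤ r := hγ
    exact isLowerBlock_skewUnit (by omega) (by simp only [Root.fst]; omega)

theorem rootMatrix_isLowerBlock_or_commute {γ : Root} (hγ : ClassicalType.C.IsPos r γ) :
    IsLowerBlock (ClassicalType.C.rootMatrix r γ) ∨
      Commute (ClassicalType.C.rootMatrix r γ) (signMatrix r) := by
  by_cases h : ∀ i j, γ ≠ .diff i j
  · exact .inl (isLowerBlock_rootMatrix hγ h)
  · push Not at h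
    obtain ⟨i, j, rfl⟩ := h
    obtain ⟨h1, h2, h3⟩ : 1 ≤ i ∧ i < j ∧ j ≤ r := hγ
    rw [rootMatrix_C_diff]
    exact .inr (commute_skewUnit_signMatrix (by omega) (by omega))

/-- The iterated commutator of root vectors with the sign matrix. -/
def rootNest (r : ℕ) (L : List Root) : Matrix (Ix r) (Ix r) ℂ :=
  adNest (L.map (ClassicalType.C.rootMatrix r))

/-- Root vectors that are not of the form `F_{e_i - e_j}` lie in the commutative lower left block
and kill all longer iterated commutators. -/
theorem rootNest_cons_of_ne_diff {γ : Root} {L : List Root} (hγ : ClassicalType.C.IsPos r γ)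
    (h : ∀ i j, γ ≠ .diff i j) (hL : ∀ γ ∈ L, ClassicalType.C.IsPos r γ) :
    rootNest r (γ :: L) = if L = [] then (2 : ℂ) • ClassicalType.C.rootMatrix r γ else 0 := by
  rw [rootNest, List.map_cons, adNest_cons_of_isLowerBlock (isLowerBlock_rootMatrix hγ h)]
  · simp only [List.map_eq_nil_iff]
  · intro M hM
    obtain ⟨δ, hδ, rfl⟩ := List.mem_map.1 hM
    exact rootMatrix_isLowerBlock_or_commute (hL δ hδ)

theorem rootNest_diff_singleton {i j : ℕ} (h : ClassicalType.C.IsPos r (.diff i j)) :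
    rootNest r [.diff i j] = 0 := by
  obtain ⟨h1, h2, h3⟩ : 1 ≤ i ∧ i < j ∧ j ≤ r := h
  have : rootNest r [.diff i j] = ⁅ClassicalType.C.rootMatrix r (.diff i j), signMatrix r⁆ := rfl
  rw [this, rootMatrix_C_diff, (commute_skewUnit_signMatrix (by omega) (by omega)).lie_eq]

/-- The recursion for the entries of an iterated commutator. -/
theorem entry_rootNest_cons {γ : Root} {L : List Root} (hγ : ClassicalType.C.IsPos r γ)
    (hL : ∀ γ ∈ L, ClassicalType.C.IsPos r γ) {x y : ℕ} (hx : x ≤ r) (hy : y ≤ r)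
    (hx1 : 1 ≤ x) (hy1 : 1 ≤ y) (hne : entry r (-x) y (rootNest r (γ :: L)) ≠ 0) :
    (L = [] ∧ (γ = .sum x y ∨ γ = .sum y x ∨ γ = .double x ∧ x = y)) ∨
    (L ≠ [] ∧ ∃ i j, γ = .diff i j ∧ (x = i ∧ entry r (-j) y (rootNest r L) ≠ 0 ∨
      y = i ∧ entry r (-x) j (rootNest r L) ≠ 0)) := by
  by_cases h : ∀ i j, γ ≠ .diff i j
  · left
    rw [rootNest_cons_of_ne_diff hγ h hL] at hne
    split_ifs at hne with hLe
    · refine ⟨hLe, ?_⟩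
      rw [map_smul, ClassicalType.rootMatrix, map_smul] at hne
      have h1 := right_ne_zero_of_smul (right_ne_zero_of_smul hne)
      cases γ with
      | diff i j => exact absurd rfl (h i j)
      | single i => exact hγ.elim
      | sum i j =>
        obtain ⟨h2, h3, h4⟩ : 1 ≤ i ∧ i < j ∧ j ≤ r := hγ
        simp only [Root.tgt, Root.fst] at h1
        rw [entry_skewUnit_neg hx hy (by omega)] at h1
        by_cases h5 : x = j ∧ y = i
        · exact .inr (.inl (by rw [h5.1, h5.2]))
        · by_cases h6 : x = i ∧ y = j
          · exact .inl (by rw [h6.1, h6.2])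
          · rw [if_neg h5, if_neg h6, add_zero] at h1
            exact absurd rfl h1
      | double i =>
        obtain ⟨h2, h3⟩ : 1 ≤ i ∧ i ≤ r := hγ
        simp only [Root.tgt, Root.fst] at h1
        rw [entry_skewUnit_neg hx hy (by omega)] at h1
        by_cases h5 : x = i ∧ y = i
        · exact .inr (.inr ⟨by rw [h5.1], by rw [h5.1, h5.2]⟩)
        · rw [if_neg h5, add_zero] at h1
          exact absurd rfl h1
    · rw [map_zero] at hne
      exact absurd rfl hne
  · right
    push Not at h
    obtain ⟨i, j, rfl⟩ := h
    have hLe : L ≠ [] := by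
      rintro rfl
      rw [rootNest_diff_singleton hγ, map_zero] at hne
      exact hne rfl
    refine ⟨hLe, i, j, rfl, ?_⟩
    have h4 : rootNest r (.diff i j :: L) = ⁅skewUnit .C r j i, rootNest r L⁆ := by
      rw [← rootMatrix_C_diff]
      rfl
    rw [h4, entry_lie_skewUnit _ hx hy hx1 hy1] at hne
    by_contra! h5
    apply hne
    by_cases h6 : x = i <;> by_cases h7 : y = i
    · rw [if_pos h6, if_pos h7, h5.1 h6, h5.2 h7, neg_zero, sub_zero]
    · rw [if_pos h6, if_neg h7, h5.1 h6, neg_zero, sub_zero]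
    · rw [if_neg h6, if_pos h7, h5.2 h7, neg_zero, sub_zero]
    · rw [if_neg h6, if_neg h7, neg_zero, sub_zero]

/-- Root vectors with first index at most `i` do not reach entries both of whose indices exceed `i`.
-/
theorem entry_rootNest_eq_zero {i : ℕ} {L : List Root} (hne : L ≠ [])
    (hL : ∀ γ ∈ L, ClassicalType.C.IsPos r γ) (hi : ∀ γ ∈ L, γ.fst ≤ i) {x y : ℕ} (hx : i < x)
    (hy : i < y) (hxr : x ≤ r) (hyr : y ≤ r) : entry r (-x) y (rootNest r L) = 0 := by
  obtain ⟨γ, L, rfl⟩ := List.exists_cons_of_ne_nil hne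
  by_contra h
  have hf := hi γ List.mem_cons_self
  rcases entry_rootNest_cons (hL γ List.mem_cons_self)
      (fun δ hδ => hL δ (List.mem_cons_of_mem _ hδ)) hxr hyr (by omega) (by omega) h with
    ⟨-, rfl | rfl | ⟨rfl, -⟩⟩ | ⟨-, i', j, rfl, h⟩
  all_goals
    simp only [Root.fst] at hf
    omega

/-- Root vectors with first index at most `i` reach the entries with indices `i` and `j > i` only by
the root vector for `e_i + e_j` alone. -/
theorem eq_sum_of_entry_rootNest_ne_zero {i j : ℕ} {L : List Root} (hne : L ≠ [])
    (hL : ∀ γ ∈ L, ClassicalType.C.IsPos r γ) (hi : ∀ γ ∈ L, γ.fst ≤ i) (hi1 : 1 ≤ i) (hij : i < j)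
    (hjr : j ≤ r) (h : entry r (-i) j (rootNest r L) ≠ 0 ∨ entry r (-j) i (rootNest r L) ≠ 0) :
    L = [.sum i j] := by
  obtain ⟨γ, L, rfl⟩ := List.exists_cons_of_ne_nil hne
  have hf := hi γ List.mem_cons_self
  have hγ := hL γ List.mem_cons_self
  have hL' : ∀ δ ∈ L, ClassicalType.C.IsPos r δ := fun δ hδ => hL δ (List.mem_cons_of_mem _ hδ)
  have hi' : ∀ δ ∈ L, δ.fst ≤ i := fun δ hδ => hi δ (List.mem_cons_of_mem _ hδ)
  have key : ∀ f j', γ = .diff f j' → L ≠ [] →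
      (f = i ∧ (entry r (-j') j (rootNest r L) ≠ 0 ∨ entry r (-j) j' (rootNest r L) ≠ 0)) →
        False := by
    rintro f j' rfl hLe ⟨rfl, h'⟩
    obtain ⟨h1, h2, h3⟩ : 1 ≤ f ∧ f < j' ∧ j' ≤ r := hγ
    rcases h' with h' | h'
    · exact h' (entry_rootNest_eq_zero hLe hL' hi' h2 hij h3 hjr)
    · exact h' (entry_rootNest_eq_zero hLe hL' hi' hij h2 hjr h3)
  rcases h with h | h
  · rcases entry_rootNest_cons hγ hL' (by omega) hjr hi1 (by omega) h with
      ⟨rfl, rfl | rfl | ⟨rfl, h⟩⟩ | ⟨hLe, f, j', h1, ⟨rfl, h⟩ | ⟨rfl, h⟩⟩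
    · rfl
    · simp only [Root.fst] at hf
      omega
    · omega
    · exact (key _ _ h1 hLe ⟨rfl, .inl h⟩).elim
    · simp only [h1, Root.fst] at hf
      omega
  · rcases entry_rootNest_cons hγ hL' hjr (by omega) (by omega) hi1 h with
      ⟨rfl, rfl | rfl | ⟨rfl, h⟩⟩ | ⟨hLe, f, j', h1, ⟨rfl, h⟩ | ⟨rfl, h⟩⟩
    · simp only [Root.fst] at hf
      omega
    · rfl
    · omega
    · simp only [h1, Root.fst] at hf
      omega
    · exact (key _ _ h1 hLe ⟨rfl, .inr h⟩).elim

theorem entry_rootNest_double {i : ℕ} (hi1 : 1 ≤ i) (hir : i ≤ r) :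
    entry r (-i) i (rootNest r [.double i]) = 4 * ClassicalType.C.rootScalar r (.double i) := by
  have h1 : rootNest r [.double i] = (2 : ℂ) • ClassicalType.C.rootMatrix r (.double i) := by
    rw [rootNest_cons_of_ne_diff (γ := .double i) (show 1 ≤ i ∧ i ≤ r from ⟨hi1, hir⟩) (by simp)
      (by simp), if_pos rfl]
  rw [h1, map_smul, ClassicalType.rootMatrix, map_smul, Root.tgt, Root.fst,
    entry_skewUnit_neg hir hir hi1, if_pos ⟨rfl, rfl⟩, smul_eq_mul, smul_eq_mul]
  ring

/-- Among the increasing sequences of root vectors, only the root vector for `2 e_i` itself has an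
iterated commutator with a nonzero entry at the place `(-i, i)`. -/
theorem entry_rootNest_of_ne {i : ℕ} (hi1 : 1 ≤ i) (hir : i ≤ r) {L : List Root}
    (hL : ∀ γ ∈ L, ClassicalType.C.IsPos r γ)
    (hs : L.Pairwise fun γ δ => γ = δ ∨ ClassicalType.C.Precedes r γ δ) (h : L ≠ [.double i]) :
    entry r (-i) i (rootNest r L) = 0 := by
  by_contra hne
  match L, hL, hs, h, hne with
  | [], _, _, _, hne =>
    apply hne
    obtain ⟨x, y, hx, hy, h1⟩ := exists_entry_eq hne
    rw [h1]
    refine Matrix.diagonal_apply_ne _ fun hxy => ?_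
    rw [hxy] at hx
    omega
  | γ :: L, hL, hs, h, hne =>
    rw [List.pairwise_cons] at hs
    have hγ := hL γ List.mem_cons_self
    have hL' : ∀ δ ∈ L, ClassicalType.C.IsPos r δ := fun δ hδ => hL δ (List.mem_cons_of_mem _ hδ)
    have key : ∀ j, γ = .diff i j → L ≠ [] → L ≠ [.sum i j] := by
      rintro j rfl - rfl
      rcases hs.1 (.sum i j) List.mem_cons_self with h1 | h1
      · simp at h1
      · obtain ⟨-, h2, h3⟩ : 1 ≤ i ∧ i < j ∧ j ≤ r := hγ
        simp only [ClassicalType.Precedes, ClassicalType.blockKey, ClassicalType.innerKey,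
          Root.fst] at h1
        omega
    have hle : ∀ j, γ = .diff i j → ∀ δ ∈ L, δ.fst ≤ i := by
      rintro j rfl δ hδ
      rcases hs.1 δ hδ with rfl | h1
      · exact le_rfl
      · simp only [ClassicalType.Precedes, ClassicalType.blockKey, Root.fst] at h1
        simp only [Root.fst]
        omega
    have hj : ∀ j, γ = .diff i j → i < j ∧ j ≤ r := by
      rintro j rfl
      exact hγ.2
    rcases entry_rootNest_cons hγ hL' hir hir hi1 hi1 hne with
      ⟨rfl, rfl | rfl | ⟨rfl, -⟩⟩ | ⟨hLe, f, j, h1, ⟨rfl, h2⟩ | ⟨rfl, h2⟩⟩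
    · exact absurd hγ.2.1 (lt_irrefl _)
    · exact absurd hγ.2.1 (lt_irrefl _)
    · exact h rfl
    · exact key j h1 hLe (eq_sum_of_entry_rootNest_ne_zero hLe hL' (hle j h1) hi1 (hj j h1).1
        (hj j h1).2 (.inr h2))
    · exact key j h1 hLe (eq_sum_of_entry_rootNest_ne_zero hLe hL' (hle j h1) hi1 (hj j h1).1
        (hj j h1).2 (.inl h2))

variable {r : ℕ}

/-! ### Iterated commutators along words, and the functional for the long roots -/

/-- The number of ways to split the list `W` into the complementary sublists `A` and `B`. -/
def shuffleCount (W A B : List ℕ) : ℂ :=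
  ((splits W).map fun AB => if AB.1 = A ∧ AB.2 = B then 1 else 0).sum

theorem sum_splits_concat {α : Type*} (l : List α) (a : α) (f : List α × List α → ℂ) :
    ((splits (l ++ [a])).map f).sum =
      ((splits l).map fun AB => f (AB.1 ++ [a], AB.2)).sum +
        ((splits l).map fun AB => f (AB.1, AB.2 ++ [a])).sum := by
  induction l generalizing f with
  | nil => simp [splits]
  | cons b l ih =>
    have h1 := ih fun AB => f (b :: AB.1, AB.2)
    have h2 := ih fun AB => f (AB.1, b :: AB.2)
    simp only [List.cons_append, splits, List.map_append, List.sum_append, List.map_map,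
      Function.comp_def] at h1 h2 ⊢
    rw [h1, h2]
    ring

theorem concat_eq_down {A : List ℕ} {l a b : ℕ} :
    A ++ [l] = down a b ↔ l = b ∧ b ≤ a ∧ A = down a (b + 1) := by
  by_cases h : b ≤ a
  · rw [down_concat h]
    constructor
    · intro h1
      have h2 := List.append_inj' h1 rfl
      exact ⟨by simpa using h2.2, h, h2.1⟩
    · rintro ⟨rfl, -, rfl⟩
      rfl
  · rw [down_eq_nil (by omega)]
    simp [h]

/-- The last term of the word is the last term of one of the two parts. -/
theorem shuffleCount_concat (W : List ℕ) (l a x y : ℕ) :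
    shuffleCount (W ++ [l]) (down a x) (down a y) =
      (if l = x ∧ x ≤ a then shuffleCount W (down a (x + 1)) (down a y) else 0) +
      (if l = y ∧ y ≤ a then shuffleCount W (down a x) (down a (y + 1)) else 0) := by
  rw [shuffleCount, sum_splits_concat]
  simp only [concat_eq_down]
  congr 1
  · split_ifs with h
    · simp only [h, true_and, shuffleCount]
    · refine List.sum_eq_zero fun c hc => ?_
      obtain ⟨AB, -, rfl⟩ := List.mem_map.1 hc
      rw [if_neg (by tauto)]
  · split_ifs with h
    · simp only [h, true_and, shuffleCount]
    · refine List.sum_eq_zero fun c hc => ?_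
      obtain ⟨AB, -, rfl⟩ := List.mem_map.1 hc
      rw [if_neg (by tauto)]

/-- The iterated commutator of the matrices of the letters of a word with the sign matrix, with the
first letter acting first. -/
def wordNest (r : ℕ) (W : List ℕ) : Matrix (Ix r) (Ix r) ℂ :=
  adNest (W.reverse.map (ClassicalType.C.lowering r))

theorem wordNest_concat (W : List ℕ) (l : ℕ) :
    wordNest r (W ++ [l]) = ⁅ClassicalType.C.lowering r l, wordNest r W⁆ := by
  rw [wordNest, List.reverse_append]
  rfl

theorem lowering_C_of_ne {l : ℕ} (h : l ≠ r) :
    ClassicalType.C.lowering r l = skewUnit .C r (l + 1 : ℕ) l := by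
  rw [ClassicalType.lowering, ClassicalType.row, if_neg h]
  push_cast
  rfl

theorem lowering_C_last : ClassicalType.C.lowering r r = skewUnit .C r (-r) r := by
  rw [ClassicalType.lowering, ClassicalType.row, if_pos rfl]
  rfl

theorem lowering_isLowerBlock_or_commute (hr : 1 ≤ r) {l : ℕ} (hl : 1 ≤ l) :
    IsLowerBlock (ClassicalType.C.lowering r l) ∨
      Commute (ClassicalType.C.lowering r l) (signMatrix r) := by
  by_cases h : l = r
  · rw [h, lowering_C_last]
    exact .inl (isLowerBlock_skewUnit (by omega) (by omega))
  · rw [lowering_C_of_ne h]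
    exact .inr (commute_skewUnit_signMatrix (by omega) (by omega))

/-- After the letter `r`, the two indices of an entry move independently along descending sequences.
So an entry counts the ways to merge two such sequences. -/
theorem entry_wordNest_cons_last (hr : 1 ≤ r) (W : List ℕ) (hW : ∀ l ∈ W, 1 ≤ l ∧ l ≤ r) {x y : ℕ}
    (hx1 : 1 ≤ x) (hx : x ≤ r) (hy1 : 1 ≤ y) (hy : y ≤ r) :
    entry r (-x) y (wordNest r (r :: W)) =
      4 * (-1) ^ (r - x + (r - y)) * shuffleCount W (down (r - 1) x) (down (r - 1) y) := by
  induction W using List.reverseRecOn generalizing x y with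
  | nil =>
    have h1 : wordNest r [r] = (2 : ℂ) • skewUnit .C r (-r) r := by
      rw [← (isLowerBlock_skewUnit (r := r) (a := r) (c := r) (by omega) (by omega)).lie_signMatrix,
        ← lowering_C_last]
      rfl
    rw [h1, map_smul, entry_skewUnit_neg hx hy hr, smul_eq_mul]
    simp only [shuffleCount, splits, List.map_cons, List.map_nil, List.sum_cons, List.sum_nil,
      nil_eq_down, add_zero]
    by_cases h : x = r ∧ y = r
    · rw [if_pos h, if_pos (by omega), h.1, h.2]
      simp
      norm_num
    · rw [if_neg h, if_neg (by omega)]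
      ring
  | append_singleton W l ih =>
    have hl := hW l (by simp)
    have hW' : ∀ l ∈ W, 1 ≤ l ∧ l ≤ r := fun l h => hW l (by simp [h])
    rw [← List.cons_append, wordNest_concat, shuffleCount_concat]
    by_cases hlr : l = r
    · have h1 : IsLowerBlock (wordNest r (r :: W)) := by
        refine isLowerBlock_adNest ?_ (by simp)
        intro M hM
        obtain ⟨m, hm, rfl⟩ := List.mem_map.1 hM
        rw [List.mem_reverse, List.mem_cons] at hm
        refine lowering_isLowerBlock_or_commute hr ?_
        rcases hm with rfl | hm
        · exact hr
        · exact (hW' m hm).1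
      rw [hlr, lowering_C_last, (isLowerBlock_skewUnit (by omega) (by omega)).lie_eq_zero h1,
        map_zero, if_neg (by omega), if_neg (by omega)]
      ring
    · rw [lowering_C_of_ne hlr, entry_lie_skewUnit _ hx hy hx1 hy1]
      have e1 : (if x = l then entry r (-((l + 1 : ℕ) : ℤ)) y (wordNest r (r :: W)) else 0) =
          -(4 * (-1) ^ (r - x + (r - y)) * if l = x ∧ x ≤ r - 1 then
            shuffleCount W (down (r - 1) (x + 1)) (down (r - 1) y) else 0) := by
        by_cases h : x = l
        · subst h
          rw [if_pos rfl, if_pos ⟨rfl, by omega⟩, ih hW' (by omega) (by omega) hy1 hy,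
            show r - x = (r - (x + 1)) + 1 by omega, add_right_comm, pow_succ]
          ring
        · rw [if_neg h, if_neg (fun h' => h h'.1.symm)]
          ring
      have e2 : (if y = l then entry r (-x) ((l + 1 : ℕ) : ℤ) (wordNest r (r :: W)) else 0) =
          -(4 * (-1) ^ (r - x + (r - y)) * if l = y ∧ y ≤ r - 1 then
            shuffleCount W (down (r - 1) x) (down (r - 1) (y + 1)) else 0) := by
        by_cases h : y = l
        · subst h
          rw [if_pos rfl, if_pos ⟨rfl, by omega⟩, ih hW' hx1 hx (by omega) (by omega),
            show r - y = (r - (y + 1)) + 1 by omega, ← add_assoc, pow_succ]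
          ring
        · rw [if_neg h, if_neg (fun h' => h h'.1.symm)]
          ring
      rw [e1, e2]
      ring

/-- All letters but `r` commute with the sign matrix, so that the letter that acts first must be
`r`. -/
theorem wordNest_cons_of_ne {l : ℕ} (hl : 1 ≤ l) (hlr : l ≠ r) (W : List ℕ) :
    wordNest r (l :: W) = 0 := by
  induction W using List.reverseRecOn with
  | nil =>
    have h1 : wordNest r [l] = ⁅ClassicalType.C.lowering r l, signMatrix r⁆ := rfl
    rw [h1, lowering_C_of_ne hlr, (commute_skewUnit_signMatrix (by omega) (by omega)).lie_eq]
  | append_singleton W m ih => rw [← List.cons_append, wordNest_concat, ih, lie_zero]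

theorem entry_wordNest (hr : 1 ≤ r) (W : List ℕ) (hW : ∀ l ∈ W, 1 ≤ l ∧ l ≤ r) {i : ℕ}
    (hi1 : 1 ≤ i) (hi : i ≤ r) :
    entry r (-i) i (wordNest r W) =
      4 * if W.head? = some r
        then shuffleCount W.tail (down (r - 1) i) (down (r - 1) i) else 0 := by
  cases W with
  | nil =>
    rw [List.head?_nil, if_neg (by simp), mul_zero]
    by_contra hne
    obtain ⟨x, y, hx, hy, h1⟩ := exists_entry_eq hne
    apply hne
    rw [h1]
    refine Matrix.diagonal_apply_ne _ fun hxy => ?_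
    rw [hxy] at hx
    omega
  | cons l W =>
    simp only [List.head?_cons, List.tail_cons, Option.some_inj]
    split_ifs with h
    · rw [h, entry_wordNest_cons_last hr W (fun m hm => hW m (List.mem_cons_of_mem _ hm)) hi1 hi
        hi1 hi,
        ← two_mul, pow_mul]
      simp
    · rw [wordNest_cons_of_ne (hW l List.mem_cons_self).1 h, map_zero, mul_zero]

section Functional

variable {𝔤 : Type*} [LieRing 𝔤] [LieAlgebra ℂ 𝔤] [FiniteDimensional ℂ 𝔤]
  {𝔥 : LieSubalgebra ℂ 𝔤} {b : LieAlgebra.Basis (Fin (ClassicalType.C.rank r)) 𝔥}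
  (hr : ClassicalType.C.minSize ≤ r) (hb : IsOfType .C r b)

/-- The action of the enveloping algebra on matrices by commutators. -/
def uAd : U b →ₐ[ℂ] Module.End ℂ (Matrix (Ix r) (Ix r) ℂ) :=
  UniversalEnvelopingAlgebra.lift ℂ
    ((LieAlgebra.ad ℂ (Matrix (Ix r) (Ix r) ℂ)).comp (matrixRep b hr hb))

theorem uAd_listProd {α : Type*} (g : α → lowerNil b) (L : List α) :
    uAd hr hb (listProd g L) (signMatrix r) = adNest (L.map fun a => matrixRep b hr hb (g a)) := by
  induction L with
  | nil => simp [listProd, adNest]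
  | cons a L ih =>
    rw [listProd_cons, map_mul, Module.End.mul_apply, ih, uAd,
      UniversalEnvelopingAlgebra.lift_ι_apply]
    rfl

/-- The functional that is dual to the root vector `F_β` for `β = 2 e_i`. -/
def doubleFunctional (i : ℕ) : U b →ₗ[ℂ] ℂ :=
  (4 * ClassicalType.C.rootScalar r (.double i))⁻¹ •
    (entry r (-i) i ∘ₗ LinearMap.applyₗ (signMatrix r) ∘ₗ (uAd hr hb).toLinearMap)

theorem doubleFunctional_apply (i : ℕ) (u : U b) :
    doubleFunctional hr hb i u = (4 * ClassicalType.C.rootScalar r (.double i))⁻¹ *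
      entry r (-i) i (uAd hr hb u (signMatrix r)) := rfl

/-- At monomials in the generators, the functional counts the ways to merge two descending
sequences. -/
theorem doubleFunctional_revProd {i : ℕ} (hi1 : 1 ≤ i) (hi : i ≤ r)
    (L : List (Fin (ClassicalType.C.rank r))) :
    doubleFunctional hr hb i (revProd (gen b) L) = (ClassicalType.C.rootScalar r (.double i))⁻¹ *
      if (L.map (fun i : Fin (ClassicalType.C.rank r) => (i : ℕ) + 1)).head? = some r then
        shuffleCount (L.map (fun i : Fin (ClassicalType.C.rank r) => (i : ℕ) + 1)).tail
          (down (r - 1) i) (down (r - 1) i) else 0 := by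
  have h1 : uAd hr hb (revProd (gen b) L) (signMatrix r) =
      wordNest r (L.map (fun i : Fin (ClassicalType.C.rank r) => (i : ℕ) + 1)) := by
    rw [revProd, uAd_listProd, wordNest, ← List.map_reverse, List.map_map]
    congr 1
    exact List.map_congr_left fun i _ => matrixRep_gen hr hb i
  rw [doubleFunctional_apply, h1, entry_wordNest hr _ (letters_bound L) hi1 hi, mul_inv]
  ring

theorem doubleFunctional_listProd {i : ℕ} (j : Fin (ClassicalType.C.posRoots r).length)
    (hj : ClassicalType.C.root r j = .double i)
    (L : List (Fin (ClassicalType.C.posRoots r).length)) (hL : L.Pairwise (· ≤ ·)) :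
    doubleFunctional hr hb i
      (listProd (fun j => rootVector .C r b (ClassicalType.C.root r j)) L) =
      if L = [j] then 1 else 0 := by
  obtain ⟨hi1, hi⟩ : 1 ≤ i ∧ i ≤ r := by
    have := isPos_root j
    rw [hj] at this
    exact this
  have h1 : uAd hr hb (listProd (fun j => rootVector .C r b (ClassicalType.C.root r j)) L)
      (signMatrix r) = rootNest r (L.map (ClassicalType.C.root r)) := by
    rw [uAd_listProd, rootNest, List.map_map]
    congr 1
    exact List.map_congr_left fun j _ => matrixRep_rootVector hr hb (isPos_root j)
  rw [doubleFunctional_apply, h1]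
  split_ifs with h
  · rw [h, List.map_singleton, hj, entry_rootNest_double hi1 hi, inv_mul_cancel₀]
    exact mul_ne_zero (by norm_num) (rootScalar_ne_zero _)
  · rw [entry_rootNest_of_ne hi1 hi, mul_zero]
    · intro γ hγ
      obtain ⟨m, -, rfl⟩ := List.mem_map.1 hγ
      exact isPos_root m
    · rw [List.pairwise_map]
      refine hL.imp fun {a c} hac => ?_
      rcases hac.eq_or_lt with rfl | hac
      · exact .inl rfl
      · exact .inr (precedes_root hac)
    · rwa [← hj, Ne, map_root_eq_singleton]

end Functional

/-! ### Residues of the tree with two branches -/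

theorem invSign_down_append_up {i s a : ℕ} (hi : 1 ≤ i) (ha : a ≤ s + 1) :
    invSign (((down a i).map (fun m => (m, 1)) ++ (up i s).map (fun m => (m, 2))).map toLex) =
      1 := by
  induction a with
  | zero =>
    rw [down_eq_nil (by omega), List.map_nil, List.nil_append, invSign_map_pair,
      invSign_eq_one (pairwise_lt_up _ _)]
  | succ a ih =>
    by_cases hia : i ≤ a + 1
    · rw [down_succ hia, List.map_cons, List.cons_append, List.map_cons, invSign, ih (by omega),
        List.map_append, List.countP_append, List.map_map, List.map_map, List.countP_map,
        List.countP_map, List.countP_eq_length.2, length_down]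
      · have h1 : (up i s).countP ((fun b => decide (b < toLex (a + 1, 1))) ∘
            toLex ∘ fun m : ℕ => (m, 2)) = a + 1 - i := by
          rw [← countP_up (a := i) (b := s) (c := a) (by omega) (by omega)]
          refine List.countP_congr fun m _ => ?_
          simp only [Function.comp_apply, decide_eq_true_eq, lex_lt]
          omega
        rw [h1, mul_one, ← two_mul, pow_mul]
        simp
      · intro m hm
        rw [mem_down] at hm
        simp only [Function.comp_apply, decide_eq_true_eq, lex_lt]
        omega
    · rw [down_eq_nil (by omega), List.map_nil, List.nil_append, invSign_map_pair,
        invSign_eq_one (pairwise_lt_up _ _)]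

theorem pathEdges_map_down {V : Type} (g : ℕ → V) {a b : ℕ} (h : a ≤ b + 1) :
    pathEdges ((down (b + 1) a).map g) = (down b a).map fun m => s(g (m + 1), g m) := by
  induction b with
  | zero =>
    rcases Nat.eq_zero_or_pos a with rfl | ha
    · rfl
    · obtain rfl : a = 1 := by omega
      rfl
  | succ b ih =>
    by_cases h' : a ≤ b + 1
    · rw [down_succ h, down_succ h', List.map_cons, List.map_cons, List.map_cons, ← ih h',
        down_succ h',
        List.map_cons]
      rfl
    · rw [down_succ h, down_eq_nil (by omega)]
      rfl

/-- The code of the neighbour towards the root in the tree with two branches whose first edge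
leads to `t^{(r)}_1`; it is not the code of a variable if this neighbour is the root. -/
def nextCode (r : ℕ) (v : ℕ × ℕ) : ℕ × ℕ :=
  if v.2 = 2 ∧ v.1 + 1 = r then (r, 1) else (v.1 + 1, v.2)

section Tvar

variable {n : ℕ} {k : Fin n → ℕ}

theorem tvar_eq_some {a c : ℕ} (ha : 1 ≤ a) (hc : 1 ≤ c) {y : Var k} :
    tvar k a c = some y ↔ varCode y = (a, c) := by
  constructor
  · intro h
    rw [tvar] at h
    split_ifs at h with h1
    rw [← Option.some_inj.1 h]
    simp only [varCode]
    rw [Nat.sub_add_cancel ha, Nat.sub_add_cancel hc]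
  · intro h
    have := tvar_varCode y
    rwa [h] at this

/-- The sequence of the colours of an ordering is descending if each variable comes after those of
the next higher colour. -/
theorem colors_eq_down {a b : ℕ} (ha : a ≤ n) (hb : 1 ≤ b)
    (hk : ∀ m : Fin n, k m = (down a b).count ((m : ℕ) + 1)) (w : Fin (∑ i, k i) ≃ Var k) :
    (∀ x y : Var k, (y.1 : ℕ) = x.1 + 1 → w.symm y < w.symm x) ↔
      (colors w).map (fun i : Fin n => (i : ℕ) + 1) = down a b := by
  constructor
  · intro h
    have h1 : ((down a b).map fun m => (m, 1)).map Prod.fst = down a b := by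
      rw [List.map_map]
      exact List.map_id _
    obtain ⟨s, hs⟩ := exists_ordering (k := k) (vs := (down a b).map fun m => (m, 1))
      ((nodup_down a b).map fun a b h => congrArg Prod.fst h)
      (fun v hv => by
        obtain ⟨m, hm, rfl⟩ := List.mem_map.1 hv
        rw [h1, (nodup_down a b).count, if_pos hm]
        rw [mem_down] at hm
        exact ⟨hb.trans hm.1, hm.2.trans ha, le_rfl, le_rfl⟩)
      (fun m => by rw [h1, hk])
    have hc : (List.ofFn fun p => ((s p).1 : ℕ) + 1) = down a b := by
      rw [← h1, ← hs, List.map_map, List.map_ofFn]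
      rfl
    have hval : ∀ p, ((s p).1 : ℕ) + 1 + p = a := by
      intro p
      have hp : (p : ℕ) < (down a b).length := by
        rw [← hc, List.length_ofFn]
        exact p.2
      have h2 : (down a b)[(p : ℕ)] = ((s p).1 : ℕ) + 1 := by
        simp only [← hc, List.getElem_ofFn]
      have h3 : (down a b)[(p : ℕ)] = a - p := by
        rw [length_down] at hp
        simp only [down, up, List.getElem_reverse, List.getElem_range', List.length_range']
        omega
      rw [length_down] at hp
      omega
    have h4 : s = w := by
      refine eq_of_strTail_lt fun p y hy => ?_
      rw [strTail] at hy
      split_ifs at hy with hp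
      rw [← Option.some_inj.1 hy]
      refine h _ _ ?_
      have h5 := hval p
      have h6 := hval ⟨p - 1, by omega⟩
      simp only at h6
      omega
    rw [← h4, map_succ_colors, hs, h1]
  · intro h x y hxy
    rw [colors, List.map_ofFn] at h
    have h1 := pairwise_gt_down a b
    rw [← h, List.pairwise_ofFn] at h1
    by_contra hle
    rcases (not_lt.1 hle).eq_or_lt with h2 | h2
    · rw [w.symm.injective h2] at hxy
      omega
    · have := h1 h2
      simp only [Function.comp_apply, Equiv.apply_symm_apply] at this
      omega

end Tvar

section TwoBranches

variable {r : ℕ} {i : ℕ} {k l : Fin r → ℕ}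

theorem varCode_inl (x : Var k) : varCode (varSplit k l (.inl x)) = varCode x := rfl

theorem varCode_inr (x : Var l) :
    varCode (varSplit k l (.inr x)) = ((x.1 : ℕ) + 1, k x.1 + x.2 + 1) := rfl

/-- The codes of the vertices of the tree with two branches, in the order of the edges leading to
them. -/
def branchCodes (r i : ℕ) : List (ℕ × ℕ) :=
  (down r i).map (fun m => (m, 1)) ++ (up i (r - 1)).map (fun m => (m, 2))

theorem map_fst_branchCodes (r i : ℕ) :
    (branchCodes r i).map Prod.fst = down r i ++ up i (r - 1) := by
  rw [branchCodes, List.map_append, List.map_map, List.map_map]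
  exact congrArg₂ _ (List.map_id _) (List.map_id _)

/-- The heads of the edges of the tree with two branches. -/
theorem exists_branch_ordering (hi : 1 ≤ i)
    (hk : ∀ m : Fin r, k m = (down r i).count ((m : ℕ) + 1))
    (hl : ∀ m : Fin r, l m = (down (r - 1) i).count ((m : ℕ) + 1)) :
    ∃ w : Fin (∑ i, (k + l) i) ≃ Var (k + l), (List.ofFn w).map varCode = branchCodes r i := by
  refine exists_ordering ?_ ?_ ?_
  · refine List.Nodup.append ((nodup_down r i).map fun a b h => congrArg Prod.fst h)
      ((nodup_up i _).map fun a b h => congrArg Prod.fst h) ?_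
    intro v hv hv'
    obtain ⟨m, -, rfl⟩ := List.mem_map.1 hv
    obtain ⟨m', -, h⟩ := List.mem_map.1 hv'
    simp at h
  · intro v hv
    rw [map_fst_branchCodes, List.count_append, count_down, count_up]
    rcases List.mem_append.1 hv with hv | hv <;> obtain ⟨m, hm, rfl⟩ := List.mem_map.1 hv
    · rw [mem_down] at hm
      rw [if_pos hm]
      simp only
      omega
    · rw [mem_up] at hm
      rw [if_pos (by simp only; omega), if_pos hm]
      simp only
      omega
  · intro m
    rw [map_fst_branchCodes, List.count_append, Pi.add_apply, hk, hl, count_down, count_down,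
      count_up]

/-- The tree with two branches, with its edges directed away from the root. -/
theorem twoBranchTree_eq (hi : 1 ≤ i) (hir : i ≤ r)
    {h : Fin (∑ i, (k + l) i) ≃ Var (k + l)} (hh : (List.ofFn h).map varCode = branchCodes r i) :
    twoBranchTree (k + l) r i = asym (k + l) (cls fun p =>
      s(tvar (k + l) (nextCode r (varCode (h p))).1 (nextCode r (varCode (h p))).2,
        some (h p))) := by
  set f : ℕ × ℕ → Sym2 (Vert (k + l)) := fun v =>
    s(tvar (k + l) (nextCode r v).1 (nextCode r v).2, tvar (k + l) v.1 v.2) with hf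
  have h1 : (List.ofFn fun p => s(tvar (k + l) (nextCode r (varCode (h p))).1
      (nextCode r (varCode (h p))).2, some (h p))) = (branchCodes r i).map f := by
    rw [← hh, List.map_map, List.map_ofFn]
    congr 1
    funext p
    simp only [Function.comp_apply, hf, tvar_varCode]
  rw [twoBranchTree]
  refine asymTree_eq ?_
  rw [h1]
  obtain ⟨s, rfl⟩ : ∃ s, r = s + 1 := ⟨r - 1, by omega⟩
  have h2 : (tvar (k + l) (s + 1) 1 :: (down s i).map fun m => tvar (k + l) m 2) =
      (down (s + 1) i).map fun m =>
        if m = s + 1 then tvar (k + l) (s + 1) 1 else tvar (k + l) m 2 := by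
    rw [down_succ hir, List.map_cons, if_pos rfl]
    congr 1
    refine List.map_congr_left fun m hm => ?_
    rw [mem_down] at hm
    rw [if_neg (by omega)]
  have h3 : tvar (k + l) (s + 1 + 1) 1 = none := by
    rw [tvar, dif_neg]
    rintro ⟨h, -⟩
    omega
  rw [Nat.add_sub_cancel, h2, pathEdges_map_down _ hir, pathEdges_map_down _ hir, branchCodes,
    List.map_append, List.map_map, List.map_map, down_succ hir, List.map_cons, List.cons_append,
    Nat.add_sub_cancel]
  congr 1
  · simp only [Function.comp_apply, hf, nextCode]
    rw [if_neg (by simp), h3]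
  congr 1
  · rw [down, List.map_reverse, List.reverse_reverse]
    refine List.map_congr_left fun m hm => ?_
    rw [mem_up] at hm
    simp only [Function.comp_apply, hf, nextCode, true_and, Nat.add_right_cancel_iff]
    rw [if_neg (by omega : ¬ m = s + 1)]
    by_cases hms : m = s
    · rw [if_pos hms, if_pos hms]
    · rw [if_neg hms, if_neg hms]

/-- The compatibility of an ordering with the tree with two branches, in terms of colours. -/
theorem compatible_iff (hi : 1 ≤ i) (hir : i ≤ r)
    (hk : ∀ m : Fin r, k m = (down r i).count ((m : ℕ) + 1))
    (hl : ∀ m : Fin r, l m = (down (r - 1) i).count ((m : ℕ) + 1))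
    (w : Fin (∑ i, (k + l) i) ≃ Var (k + l)) :
    (∀ x y : Var (k + l), varCode y = nextCode r (varCode x) → w.symm y < w.symm x) ↔
      ((colors w).map (fun m : Fin r => (m : ℕ) + 1)).head? = some r ∧
      pick (fun a => ((w a).1 : ℕ) + 1) (fun a => isLeft (w a)) = down r i ∧
      pick (fun a => ((w a).1 : ℕ) + 1) (fun a => !isLeft (w a)) = down (r - 1) i := by
  obtain ⟨⟨w₁, hw₁, hc₁⟩, w₂, hw₂, hc₂⟩ := exists_sub_ordering w
  have hmap : ∀ c : Fin (∑ i, (k + l) i) → Bool, pick (fun a => ((w a).1 : ℕ) + 1) c =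
      (pick (fun a => (w a).1) c).map fun m : Fin r => (m : ℕ) + 1 := by
    intro c
    rw [pick, pick, List.map_filterMap]
    congr 1
    funext a
    by_cases h : c a = true <;> simp [h]
  rw [hmap, hmap, ← hc₁, ← hc₂, ← colors_eq_down le_rfl hi hk,
    ← colors_eq_down (Nat.sub_le r 1) hi hl]
  have hkx : ∀ x : Var k, (x.2 : ℕ) = 0 ∧ i ≤ (x.1 : ℕ) + 1 := by
    intro x
    have h1 := x.2.2
    have h2 := hk x.1
    rw [count_down] at h2
    split_ifs at h2 <;> omega
  have hlx : ∀ x : Var l, (x.2 : ℕ) = 0 ∧ i ≤ (x.1 : ℕ) + 1 ∧ (x.1 : ℕ) + 1 ≤ r - 1 ∧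
      k x.1 = 1 := by
    intro x
    have h1 := x.2.2
    have h2 := hl x.1
    have h3 := hk x.1
    rw [count_down] at h2 h3
    split_ifs at h2 h3 <;> omega
  have hkv : ∀ m : ℕ, i ≤ m + 1 → m < r → ∃ y : Var k, (y.1 : ℕ) = m := by
    intro m h1 h2
    refine ⟨⟨⟨m, h2⟩, ⟨0, ?_⟩⟩, rfl⟩
    rw [hk, count_down, if_pos]
    · exact Nat.one_pos
    · simp only
      omega
  have hlv : ∀ m : ℕ, i ≤ m + 1 → m + 1 < r → ∃ y : Var l, (y.1 : ℕ) = m := by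
    intro m h1 h2
    refine ⟨⟨⟨m, by omega⟩, ⟨0, ?_⟩⟩, rfl⟩
    rw [hl, count_down, if_pos]
    · exact Nat.one_pos
    · simp only
      omega
  have hll : ∀ x y : Var k, varCode (varSplit k l (.inl y)) =
      nextCode r (varCode (varSplit k l (.inl x))) ↔ (y.1 : ℕ) = x.1 + 1 := by
    intro x y
    have h1 := (hkx x).1
    have h2 := (hkx y).1
    rw [varCode_inl, varCode_inl, varCode, varCode, nextCode, if_neg (by simp only; omega), h1, h2,
      Prod.mk.injEq]
    simp
  have hrr : ∀ x y : Var l, varCode (varSplit k l (.inr y)) =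
      nextCode r (varCode (varSplit k l (.inr x))) ↔ (y.1 : ℕ) = x.1 + 1 := by
    intro x y
    have h1 := hlx x
    have h2 := hlx y
    rw [varCode_inr, varCode_inr, nextCode, h1.1, h2.1, h1.2.2.2, h2.2.2.2]
    simp only
    split_ifs with h3
    · rw [Prod.mk.injEq]
      omega
    · rw [Prod.mk.injEq]
      omega
  have hlr : ∀ (x : Var k) (y : Var l), ¬ varCode (varSplit k l (.inr y)) =
      nextCode r (varCode (varSplit k l (.inl x))) := by
    intro x y
    have h1 := (hkx x).1
    have h2 := hlx y
    rw [varCode_inl, varCode_inr, varCode, nextCode, if_neg (by simp only; omega), h1, h2.1,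
      h2.2.2.2, Prod.mk.injEq]
    omega
  have hrl : ∀ (x : Var l) (y : Var k), varCode (varSplit k l (.inl y)) =
      nextCode r (varCode (varSplit k l (.inr x))) ↔ (x.1 : ℕ) + 2 = r ∧ (y.1 : ℕ) + 1 = r := by
    intro x y
    have h1 := hlx x
    have h2 := (hkx y).1
    have h4 := y.1.2
    rw [varCode_inl, varCode_inr, varCode, nextCode, h1.1, h1.2.2.2, h2]
    by_cases h3 : (x.1 : ℕ) + 2 = r
    · rw [if_pos ⟨rfl, h3⟩, Prod.mk.injEq]
      omega
    · rw [if_neg (fun h => h3 h.2), Prod.mk.injEq]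
      omega
  have hpos : 0 < ∑ i, (k + l) i := by
    obtain ⟨y, -⟩ := hkv (r - 1) (by omega) (by omega)
    exact (Nat.zero_le _).trans_lt (w.symm (varSplit k l (.inl y))).2
  have hhead : ((colors w).map (fun m : Fin r => (m : ℕ) + 1)).head? = some r ↔
      ((w ⟨0, hpos⟩).1 : ℕ) + 1 = r := by
    rw [colors, List.map_ofFn, List.head?_eq_getElem?, List.getElem?_ofFn, dif_pos hpos,
      Option.some_inj]
    rfl
  rw [hhead]
  have hlast : ∀ v, w.symm v = ⟨0, hpos⟩ → w ⟨0, hpos⟩ = v := fun v hv => by rw [← hv]; simp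
  constructor
  · intro h
    refine ⟨?_, fun x y hxy => (hw₁ y x).1 (h _ _ ((hll x y).2 hxy)),
      fun x y hxy => (hw₂ y x).1 (h _ _ ((hrr x y).2 hxy))⟩
    by_contra hne
    have hmin : ∀ y : Var (k + l), ¬ varCode y = nextCode r (varCode (w ⟨0, hpos⟩)) := by
      intro y hy
      have := h _ _ hy
      rw [Equiv.symm_apply_apply] at this
      exact absurd this (Nat.not_lt_zero _)
    obtain ⟨s, hs⟩ := (varSplit k l).surjective (w ⟨0, hpos⟩)
    rw [← hs] at hmin hne
    rcases s with x | x
    · have h1 := hkx x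
      have h2 : (x.1 : ℕ) + 1 ≠ r := hne
      obtain ⟨y, hy⟩ := hkv (x.1 + 1) (by omega) (by have := x.1.2; omega)
      exact hmin _ ((hll x y).2 hy)
    · have h1 := hlx x
      by_cases h2 : (x.1 : ℕ) + 2 = r
      · obtain ⟨y, hy⟩ := hkv (r - 1) (by omega) (by omega)
        exact hmin _ ((hrl x y).2 ⟨h2, by omega⟩)
      · obtain ⟨y, hy⟩ := hlv (x.1 + 1) (by omega) (by omega)
        exact hmin _ ((hrr x y).2 hy)
  · rintro ⟨h0, h1, h2⟩ x y hxy
    obtain ⟨x, rfl⟩ := (varSplit k l).surjective x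
    obtain ⟨y, rfl⟩ := (varSplit k l).surjective y
    rcases x with x | x <;> rcases y with y | y
    · exact (hw₁ y x).2 (h1 x y ((hll x y).1 hxy))
    · exact absurd hxy (hlr x y)
    · have h3 := (hrl x y).1 hxy
      have h4 : w ⟨0, hpos⟩ = varSplit k l (.inl y) := by
        apply varCode_injective
        obtain ⟨s, hs⟩ := (varSplit k l).surjective (w ⟨0, hpos⟩)
        rw [← hs] at h0 ⊢
        rcases s with z | z
        · have h5 : (z.1 : ℕ) + 1 = r := h0
          have h6 := hkx z
          have h7 := hkx y
          rw [varCode_inl, varCode_inl, varCode, varCode, Prod.mk.injEq]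
          omega
        · have h5 : (z.1 : ℕ) + 1 = r := h0
          have h6 := hlx z
          omega
      rw [← h4, Equiv.symm_apply_apply]
      refine lt_of_le_of_ne (Nat.zero_le _) fun h5 => ?_
      have h6 := hlast _ h5.symm
      rw [h4] at h6
      simpa using (varSplit k l).injective h6
    · exact (hw₂ y x).2 (h2 x y ((hrr x y).1 hxy))

/-- The letter `r` occurs in the longer sequence only, as its first term. -/
theorem shuffleCount_cons (hi : 1 ≤ i) (hir : i ≤ r) (W : List ℕ) :
    shuffleCount (r :: W) (down r i) (down (r - 1) i) =
      shuffleCount W (down (r - 1) i) (down (r - 1) i) := by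
  obtain ⟨s, rfl⟩ : ∃ s, r = s + 1 := ⟨r - 1, by omega⟩
  rw [shuffleCount, splits, List.map_append, List.sum_append, List.map_map, List.map_map,
    Nat.add_sub_cancel, shuffleCount]
  refine (add_eq_left.2 (List.sum_eq_zero ?_)).trans ?_
  rotate_left
  · congr 2
    funext AB
    simp only [Function.comp_apply, down_succ hir, List.cons.injEq, true_and]
  · intro x hx
    obtain ⟨AB, -, rfl⟩ := List.mem_map.1 hx
    simp only [Function.comp_apply]
    rw [if_neg]
    rintro ⟨-, h⟩
    have h1 : s + 1 ∈ down s i := h ▸ List.mem_cons_self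
    rw [mem_down] at h1
    omega

theorem perm_of_shuffleCount_ne_zero {W A B : List ℕ} (h : shuffleCount W A B ≠ 0) :
    (A ++ B).Perm W := by
  by_contra hp
  refine h (List.sum_eq_zero fun x hx => ?_)
  obtain ⟨AB, hAB, rfl⟩ := List.mem_map.1 hx
  rw [if_neg]
  rintro ⟨rfl, rfl⟩
  exact hp (perm_of_mem_splits hAB)

open Classical in
/-- The normalized residues of the oriented tree with two branches, before antisymmetrization. -/
theorem nres_branches (hi : 1 ≤ i) (h w : Fin (∑ i, (k + l) i) ≃ Var (k + l))
    (hh : (List.ofFn h).map varCode = branchCodes r i) :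
    nres w (cls fun p => s(tvar (k + l) (nextCode r (varCode (h p))).1
      (nextCode r (varCode (h p))).2, some (h p))) =
      if ∀ x y : Var (k + l), varCode y = nextCode r (varCode x) → w.symm y < w.symm x
        then 1 else 0 := by
  have hpos : ∀ x : Var (k + l), 1 ≤ (nextCode r (varCode x)).1 ∧
      1 ≤ (nextCode r (varCode x)).2 := by
    intro x
    rw [nextCode]
    split_ifs with h
    · rw [← h.2]
      exact ⟨Nat.le_add_left _ _, le_rfl⟩
    · exact ⟨Nat.le_add_left _ _, Nat.le_add_left _ _⟩
  have hiff : ∀ x y : Var (k + l), tvar (k + l) (nextCode r (varCode x)).1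
      (nextCode r (varCode x)).2 = some y ↔ varCode y = nextCode r (varCode x) :=
    fun x y => tvar_eq_some (hpos x).1 (hpos x).2
  rw [nres, ordRes_cls, headDet_oriented (stdOrd (k + l)) h _ fun y => r - ((y.1 : ℕ) + 1)]
  · rw [ordSign_stdOrd, hh, branchCodes, invSign_down_append_up hi (by omega)]
    refine if_congr ⟨fun H x y hxy => ?_, fun H b y hby => H _ _ ((hiff _ _).1 hby)⟩ rfl rfl
    have := H (h.symm x) y
    simp only [Equiv.apply_symm_apply] at this
    exact this ((hiff x y).2 hxy)
  · intro b y hby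
    have h1 := congrArg Prod.fst ((hiff _ _).1 hby)
    have h2 := y.1.2
    have h3 : (nextCode r (varCode (h b))).1 = ((h b).1 : ℕ) + 1 + 1 := by
      rw [nextCode]
      split_ifs with h4
      · exact h4.2.symm
      · rfl
    rw [h3] at h1
    replace h1 : (y.1 : ℕ) + 1 = ((h b).1 : ℕ) + 1 + 1 := h1
    omega

/-- The residues of the tree with two branches count the ways to merge the two branches. -/
theorem coeff_twoBranchTree (hi : 1 ≤ i) (hir : i ≤ r)
    (hk : ∀ m : Fin r, k m = (down r i).count ((m : ℕ) + 1))
    (hl : ∀ m : Fin r, l m = (down (r - 1) i).count ((m : ℕ) + 1)) (L : List (Fin r)) :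
    coeff (k + l) L (twoBranchTree (k + l) r i) =
      if (L.map fun m : Fin r => (m : ℕ) + 1).head? = some r then
        shuffleCount (L.map fun m : Fin r => (m : ℕ) + 1).tail (down (r - 1) i) (down (r - 1) i)
      else 0 := by
  classical
  have hcons : (L.map fun m : Fin r => (m : ℕ) + 1).head? = some r →
      shuffleCount (L.map fun m : Fin r => (m : ℕ) + 1).tail (down (r - 1) i) (down (r - 1) i) =
        shuffleCount (L.map fun m : Fin r => (m : ℕ) + 1) (down r i) (down (r - 1) i) := by
    intro h
    rw [← shuffleCount_cons hi hir, List.cons_head?_tail h]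
  have hinj : Function.Injective fun m : Fin r => (m : ℕ) + 1 :=
    fun a b h => Fin.ext (Nat.add_right_cancel h)
  by_cases h : ∃ w : Fin (∑ i, (k + l) i) ≃ Var (k + l), colors w = L
  · obtain ⟨w, rfl⟩ := h
    obtain ⟨h, hh⟩ := exists_branch_ordering hi hk hl
    set K : Fin (∑ i, (k + l) i) → ℕ := fun a => ((w a).1 : ℕ) + 1 with hK
    have hKw : (colors w).map (fun m : Fin r => (m : ℕ) + 1) = List.ofFn K := by
      rw [colors, List.map_ofFn]
      rfl
    rw [coeff_colors, twoBranchTree_eq hi hir hh, nres_asym]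
    set F : (Fin (∑ i, (k + l) i) → Bool) → ℂ := fun c =>
      if pick K c = down r i ∧ pick K (fun a => !c a) = down (r - 1) i then 1 else 0 with hF
    have hres : ∀ π : ColorPerm (k + l), nres (w.trans (permVar π)) (cls fun p =>
        s(tvar (k + l) (nextCode r (varCode (h p))).1 (nextCode r (varCode (h p))).2, some (h p))) =
        if ((colors w).map fun m : Fin r => (m : ℕ) + 1).head? = some r then
          F fun a => isLeft (permVar π (w a)) else 0 := by
      intro π
      rw [nres_branches hi h _ hh, if_congr (compatible_iff hi hir hk hl _) rfl rfl]
      exact ite_and _ _ _ _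
    rw [Finset.sum_congr rfl fun π _ => hres π]
    by_cases hr : ((colors w).map fun m : Fin r => (m : ℕ) + 1).head? = some r
    · rw [if_pos hr, Finset.sum_congr rfl fun π _ => if_pos hr, hcons hr, hKw]
      have hcount : ∀ (c : Fin (∑ i, (k + l) i) → Bool) (m : Fin r),
          (pick (fun a => (w a).1) c).count m = (pick K c).count ((m : ℕ) + 1) := by
        intro c m
        rw [← List.count_map_of_injective _ _ hinj]
        congr 1
        rw [pick, pick, List.map_filterMap]
        congr 1
        funext a
        by_cases h : c a = true <;> simp [h, hK]
      have hFne : ∀ c, F c ≠ 0 → pick K c = down r i ∧ pick K (fun a => !c a) = down (r - 1) i := by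
        intro c hc
        by_contra hne
        exact hc (if_neg hne)
      refine (sum_permVar_isLeft w F (fun c hc m => ?_) (fun c hc m => ?_)).trans ?_
      · rw [hcount, (hFne c hc).1, hk]
      · rw [hcount, (hFne c hc).2, hl]
      · rw [Finset.prod_eq_one, Nat.cast_one, one_mul]
        · exact sum_pick_eq_sum_splits K fun A B =>
            if A = down r i ∧ B = down (r - 1) i then 1 else 0
        · intro m _
          rw [hk, hl, count_down, count_down]
          split_ifs <;> rfl
    · rw [if_neg hr]
      exact Finset.sum_eq_zero fun π _ => if_neg hr
  · rw [coeff_eq_zero h, LinearMap.zero_apply, eq_comm]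
    split_ifs with hr
    · rw [hcons hr]
      by_contra hne
      apply h
      rw [exists_colors_iff]
      intro m
      rw [← List.count_map_of_injective L _ hinj, ← (perm_of_shuffleCount_ne_zero hne).count_eq,
        List.count_append, ← hk, ← hl]
      rfl
    · rfl

end TwoBranches

/-- The coefficients of the listed element for a long root of type `C`. -/
theorem coeff_listed_double {r i : ℕ} (hi : 1 ≤ i) (hir : i ≤ r)
    (L : List (Fin (ClassicalType.C.rank r))) :
    coeff _ L (listed (ClassicalType.C.deg r (.double i)) .C r (.double i)) =
      (ClassicalType.C.rootScalar r (.double i))⁻¹ *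
      if (L.map (fun i : Fin (ClassicalType.C.rank r) => (i : ℕ) + 1)).head? = some r then
        shuffleCount (L.map (fun i : Fin (ClassicalType.C.rank r) => (i : ℕ) + 1)).tail
          (down (r - 1) i) (down (r - 1) i) else 0 := by
  have h1 : ClassicalType.C.deg r (.double i) =
      (fun m : Fin r => (down r i).count ((m : ℕ) + 1)) +
        fun m : Fin r => (down (r - 1) i).count ((m : ℕ) + 1) := by
    funext m
    refine List.count_append.trans ?_
    rw [count_up, ← count_down]
    rfl
  have h2 : (if i = r then 2 else 1 : ℂ) = (ClassicalType.C.rootScalar r (.double i))⁻¹ := by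
    simp only [ClassicalType.rootScalar]
    split_ifs <;> norm_num
  rw [listed, map_smul, smul_eq_mul, h2, h1]
  congr 1
  exact coeff_twoBranchTree hi hir (fun _ => rfl) (fun _ => rfl) L

/-! ### The dual functionals of the root vectors -/

/-- For each positive root there is a functional on the enveloping algebra that is 1 at its root
vector, 0 at all other ordered products of root vectors, and whose values at the monomials in the
generators are the residues of the listed element. -/
theorem exists_dualFunctional {X : ClassicalType} {r : ℕ} (hr : X.minSize ≤ r)
    {𝔤 : Type*} [LieRing 𝔤] [LieAlgebra ℂ 𝔤] [FiniteDimensional ℂ 𝔤] [LieAlgebra.IsSimple ℂ 𝔤]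
    {𝔥 : LieSubalgebra ℂ 𝔤} {b : LieAlgebra.Basis (Fin (X.rank r)) 𝔥} (hb : IsOfType X r b)
    (j : Fin (X.posRoots r).length) :
    ∃ ψ : U b →ₗ[ℂ] ℂ,
      (∀ L : List (Fin (X.posRoots r).length), L.Pairwise (· ≤ ·) →
        ψ (listProd (fun j => rootVector X r b (X.root r j)) L) = if L = [j] then 1 else 0) ∧
      ∀ L, coeff _ L (listedEta X r j) = ψ (revProd (gen b) L) := by
  by_cases hj : ∃ i, X.root r j = .double i
  · obtain ⟨i, hj⟩ := hj
    have hpos := isPos_root j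
    rw [hj] at hpos
    cases X with
    | C =>
      refine ⟨doubleFunctional hr hb i, doubleFunctional_listProd hr hb j hj, fun L => ?_⟩
      rw [doubleFunctional_revProd hr hb hpos.1 hpos.2]
      unfold listedEta
      rw [hj]
      exact coeff_listed_double hpos.1 hpos.2 L
    | _ => exact hpos.elim
  · push Not at hj
    refine ⟨entryFunctional hr hb (X.root r j), entryFunctional_listProd hr hb j hj, fun L => ?_⟩
    rw [entryFunctional_revProd]
    exact coeff_listed (isPos_root j) hj L

end TreePBW

end

theorem mainTheorem1 (X : TreePBW.ClassicalType) (r : ℕ) (hr : X.minSize ≤ r)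
    {𝔤 : Type*} [LieRing 𝔤] [LieAlgebra ℂ 𝔤] [FiniteDimensional ℂ 𝔤] [LieAlgebra.IsSimple ℂ 𝔤]
    {𝔥 : LieSubalgebra ℂ 𝔤} (b : LieAlgebra.Basis (Fin (X.rank r)) 𝔥)
    (hb : TreePBW.IsOfType X r b) :
    (LinearIndependent ℂ (TreePBW.pbwMonomial X r b) ∧
      Submodule.span ℂ (Set.range (TreePBW.pbwMonomial X r b)) = ⊤) ∧
    (∀ k : Fin (X.rank r) → ℕ,
      ∃! Ω : TensorProduct ℂ (TreePBW.skew k) (TreePBW.freePart k), TreePBW.IsCanonical k Ω) ∧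
    (∀ η : TreePBW.EtaFamily X r,
      TreePBW.ProductFormula X r b η ↔ η = TreePBW.listedEta X r) := by
  choose ψ hψ hcoeff using TreePBW.exists_dualFunctional hr hb
  have h := TreePBW.productFormula_of_functionals b (TreePBW.span_rootVector hr hb) ψ hψ hcoeff
    TreePBW.deg_ne_zero
  exact ⟨h.1, TreePBW.existsUnique_isCanonical, h.2⟩
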